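/- Model of computation. Let $\mathbb{F}_p$ be a finite field of order $p$ ($p$ a prime power). Algorithms are uniform probabilistic word-RAM programs, with words of $O(\log n)$ bits (i.e. all integers that occur are bounded by a fixed polynomial in $n$), unit-cost integer arithmetic and memory access, unit-cost operations of $\mathbb{F}_p$, unit-cost sampling of a uniform element of $\mathbb{F}_p$ or of $\{0,\dots,k\}$ for a word $k$, and unit cost for each integer or field element written to the output. Running times are worst-case over inputs and random choices. For $f,g:\mathbb{N}\to\mathbb{R}_{\ge 0}$, $f=\tilde O(g)$ means that $f(n)=O(g(n)\log^k n)$ as $n\to\infty$ for some constant $k$. For matrices $X,Y$ of the same shape, $\mathrm{dist}(X,Y)$ is the number of entries in which they differ. Trapdoored matrix family. A trapdoored matrix family over $\mathbb{F}_p$ is an algorithm that on input $n$ outputs, in time $\tilde O(n^2)$, a pair $(R,C)$ such that: (correctness and efficiency) $R\in\mathbb{F}_p^{n\times n}$, and $C$ is an arithmetic circuit over $\mathbb{F}_p$ with $\tilde O(n)$ gates and $C(v)=Rv$ for every $v\in\mathbb{F}_p^n$; (indistinguishability) for every probabilistic polynomial-time algorithm $\mathcal{A}$, the quantity $$\Big|\Pr_{R\sim\mathbb{F}_p^{n\times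 n}}[\mathcal{A}(R)=1]-\Pr_{(R,C)\text{ sampled}}[\mathcal{A}(R)=1]\Big|$$ tends to $0$ faster than any inverse polynomial in $n$. Theorem. Assume that a trapdoored matrix family over $\mathbb{F}_p$ exists and let $\varepsilon>0$. Let $\mathcal{M}$ be a (possibly randomized) algorithm that on input $n$ and $A,B\in\mathbb{F}_p^{n\times n}$ outputs a matrix $\mathcal{M}(A,B)\in\mathbb{F}_p^{n\times n}$ in time at most $T(n)$, and suppose that for every sufficiently large $n$ $$\mathbb{E}_{A,B\sim\mathbb{F}_p^{n\times n}}\big[\mathrm{dist}(A\cdot B,\ \mathcal{M}(A,B))\big]\le\Big(1-\frac1p-\varepsilon\Big)n^2,$$ where $A,B$ are independent and uniform and the expectation is also over the random choices of $\mathcal{M}$. Then for every constant $c\in\mathbb{N}$ there is a (uniform, randomized) algorithm running in time $\tilde O(T(n))$ that, for every $n\ge 1$ and all matrices $A,B\in\mathbb{F}_p^{n\times n}$, outputs exactly $A\cdot B$ with probability at least $1-n^{-c}$. -/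

import Mathlib

open Filter Asymptotics

namespace WordRAM

/-!
A probabilistic word RAM over a fixed finite field `F`. The memory consists of arrays of natural
numbers and arrays of field elements (each array is named by a number that is written in the
program, so a program uses finitely many of them). A program is a finite text that does not depend
on the input size; it is run on all input sizes. Each operation costs one unit of time. The largest
integer that occurs in a run is recorded, and algorithms are required to use only words of
`O(log n)` bits, that is, integers bounded by a fixed polynomial in the input size `n`.
-/

/-- Memory, output tapes and resource counters. -/
structure State (F : Type*) where
  /-- `narr a i` is the content of cell `i` of the integer array `a`. -/
  narr : ℕ → ℕ → ℕ
  /-- `farr a i` is the content of cell `i` of the field array `a`. -/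
  farr : ℕ → ℕ → F
  /-- Integers written to the output so far. -/
  nOut : List ℕ
  /-- Field elements written to the output so far. -/
  fOut : List F
  /-- Time used so far. -/
  time : ℕ
  /-- Largest integer that has occurred so far. -/
  peak : ℕ

namespace State

variable {F : Type*}

/-- Write `v` into cell `i` of the integer array `a`. -/
def setN (s : State F) (a i v : ℕ) : State F :=
  { s with narr := Function.update s.narr a (Function.update (s.narr a) i v) }

/-- Write `v` into cell `i` of the field array `a`. -/
def setF (s : State F) (a i : ℕ) (v : F) : State F :=
  { s with farr := Function.update s.farr a (Function.update (s.farr a) i v) }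

/-- Append an integer to the output. -/
def emitN (s : State F) (v : ℕ) : State F := { s with nOut := s.nOut ++ [v] }

/-- Append a field element to the output. -/
def emitF (s : State F) (v : F) : State F := { s with fOut := s.fOut ++ [v] }

/-- Account for `t` units of time during which `v` is the largest integer that occurs. -/
def charge (s : State F) (t v : ℕ) : State F :=
  { s with time := s.time + t, peak := max s.peak v }

end State

/-- Integer expressions; subtraction is truncated, division by zero gives zero. -/
inductive NExp where
  | lit (c : ℕ)
  | read (a : ℕ) (i : NExp)
  | add (x y : NExp)
  | sub (x y : NExp)
  | mul (x y : NExp)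
  | div (x y : NExp)
  | mod (x y : NExp)

namespace NExp

variable {F : Type*}

/-- Value of an integer expression. -/
def eval (s : State F) : NExp → ℕ
  | lit c => c
  | read a i => s.narr a (i.eval s)
  | add x y => x.eval s + y.eval s
  | sub x y => x.eval s - y.eval s
  | mul x y => x.eval s * y.eval s
  | div x y => x.eval s / y.eval s
  | mod x y => x.eval s % y.eval s

/-- Number of operations in an integer expression. -/
def cost : NExp → ℕ
  | lit _ => 1
  | read _ i => i.cost + 1
  | add x y => x.cost + y.cost + 1
  | sub x y => x.cost + y.cost + 1
  | mul x y => x.cost + y.cost + 1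
  | div x y => x.cost + y.cost + 1
  | mod x y => x.cost + y.cost + 1

/-- Largest value of a subexpression (addresses included). -/
def peak (s : State F) : NExp → ℕ
  | lit c => c
  | read a i => max (i.peak s) (s.narr a (i.eval s))
  | add x y => max (max (x.peak s) (y.peak s)) (x.eval s + y.eval s)
  | sub x y => max (x.peak s) (y.peak s)
  | mul x y => max (max (x.peak s) (y.peak s)) (x.eval s * y.eval s)
  | div x y => max (x.peak s) (y.peak s)
  | mod x y => max (x.peak s) (y.peak s)

end NExp

/-- Field expressions; the inverse of zero is zero. -/
inductive FExp (F : Type*) where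
  | lit (c : F)
  | read (a : ℕ) (i : NExp)
  | add (x y : FExp F)
  | sub (x y : FExp F)
  | mul (x y : FExp F)
  | inv (x : FExp F)

namespace FExp

variable {F : Type*}

/-- Value of a field expression. -/
def eval [Field F] (s : State F) : FExp F → F
  | lit c => c
  | read a i => s.farr a (i.eval s)
  | add x y => x.eval s + y.eval s
  | sub x y => x.eval s - y.eval s
  | mul x y => x.eval s * y.eval s
  | inv x => (x.eval s)⁻¹

/-- Number of operations in a field expression. -/
def cost : FExp F → ℕ
  | lit _ => 1
  | read _ i => i.cost + 1
  | add x y => x.cost + y.cost + 1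
  | sub x y => x.cost + y.cost + 1
  | mul x y => x.cost + y.cost + 1
  | inv x => x.cost + 1

/-- Largest integer that occurs in a field expression, in the computation of addresses. -/
def peak (s : State F) : FExp F → ℕ
  | lit _ => 0
  | read _ i => i.peak s
  | add x y => max (x.peak s) (y.peak s)
  | sub x y => max (x.peak s) (y.peak s)
  | mul x y => max (x.peak s) (y.peak s)
  | inv x => x.peak s

end FExp

/-- Boolean tests. -/
inductive BExp (F : Type*) where
  | lt (x y : NExp)
  | eq (x y : NExp)
  | feq (x y : FExp F)
  | neg (b : BExp F)
  | and (b c : BExp F)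

namespace BExp

variable {F : Type*}

/-- Value of a test. -/
def eval [Field F] [DecidableEq F] (s : State F) : BExp F → Bool
  | lt x y => decide (x.eval s < y.eval s)
  | eq x y => decide (x.eval s = y.eval s)
  | feq x y => decide (x.eval s = y.eval s)
  | neg b => !(b.eval s)
  | and b c => b.eval s && c.eval s

/-- Number of operations in a test. -/
def cost : BExp F → ℕ
  | lt x y => x.cost + y.cost + 1
  | eq x y => x.cost + y.cost + 1
  | feq x y => x.cost + y.cost + 1
  | neg b => b.cost + 1
  | and b c => b.cost + c.cost + 1

/-- Largest integer that occurs in a test. -/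
def peak (s : State F) : BExp F → ℕ
  | lt x y => max (x.peak s) (y.peak s)
  | eq x y => max (x.peak s) (y.peak s)
  | feq x y => max (x.peak s) (y.peak s)
  | neg b => b.peak s
  | and b c => max (b.peak s) (c.peak s)

end BExp

/-- Programs. -/
inductive Prog (F : Type*) where
  | skip
  /-- `narr a [i] := e` -/
  | nset (a : ℕ) (i e : NExp)
  /-- `farr a [i] := e` -/
  | fset (a : ℕ) (i : NExp) (e : FExp F)
  /-- `narr a [i] :=` a uniformly random element of `{0, …, k}` -/
  | nrand (a : ℕ) (i k : NExp)
  /-- `farr a [i] :=` a uniformly random field element -/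
  | frand (a : ℕ) (i : NExp)
  /-- append an integer to the output -/
  | nemit (e : NExp)
  /-- append a field element to the output -/
  | femit (e : FExp F)
  | seq (p q : Prog F)
  | cond (b : BExp F) (p q : Prog F)
  /-- `while b do p` -/
  | loop (b : BExp F) (p : Prog F)

/-- The loop `while b do body`, cut off with outcome `none` when the guard would have to be
tested more than `k` times. -/
noncomputable def runLoop {F : Type*} [Field F] [DecidableEq F] (b : BExp F)
    (body : State F → PMF (Option (State F))) : ℕ → State F → PMF (Option (State F))
  | 0, _ => PMF.pure none
  | k + 1, s =>
      if b.eval s then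
        (body (s.charge (b.cost + 1) (b.peak s))).bind fun o =>
          o.elim (PMF.pure none) (runLoop b body k)
      else PMF.pure (some (s.charge (b.cost + 1) (b.peak s)))

/-- The distribution of the final state of a program started in the state `s`, where `none` stands
for a run in which some loop was cut off after `fuel` tests of its guard. As every such test takes
time, a run that takes time at most `fuel` is never cut off. -/
noncomputable def Prog.run {F : Type*} [Field F] [Fintype F] [DecidableEq F] (fuel : ℕ) :
    Prog F → State F → PMF (Option (State F))
  | .skip, s => PMF.pure (some (s.charge 1 0))
  | .nset a i e, s => PMF.pure (some
      ((s.charge (i.cost + e.cost + 1) (max (i.peak s) (e.peak s))).setN a (i.eval s) (e.eval s)))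
  | .fset a i e, s => PMF.pure (some
      ((s.charge (i.cost + e.cost + 1) (max (i.peak s) (e.peak s))).setF a (i.eval s) (e.eval s)))
  | .nrand a i k, s => (PMF.uniformOfFintype (Fin (k.eval s + 1))).map
      fun r : Fin (k.eval s + 1) => some
        ((s.charge (i.cost + k.cost + 1) (max (i.peak s) (k.peak s))).setN a (i.eval s) r.val)
  | .frand a i, s => (PMF.uniformOfFintype F).map fun r : F => some
      ((s.charge (i.cost + 1) (i.peak s)).setF a (i.eval s) r)
  | .nemit e, s => PMF.pure (some ((s.charge (e.cost + 1) (e.peak s)).emitN (e.eval s)))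
  | .femit e, s => PMF.pure (some ((s.charge (e.cost + 1) (e.peak s)).emitF (e.eval s)))
  | .seq p q, s => (p.run fuel s).bind fun o => o.elim (PMF.pure none) (q.run fuel)
  | .cond b p q, s =>
      if b.eval s then p.run fuel (s.charge (b.cost + 1) (b.peak s))
      else q.run fuel (s.charge (b.cost + 1) (b.peak s))
  | .loop b p, s => runLoop b (p.run fuel) fuel s

/-- Whatever the random choices, the program `P` started in the state `s` halts within time `t`,
meets only integers at most `w`, and its final state satisfies `Q`. -/
def Prog.HaltsWithin {F : Type*} [Field F] [Fintype F] [DecidableEq F] (P : Prog F) (s : State F)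
    (t w : ℕ) (Q : State F → Prop) : Prop :=
  ∀ o ∈ (P.run t s).support, ∃ s', o = some s' ∧ s'.time ≤ t ∧ s'.peak ≤ w ∧ Q s'

/-! ### Matrices as inputs and outputs -/

/-- Square matrices of size `n`. -/
abbrev Mat (F : Type*) (n : ℕ) := Matrix (Fin n) (Fin n) F

/-- The entries of a matrix in row-major order: entry `(i, j)` stands at position `i * n + j`. -/
def matList {F : Type*} {n : ℕ} (A : Mat F n) : List F :=
  List.ofFn fun k : Fin (n * n) => A (finProdFinEquiv.symm k).1 (finProdFinEquiv.symm k).2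

/-- The initial state in which cell `0` of integer array `0` holds `n`, the field arrays `0` and
`1` hold the two given lists, and all other cells hold zero. -/
def initState {F : Type*} [Field F] (n : ℕ) (x y : List F) : State F where
  narr := fun a i => if a = 0 ∧ i = 0 then n else 0
  farr := fun a i => if a = 0 then x.getD i 0 else if a = 1 then y.getD i 0 else 0
  nOut := []
  fOut := []
  time := 0
  peak := 0

/-- The matrix formed by the first `n * n` field elements of the output, in row-major order. -/
def State.outMat {F : Type*} [Field F] (n : ℕ) (s : State F) : Mat F n :=
  fun i j => s.fOut.getD (i * n + j) 0

section Algorithms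

variable {F : Type*} [Field F] [Fintype F] [DecidableEq F]

/-- The (possibly randomized) algorithm `P` takes two `n × n` matrices as input, for every `n`,
and outputs an `n × n` matrix, in time at most `T n` on a word RAM with words of `O(log n)`
bits. -/
def RunsInTime (P : Prog F) (T : ℕ → ℕ) : Prop :=
  ∃ k : ℕ, ∀ (n : ℕ) (A B : Mat F n),
    P.HaltsWithin (initState n (matList A) (matList B)) (T n) ((n + 2) ^ k)
      fun s => s.fOut.length = n * n

/-- The distribution of the output matrix of `P` on input `A`, `B`, if `P` is run for time `t`. -/
noncomputable def output (P : Prog F) (t : ℕ) {n : ℕ} (A B : Mat F n) : PMF (Mat F n) :=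
  (P.run t (initState n (matList A) (matList B))).map fun o => o.elim 0 (State.outMat n)

/-- Hamming distance of two matrices: the number of entries in which they differ. -/
def matDist {n : ℕ} (A B : Mat F n) : ℕ :=
  hammingDist (fun ij : Fin n × Fin n => A ij.1 ij.2) (fun ij => B ij.1 ij.2)

/-- The expected Hamming distance of `A * B` and the output of `P` on input `A`, `B`, for
independent uniformly random `n × n` matrices `A` and `B` (and the random choices of `P`). -/
noncomputable def expectedDist (P : Prog F) (t n : ℕ) : ℝ :=
  (∑ A : Mat F n, ∑ B : Mat F n, ∑ C : Mat F n,
    (output P t A B C).toReal * (matDist (A * B) C : ℝ)) / (Fintype.card (Mat F n) : ℝ) ^ 2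

end Algorithms

/-- `f = Õ(g)`: the function `f` is bounded by `g` up to polylogarithmic factors in `n`. -/
def SoftO (f g : ℕ → ℝ) : Prop :=
  ∃ k : ℕ, f =O[atTop] fun n : ℕ => g n * Real.log n ^ k

/-! ### Arithmetic circuits -/

/-- A gate of an arithmetic circuit with `m` inputs; earlier gates are referred to by position. -/
inductive Gate (F : Type*) (m : ℕ) where
  | input (i : Fin m)
  | const (c : F)
  | add (i j : ℕ)
  | mul (i j : ℕ)

namespace Gate

variable {F : Type*} {m : ℕ}

/-- The gate refers only to gates at positions below `k`. -/
def RefsBelow (k : ℕ) : Gate F m → Prop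
  | input _ => True
  | const _ => True
  | add i j => i < k ∧ j < k
  | mul i j => i < k ∧ j < k

/-- Value of a gate on input `v`, given the list `w` of the values of the earlier gates. -/
def value [Field F] (v : Fin m → F) (w : List F) : Gate F m → F
  | input i => v i
  | const c => c
  | add i j => w.getD i 0 + w.getD j 0
  | mul i j => w.getD i 0 * w.getD j 0

/-- Integer part of the encoding of a gate. -/
def code : Gate F m → List ℕ
  | input i => [0, i, 0]
  | const _ => [1, 0, 0]
  | add i j => [2, i, j]
  | mul i j => [3, i, j]

/-- Field part of the encoding of a gate. -/
def fcode [Field F] : Gate F m → F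
  | const c => c
  | _ => 0

end Gate

/-- An arithmetic circuit over `F` with `m` inputs and `n` outputs. -/
structure Circuit (F : Type*) (m n : ℕ) where
  gates : List (Gate F m)
  /-- the positions of the output gates -/
  out : Fin n → ℕ
  gates_wf : ∀ (k : ℕ) (g : Gate F m), gates[k]? = some g → g.RefsBelow k
  out_wf : ∀ i, out i < gates.length

namespace Circuit

variable {F : Type*} {m n : ℕ}

/-- The number of gates. -/
def size (C : Circuit F m n) : ℕ := C.gates.length

/-- The function computed by a circuit. -/
def eval [Field F] (C : Circuit F m n) (v : Fin m → F) : Fin n → F :=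
  fun i => (C.gates.foldl (fun w g => w ++ [g.value v w]) []).getD (C.out i) 0

/-- Integer part of the encoding of a circuit. -/
def code (C : Circuit F m n) : List ℕ :=
  C.gates.length :: (C.gates.flatMap Gate.code ++ List.ofFn C.out)

/-- Field part of the encoding of a circuit. -/
def fcode [Field F] (C : Circuit F m n) : List F := C.gates.map Gate.fcode

end Circuit

/-! ### Trapdoored matrices -/

section Trapdoor

variable {F : Type*} [Field F] [Fintype F] [DecidableEq F]

/-- The final state `s` of a sampler outputs a pair consisting of an `n × n` matrix `M` and a
circuit of size at most `σ` that computes `v ↦ M v`. -/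
def OutputsTrapdooredPair (n σ : ℕ) (s : State F) : Prop :=
  ∃ (M : Mat F n) (C : Circuit F n n),
    s.fOut = matList M ++ C.fcode ∧ s.nOut = C.code ∧ C.size ≤ σ ∧
      ∀ v : Fin n → F, C.eval v = M.mulVec v

/-- The distribution of the matrix sampled by `S` on input `n`, if `S` is run for time `t`. -/
noncomputable def sampledMat (S : Prog F) (t n : ℕ) : PMF (Mat F n) :=
  (S.run t (initState n [] [])).map fun o => o.elim 0 (State.outMat n)

/-- `A` is an algorithm that takes a square matrix as input and runs in polynomial time, with
time at most `(n + 2) ^ k` on `n × n` matrices. -/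
def PolyTime (A : Prog F) (k : ℕ) : Prop :=
  ∀ (n : ℕ) (M : Mat F n),
    A.HaltsWithin (initState n (matList M) []) ((n + 2) ^ k) ((n + 2) ^ k) fun _ => True

/-- The probability that `A`, run for time `t`, outputs `1` on a matrix drawn from `μ`. -/
noncomputable def acceptProb (A : Prog F) (t : ℕ) {n : ℕ} (μ : PMF (Mat F n)) : ℝ :=
  ((μ.bind fun M => A.run t (initState n (matList M) [])).toOuterMeasure
    {o | ∃ s, o = some s ∧ s.nOut = [1]}).toReal

/-- The program `S` samples a trapdoored matrix family over `F`: on input `n` it outputs, in time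
`Õ(n ^ 2)`, a matrix `M` of size `n × n` and a circuit of size `Õ(n)` that computes `v ↦ M v`, and
no probabilistic polynomial-time algorithm distinguishes `M` from a uniformly random matrix with
non-negligible advantage. -/
def IsTrapdooredFamily (S : Prog F) : Prop :=
  ∃ τ σ : ℕ → ℕ,
    SoftO (fun n => (τ n : ℝ)) (fun n => (n : ℝ) ^ 2) ∧
    SoftO (fun n => (σ n : ℝ)) (fun n => (n : ℝ)) ∧
    (∃ k : ℕ, ∀ n : ℕ, S.HaltsWithin (initState n [] []) (τ n) ((n + 2) ^ k)
      (OutputsTrapdooredPair n (σ n))) ∧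
    ∀ (A : Prog F) (k : ℕ), PolyTime A k →
      SuperpolynomialDecay atTop (fun n : ℕ => (n : ℝ)) fun n : ℕ =>
        |acceptProb A ((n + 2) ^ k) (PMF.uniformOfFintype (Mat F n)) -
          acceptProb A ((n + 2) ^ k) (sampledMat S (τ n) n)|

end Trapdoor

end WordRAM

open Filter Asymptotics

set_option linter.unusedSectionVars false
set_option linter.unusedSimpArgs false

namespace WordRAM

/-! Write p for the order of `F`. On random matrices, a random entry of the output of `M` is right
with probability at least 1/p + ε. This small edge over guessing is amplified by a random
self-reduction.

To estimate X Yᵀ, hide X by scaling it with a random unit u, shifting its rows cyclically by a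
random r and adding a mask R. Hide Y in the same way with u', r', R', and let `M` multiply the
hidden matrices (the second one transposed). If the masks are uniform, the hidden matrices are
uniform and independent of shifts and scalars (`ex_maskDist_uniform`). After the masks, shifts and
scalars have been undone (`estimate_eq`), the error of the estimate at (i, j) is (u u')⁻¹ times the
error of `M` at the uniformly random position (i - r, j - r'). Hence all nonzero error values are
equally likely, each with probability at most 1/p - ε/(p - 1), whereas no error occurs with
probability at least 1/p + ε. For every input, the entrywise plurality of O(log n) independent
estimates is therefore wrong with polynomially small probability only. This is an exponential moment
bound (`ex_trialDist`, `weight_bound`, `ex_coreDist_le`).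

Undoing the masks takes products with Rᵀ and R'ᵀ, which for uniform masks are as hard as the
original problem. With trapdoored masks they cost one circuit evaluation per row, `Õ(n²)` altogether
(`impl_circApply`). This is also `Õ(T)`, as `M` needs n² steps just to write its output
(`le_time_of_haltsWithin`).

That trapdoored masks are as good as uniform ones is shown by a polynomial-time test: draw X and Y,
form the plurality of estimates, and compare it with the naive product. A hybrid argument over the
2m masks of m estimates bounds the loss by 2m times the advantage of this test (`coreDist_hybrid`,
`hybrid_gap`). As the test has to draw X and Y itself, the conclusion concerns random X and Y only.
Arbitrary A and B are therefore written as sums of two uniform matrices each, and the four resulting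
products are added (`ex_splitDist_le`).

The remaining work is to carry this out on the word RAM. `Impl` couples runs of a program with a
random experiment, so that the analysis concerns distributions only. The given programs are run as
subroutines in fresh windows of the memory, under a clock (`simulates`, `impl_subRun`). The clock is
needed since `T` need not be polynomially bounded while the test has to be. When it reaches a
polynomial W, the result of `M` is replaced by the naive product. This only improves correctness
(`meanDist_cutDist_le`), and the cubic cost is below W, hence below `T`, whenever it is incurred
(`soft_mainTime`). -/

/-! ### Couplings -/

/-- There is a coupling of `μ` and `ν` that is supported on pairs related by `Q`. -/
def Coup {α β : Type*} (μ : PMF α) (ν : PMF β) (Q : α → β → Prop) : Prop :=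
  ∃ κ : PMF (α × β), κ.map Prod.fst = μ ∧ κ.map Prod.snd = ν ∧ ∀ x ∈ κ.support, Q x.1 x.2

namespace Coup

variable {α β γ δ : Type*}

theorem pure {a : α} {b : β} {Q : α → β → Prop} (h : Q a b) : Coup (PMF.pure a) (PMF.pure b) Q :=
  ⟨PMF.pure (a, b), by simp [PMF.pure_map], by simp [PMF.pure_map], by simpa using h⟩

theorem mono {μ : PMF α} {ν : PMF β} {Q Q' : α → β → Prop} (h : Coup μ ν Q)
    (hQ : ∀ a ∈ μ.support, ∀ b ∈ ν.support, Q a b → Q' a b) : Coup μ ν Q' := by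
  obtain ⟨κ, rfl, rfl, h3⟩ := h
  refine ⟨κ, rfl, rfl, fun x hx => hQ _ ?_ _ ?_ (h3 x hx)⟩
  · exact (PMF.mem_support_map_iff _ _ _).2 ⟨x, hx, rfl⟩
  · exact (PMF.mem_support_map_iff _ _ _).2 ⟨x, hx, rfl⟩

/-- The independent coupling. It serves as a filler in `Coup.bind`, where a kernel is needed also at
pairs for which no related coupling is available. -/
theorem exists_product (μ : PMF α) (ν : PMF β) :
    ∃ κ : PMF (α × β), κ.map Prod.fst = μ ∧ κ.map Prod.snd = ν := by
  refine ⟨μ.bind fun a => ν.map fun b => (a, b), ?_, ?_⟩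
  · rw [PMF.map_bind]
    simp only [PMF.map_comp]
    have : ∀ a : α, (Prod.fst ∘ fun b : β => (a, b)) = Function.const β a := fun a => rfl
    simp [this, PMF.map_const]
  · rw [PMF.map_bind]
    simp only [PMF.map_comp]
    have : ∀ a : α, (Prod.snd ∘ fun b : β => (a, b)) = id := fun a => rfl
    simp [this, PMF.map_id]

/-- Glue the couplings of `f a` and `g b` along the coupling of `μ` and `ν`. The marginals of the
glued kernel have to be right at every pair, but the relation `R` matters only at pairs in the
support, all of which satisfy `Q`. -/
theorem bind {μ : PMF α} {ν : PMF β} {Q : α → β → Prop} {f : α → PMF γ} {g : β → PMF δ}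
    {R : γ → δ → Prop} (h : Coup μ ν Q) (hfg : ∀ a b, Q a b → Coup (f a) (g b) R) :
    Coup (μ.bind f) (ν.bind g) R := by
  classical
  obtain ⟨κ, rfl, rfl, h3⟩ := h
  have key : ∀ x : α × β, ∃ κ' : PMF (γ × δ), κ'.map Prod.fst = f x.1 ∧ κ'.map Prod.snd = g x.2 ∧
      (Q x.1 x.2 → ∀ y ∈ κ'.support, R y.1 y.2) := by
    intro x
    by_cases hx : Q x.1 x.2
    · obtain ⟨κ', h1, h2, h4⟩ := hfg _ _ hx
      exact ⟨κ', h1, h2, fun _ => h4⟩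
    · obtain ⟨κ', h1, h2⟩ := exists_product (f x.1) (g x.2)
      exact ⟨κ', h1, h2, fun h => absurd h hx⟩
  choose K hK1 hK2 hK3 using key
  refine ⟨κ.bind K, ?_, ?_, ?_⟩
  · rw [PMF.map_bind, PMF.bind_map]; congr 1; funext x; exact hK1 x
  · rw [PMF.map_bind, PMF.bind_map]; congr 1; funext x; exact hK2 x
  · intro y hy
    obtain ⟨x, hx, hy⟩ := (PMF.mem_support_bind_iff _ _ _).1 hy
    exact hK3 x (h3 x hx) y hy

theorem refl (μ : PMF α) {Q : α → α → Prop} (h : ∀ a ∈ μ.support, Q a a) : Coup μ μ Q := by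
  refine ⟨μ.map fun a => (a, a), ?_, ?_, ?_⟩
  · rw [PMF.map_comp]; exact PMF.map_id _
  · rw [PMF.map_comp]; exact PMF.map_id _
  · intro x hx
    obtain ⟨a, ha, rfl⟩ := (PMF.mem_support_map_iff _ _ _).1 hx
    exact h a ha

theorem map {μ : PMF α} {ν : PMF β} {Q : α → β → Prop} {f : α → γ} {g : β → δ}
    {R : γ → δ → Prop} (h : Coup μ ν Q) (hfg : ∀ a b, Q a b → R (f a) (g b)) :
    Coup (μ.map f) (ν.map g) R :=
  h.bind fun a b hab => Coup.pure (hfg a b hab)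

/-- A coupling on the diagonal has equal marginals. Together with `Coup.map` this turns a simulation
into an equality of output distributions. -/
theorem eq_of_eq {μ ν : PMF α} (h : Coup μ ν (· = ·)) : μ = ν := by
  obtain ⟨κ, rfl, rfl, h3⟩ := h
  ext a
  rw [PMF.map_apply, PMF.map_apply]
  refine tsum_congr fun x => ?_
  by_cases hx : x ∈ κ.support
  · rw [h3 x hx]
  · rw [PMF.mem_support_iff, not_not] at hx; simp [hx]

theorem map_eq {μ : PMF α} {ν : PMF β} {Q : α → β → Prop} {f : α → γ} {g : β → γ}
    (h : Coup μ ν Q) (hfg : ∀ a b, Q a b → f a = g b) : μ.map f = ν.map g :=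
  (h.map hfg).eq_of_eq

theorem forall_right {μ : PMF α} {ν : PMF β} {Q : α → β → Prop} {R : β → Prop}
    (h : Coup μ ν Q) (hQ : ∀ a b, Q a b → R b) : ∀ b ∈ ν.support, R b := by
  obtain ⟨κ, rfl, rfl, h3⟩ := h
  intro b hb
  obtain ⟨x, hx, rfl⟩ := (PMF.mem_support_map_iff _ _ _).1 hb
  exact hQ _ _ (h3 x hx)

end Coup

/-! ### Deterministic programs without loops -/

variable {F : Type*} [Field F] [Fintype F] [DecidableEq F]

/-- The program contains neither loops nor random choices. -/
def Prog.Simple : Prog F → Bool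
  | .nrand _ _ _ => false
  | .frand _ _ => false
  | .loop _ _ => false
  | .seq p q => p.Simple && q.Simple
  | .cond _ p q => p.Simple && q.Simple
  | _ => true

/-- The final state of a program without loops and random choices. -/
def Prog.exec : Prog F → State F → State F
  | .skip, s => s.charge 1 0
  | .nset a i e, s =>
      (s.charge (i.cost + e.cost + 1) (max (i.peak s) (e.peak s))).setN a (i.eval s) (e.eval s)
  | .fset a i e, s =>
      (s.charge (i.cost + e.cost + 1) (max (i.peak s) (e.peak s))).setF a (i.eval s) (e.eval s)
  | .nemit e, s => (s.charge (e.cost + 1) (e.peak s)).emitN (e.eval s)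
  | .femit e, s => (s.charge (e.cost + 1) (e.peak s)).emitF (e.eval s)
  | .seq p q, s => q.exec (p.exec s)
  | .cond b p q, s =>
      if b.eval s then p.exec (s.charge (b.cost + 1) (b.peak s))
      else q.exec (s.charge (b.cost + 1) (b.peak s))
  | _, s => s

/-- A bound for the running time of a program without loops. -/
def Prog.tbound : Prog F → ℕ
  | .skip => 1
  | .nset _ i e => i.cost + e.cost + 1
  | .fset _ i e => i.cost + e.cost + 1
  | .nrand _ i k => i.cost + k.cost + 1
  | .frand _ i => i.cost + 1
  | .nemit e => e.cost + 1
  | .femit e => e.cost + 1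
  | .seq p q => p.tbound + q.tbound
  | .cond b p q => b.cost + 1 + max p.tbound q.tbound
  | .loop b _ => b.cost

theorem Prog.run_simple (fuel : ℕ) (P : Prog F) (hP : P.Simple = true) (s : State F) :
    P.run fuel s = PMF.pure (some (P.exec s)) := by
  induction P generalizing s with
  | seq p q ihp ihq =>
    simp only [Prog.Simple, Bool.and_eq_true] at hP
    simp [Prog.run, Prog.exec, ihp hP.1, ihq hP.2]
  | cond b p q ihp ihq =>
    simp only [Prog.Simple, Bool.and_eq_true] at hP
    simp only [Prog.run, Prog.exec, ihp hP.1, ihq hP.2]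
    split <;> rfl
  | nrand => simp [Prog.Simple] at hP
  | frand => simp [Prog.Simple] at hP
  | loop => simp [Prog.Simple] at hP
  | _ => simp [Prog.run, Prog.exec]

theorem Prog.exec_time (P : Prog F) (hP : P.Simple = true) (s : State F) :
    (P.exec s).time ≤ s.time + P.tbound := by
  induction P generalizing s with
  | seq p q ihp ihq =>
    simp only [Prog.Simple, Bool.and_eq_true] at hP
    have h1 := ihp hP.1 s
    have h2 := ihq hP.2 (p.exec s)
    simp only [Prog.exec, Prog.tbound]; omega
  | cond b p q ihp ihq =>
    simp only [Prog.Simple, Bool.and_eq_true] at hP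
    have h1 := ihp hP.1 (s.charge (b.cost + 1) (b.peak s))
    have h2 := ihq hP.2 (s.charge (b.cost + 1) (b.peak s))
    simp only [Prog.exec, Prog.tbound, State.charge] at *
    split <;> omega
  | nrand => simp [Prog.Simple] at hP
  | frand => simp [Prog.Simple] at hP
  | loop => simp [Prog.Simple] at hP
  | _ => simp [Prog.exec, Prog.tbound, State.charge, State.setN, State.setF, State.emitN,
      State.emitF]

/-! ### Programs that implement random experiments -/

/-- Started in the state `s`, the program `P` performs the random experiment `μ` within time `t`,
meets only integers at most `w`, and the outcome and the final state are related by `Q`. -/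
def Impl {α : Type*} (P : Prog F) (s : State F) (t w : ℕ) (μ : PMF α)
    (Q : α → State F → Prop) : Prop :=
  ∀ fuel ≥ t, Coup μ (P.run fuel s) fun a o =>
    ∃ s', o = some s' ∧ s'.time ≤ s.time + t ∧ s'.peak ≤ max s.peak w ∧ Q a s'

namespace Impl

variable {α β : Type*} {P P₁ P₂ : Prog F} {s : State F} {t t₁ t₂ w : ℕ}

theorem mono {μ : PMF α} {Q Q' : α → State F → Prop} {t' : ℕ} (h : Impl P s t w μ Q)
    (ht : t ≤ t') (hQ : ∀ a ∈ μ.support, ∀ s', Q a s' → Q' a s') : Impl P s t' w μ Q' := by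
  intro fuel hf
  refine (h fuel (ht.trans hf)).mono ?_
  rintro a ha o - ⟨s', rfl, h1, h2, h3⟩
  exact ⟨s', rfl, by omega, h2, hQ a ha s' h3⟩

theorem imp {μ : PMF α} {Q Q' : α → State F → Prop} (h : Impl P s t w μ Q)
    (hQ : ∀ a s', Q a s' → Q' a s') : Impl P s t w μ Q' :=
  h.mono le_rfl fun a _ s' => hQ a s'

theorem map {μ : PMF α} {Q : α → State F → Prop} {Q' : β → State F → Prop} (f : α → β)
    (h : Impl P s t w μ Q) (hQ : ∀ a s', Q a s' → Q' (f a) s') : Impl P s t w (μ.map f) Q' := by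
  intro fuel hf
  have := (h fuel hf).map (f := f) (g := id) (R := fun a o =>
    ∃ s', o = some s' ∧ s'.time ≤ s.time + t ∧ s'.peak ≤ max s.peak w ∧ Q' a s') ?_
  · rwa [PMF.map_id] at this
  · rintro a o ⟨s', rfl, h1, h2, h3⟩
    exact ⟨s', rfl, h1, h2, hQ a s' h3⟩

theorem seq {μ : PMF α} {Q : α → State F → Prop} {f : α → PMF β} {Q' : β → State F → Prop}
    (h₁ : Impl P₁ s t₁ w μ Q) (h₂ : ∀ a s', Q a s' → Impl P₂ s' t₂ w (f a) Q')
    (ht : t₁ + t₂ ≤ t) : Impl (.seq P₁ P₂) s t w (μ.bind f) Q' := by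
  intro fuel hf
  simp only [Prog.run]
  refine (h₁ fuel (by omega)).bind ?_
  rintro a o ⟨s', rfl, h1, h2, h3⟩
  refine (h₂ a s' h3 fuel (by omega)).mono ?_
  rintro b - o - ⟨s'', rfl, h4, h5, h6⟩
  exact ⟨s'', rfl, by omega, by omega, h6⟩

/-- Composition with a deterministic first step. Only the outcome `a` lies in the support, so the
continuation needs to be analysed for this outcome alone. -/
theorem seq_pure {a : α} {Q : α → State F → Prop} {ν : PMF β} {Q' : β → State F → Prop}
    (h₁ : Impl P₁ s t₁ w (PMF.pure a) Q) (h₂ : ∀ s', Q a s' → Impl P₂ s' t₂ w ν Q')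
    (ht : t₁ + t₂ ≤ t) : Impl (.seq P₁ P₂) s t w ν Q' := by
  have := seq (f := fun _ => ν) (Q := fun b s' => b = a ∧ Q a s')
    (h₁.mono le_rfl (Q' := fun b s' => b = a ∧ Q a s') ?_) (fun b s' h => h₂ s' h.2) ht
  · rwa [PMF.pure_bind] at this
  · intro b hb s' h
    have : b = a := by simpa using hb
    subst this; exact ⟨rfl, h⟩

/-- Straight-line code is verified by computing its final state. The time bound is syntactic, and no
fuel is involved as there are no loops. -/
theorem exec {Q : Unit → State F → Prop} (hP : P.Simple = true) (ht : P.tbound ≤ t)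
    (hw : (P.exec s).peak ≤ max s.peak w) (hQ : Q () (P.exec s)) :
    Impl P s t w (PMF.pure ()) Q := by
  intro fuel _
  rw [P.run_simple fuel hP]
  exact Coup.pure ⟨_, rfl, (P.exec_time hP s).trans (by omega), hw, hQ⟩

theorem cond {b : BExp F} {μ : PMF α} {Q : α → State F → Prop} (hw : b.peak s ≤ w)
    (h₁ : b.eval s = true → Impl P₁ (s.charge (b.cost + 1) (b.peak s)) t₁ w μ Q)
    (h₂ : b.eval s = false → Impl P₂ (s.charge (b.cost + 1) (b.peak s)) t₁ w μ Q)
    (ht : b.cost + 1 + t₁ ≤ t) : Impl (.cond b P₁ P₂) s t w μ Q := by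
  intro fuel hf
  simp only [Prog.run]
  split
  · rename_i h
    refine (h₁ h fuel (by omega)).mono ?_
    rintro a - o - ⟨s', rfl, h4, h5, h6⟩
    simp only [State.charge] at h4 h5
    exact ⟨s', rfl, by omega, by omega, h6⟩
  · rename_i h
    refine (h₂ (by simpa using h) fuel (by omega)).mono ?_
    rintro a - o - ⟨s', rfl, h4, h5, h6⟩
    simp only [State.charge] at h4 h5
    exact ⟨s', rfl, by omega, by omega, h6⟩

theorem frand {a : ℕ} {i : NExp} {Q : F → State F → Prop} (hw : i.peak s ≤ w)
    (ht : i.cost + 1 ≤ t)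
    (hQ : ∀ r, Q r ((s.charge (i.cost + 1) (i.peak s)).setF a (i.eval s) r)) :
    Impl (.frand a i) s t w (PMF.uniformOfFintype F) Q := by
  intro fuel _
  simp only [Prog.run]
  have := (Coup.refl (PMF.uniformOfFintype F) (Q := (· = ·)) (fun _ _ => rfl)).map (f := id)
    (g := fun r : F => some ((s.charge (i.cost + 1) (i.peak s)).setF a (i.eval s) r))
    (R := fun a o => ∃ s', o = some s' ∧ s'.time ≤ s.time + t ∧ s'.peak ≤ max s.peak w ∧ Q a s') ?_
  · rwa [PMF.map_id] at this
  · rintro r _ rfl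
    refine ⟨_, rfl, ?_, ?_, hQ r⟩
    · simp only [State.charge, State.setF]; omega
    · simp only [State.charge, State.setF]; omega

/-- The size of the sample space is a separate variable, so that the outcome has type `Fin n` for
the mathematical `n` rather than for the value of an expression. -/
theorem nrand {n : ℕ} [NeZero n] {a : ℕ} {i k : NExp} {Q : Fin n → State F → Prop}
    (hn : k.eval s + 1 = n) (hwi : i.peak s ≤ w) (hwk : k.peak s ≤ w)
    (ht : i.cost + k.cost + 1 ≤ t)
    (hQ : ∀ r : Fin n, Q r ((s.charge (i.cost + k.cost + 1) (max (i.peak s) (k.peak s))).setN a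
      (i.eval s) r.val)) :
    Impl (.nrand a i k) s t w (PMF.uniformOfFintype (Fin n)) Q := by
  intro fuel _
  simp only [Prog.run]
  subst hn
  have := (Coup.refl (PMF.uniformOfFintype (Fin (k.eval s + 1))) (Q := (· = ·))
    (fun _ _ => rfl)).map (f := id)
    (g := fun r : Fin (k.eval s + 1) => some ((s.charge (i.cost + k.cost + 1)
      (max (i.peak s) (k.peak s))).setN a (i.eval s) r.val))
    (R := fun a o => ∃ s', o = some s' ∧ s'.time ≤ s.time + t ∧ s'.peak ≤ max s.peak w ∧ Q a s') ?_
  · rwa [PMF.map_id] at this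
  · rintro r _ rfl
    refine ⟨_, rfl, ?_, ?_, hQ r⟩
    · simp only [State.charge, State.setN]; omega
    · simp only [State.charge, State.setN]; omega

end Impl

/-! ### Frames -/

/-- The states agree outside the integer arrays in `l` and the field arrays in `k`, where the
arrays from `40` on count as one array, called `40`. Time and peak are ignored. -/
structure Same (l k : List ℕ) (s s' : State F) : Prop where
  n : ∀ a, min a 40 ∉ l → s'.narr a = s.narr a
  f : ∀ a, min a 40 ∉ k → s'.farr a = s.farr a
  no : s'.nOut = s.nOut
  fo : s'.fOut = s.fOut

namespace Same

variable {l k l' k' : List ℕ} {s s' s'' : State F}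

theorem refl (l k : List ℕ) (s : State F) : Same l k s s :=
  ⟨fun _ _ => rfl, fun _ _ => rfl, rfl, rfl⟩

theorem mono (h : Same l k s s') (hl : l ⊆ l') (hk : k ⊆ k') : Same l' k' s s' :=
  ⟨fun a ha => h.n a fun h => ha (hl h), fun a ha => h.f a fun h => ha (hk h), h.no, h.fo⟩

theorem trans (h : Same l k s s') (h' : Same l k s' s'') : Same l k s s'' :=
  ⟨fun a ha => (h'.n a ha).trans (h.n a ha), fun a ha => (h'.f a ha).trans (h.f a ha),
    h'.no.trans h.no, h'.fo.trans h.fo⟩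

theorem charge (s : State F) (l k : List ℕ) (t v : ℕ) : Same l k s (s.charge t v) :=
  ⟨fun _ _ => rfl, fun _ _ => rfl, rfl, rfl⟩

theorem setN (s : State F) {l : List ℕ} (k : List ℕ) {a : ℕ} (i v : ℕ) (ha : min a 40 ∈ l) :
    Same l k s (s.setN a i v) := by
  refine ⟨fun b hb => ?_, fun _ _ => rfl, rfl, rfl⟩
  have : b ≠ a := by rintro rfl; exact hb ha
  simp [State.setN, this]

theorem setF (s : State F) (l : List ℕ) {k : List ℕ} {a : ℕ} (i : ℕ) (v : F) (ha : min a 40 ∈ k) :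
    Same l k s (s.setF a i v) := by
  refine ⟨fun _ _ => rfl, fun b hb => ?_, rfl, rfl⟩
  have : b ≠ a := by rintro rfl; exact hb ha
  simp [State.setF, this]

end Same

/-! ### Loops with a counter -/

/-- The content of cell `0` of integer array `a`. -/
abbrev V (a : ℕ) : NExp := .read a (.lit 0)

/-- `for v < bd do p` -/
def forN (v : ℕ) (bd : NExp) (p : Prog F) : Prog F :=
  .seq (.nset v (.lit 0) (.lit 0))
    (.loop (.lt (V v) bd) (.seq p (.nset v (.lit 0) (.add (V v) (.lit 1)))))

/-- The outcome after `j` steps of an experiment that performs step `k` by `f k`, starting with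
step `i`. -/
noncomputable def iterFrom {α : Type*} (f : ℕ → α → PMF α) (i : ℕ) : ℕ → α → PMF α
  | 0, a => PMF.pure a
  | j + 1, a => (f i a).bind (iterFrom f (i + 1) j)

/-- The definition splits off the first step, as a loop does. Inductions on the number of steps in
the probabilistic analysis need the last step instead. -/
theorem iterFrom_succ {α : Type*} (f : ℕ → α → PMF α) (i j : ℕ) (a : α) :
    iterFrom f i (j + 1) a = (iterFrom f i j a).bind (f (i + j)) := by
  induction j generalizing i a with
  | zero => simp [iterFrom]
  | succ j ih =>
    have h : i + 1 + j = i + (j + 1) := by omega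
    change (f i a).bind (iterFrom f (i + 1) (j + 1)) =
      ((f i a).bind (iterFrom f (i + 1) j)).bind (f (i + (j + 1)))
    rw [PMF.bind_bind, ← h]
    congr 1
    funext b
    exact ih (i + 1) b

/-- The invariant rule. `hstab` says that the invariant ignores time, peak and the loop counter,
hence survives guard tests and increments. A round costs `tb`, plus `bd.cost + 4` for the guard,
plus `6` for the increment. -/
theorem Impl.forN {α : Type*} {v : ℕ} {bd : NExp} {p : Prog F} {s : State F} {t w N tb : ℕ}
    {f : ℕ → α → PMF α} {a₀ : α} (I : ℕ → α → State F → Prop) {Q : α → State F → Prop}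
    (hstab : ∀ k a s₁ s₂, I k a s₁ → Same [min v 40] [] s₁ s₂ → I k a s₂)
    (hbd : ∀ k a s', k ≤ N → I k a s' → s'.narr v 0 = k → bd.eval s' = N ∧ bd.peak s' ≤ w)
    (hN : N ≤ w)
    (h0 : I 0 a₀ s)
    (hbody : ∀ k a s', k < N → I k a s' → s'.narr v 0 = k →
      Impl p s' tb w (f k a) fun a' s'' => s''.narr v 0 = k ∧ I (k + 1) a' s'')
    (hQ : ∀ a s', I N a s' → Q a s')
    (ht : N * (tb + bd.cost + 10) + bd.cost + 10 ≤ t) :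
    Impl (forN v bd p) s t w (iterFrom f 0 N a₀) Q := by
  -- Induction on the number `j` of remaining rounds. The number `fuel'` of guard tests that are
  -- left decreases, while the fuel available to the body stays the same.
  have loop : ∀ j k a s' fuel fuel', k + j = N → I k a s' → s'.narr v 0 = k → j < fuel' →
      tb ≤ fuel → Coup (iterFrom f k j a)
        (runLoop (.lt (V v) bd)
          ((Prog.seq p (.nset v (.lit 0) (.add (V v) (.lit 1)))).run fuel) fuel' s')
        fun a o => ∃ s'', o = some s'' ∧ s''.time ≤ s'.time + (j * (tb + bd.cost + 10) + bd.cost + 4)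
          ∧ s''.peak ≤ max s'.peak w ∧ Q a s'' := by
    intro j
    induction j with
    | zero =>
      intro k a s' fuel fuel' hk hI hv hf _
      obtain ⟨fuel', rfl⟩ : ∃ m, fuel' = m + 1 := ⟨fuel' - 1, by omega⟩
      obtain ⟨h1, h2⟩ := hbd k a s' (by omega) hI hv
      have hk' : k = N := by omega
      subst hk'
      simp only [runLoop, BExp.eval, NExp.eval, hv, h1, lt_irrefl, decide_false, iterFrom,
        Bool.false_eq_true, if_false]
      refine Coup.pure ⟨_, rfl, ?_, ?_, hQ _ _ (hstab _ _ _ _ hI (Same.charge _ _ _ _ _))⟩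
      · simp only [State.charge, BExp.cost, NExp.cost]; omega
      · simp only [State.charge, BExp.peak, NExp.peak, NExp.eval, hv]; omega
    | succ j ih =>
      intro k a s' fuel fuel' hk hI hv hf hfu
      obtain ⟨fuel', rfl⟩ : ∃ m, fuel' = m + 1 := ⟨fuel' - 1, by omega⟩
      obtain ⟨h1, h2⟩ := hbd k a s' (by omega) hI hv
      have hlt : k < N := by omega
      simp only [runLoop, BExp.eval, NExp.eval, hv, h1, hlt, decide_true, if_true, iterFrom]
      set s₁ := s'.charge ((BExp.lt (F := F) (V v) bd).cost + 1)
        ((BExp.lt (F := F) (V v) bd).peak s') with hs₁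
      have hI₁ : I k a s₁ := hstab _ _ _ _ hI (Same.charge _ _ _ _ _)
      have hb := hbody k a s₁ hlt hI₁ hv fuel hfu
      simp only [Prog.run, PMF.bind_bind]
      refine hb.bind ?_
      rintro a' o ⟨s₂, rfl, ht2, hp2, hv2, hI2⟩
      simp only [Option.elim, PMF.pure_bind, NExp.eval, hv2]
      set s₃ := ((s₂.charge ((NExp.lit 0).cost + ((V v).add (.lit 1)).cost + 1)
        (max ((NExp.lit 0).peak s₂) (((V v).add (.lit 1)).peak s₂))).setN v 0 (k + 1)) with hs₃
      have hI3 : I (k + 1) a' s₃ := by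
        refine hstab _ _ _ _ hI2 ((Same.charge _ _ _ _ _).trans (Same.setN _ _ _ _ (by simp)))
      have hv3 : s₃.narr v 0 = k + 1 := by simp [hs₃, State.setN]
      refine (ih (k + 1) a' s₃ fuel fuel' (by omega) hI3 hv3 (by omega) hfu).mono ?_
      rintro b - o - ⟨s₄, rfl, ht4, hp4, hq⟩
      refine ⟨s₄, rfl, ?_, ?_, hq⟩
      · have e3 : s₃.time = s₂.time + 6 := by
          simp [hs₃, State.setN, State.charge, NExp.cost]
        have e1 : s₁.time = s'.time + (bd.cost + 4) := by
          simp only [hs₁, State.charge, BExp.cost, NExp.cost]; omega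
        have : (j + 1) * (tb + bd.cost + 10) = j * (tb + bd.cost + 10) + (tb + bd.cost + 10) := by
          ring
        omega
      · have e3 : s₃.peak ≤ max s₂.peak w := by
          simp only [hs₃, State.setN, State.charge, NExp.peak, NExp.eval, hv2]; omega
        have e1 : s₁.peak ≤ max s'.peak w := by
          simp only [hs₁, State.charge, BExp.peak, NExp.peak, NExp.eval, hv]; omega
        omega
  intro fuel hf
  have hlen : N ≤ N * (tb + bd.cost + 10) := Nat.le_mul_of_pos_right _ (by omega)
  -- For `N = 0` the time bound says nothing about `tb`, so the body may lack fuel, but then it is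
  -- never run.
  have htb : N = 0 ∨ tb ≤ N * (tb + bd.cost + 10) := by
    rcases Nat.eq_zero_or_pos N with h | h
    · exact Or.inl h
    · right
      calc tb ≤ 1 * (tb + bd.cost + 10) := by omega
        _ ≤ _ := Nat.mul_le_mul_right _ h
  unfold WordRAM.forN
  simp only [Prog.run, PMF.pure_bind, Option.elim, NExp.eval]
  set s₁ := ((s.charge ((NExp.lit 0).cost + (NExp.lit 0).cost + 1)
    (max ((NExp.lit 0).peak s) ((NExp.lit 0).peak s))).setN v 0 0) with hs₁
  have hI1 : I 0 a₀ s₁ := hstab _ _ _ _ h0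
    ((Same.charge _ _ _ _ _).trans (Same.setN _ _ _ _ (by simp)))
  have hv1 : s₁.narr v 0 = 0 := by simp [hs₁, State.setN]
  have et : s₁.time = s.time + 3 := by simp [hs₁, State.setN, State.charge, NExp.cost]
  have ep : s₁.peak ≤ max s.peak w := by
    simp [hs₁, State.setN, State.charge, NExp.peak]
  rcases htb with h | h
  · subst h
    obtain ⟨fuel', rfl⟩ : ∃ m, fuel = m + 1 := ⟨fuel - 1, by omega⟩
    obtain ⟨h1, h2⟩ := hbd 0 a₀ s₁ le_rfl hI1 hv1
    simp only [runLoop, BExp.eval, NExp.eval, hv1, h1, lt_irrefl, decide_false, iterFrom,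
      Bool.false_eq_true, if_false]
    refine Coup.pure ⟨_, rfl, ?_, ?_, hQ _ _ (hstab _ _ _ _ hI1 (Same.charge _ _ _ _ _))⟩
    · simp only [State.charge, BExp.cost, NExp.cost]; omega
    · simp only [State.charge, BExp.peak, NExp.peak, NExp.eval, hv1]; omega
  · refine (loop N 0 a₀ s₁ fuel fuel (by omega) hI1 hv1 (by omega) (by omega)).mono ?_
    rintro a - o - ⟨s₂, rfl, h1, h2, h3⟩
    exact ⟨s₂, rfl, by omega, by omega, h3⟩

theorem iterFrom_pure {α : Type*} (f : ℕ → α → α) (i j : ℕ) (a : α) :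
    ∃ b, iterFrom (fun k a => PMF.pure (f k a)) i j a = PMF.pure b := by
  induction j generalizing i a with
  | zero => exact ⟨a, rfl⟩
  | succ j ih => simpa [iterFrom] using ih (i + 1) (f i a)

theorem Impl.forN_det {v : ℕ} {bd : NExp} {p : Prog F} {s : State F} {t w N tb : ℕ}
    (I : ℕ → State F → Prop) {Q : Unit → State F → Prop}
    (hstab : ∀ k s₁ s₂, I k s₁ → Same [min v 40] [] s₁ s₂ → I k s₂)
    (hbd : ∀ k s', k ≤ N → I k s' → s'.narr v 0 = k → bd.eval s' = N ∧ bd.peak s' ≤ w)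
    (hN : N ≤ w)
    (h0 : I 0 s)
    (hbody : ∀ k s', k < N → I k s' → s'.narr v 0 = k →
      Impl p s' tb w (PMF.pure ()) fun _ s'' => s''.narr v 0 = k ∧ I (k + 1) s'')
    (hQ : ∀ s', I N s' → Q () s')
    (ht : N * (tb + bd.cost + 10) + bd.cost + 10 ≤ t) :
    Impl (WordRAM.forN v bd p) s t w (PMF.pure ()) Q := by
  obtain ⟨b, hb⟩ := iterFrom_pure (fun _ (a : Unit) => a) 0 N ()
  rw [← hb]
  exact Impl.forN (fun k _ => I k) (fun k _ => hstab k) (fun k _ => hbd k) hN h0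
    (fun k _ => hbody k) (fun _ => hQ) ht

/-! ### Monotonicity along a run -/

/-- Resources and outputs have grown from `s` to `s'`. -/
structure Grows (s s' : State F) : Prop where
  time : s.time ≤ s'.time
  peak : s.peak ≤ s'.peak
  nOut : s.nOut.length ≤ s'.nOut.length
  fOut : s.fOut.length ≤ s'.fOut.length
  /-- Each element of the output takes time. -/
  fOut_time : s'.fOut.length + s.time ≤ s.fOut.length + s'.time

theorem Grows.trans {s s' s'' : State F} (h : Grows s s') (h' : Grows s' s'') : Grows s s'' :=
  ⟨h.time.trans h'.time, h.peak.trans h'.peak, h.nOut.trans h'.nOut, h.fOut.trans h'.fOut, by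
    have := h.fOut_time
    have := h'.fOut_time
    omega⟩

theorem Grows.charge (s : State F) (t v : ℕ) : Grows s (s.charge t v) :=
  ⟨by simp [State.charge], by simp [State.charge], le_rfl, le_rfl,
    by simp [State.charge]⟩

theorem runLoop_grows {b : BExp F} {body : State F → PMF (Option (State F))}
    (hbody : ∀ s s', some s' ∈ (body s).support → Grows s s') (k : ℕ) (s s' : State F)
    (h : some s' ∈ (runLoop b body k s).support) : Grows s s' := by
  induction k generalizing s with
  | zero => simp [runLoop] at h
  | succ k ih =>
    rw [runLoop] at h
    split at h
    · rw [PMF.mem_support_bind_iff] at h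
      obtain ⟨o, ho, h⟩ := h
      cases o with
      | none => simp at h
      | some s₁ => exact ((Grows.charge _ _ _).trans (hbody _ _ ho)).trans (ih _ h)
    · simp only [PMF.support_pure, Set.mem_singleton_iff, Option.some.injEq] at h
      subst h
      exact Grows.charge _ _ _

/-- Monotonicity transfers resource bounds from final states back to all intermediate states of a
run. Its last clause also shows that writing n² elements takes time n². -/
theorem Prog.run_grows (fuel : ℕ) (P : Prog F) (s s' : State F)
    (h : some s' ∈ (P.run fuel s).support) : Grows s s' := by
  induction P generalizing s s' with
  | seq p q ihp ihq =>
    rw [Prog.run, PMF.mem_support_bind_iff] at h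
    obtain ⟨o, ho, h⟩ := h
    cases o with
    | none => simp at h
    | some s₁ => exact (ihp _ _ ho).trans (ihq _ _ h)
  | cond b p q ihp ihq =>
    rw [Prog.run] at h
    split at h
    · exact (Grows.charge _ _ _).trans (ihp _ _ h)
    · exact (Grows.charge _ _ _).trans (ihq _ _ h)
  | loop b p ih =>
    rw [Prog.run] at h
    exact runLoop_grows ih _ _ _ h
  | nrand a i k =>
    rw [Prog.run, PMF.mem_support_map_iff] at h
    obtain ⟨r, -, h⟩ := h
    obtain rfl := Option.some.inj h
    exact ⟨by simp [State.charge, State.setN], by simp [State.charge, State.setN], le_rfl, le_rfl,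
      by simp [State.charge, State.setN]⟩
  | frand a i =>
    rw [Prog.run, PMF.mem_support_map_iff] at h
    obtain ⟨r, -, h⟩ := h
    obtain rfl := Option.some.inj h
    exact ⟨by simp [State.charge, State.setF], by simp [State.charge, State.setF], le_rfl, le_rfl,
      by simp [State.charge, State.setF]⟩
  | _ =>
    simp only [Prog.run, PMF.support_pure, Set.mem_singleton_iff, Option.some.injEq] at h
    subst h
    constructor <;> simp [State.charge, State.setN, State.setF, State.emitN, State.emitF] <;> omega

/-- Needed once the clock has expired: the original run may go on at random, while the moved program
does nothing. -/
theorem Coup.pure_right {α β : Type*} {μ : PMF α} {b : β} {Q : α → β → Prop}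
    (h : ∀ a ∈ μ.support, Q a b) : Coup μ (PMF.pure b) Q := by
  have := (Coup.refl μ (Q := fun a a' => a = a' ∧ a ∈ μ.support) fun a ha => ⟨rfl, ha⟩).bind
    (f := PMF.pure) (g := fun _ => PMF.pure b) (R := Q) ?_
  · simpa using this
  · rintro a a' ⟨rfl, ha⟩
    exact Coup.pure (h a ha)

/-! ### Running a program in a window of the memory -/

section Relocation

/-- The integer expression with all arrays and addresses moved. -/
def NExp.tr : NExp → NExp
  | lit c => lit c
  | read a i => read (a + 40) (add (V 2) i.tr)
  | add x y => add x.tr y.tr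
  | sub x y => sub x.tr y.tr
  | mul x y => mul x.tr y.tr
  | div x y => div x.tr y.tr
  | mod x y => mod x.tr y.tr

/-- The field expression with all arrays and addresses moved. -/
def FExp.tr : FExp F → FExp F
  | lit c => lit c
  | read a i => read (a + 40) (.add (V 2) i.tr)
  | add x y => add x.tr y.tr
  | sub x y => sub x.tr y.tr
  | mul x y => mul x.tr y.tr
  | inv x => inv x.tr

/-- The test with all arrays and addresses moved. -/
def BExp.tr : BExp F → BExp F
  | lt x y => lt x.tr y.tr
  | eq x y => eq x.tr y.tr
  | feq x y => feq x.tr y.tr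
  | neg b => neg b.tr
  | and b c => and b.tr c.tr

/-- Perform `p` if the clock has not expired. -/
def guarded (p : Prog F) : Prog F := .cond (.lt (V 4) (V 1)) p .skip

/-- Advance the clock. -/
def tick (c : ℕ) : Prog F := .nset 4 (.lit 0) (.add (V 4) (.lit c))

/-- Evaluate a loop guard and store the result in the flag. -/
def testFlag (b : BExp F) : Prog F :=
  .cond (.lt (V 4) (V 1))
    (.seq (.cond b.tr (.nset 7 (.lit 0) (.lit 1)) (.nset 7 (.lit 0) (.lit 0))) (tick (b.cost + 1)))
    (.nset 7 (.lit 0) (.lit 0))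

/-- The program `P`, moved into a window of the memory, writing its output to arrays
(integers only if `keep` holds) and stopping when the clock expires. -/
def Prog.tr (keep : Bool) : Prog F → Prog F
  | .skip => guarded (tick 1)
  | .nset a i e => guarded (.seq (.nset (a + 40) (.add (V 2) i.tr) e.tr)
      (tick (i.cost + e.cost + 1)))
  | .fset a i e => guarded (.seq (.fset (a + 40) (.add (V 2) i.tr) e.tr)
      (tick (i.cost + e.cost + 1)))
  | .nrand a i k => guarded (.seq (.nrand (a + 40) (.add (V 2) i.tr) k.tr)
      (tick (i.cost + k.cost + 1)))
  | .frand a i => guarded (.seq (.frand (a + 40) (.add (V 2) i.tr)) (tick (i.cost + 1)))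
  -- For a multiplication algorithm the emitted integers are irrelevant and no bound on their number
  -- is assumed, so they are dropped. For a sampler they encode the circuit and are kept.
  | .nemit e => guarded (.seq (if keep then .seq (.nset 30 (V 5) e.tr)
      (.nset 5 (.lit 0) (.add (V 5) (.lit 1))) else .skip) (tick (e.cost + 1)))
  | .femit e => guarded (.seq (.seq (.fset 30 (V 6) e.tr)
      (.nset 6 (.lit 0) (.add (V 6) (.lit 1)))) (tick (e.cost + 1)))
  | .seq p q => .seq (p.tr keep) (q.tr keep)
  | .cond b p q => guarded (.cond b.tr (.seq (tick (b.cost + 1)) (p.tr keep))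
      (.seq (tick (b.cost + 1)) (q.tr keep)))
  -- The guard is evaluated into a flag because each evaluation has to check and to advance the
  -- clock, which an expression cannot do. An expired clock clears the flag and thereby ends all
  -- enclosing loops.
  | .loop b p => .seq (testFlag b)
      (.loop (.eq (V 7) (.lit 1)) (.seq (p.tr keep) (testFlag b)))

/-- The factor by which the moved program is slower. -/
def Prog.slow (keep : Bool) : Prog F → ℕ
  | .seq p q => p.slow keep + q.slow keep
  | .cond b p q => p.slow keep + q.slow keep + b.tr.cost + b.cost + 20
  | .loop b p => p.slow keep + (testFlag b).tbound + b.cost + 10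
  | .skip => 100
  | .nset a i e => (Prog.nset a i e : Prog F).tbound + ((Prog.nset a i e : Prog F).tr keep).tbound
  | .fset a i e => (Prog.fset a i e : Prog F).tbound + ((Prog.fset a i e : Prog F).tr keep).tbound
  | .nrand a i e => (Prog.nrand a i e : Prog F).tbound + ((Prog.nrand a i e : Prog F).tr keep).tbound
  | .frand a i => (Prog.frand a i : Prog F).tbound + ((Prog.frand a i : Prog F).tr keep).tbound
  | .nemit e => (Prog.nemit e : Prog F).tbound + ((Prog.nemit e : Prog F).tr keep).tbound
  | .femit e => (Prog.femit e : Prog F).tbound + ((Prog.femit e : Prog F).tr keep).tbound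


/-! ### Moved expressions, and the relation between a run and its moved version -/

theorem NExp.eval_le_peak (s : State F) (e : NExp) : e.eval s ≤ e.peak s := by
  induction e with
  | lit c => simp [NExp.eval, NExp.peak]
  | read a i => simp [NExp.eval, NExp.peak]
  | add x y => simp [NExp.eval, NExp.peak]
  | sub x y hx hy => simp only [NExp.eval, NExp.peak]; omega
  | mul x y => simp [NExp.eval, NExp.peak]
  | div x y hx hy =>
    simp only [NExp.eval, NExp.peak]
    exact (Nat.div_le_self _ _).trans (hx.trans (le_max_left _ _))
  | mod x y hx hy =>
    simp only [NExp.eval, NExp.peak]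
    exact (Nat.mod_le _ _).trans (hx.trans (le_max_left _ _))

/-- The window of `ŝ` that starts at `b` shows the memory of `s`, up to address `w`. -/
structure MemRel (b w : ℕ) (s ŝ : State F) : Prop where
  base : ŝ.narr 2 0 = b
  n : ∀ a i, i ≤ w → ŝ.narr (a + 40) (b + i) = s.narr a i
  f : ∀ a i, i ≤ w → ŝ.farr (a + 40) (b + i) = s.farr a i

/-- Addresses count towards the peak, so a peak of at most `w` guarantees that every cell that is
read lies in the visible part of the window. -/
theorem NExp.tr_eval {b w : ℕ} {s ŝ : State F} (h : MemRel b w s ŝ) (e : NExp)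
    (he : e.peak s ≤ w) : e.tr.eval ŝ = e.eval s ∧ e.tr.peak ŝ ≤ b + w := by
  induction e with
  | lit c => simp only [NExp.peak] at he; simp only [NExp.tr, NExp.eval, NExp.peak, true_and]; omega
  | read a i ih =>
    simp only [NExp.peak] at he
    obtain ⟨h1, h2⟩ := ih (by omega)
    have h3 := NExp.eval_le_peak s i
    have h4 := h.n a (i.eval s) (by omega)
    simp only [NExp.tr, NExp.eval, NExp.peak, h.base, h1, h4, true_and]
    omega
  | add x y hx hy =>
    simp only [NExp.peak] at he
    obtain ⟨h1, h2⟩ := hx (by omega)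
    obtain ⟨h3, h4⟩ := hy (by omega)
    simp only [NExp.tr, NExp.eval, NExp.peak, h1, h3, true_and]; omega
  | sub x y hx hy =>
    simp only [NExp.peak] at he
    obtain ⟨h1, h2⟩ := hx (by omega)
    obtain ⟨h3, h4⟩ := hy (by omega)
    simp only [NExp.tr, NExp.eval, NExp.peak, h1, h3, true_and]; omega
  | mul x y hx hy =>
    simp only [NExp.peak] at he
    obtain ⟨h1, h2⟩ := hx (by omega)
    obtain ⟨h3, h4⟩ := hy (by omega)
    simp only [NExp.tr, NExp.eval, NExp.peak, h1, h3, true_and]; omega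
  | div x y hx hy =>
    simp only [NExp.peak] at he
    obtain ⟨h1, h2⟩ := hx (by omega)
    obtain ⟨h3, h4⟩ := hy (by omega)
    simp only [NExp.tr, NExp.eval, NExp.peak, h1, h3, true_and]; omega
  | mod x y hx hy =>
    simp only [NExp.peak] at he
    obtain ⟨h1, h2⟩ := hx (by omega)
    obtain ⟨h3, h4⟩ := hy (by omega)
    simp only [NExp.tr, NExp.eval, NExp.peak, h1, h3, true_and]; omega

theorem FExp.tr_eval {b w : ℕ} {s ŝ : State F} (h : MemRel b w s ŝ) (e : FExp F)
    (he : e.peak s ≤ w) : e.tr.eval ŝ = e.eval s ∧ e.tr.peak ŝ ≤ b + w := by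
  induction e with
  | lit c => simp [FExp.tr, FExp.eval, FExp.peak]
  | read a i =>
    simp only [FExp.peak] at he
    obtain ⟨h1, h2⟩ := NExp.tr_eval h i he
    have h3 := NExp.eval_le_peak s i
    have h4 := h.f a (i.eval s) (by omega)
    simp only [FExp.tr, FExp.eval, FExp.peak, NExp.eval, NExp.peak, h.base, h1, h4, true_and]
    omega
  | add x y hx hy =>
    simp only [FExp.peak] at he
    obtain ⟨h1, h2⟩ := hx (by omega)
    obtain ⟨h3, h4⟩ := hy (by omega)
    simp only [FExp.tr, FExp.eval, FExp.peak, h1, h3, true_and]; omega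
  | sub x y hx hy =>
    simp only [FExp.peak] at he
    obtain ⟨h1, h2⟩ := hx (by omega)
    obtain ⟨h3, h4⟩ := hy (by omega)
    simp only [FExp.tr, FExp.eval, FExp.peak, h1, h3, true_and]; omega
  | mul x y hx hy =>
    simp only [FExp.peak] at he
    obtain ⟨h1, h2⟩ := hx (by omega)
    obtain ⟨h3, h4⟩ := hy (by omega)
    simp only [FExp.tr, FExp.eval, FExp.peak, h1, h3, true_and]; omega
  | inv x hx =>
    simp only [FExp.peak] at he
    obtain ⟨h1, h2⟩ := hx (by omega)
    simp only [FExp.tr, FExp.eval, FExp.peak, h1, true_and]; omega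

theorem BExp.tr_eval {b w : ℕ} {s ŝ : State F} (h : MemRel b w s ŝ) (e : BExp F)
    (he : e.peak s ≤ w) : e.tr.eval ŝ = e.eval s ∧ e.tr.peak ŝ ≤ b + w := by
  induction e with
  | lt x y =>
    simp only [BExp.peak] at he
    obtain ⟨h1, h2⟩ := NExp.tr_eval h x (by omega)
    obtain ⟨h3, h4⟩ := NExp.tr_eval h y (by omega)
    simp only [BExp.tr, BExp.eval, BExp.peak, h1, h3, true_and]; omega
  | eq x y =>
    simp only [BExp.peak] at he
    obtain ⟨h1, h2⟩ := NExp.tr_eval h x (by omega)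
    obtain ⟨h3, h4⟩ := NExp.tr_eval h y (by omega)
    simp only [BExp.tr, BExp.eval, BExp.peak, h1, h3, true_and]; omega
  | feq x y =>
    simp only [BExp.peak] at he
    obtain ⟨h1, h2⟩ := FExp.tr_eval h x (by omega)
    obtain ⟨h3, h4⟩ := FExp.tr_eval h y (by omega)
    simp only [BExp.tr, BExp.eval, BExp.peak, h1, h3, true_and]; omega
  | neg x hx =>
    obtain ⟨h1, h2⟩ := hx he
    simp only [BExp.tr, BExp.eval, BExp.peak, h1, true_and]; omega
  | and x y hx hy =>
    simp only [BExp.peak] at he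
    obtain ⟨h1, h2⟩ := hx (by omega)
    obtain ⟨h3, h4⟩ := hy (by omega)
    simp only [BExp.tr, BExp.eval, BExp.peak, h1, h3, true_and]; omega

/-- The state `ŝ` shows the memory and the outputs of `s`. -/
structure RelM (keep : Bool) (b w : ℕ) (s ŝ : State F) : Prop where
  mem : MemRel b w s ŝ
  cn : keep = true → ŝ.narr 5 0 = s.nOut.length ∧
    ∀ i < s.nOut.length, ŝ.narr 30 i = s.nOut.getD i 0
  cf : ŝ.narr 6 0 = s.fOut.length ∧ ∀ i < s.fOut.length, ŝ.farr 30 i = s.fOut.getD i 0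

/-- Unless the clock has expired, `ŝ` shows `s` and the clock shows the time. -/
structure Sim (keep : Bool) (b w cap : ℕ) (s ŝ : State F) : Prop where
  clk : ŝ.narr 4 0 ≤ s.time
  rel : ŝ.narr 4 0 < cap → RelM keep b w s ŝ ∧ ŝ.narr 4 0 = s.time

/-- What is guaranteed about the change from `ŝ` to `ŝ'` when a program is run in a window. -/
structure Moved (b w cap B K : ℕ) (ŝ ŝ' : State F) : Prop where
  frame : Same [4, 5, 6, 7, 30, 40] [30, 40] ŝ ŝ'
  hi : ∀ a i, 40 ≤ a → b + w < i → ŝ'.narr a i = ŝ.narr a i ∧ ŝ'.farr a i = ŝ.farr a i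
  time : ∃ d, ŝ'.narr 4 0 = ŝ.narr 4 0 + d ∧ ŝ'.time ≤ ŝ.time + K * (1 + d)
  peak : ŝ'.peak ≤ max ŝ.peak B
  clk : ŝ'.narr 4 0 ≤ max (ŝ.narr 4 0) (cap + K)

/-- In the time bound `K * (1 + d)`, the advance `d` of the clock pays for steps that are really
simulated, and the summand `1` for steps skipped after the clock has expired. Such bounds add up
under composition. -/
theorem Moved.trans {b w cap B K₁ K₂ K : ℕ} {s s' s'' : State F} (h : Moved b w cap B K₁ s s')
    (h' : Moved b w cap B K₂ s' s'') (hK : K₁ + K₂ ≤ K) : Moved b w cap B K s s'' := by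
  refine ⟨h.frame.trans h'.frame, fun a i ha hi => ?_, ?_, ?_, ?_⟩
  · exact ⟨(h'.hi a i ha hi).1.trans (h.hi a i ha hi).1, (h'.hi a i ha hi).2.trans (h.hi a i ha hi).2⟩
  · obtain ⟨d, h1, h2⟩ := h.time
    obtain ⟨d', h3, h4⟩ := h'.time
    refine ⟨d + d', by omega, ?_⟩
    have e1 : K₁ * (1 + d) ≤ K₁ * (1 + (d + d')) := Nat.mul_le_mul_left _ (by omega)
    have e2 : K₂ * (1 + d') ≤ K₂ * (1 + (d + d')) := Nat.mul_le_mul_left _ (by omega)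
    have e3 : K₁ * (1 + (d + d')) + K₂ * (1 + (d + d')) ≤ K * (1 + (d + d')) := by
      rw [← Nat.add_mul]; exact Nat.mul_le_mul_right _ hK
    omega
  · have := h.peak; have := h'.peak; omega
  · have := h.clk; have := h'.clk; omega

/-- The clock is advanced after a step of the moved program. -/
theorem tick_moved {keep : Bool} {b w cap B K c X : ℕ} {s s' ŝ ŝ₁ : State F}
    (hc : ŝ.narr 4 0 = s.time) (hlt : s.time < cap)
    (hB : cap + K ≤ B) (hrel : RelM keep b w s' ŝ₁)
    (hframe : Same [5, 6, 7, 30, 40] [30, 40] ŝ ŝ₁)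
    (hhi : ∀ a i, 40 ≤ a → b + w < i → ŝ₁.narr a i = ŝ.narr a i ∧ ŝ₁.farr a i = ŝ.farr a i)
    (ht : ŝ₁.time ≤ ŝ.time + X) (hp : ŝ₁.peak ≤ max ŝ.peak B) (hs' : s'.time = s.time + c)
    (hX : X + 6 ≤ K) (hcK : c ≤ K) :
    Moved b w cap B K ŝ ((tick c : Prog F).exec ŝ₁) ∧
      Sim keep b w cap s' ((tick c : Prog F).exec ŝ₁) := by
  have h4 : ŝ₁.narr 4 = ŝ.narr 4 := hframe.n 4 (by decide)
  have key : ∀ a, a ≠ 4 → ((tick c : Prog F).exec ŝ₁).narr a = ŝ₁.narr a := by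
    intro a ha; simp [tick, Prog.exec, State.setN, State.charge, ha]
  have key4 : ((tick c : Prog F).exec ŝ₁).narr 4 0 = s.time + c := by
    simp [tick, Prog.exec, State.setN, NExp.eval, State.charge, h4, hc]
  have keyf : ((tick c : Prog F).exec ŝ₁).farr = ŝ₁.farr := rfl
  have keyt : ((tick c : Prog F).exec ŝ₁).time = ŝ₁.time + 6 := by
    simp [tick, Prog.exec, State.setN, State.charge, NExp.cost]
  have keyp : ((tick c : Prog F).exec ŝ₁).peak ≤ max ŝ.peak B := by
    simp only [tick, Prog.exec, State.setN, State.charge, NExp.peak, NExp.eval, h4, hc]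
    omega
  refine ⟨⟨?_, ?_, ⟨c, ?_, ?_⟩, keyp, ?_⟩, ⟨?_, fun _ => ⟨⟨⟨?_, ?_, ?_⟩, ?_, ?_⟩, ?_⟩⟩⟩
  · refine ⟨fun a ha => ?_, fun a ha => ?_, ?_, ?_⟩
    · have : a ≠ 4 := by rintro rfl; simp at ha
      rw [key a this]
      exact hframe.n a fun h => ha (List.mem_cons_of_mem _ h)
    · rw [keyf]; exact hframe.f a ha
    · exact hframe.no
    · exact hframe.fo
  · intro a i ha hi
    rw [key a (by omega), keyf]
    exact hhi a i ha hi
  · rw [key4, hc]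
  · rw [keyt]
    have : K * 1 ≤ K * (1 + c) := Nat.mul_le_mul_left _ (by omega)
    omega
  · rw [key4]; omega
  · rw [key4, hs']
  · rw [key 2 (by decide)]; exact hrel.mem.base
  · intro a i hi; rw [key _ (by omega)]; exact hrel.mem.n a i hi
  · intro a i hi; rw [keyf]; exact hrel.mem.f a i hi
  · intro hk; rw [key 5 (by decide), key 30 (by decide)]; exact hrel.cn hk
  · rw [key 6 (by decide), keyf]; exact hrel.cf
  · rw [key4, hs']

theorem RelM.charge {keep : Bool} {b w : ℕ} {s ŝ : State F} (h : RelM keep b w s ŝ)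
    (t v t' v' : ℕ) : RelM keep b w (s.charge t v) (ŝ.charge t' v') :=
  ⟨⟨h.mem.base, h.mem.n, h.mem.f⟩, h.cn, h.cf⟩

theorem RelM.setN {keep : Bool} {b w : ℕ} {s ŝ : State F} (h : RelM keep b w s ŝ)
    (a i v : ℕ) : RelM keep b w (s.setN a i v) (ŝ.setN (a + 40) (b + i) v) := by
  have key : ∀ c, c < 40 → (ŝ.setN (a + 40) (b + i) v).narr c = ŝ.narr c := by
    intro c hc
    have : c ≠ a + 40 := by omega
    simp [State.setN, this]
  refine ⟨⟨?_, fun a' j hj => ?_, h.mem.f⟩, ?_, ?_⟩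
  · rw [key _ (by omega)]; exact h.mem.base
  · by_cases ha : a' = a
    · subst ha
      by_cases hj' : j = i
      · subst hj'; simp [State.setN]
      · have : b + j ≠ b + i := by omega
        simpa [State.setN, Function.update_of_ne hj', Function.update_of_ne this] using
          h.mem.n a' j hj
    · have : a' + 40 ≠ a + 40 := by omega
      simpa [State.setN, Function.update_of_ne ha, Function.update_of_ne this] using h.mem.n a' j hj
  · rw [key _ (by omega), key _ (by omega)]; exact h.cn
  · rw [key _ (by omega)]; exact h.cf

theorem RelM.setF {keep : Bool} {b w : ℕ} {s ŝ : State F} (h : RelM keep b w s ŝ)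
    (a i : ℕ) (v : F) : RelM keep b w (s.setF a i v) (ŝ.setF (a + 40) (b + i) v) := by
  have key : ∀ c, c < 40 → (ŝ.setF (a + 40) (b + i) v).farr c = ŝ.farr c := by
    intro c hc
    have : c ≠ a + 40 := by omega
    simp [State.setF, this]
  refine ⟨⟨h.mem.base, h.mem.n, fun a' j hj => ?_⟩, h.cn, ?_⟩
  · by_cases ha : a' = a
    · subst ha
      by_cases hj' : j = i
      · subst hj'; simp [State.setF]
      · have : b + j ≠ b + i := by omega
        simpa [State.setF, Function.update_of_ne hj', Function.update_of_ne this] using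
          h.mem.f a' j hj
    · have : a' + 40 ≠ a + 40 := by omega
      simpa [State.setF, Function.update_of_ne ha, Function.update_of_ne this] using h.mem.f a' j hj
  · rw [key _ (by omega)]; exact h.cf

theorem getD_append_single {α : Type*} (l : List α) (v d : α) (i : ℕ) (hi : i < l.length + 1) :
    (l ++ [v]).getD i d = if i = l.length then v else l.getD i d := by
  split
  · rename_i h; subst h; simp
  · rename_i h; rw [List.getD_append]; omega

theorem RelM.emitF {keep : Bool} {b w : ℕ} {s ŝ : State F} (h : RelM keep b w s ŝ) (v : F) :
    RelM keep b w (s.emitF v) ((ŝ.setF 30 s.fOut.length v).setN 6 0 (s.fOut.length + 1)) := by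
  refine ⟨⟨?_, fun a' j hj => ?_, fun a' j hj => ?_⟩, ?_, ?_⟩
  · simpa [State.setN, State.setF] using h.mem.base
  · have : a' + 40 ≠ 6 := by omega
    simpa [State.setN, State.setF, State.emitF, Function.update_of_ne this] using h.mem.n a' j hj
  · have : a' + 40 ≠ 30 := by omega
    simpa [State.setN, State.setF, State.emitF, Function.update_of_ne this] using h.mem.f a' j hj
  · simpa [State.setN, State.setF, State.emitF] using h.cn
  · simp only [State.setN, State.setF, State.emitF, Function.update_self, List.length_append,
      List.length_singleton, true_and]
    intro i hi
    rw [getD_append_single _ _ _ _ hi]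
    split
    · rename_i h; subst h; simp
    · rename_i h'
      rw [Function.update_of_ne h']; exact h.cf.2 i (by omega)

theorem RelM.emitN {keep : Bool} {b w : ℕ} {s ŝ : State F} (h : RelM keep b w s ŝ) (v : ℕ) :
    RelM keep b w (s.emitN v) ((ŝ.setN 30 s.nOut.length v).setN 5 0 (s.nOut.length + 1)) := by
  refine ⟨⟨?_, fun a' j hj => ?_, h.mem.f⟩, fun hk => ?_, ?_⟩
  · simpa [State.setN] using h.mem.base
  · have h1 : a' + 40 ≠ 5 := by omega
    have h2 : a' + 40 ≠ 30 := by omega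
    simpa [State.setN, State.emitN, Function.update_of_ne h1, Function.update_of_ne h2] using
      h.mem.n a' j hj
  · simp only [State.setN, State.emitN, Function.update_self, List.length_append,
      List.length_singleton, true_and]
    intro i hi
    rw [getD_append_single _ _ _ _ hi, Function.update_of_ne (by decide), Function.update_self]
    split
    · rename_i h; subst h; simp
    · rename_i h'
      rw [Function.update_of_ne h']; exact (h.cn hk).2 i (by omega)
  · simpa [State.setN, State.emitN] using h.cf

theorem RelM.emitN_drop {b w : ℕ} {s ŝ : State F} (h : RelM false b w s ŝ) (v : ℕ) :
    RelM false b w (s.emitN v) ŝ :=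
  ⟨⟨h.mem.base, h.mem.n, h.mem.f⟩, fun hk => by simp at hk, h.cf⟩

end Relocation

/-! ### Simulation of the elementary statements -/

section Relocation

theorem run_guarded (fuel : ℕ) (p : Prog F) (s : State F) :
    (guarded p).run fuel s = if s.narr 4 0 < s.narr 1 0 then
      p.run fuel (s.charge 6 (max (s.narr 4 0) (s.narr 1 0))) else
      PMF.pure (some ((s.charge 6 (max (s.narr 4 0) (s.narr 1 0))).charge 1 0)) := by
  by_cases h : s.narr 4 0 < s.narr 1 0 <;>
    simp [guarded, Prog.run, BExp.eval, BExp.peak, BExp.cost, NExp.eval, NExp.peak, NExp.cost, h]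

theorem guarded_cut {b w cap B K fuel : ℕ} {p : Prog F} {s : State F} (hcap : s.narr 1 0 = cap)
    (hB : cap < B) (hclk : s.narr 4 0 ≤ B) (hcut : cap ≤ s.narr 4 0) (hK : 7 ≤ K) :
    ∃ s', (guarded p).run fuel s = PMF.pure (some s') ∧ s'.narr 4 0 = s.narr 4 0 ∧
      Moved b w cap B K s s' := by
  have h : ¬ s.narr 4 0 < s.narr 1 0 := by omega
  refine ⟨_, (run_guarded fuel p s).trans (if_neg h), rfl, ?_⟩
  refine ⟨(Same.charge _ _ _ _ _).trans (Same.charge _ _ _ _ _), fun _ _ _ _ => ⟨rfl, rfl⟩,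
    ⟨0, rfl, ?_⟩, ?_, ?_⟩
  · simp only [State.charge]; omega
  · simp only [State.charge]; omega
  · simp only [State.charge]; omega

theorem testFlag_cut {b w cap B K fuel : ℕ} {e : BExp F} {s : State F} (hcap : s.narr 1 0 = cap)
    (hB : cap < B) (hclk : s.narr 4 0 ≤ B) (hcut : cap ≤ s.narr 4 0)
    (hK : (testFlag e).tbound ≤ K) :
    ∃ s', (testFlag e).run fuel s = PMF.pure (some s') ∧ s'.narr 4 0 = s.narr 4 0 ∧
      s'.narr 7 0 = 0 ∧ s'.time ≤ s.time + K ∧ Moved b w cap B K s s' := by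
  have hs : (testFlag e).Simple = true := by simp [testFlag, Prog.Simple, tick]
  have he : (testFlag e).exec s = ((s.charge 6 (max (s.narr 4 0) (s.narr 1 0))).charge 3 0).setN
      7 0 0 := by
    have : ¬ s.narr 4 0 < s.narr 1 0 := by omega
    simp [testFlag, Prog.exec, BExp.eval, BExp.peak, BExp.cost, NExp.eval, NExp.peak, NExp.cost,
      this]
  have ht := (testFlag e).exec_time hs s
  refine ⟨_, Prog.run_simple fuel _ hs s, ?_, ?_, by omega, ?_, ?_, ⟨0, ?_, by omega⟩, ?_, ?_⟩
  · rw [he]; simp [State.setN, State.charge]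
  · rw [he]; simp [State.setN]
  · rw [he]; exact (Same.charge _ _ _ _ _).trans
      ((Same.charge _ _ _ _ _).trans (Same.setN _ _ _ _ (by decide)))
  · intro a i ha hi
    have : a ≠ 7 := by omega
    rw [he]; simp [State.setN, State.charge, this]
  · rw [he]; simp [State.setN, State.charge]
  · rw [he]; simp only [State.setN, State.charge]; omega
  · rw [he]; simp [State.setN, State.charge]

/-- Outcomes of a run and of the moved run that belong together. -/
def SimPost (keep : Bool) (b w cap B K : ℕ) (ŝ : State F) (o o' : Option (State F)) : Prop :=
  ∃ s' ŝ', o = some s' ∧ o' = some ŝ' ∧ Sim keep b w cap s' ŝ' ∧ Moved b w cap B K ŝ ŝ'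

/-- All outcomes are final states within the resource bounds. -/
def Bounded (keep : Bool) (w : ℕ) (μ : PMF (Option (State F))) : Prop :=
  ∀ o ∈ μ.support, ∃ s', o = some s' ∧ s'.peak ≤ w ∧ s'.fOut.length ≤ w ∧
    (keep = true → s'.nOut.length ≤ w)

/-- After the clock has expired nothing is claimed about the memory. All that has to survive is that
the clock is at most the time of the original run, and this time can only grow. -/
theorem simPost_of_cut {keep : Bool} {b w cap B K : ℕ} {s ŝ ŝ' : State F}
    {μ : PMF (Option (State F))} (hgood : Bounded keep w μ)
    (hgrow : ∀ s', some s' ∈ μ.support → Grows s s')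
    (hsim : Sim keep b w cap s ŝ) (hcut : cap ≤ ŝ.narr 4 0) (h4 : ŝ'.narr 4 0 = ŝ.narr 4 0)
    (hm : Moved b w cap B K ŝ ŝ') :
    Coup μ (PMF.pure (some ŝ')) (SimPost keep b w cap B K ŝ) := by
  refine Coup.pure_right fun o ho => ?_
  obtain ⟨s', rfl, -⟩ := hgood o ho
  have := (hgrow s' ho).time
  have := hsim.clk
  exact ⟨s', ŝ', rfl, rfl, ⟨by omega, fun h => by omega⟩, hm⟩

theorem RelM.charge_right {keep : Bool} {b w : ℕ} {s ŝ : State F} (h : RelM keep b w s ŝ)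
    (t v : ℕ) : RelM keep b w s (ŝ.charge t v) :=
  ⟨⟨h.mem.base, h.mem.n, h.mem.f⟩, h.cn, h.cf⟩

/-- Common part of the elementary statements. Either the clock has expired and the statement is
skipped, or `q` imitates it and the clock advances by its original cost `c`. Only `hbody` depends on
the kind of statement. -/
theorem prim_sim {keep : Bool} {b w cap B K c X fuel : ℕ} {s ŝ : State F} {q : Prog F}
    {μ : PMF (Option (State F))} (hcap : ŝ.narr 1 0 = cap) (hB : cap + K ≤ B)
    (hclk : ŝ.narr 4 0 ≤ B) (hX : X + 6 ≤ K) (hcK : c ≤ K) (hX7 : 7 ≤ K)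
    (hgood : Bounded keep w μ)
    (hgrow : ∀ s', some s' ∈ μ.support → Grows s s')
    (hsim : Sim keep b w cap s ŝ)
    (hbody : ∀ σ, RelM keep b w s σ → Same [5, 6, 7, 30, 40] [30, 40] ŝ σ →
      (∀ a i, 40 ≤ a → b + w < i → σ.narr a i = ŝ.narr a i ∧ σ.farr a i = ŝ.farr a i) →
      σ.time = ŝ.time + 6 → σ.peak ≤ max ŝ.peak B → Coup μ (q.run fuel σ) fun o o' => ∃ s' ŝ₁, o = some s' ∧ o' = some ŝ₁ ∧ RelM keep b w s' ŝ₁ ∧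
        Same [5, 6, 7, 30, 40] [30, 40] ŝ ŝ₁ ∧
        (∀ a i, 40 ≤ a → b + w < i → ŝ₁.narr a i = ŝ.narr a i ∧ ŝ₁.farr a i = ŝ.farr a i) ∧
        ŝ₁.time ≤ ŝ.time + X ∧ ŝ₁.peak ≤ max ŝ.peak B ∧ s'.time = s.time + c) :
    Coup μ ((guarded (.seq q (tick c))).run fuel ŝ) (SimPost keep b w cap B K ŝ) := by
  by_cases hcut : cap ≤ ŝ.narr 4 0
  · obtain ⟨ŝ', h1, h2, h3⟩ := guarded_cut (b := b) (w := w) (fuel := fuel)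
      (p := .seq q (tick c)) hcap (by omega : cap < B) hclk hcut hX7
    rw [h1]
    exact simPost_of_cut hgood hgrow hsim hcut h2 h3
  · have hlt : ŝ.narr 4 0 < ŝ.narr 1 0 := by omega
    rw [run_guarded, if_pos hlt]
    obtain ⟨hrel, hc⟩ := hsim.rel (by omega)
    have := (hbody _ (hrel.charge_right 6 (max (ŝ.narr 4 0) (ŝ.narr 1 0)))
      (Same.charge _ _ _ _ _) (fun _ _ _ _ => ⟨rfl, rfl⟩) rfl
      (by simp only [State.charge]; omega)).bind (f := PMF.pure)
      (g := fun o => o.elim (PMF.pure none) ((tick c : Prog F).run fuel))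
      (R := SimPost keep b w cap B K ŝ) ?_
    · rw [PMF.bind_pure] at this
      exact this
    · rintro o o' ⟨s', ŝ₁, rfl, rfl, h1, h2, h3, h4, h5, h6⟩
      simp only [Option.elim]
      rw [Prog.run_simple fuel (tick c) rfl]
      obtain ⟨h7, h8⟩ := tick_moved hc (by omega) hB h1 h2 h3 h4 h5 h6 hX hcK
      exact Coup.pure ⟨s', _, rfl, rfl, h8, h7⟩

theorem bounded_pure {keep : Bool} {w : ℕ} {s : State F}
    (h : Bounded keep w (PMF.pure (some s))) :
    s.peak ≤ w ∧ s.fOut.length ≤ w ∧ (keep = true → s.nOut.length ≤ w) := by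
  obtain ⟨s', h1, h2⟩ := h (some s) (by simp)
  obtain rfl := Option.some.inj h1
  exact h2

theorem frame_setN {b w a i v : ℕ} {s s' : State F}
    (h : Same [5, 6, 7, 30, 40] [30, 40] s s') (hi : i ≤ b + w)
    (hh : ∀ a i, 40 ≤ a → b + w < i → s'.narr a i = s.narr a i ∧ s'.farr a i = s.farr a i) :
    Same [5, 6, 7, 30, 40] [30, 40] s (s'.setN (a + 40) i v) ∧
    (∀ a' i', 40 ≤ a' → b + w < i' → (s'.setN (a + 40) i v).narr a' i' = s.narr a' i' ∧
      (s'.setN (a + 40) i v).farr a' i' = s.farr a' i') := by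
  refine ⟨h.trans (Same.setN _ _ _ _ (by simp)), fun a' i' ha hi' => ⟨?_, (hh a' i' ha hi').2⟩⟩
  rw [← (hh a' i' ha hi').1]
  by_cases h1 : a' = a + 40
  · subst h1
    have : i' ≠ i := by omega
    simp [State.setN, this]
  · simp [State.setN, h1]

theorem frame_setF {b w a i : ℕ} {v : F} {s s' : State F}
    (h : Same [5, 6, 7, 30, 40] [30, 40] s s') (hi : i ≤ b + w)
    (hh : ∀ a i, 40 ≤ a → b + w < i → s'.narr a i = s.narr a i ∧ s'.farr a i = s.farr a i) :
    Same [5, 6, 7, 30, 40] [30, 40] s (s'.setF (a + 40) i v) ∧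
    (∀ a' i', 40 ≤ a' → b + w < i' → (s'.setF (a + 40) i v).narr a' i' = s.narr a' i' ∧
      (s'.setF (a + 40) i v).farr a' i' = s.farr a' i') := by
  refine ⟨h.trans (Same.setF _ _ _ _ (by simp)), fun a' i' ha hi' => ⟨(hh a' i' ha hi').1, ?_⟩⟩
  rw [← (hh a' i' ha hi').2]
  by_cases h1 : a' = a + 40
  · subst h1
    have : i' ≠ i := by omega
    simp [State.setF, this]
  · simp [State.setF, h1]

/-- The hypotheses of the simulation theorem for one program. -/
def Simulates (keep : Bool) (b w cap B f₀ fuel : ℕ) (P : Prog F) : Prop :=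
  ∀ s ŝ : State F, ŝ.narr 1 0 = cap → ŝ.narr 4 0 ≤ B → Sim keep b w cap s ŝ →
    cap + P.slow keep ≤ B → Bounded keep w (P.run f₀ s) →
    Coup (P.run f₀ s) ((P.tr keep).run fuel ŝ) (SimPost keep b w cap B (P.slow keep) ŝ)

theorem simulates_skip {keep : Bool} {b w cap B f₀ fuel : ℕ} :
    Simulates (F := F) keep b w cap B f₀ fuel .skip := by
  intro s ŝ hcap hclk hsim hB hgood
  have hgrow := fun s' => Prog.run_grows f₀ .skip s s'
  have hlt : (tick 1 : Prog F).Simple = true := rfl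
  by_cases hcut : cap ≤ ŝ.narr 4 0
  · obtain ⟨ŝ', h1, h2, h3⟩ := guarded_cut (b := b) (w := w) (fuel := fuel)
      (p := tick 1) (K := Prog.slow keep (.skip : Prog F)) hcap
      (by simp only [Prog.slow] at hB; omega) hclk hcut (by simp [Prog.slow])
    rw [Prog.tr, h1]
    exact simPost_of_cut hgood hgrow hsim hcut h2 h3
  · have hlt' : ŝ.narr 4 0 < ŝ.narr 1 0 := by omega
    rw [Prog.tr, run_guarded, if_pos hlt', Prog.run_simple _ _ hlt]
    obtain ⟨hrel, hc⟩ := hsim.rel (by omega)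
    set ŝ₁ := ŝ.charge 6 (max (ŝ.narr 4 0) (ŝ.narr 1 0)) with hŝ₁
    obtain ⟨h7, h8⟩ := tick_moved (s' := s.charge 1 0) (ŝ₁ := ŝ₁) (c := 1) (X := 6) hc
      (by omega) hB (hrel.charge _ _ _ _) (Same.charge _ _ _ _ _) (fun _ _ _ _ => ⟨rfl, rfl⟩)
      le_rfl (by simp only [hŝ₁, State.charge, Prog.slow] at *; omega) rfl (by simp [Prog.slow])
      (by simp [Prog.slow])
    exact Coup.pure ⟨_, _, rfl, rfl, h8, h7⟩

theorem simulates_nset {keep : Bool} {b w cap B f₀ fuel : ℕ} (hw : b + w ≤ B) (a : ℕ)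
    (i e : NExp) : Simulates (F := F) keep b w cap B f₀ fuel (.nset a i e) := by
  intro s ŝ hcap hclk hsim hB hgood
  have hgrow := fun s' => Prog.run_grows f₀ (.nset a i e) s s'
  refine prim_sim (X := 6 + (Prog.nset (F := F) (a + 40) (.add (V 2) i.tr) e.tr).tbound) hcap hB hclk
    ?_ ?_ ?_ hgood hgrow hsim ?_
  · simp only [Prog.slow, Prog.tr, guarded, Prog.tbound, BExp.cost, NExp.cost, tick]; omega
  · simp only [Prog.slow, Prog.tbound]; omega
  · simp only [Prog.slow, Prog.tr, guarded, Prog.tbound, BExp.cost, NExp.cost, tick]; omega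
  intro σ hrel hsame hhi ht hpk
  obtain ⟨hp, -, -⟩ := bounded_pure hgood
  simp only [State.setN, State.charge] at hp
  have hm := hrel.mem
  obtain ⟨e1, e2⟩ := NExp.tr_eval hm i (by omega)
  obtain ⟨e3, e4⟩ := NExp.tr_eval hm e (by omega)
  have hi := NExp.eval_le_peak s i
  have h2 : σ.narr 2 0 = b := hm.base
  simp only [Prog.run, NExp.eval, e1, e3, h2]
  obtain ⟨f1, f2⟩ := frame_setN (a := a) (v := e.eval s) (i := b + i.eval s) (b := b) (w := w)
    (hsame.trans (Same.charge _ _ _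
      ((NExp.add (V 2) i.tr).cost + e.tr.cost + 1)
      (max ((NExp.add (V 2) i.tr).peak σ) (e.tr.peak σ))))
    (by omega) hhi
  refine Coup.pure ⟨_, _, rfl, rfl, ?_, f1, f2, ?_, ?_, ?_⟩
  · exact (hrel.charge _ _ _ _).setN a (i.eval s) (e.eval s)
  · simp only [State.charge, State.setN, Prog.tbound]; omega
  · simp only [State.charge, State.setN, NExp.peak, NExp.eval, h2, e1]; omega
  · simp only [State.charge, State.setN, Prog.tbound]

theorem simulates_fset {keep : Bool} {b w cap B f₀ fuel : ℕ} (hw : b + w ≤ B) (a : ℕ) (i : NExp)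
    (e : FExp F) :
    Simulates (F := F) keep b w cap B f₀ fuel (.fset a i e) := by
  intro s ŝ hcap hclk hsim hB hgood
  have hgrow := fun s' => Prog.run_grows f₀ (.fset a i e) s s'
  refine prim_sim (X := 6 + (Prog.fset (F := F) (a + 40) (.add (V 2) i.tr) e.tr).tbound) hcap hB hclk
    ?_ ?_ ?_ hgood hgrow hsim ?_
  · simp only [Prog.slow, Prog.tr, guarded, Prog.tbound, BExp.cost, NExp.cost, tick]; omega
  · simp only [Prog.slow, Prog.tbound]; omega
  · simp only [Prog.slow, Prog.tr, guarded, Prog.tbound, BExp.cost, NExp.cost, tick]; omega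
  intro σ hrel hsame hhi ht hpk
  obtain ⟨hp, -, -⟩ := bounded_pure hgood
  simp only [State.setN, State.setF, State.charge] at hp
  have hm := hrel.mem
  obtain ⟨e1, e2⟩ := NExp.tr_eval hm i (by omega)
  obtain ⟨e3, e4⟩ := FExp.tr_eval hm e (by omega)
  have hi := NExp.eval_le_peak s i
  have h2 : σ.narr 2 0 = b := hm.base
  simp only [Prog.run, NExp.eval, e1, e3, h2]
  obtain ⟨f1, f2⟩ := frame_setF (a := a) (v := e.eval s) (i := b + i.eval s) (b := b) (w := w)
    (hsame.trans (Same.charge _ _ _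
      ((NExp.add (V 2) i.tr).cost + e.tr.cost + 1)
      (max ((NExp.add (V 2) i.tr).peak σ) (e.tr.peak σ))))
    (by omega) hhi
  refine Coup.pure ⟨_, _, rfl, rfl, ?_, f1, f2, ?_, ?_, ?_⟩
  · exact (hrel.charge _ _ _ _).setF a (i.eval s) (e.eval s)
  · simp only [State.charge, State.setF, Prog.tbound]; omega
  · simp only [State.charge, State.setF, NExp.peak, NExp.eval, h2, e1]; omega
  · simp only [State.charge, State.setF, Prog.tbound]

theorem simulates_frand {keep : Bool} {b w cap B f₀ fuel : ℕ} (hw : b + w ≤ B) (a : ℕ) (i : NExp) :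
    Simulates (F := F) keep b w cap B f₀ fuel (.frand a i) := by
  intro s ŝ hcap hclk hsim hB hgood
  have hgrow := fun s' => Prog.run_grows f₀ (.frand a i) s s'
  refine prim_sim (X := 6 + (Prog.frand (F := F) (a + 40) (.add (V 2) i.tr)).tbound) hcap hB hclk
    ?_ ?_ ?_ hgood hgrow hsim ?_
  · simp only [Prog.slow, Prog.tr, guarded, Prog.tbound, BExp.cost, NExp.cost, tick]; omega
  · simp only [Prog.slow, Prog.tbound]; omega
  · simp only [Prog.slow, Prog.tr, guarded, Prog.tbound, BExp.cost, NExp.cost, tick]; omega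
  intro σ hrel hsame hhi ht hpk
  -- The peak does not depend on the element that is drawn, so the bound can be read off from the
  -- outcome `0`.
  have hp : i.peak s ≤ w := by
    obtain ⟨s', h1, h2, -⟩ := hgood (some ((s.charge (i.cost + 1) (i.peak s)).setF a (i.eval s) 0))
      (by rw [Prog.run, PMF.mem_support_map_iff]; exact ⟨0, by simp, rfl⟩)
    obtain rfl := Option.some.inj h1
    simp only [State.setF, State.charge] at h2
    omega
  have hm := hrel.mem
  obtain ⟨e1, e2⟩ := NExp.tr_eval hm i (by omega)
  have hi := NExp.eval_le_peak s i
  have h2 : σ.narr 2 0 = b := hm.base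
  simp only [Prog.run, NExp.eval, e1, h2]
  refine (Coup.refl _ (Q := (· = ·)) fun _ _ => rfl).map ?_
  rintro r _ rfl
  obtain ⟨f1, f2⟩ := frame_setF (a := a) (v := r) (i := b + i.eval s) (b := b) (w := w)
    (hsame.trans (Same.charge _ _ _
      ((NExp.add (V 2) i.tr).cost + 1) ((NExp.add (V 2) i.tr).peak σ)))
    (by omega) hhi
  refine ⟨_, _, rfl, rfl, ?_, f1, f2, ?_, ?_, ?_⟩
  · exact (hrel.charge _ _ _ _).setF a (i.eval s) r
  · simp only [State.charge, State.setF, Prog.tbound]; omega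
  · simp only [State.charge, State.setF, NExp.peak, NExp.eval, h2, e1]; omega
  · simp only [State.charge, State.setF, Prog.tbound]

/-- The original and the moved bound are equal only by a theorem, so the two sample spaces are
different types. Functions of the underlying number make the draws comparable. -/
theorem coup_uniform_fin {γ δ : Type*} {k k' : ℕ} (h : k' = k) {f : ℕ → γ} {g : ℕ → δ}
    {R : γ → δ → Prop} (hfg : ∀ r, R (f r) (g r)) :
    Coup ((PMF.uniformOfFintype (Fin (k + 1))).map fun r => f r.val)
      ((PMF.uniformOfFintype (Fin (k' + 1))).map fun r => g r.val) R := by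
  subst h
  refine (Coup.refl _ (Q := (· = ·)) fun _ _ => rfl).map ?_
  rintro r _ rfl
  exact hfg _

theorem simulates_nrand {keep : Bool} {b w cap B f₀ fuel : ℕ} (hw : b + w ≤ B) (a : ℕ) (i k : NExp) :
    Simulates (F := F) keep b w cap B f₀ fuel (.nrand a i k) := by
  intro s ŝ hcap hclk hsim hB hgood
  have hgrow := fun s' => Prog.run_grows f₀ (.nrand a i k) s s'
  refine prim_sim (X := 6 + (Prog.nrand (F := F) (a + 40) (.add (V 2) i.tr) k.tr).tbound) hcap hB hclk
    ?_ ?_ ?_ hgood hgrow hsim ?_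
  · simp only [Prog.slow, Prog.tr, guarded, Prog.tbound, BExp.cost, NExp.cost, tick]; omega
  · simp only [Prog.slow, Prog.tbound]; omega
  · simp only [Prog.slow, Prog.tr, guarded, Prog.tbound, BExp.cost, NExp.cost, tick]; omega
  intro σ hrel hsame hhi ht hpk
  have hp : max (i.peak s) (k.peak s) ≤ w := by
    obtain ⟨s', h1, h2, -⟩ := hgood (some ((s.charge (i.cost + k.cost + 1)
      (max (i.peak s) (k.peak s))).setN a (i.eval s) (0 : Fin (k.eval s + 1)).val))
      (by rw [Prog.run, PMF.mem_support_map_iff]; exact ⟨0, by simp, rfl⟩)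
    obtain rfl := Option.some.inj h1
    simp only [State.setN, State.charge] at h2
    omega
  have hm := hrel.mem
  obtain ⟨e1, e2⟩ := NExp.tr_eval hm i (by omega)
  obtain ⟨e3, e4⟩ := NExp.tr_eval hm k (by omega)
  have hi := NExp.eval_le_peak s i
  have h2 : σ.narr 2 0 = b := hm.base
  have e5 : (NExp.add (V 2) i.tr).eval σ = b + i.eval s := by simp only [NExp.eval, e1, h2]
  refine coup_uniform_fin e3
    (f := fun r => some ((s.charge (i.cost + k.cost + 1) (max (i.peak s) (k.peak s))).setN a
      (i.eval s) r))
    (g := fun r => some ((σ.charge ((NExp.add (V 2) i.tr).cost + k.tr.cost + 1)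
      (max ((NExp.add (V 2) i.tr).peak σ) (k.tr.peak σ))).setN (a + 40)
      ((NExp.add (V 2) i.tr).eval σ) r)) fun r => ?_
  rw [e5]
  obtain ⟨f1, f2⟩ := frame_setN (a := a) (v := r) (i := b + i.eval s) (b := b) (w := w)
    (hsame.trans (Same.charge _ _ _
      ((NExp.add (V 2) i.tr).cost + k.tr.cost + 1)
      (max ((NExp.add (V 2) i.tr).peak σ) (k.tr.peak σ))))
    (by omega) hhi
  refine ⟨_, _, rfl, rfl, ?_, f1, f2, ?_, ?_, ?_⟩
  · exact (hrel.charge _ _ _ _).setN a (i.eval s) r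
  · simp only [State.charge, State.setN, Prog.tbound]; omega
  · simp only [State.charge, State.setN, NExp.peak, NExp.eval, h2, e1]; omega
  · simp only [State.charge, State.setN, Prog.tbound]

theorem simulates_femit {keep : Bool} {b w cap B f₀ fuel : ℕ} (hw : b + w ≤ B) (e : FExp F) :
    Simulates (F := F) keep b w cap B f₀ fuel (.femit e) := by
  intro s ŝ hcap hclk hsim hB hgood
  have hgrow := fun s' => Prog.run_grows f₀ (.femit e) s s'
  refine prim_sim (X := 6 + (Prog.seq (.fset 30 (V 6) e.tr) (.nset 6 (.lit 0) (.add (V 6) (.lit 1)))).tbound) hcap hB hclk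
    ?_ ?_ ?_ hgood hgrow hsim ?_
  · simp only [Prog.slow, Prog.tr, guarded, Prog.tbound, BExp.cost, NExp.cost, tick]; omega
  · simp only [Prog.slow, Prog.tbound]; omega
  · simp only [Prog.slow, Prog.tr, guarded, Prog.tbound, BExp.cost, NExp.cost, tick]; omega
  intro σ hrel hsame hhi ht hpk
  obtain ⟨hp, hl, -⟩ := bounded_pure hgood
  simp only [State.emitF, State.charge, List.length_append, List.length_singleton] at hp hl
  have hm := hrel.mem
  obtain ⟨e3, e4⟩ := FExp.tr_eval hm e (by omega)
  obtain ⟨σ', hσ'⟩ : ∃ σ', σ' = σ.charge ((V 6).cost + e.tr.cost + 1)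
      (max ((V 6).peak σ) (e.tr.peak σ)) := ⟨_, rfl⟩
  have hrel' : RelM keep b w (s.charge (e.cost + 1) (e.peak s)) σ' := hσ' ▸ hrel.charge _ _ _ _
  have h6 : σ.narr 6 0 = s.fOut.length := hrel.cf.1
  have h6' : σ'.narr 6 0 = s.fOut.length := hrel'.cf.1
  have hs' : Same [5, 6, 7, 30, 40] [30, 40] ŝ σ' := hσ' ▸ hsame.trans (Same.charge _ _ _ _ _)
  have ht' : σ'.time = σ.time + (e.tr.cost + 3) := by
    simp only [hσ', State.charge, NExp.cost]; omega
  have hp' : σ'.peak ≤ max ŝ.peak B := by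
    simp only [hσ', State.charge, NExp.peak, NExp.eval, h6]; omega
  have hh' : σ'.narr = σ.narr ∧ σ'.farr = σ.farr := by rw [hσ']; exact ⟨rfl, rfl⟩
  have hres := hrel'.emitF (e.eval s)
  simp only [Prog.run, NExp.eval, e3, PMF.pure_bind, Option.elim, h6]
  rw [← hσ']
  refine Coup.pure ⟨_, _, rfl, rfl, ?_, ?_, ?_, ?_, ?_, ?_⟩
  · have := hres.charge_right 6 s.fOut.length
    rw [show (σ'.setF 30 s.fOut.length (e.eval s)).narr 6 0 = s.fOut.length from h6']
    exact ⟨⟨this.mem.base, this.mem.n, this.mem.f⟩, this.cn, this.cf⟩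
  · exact (hs'.trans (Same.setF _ _ _ _ (by decide))).trans
      ((Same.charge _ _ _ _ _).trans (Same.setN _ _ _ _ (by decide)))
  · intro a i ha hi
    have h1 : a ≠ 6 := by omega
    have h2 : a ≠ 30 := by omega
    simpa [State.setN, State.setF, State.charge, h1, h2, hh'.1, hh'.2] using hhi a i ha hi
  · simp only [State.charge, State.setN, State.setF, Prog.tbound, NExp.cost]; omega
  · simp only [State.charge, State.setN, State.setF, NExp.peak, NExp.eval, h6']; omega
  · simp only [State.charge, State.emitF]

theorem simulates_nemit {keep : Bool} {b w cap B f₀ fuel : ℕ} (hw : b + w ≤ B) (e : NExp) :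
    Simulates (F := F) keep b w cap B f₀ fuel (.nemit e) := by
  intro s ŝ hcap hclk hsim hB hgood
  have hgrow := fun s' => Prog.run_grows f₀ (.nemit e) s s'
  cases keep with
  | false =>
    refine prim_sim (X := 7) hcap hB hclk ?_ ?_ ?_ hgood hgrow hsim ?_
    · simp [Prog.slow, Prog.tr, guarded, Prog.tbound, BExp.cost, NExp.cost, tick]
    · simp only [Prog.slow, Prog.tbound]; omega
    · simp only [Prog.slow, Prog.tr, guarded, Prog.tbound, BExp.cost, NExp.cost, tick]; omega
    intro σ hrel hsame hhi ht hpk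
    simp only [Prog.run, Bool.false_eq_true, if_false]
    refine Coup.pure ⟨_, _, rfl, rfl, ((hrel.charge _ _ _ _).emitN_drop _), ?_, hhi, ?_, ?_, ?_⟩
    · exact hsame.trans (Same.charge _ _ _ _ _)
    · simp only [State.charge]; omega
    · simp only [State.charge]; omega
    · simp only [State.charge, State.emitN]
  | true =>
    refine prim_sim (X := 6 + (Prog.seq (F := F) (.nset 30 (V 5) e.tr)
      (.nset 5 (.lit 0) (.add (V 5) (.lit 1)))).tbound) hcap hB hclk ?_ ?_ ?_ hgood hgrow hsim ?_
    · simp [Prog.slow, Prog.tr, guarded, Prog.tbound, BExp.cost, NExp.cost, tick]; omega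
    · simp only [Prog.slow, Prog.tbound]; omega
    · simp only [Prog.slow, Prog.tr, guarded, Prog.tbound, BExp.cost, NExp.cost, tick]; omega
    intro σ hrel hsame hhi ht hpk
    obtain ⟨hp, -, hl⟩ := bounded_pure hgood
    simp only [State.emitN, State.charge, List.length_append, List.length_singleton,
      true_imp_iff] at hp hl
    have hm := hrel.mem
    obtain ⟨e3, e4⟩ := NExp.tr_eval hm e (by omega)
    obtain ⟨σ', hσ'⟩ : ∃ σ', σ' = σ.charge ((V 5).cost + e.tr.cost + 1)
        (max ((V 5).peak σ) (e.tr.peak σ)) := ⟨_, rfl⟩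
    have hrel' : RelM true b w (s.charge (e.cost + 1) (e.peak s)) σ' := hσ' ▸ hrel.charge _ _ _ _
    have h6 : σ.narr 5 0 = s.nOut.length := (hrel.cn rfl).1
    have h6' : σ'.narr 5 0 = s.nOut.length := (hrel'.cn rfl).1
    have hs' : Same [5, 6, 7, 30, 40] [30, 40] ŝ σ' := hσ' ▸ hsame.trans (Same.charge _ _ _ _ _)
    have ht' : σ'.time = σ.time + (e.tr.cost + 3) := by
      simp only [hσ', State.charge, NExp.cost]; omega
    have hp' : σ'.peak ≤ max ŝ.peak B := by
      simp only [hσ', State.charge, NExp.peak, NExp.eval, h6]; omega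
    have hh' : σ'.narr = σ.narr ∧ σ'.farr = σ.farr := by rw [hσ']; exact ⟨rfl, rfl⟩
    have hres := hrel'.emitN (e.eval s)
    have h5 : (σ'.setN 30 s.nOut.length (e.eval s)).narr 5 0 = s.nOut.length := by
      simpa [State.setN] using h6'
    simp only [Prog.run, if_true, NExp.eval, e3, PMF.pure_bind, Option.elim, h6]
    rw [← hσ']
    refine Coup.pure ⟨_, _, rfl, rfl, ?_, ?_, ?_, ?_, ?_, ?_⟩
    · have := hres.charge_right 6 s.nOut.length
      rw [h5]
      exact ⟨⟨this.mem.base, this.mem.n, this.mem.f⟩, this.cn, this.cf⟩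
    · exact (hs'.trans (Same.setN _ _ _ _ (by decide))).trans
        ((Same.charge _ _ _ _ _).trans (Same.setN _ _ _ _ (by decide)))
    · intro a i ha hi
      have h1 : a ≠ 5 := by omega
      have h2 : a ≠ 30 := by omega
      simpa [State.setN, State.charge, h1, h2, hh'.1, hh'.2] using hhi a i ha hi
    · simp only [State.charge, State.setN, Prog.tbound, NExp.cost]; omega
    · simp only [State.charge, NExp.peak, NExp.eval, h5]
      simp only [State.setN]; omega
    · simp only [State.charge, State.emitN]

end Relocation

/-! ### Simulation of compound statements -/

section Relocation

/-- Peak and outputs only grow, so bounds on the final states of a composition hold in the middle as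
well. A first part that is cut off would cut off the whole run. -/
theorem bounded_bind {keep : Bool} {w : ℕ} {μ : PMF (Option (State F))}
    {f : State F → PMF (Option (State F))}
    (hgrow : ∀ s₁ s₂, some s₂ ∈ (f s₁).support → Grows s₁ s₂)
    (h : Bounded keep w (μ.bind fun o => o.elim (PMF.pure none) f)) :
    Bounded keep w μ ∧ ∀ s₁, some s₁ ∈ μ.support → Bounded keep w (f s₁) := by
  have h2 : ∀ s₁, some s₁ ∈ μ.support → Bounded keep w (f s₁) := by
    intro s₁ hs₁ o ho
    exact h o ((PMF.mem_support_bind_iff _ _ _).2 ⟨some s₁, hs₁, ho⟩)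
  refine ⟨fun o ho => ?_, h2⟩
  cases o with
  | none =>
    obtain ⟨s', h1, -⟩ := h none ((PMF.mem_support_bind_iff _ _ _).2 ⟨none, ho, by simp⟩)
    simp at h1
  | some s₁ =>
    obtain ⟨o₂, ho₂⟩ := (f s₁).support_nonempty
    obtain ⟨s₂, rfl, hp, hf, hn⟩ := h2 s₁ ho o₂ ho₂
    have hg := hgrow s₁ s₂ ho₂
    exact ⟨s₁, rfl, hg.peak.trans hp, hg.fOut.trans hf, fun hk => hg.nOut.trans (hn hk)⟩

theorem Moved.clk_le {b w cap B K : ℕ} {s s' : State F} (h : Moved b w cap B K s s')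
    (h4 : s.narr 4 0 ≤ B) (hB : cap + K ≤ B) : s'.narr 4 0 ≤ B := by
  have := h.clk; omega

theorem Moved.cap_eq {b w cap B K : ℕ} {s s' : State F} (h : Moved b w cap B K s s') :
    s'.narr 1 = s.narr 1 := h.frame.n 1 (by decide)

/-- For loops, adding the constants would multiply the slowdown by the number of rounds. Here the
constant is not added up, and the time bound is supplied separately by an amortized count. -/
theorem Moved.trans_time {b w cap B K₁ K₂ K : ℕ} {s s' s'' : State F}
    (h : Moved b w cap B K₁ s s') (h' : Moved b w cap B K₂ s' s'') (h₁ : K₁ ≤ K) (h₂ : K₂ ≤ K)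
    (ht : ∃ d, s''.narr 4 0 = s.narr 4 0 + d ∧ s''.time ≤ s.time + K * (1 + d)) :
    Moved b w cap B K s s'' := by
  refine ⟨h.frame.trans h'.frame, fun a i ha hi => ?_, ht, ?_, ?_⟩
  · exact ⟨(h'.hi a i ha hi).1.trans (h.hi a i ha hi).1, (h'.hi a i ha hi).2.trans (h.hi a i ha hi).2⟩
  · have := h.peak; have := h'.peak; omega
  · have := h.clk; have := h'.clk; omega

theorem simulates_seq {keep : Bool} {b w cap B f₀ fuel : ℕ} {p q : Prog F}
    (hp : Simulates keep b w cap B f₀ fuel p) (hq : Simulates keep b w cap B f₀ fuel q) :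
    Simulates keep b w cap B f₀ fuel (.seq p q) := by
  intro s ŝ hcap hclk hsim hB hgood
  simp only [Prog.slow] at hB
  simp only [Prog.run] at hgood
  obtain ⟨h1, h2⟩ := bounded_bind (fun s₁ s₂ => Prog.run_grows f₀ q s₁ s₂) hgood
  simp only [Prog.run, Prog.tr]
  have h3 := hp s ŝ hcap hclk hsim (by omega) h1
  refine (h3.mono (Q' := fun o o' => o ∈ (p.run f₀ s).support ∧
    SimPost keep b w cap B (p.slow keep) ŝ o o') fun o ho o' _ h => ⟨ho, h⟩).bind ?_
  rintro o o' ⟨ho, s', ŝ', rfl, rfl, h4, h5⟩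
  refine (hq s' ŝ' (by rw [h5.cap_eq, hcap]) (h5.clk_le hclk (by omega)) h4 (by omega)
    (h2 s' ho)).mono ?_
  rintro o - o' - ⟨s'', ŝ'', rfl, rfl, h6, h7⟩
  exact ⟨s'', ŝ'', rfl, rfl, h6, h5.trans h7 le_rfl⟩

theorem bounded_nonempty {keep : Bool} {w : ℕ} {μ : PMF (Option (State F))}
    (h : Bounded keep w μ) : ∃ s', some s' ∈ μ.support ∧ s'.peak ≤ w := by
  obtain ⟨o, ho⟩ := μ.support_nonempty
  obtain ⟨s', rfl, h1, -⟩ := h o ho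
  exact ⟨s', ho, h1⟩

theorem simulates_cond {keep : Bool} {b w cap B f₀ fuel : ℕ} (hw : b + w ≤ B) {e : BExp F}
    {p q : Prog F} (hp : Simulates keep b w cap B f₀ fuel p)
    (hq : Simulates keep b w cap B f₀ fuel q) :
    Simulates keep b w cap B f₀ fuel (.cond e p q) := by
  intro s ŝ hcap hclk hsim hB hgood
  have hgrow := fun s' => Prog.run_grows f₀ (.cond e p q) s s'
  by_cases hcut : cap ≤ ŝ.narr 4 0
  · obtain ⟨ŝ', h1, h2, h3⟩ := guarded_cut (b := b) (w := w) (fuel := fuel)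
      (p := .cond e.tr (.seq (tick (e.cost + 1)) (p.tr keep)) (.seq (tick (e.cost + 1)) (q.tr keep)))
      (K := Prog.slow keep (.cond e p q)) hcap
      (by simp only [Prog.slow] at hB; omega) hclk hcut (by simp only [Prog.slow]; omega)
    rw [Prog.tr, h1]
    exact simPost_of_cut hgood hgrow hsim hcut h2 h3
  · simp only [Prog.slow] at hB
    have hlt : ŝ.narr 4 0 < ŝ.narr 1 0 := by omega
    rw [Prog.tr, run_guarded, if_pos hlt]
    obtain ⟨hrel, hc⟩ := hsim.rel (by omega)
    obtain ⟨s', hs', hs'w⟩ := bounded_nonempty hgood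
    have hpw : e.peak s ≤ w := by
      rw [Prog.run] at hs'
      have : (s.charge (e.cost + 1) (e.peak s)).peak ≤ s'.peak := by
        split at hs'
        · exact (Prog.run_grows _ _ _ _ hs').peak
        · exact (Prog.run_grows _ _ _ _ hs').peak
      simp only [State.charge] at this
      omega
    set σ := ŝ.charge 6 (max (ŝ.narr 4 0) (ŝ.narr 1 0)) with hσ
    have hrelσ : RelM keep b w s σ := hrel.charge_right _ _
    obtain ⟨e1, e2⟩ := BExp.tr_eval hrelσ.mem e hpw
    set σ' := σ.charge (e.tr.cost + 1) (e.tr.peak σ) with hσ'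
    have hrelσ' : RelM keep b w (s.charge (e.cost + 1) (e.peak s)) σ' := hrelσ.charge _ _ _ _
    obtain ⟨h7, h8⟩ := tick_moved (cap := cap) (K := e.tr.cost + e.cost + 20) (c := e.cost + 1)
      (X := 7 + e.tr.cost) (B := B) hc (by omega) (by omega) hrelσ'
      ((Same.charge _ _ _ _ _).trans (Same.charge _ _ _ _ _)) (fun _ _ _ _ => ⟨rfl, rfl⟩)
      (by simp only [hσ', hσ, State.charge]; omega) (by simp only [hσ', hσ, State.charge] at *; omega)
      rfl (by omega) (by omega)
    set ŝ₁ := (tick (e.cost + 1) : Prog F).exec σ' with hŝ₁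
    rw [Prog.run] at hgood
    have key : ∀ r : Prog F, Simulates keep b w cap B f₀ fuel r →
        cap + r.slow keep ≤ B → r.slow keep ≤ p.slow keep + q.slow keep →
        Bounded keep w (r.run f₀ (s.charge (e.cost + 1) (e.peak s))) →
        Coup (r.run f₀ (s.charge (e.cost + 1) (e.peak s)))
          ((Prog.seq (tick (e.cost + 1)) (r.tr keep)).run fuel σ')
          (SimPost keep b w cap B (Prog.slow keep (.cond e p q)) ŝ) := by
      intro r hr hrB hle hgr
      rw [Prog.run, Prog.run_simple fuel (tick (e.cost + 1)) rfl, PMF.pure_bind]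
      simp only [Option.elim]
      refine (hr _ ŝ₁ (by rw [h7.cap_eq, hcap]) (h7.clk_le hclk (by omega)) h8 hrB hgr).mono ?_
      rintro o - o' - ⟨s'', ŝ'', rfl, rfl, h9, h10⟩
      exact ⟨s'', ŝ'', rfl, rfl, h9, h7.trans h10 (by simp only [Prog.slow]; omega)⟩
    simp only [Prog.run, e1]
    by_cases hb : e.eval s
    · simp only [hb, if_true] at hgood ⊢
      exact key p hp (by omega) (by omega) hgood
    · simp only [hb, if_false, Bool.false_eq_true] at hgood ⊢
      exact key q hq (by omega) (by omega) hgood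

theorem testFlag_uncut {keep : Bool} {b w cap B K fuel : ℕ} {e : BExp F} {s ŝ : State F}
    (hcap : ŝ.narr 1 0 = cap) (hlt : ŝ.narr 4 0 < cap) (hB : cap + K ≤ B) (hw : b + w ≤ B)
    (hsim : Sim keep b w cap s ŝ) (hK : (testFlag e).tbound + e.cost + 1 ≤ K)
    (hp : e.peak s ≤ w) :
    ∃ ŝ', (testFlag e).run fuel ŝ = PMF.pure (some ŝ') ∧
      ŝ'.narr 7 0 = (if e.eval s then 1 else 0) ∧ ŝ'.narr 4 0 = ŝ.narr 4 0 + (e.cost + 1) ∧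
      ŝ'.time ≤ ŝ.time + (testFlag e).tbound ∧ Moved b w cap B K ŝ ŝ' ∧
      Sim keep b w cap (s.charge (e.cost + 1) (e.peak s)) ŝ' := by
  have hs : (testFlag e).Simple = true := by simp [testFlag, Prog.Simple, tick]
  obtain ⟨hrel, hc⟩ := hsim.rel hlt
  set σ := ŝ.charge 6 (max (ŝ.narr 4 0) (ŝ.narr 1 0)) with hσ
  have hrelσ : RelM keep b w s σ := hrel.charge_right _ _
  obtain ⟨e1, e2⟩ := BExp.tr_eval hrelσ.mem e hp
  set σ' := ((σ.charge (e.tr.cost + 1) (e.tr.peak σ)).charge 3 (max 0 (if e.eval s then 1 else 0))).setN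
    7 0 (if e.eval s then 1 else 0) with hσ'
  have he : (testFlag e).exec ŝ = (tick (e.cost + 1) : Prog F).exec σ' := by
    have : ŝ.narr 4 0 < ŝ.narr 1 0 := by omega
    by_cases hb : e.eval s <;>
    simp [testFlag, Prog.exec, BExp.eval, BExp.peak, BExp.cost, NExp.eval, NExp.peak, NExp.cost,
      this, hσ', ← hσ, e1, hb]
  have hrelσ' : RelM keep b w (s.charge (e.cost + 1) (e.peak s)) σ' := by
    have := ((hrelσ.charge (e.cost + 1) (e.peak s) (e.tr.cost + 1) (e.tr.peak σ)).charge_right 3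
      (max 0 (if e.eval s then 1 else 0)))
    have key : ∀ a, a ≠ 7 → σ'.narr a = ŝ.narr a := by
      intro a ha; simp [hσ', hσ, State.setN, State.charge, ha]
    refine ⟨⟨?_, fun a i hi => ?_, hrel.mem.f⟩, ?_, ?_⟩
    · rw [key 2 (by decide)]; exact hrel.mem.base
    · rw [key _ (by omega)]; exact hrel.mem.n a i hi
    · rw [key 5 (by decide), key 30 (by decide)]; exact hrel.cn
    · rw [key 6 (by decide)]; exact hrel.cf
  have hex := (testFlag e).exec_time hs ŝ
  have hb1 : (if e.eval s = true then 1 else 0) ≤ 1 := by split <;> omega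
  obtain ⟨h7, h8⟩ := tick_moved (cap := cap) (K := K) (c := e.cost + 1)
    (X := 10 + e.tr.cost) (B := B) hc (by omega) (by omega) hrelσ'
    ((Same.charge _ _ _ _ _).trans ((Same.charge _ _ _ _ _).trans ((Same.charge _ _ _ _ _).trans
      (Same.setN _ _ _ _ (by decide)))))
    (fun a i ha hi => by
      have : a ≠ 7 := by omega
      simp [hσ', hσ, State.setN, State.charge, this])
    (by simp only [hσ', hσ, State.charge, State.setN]; omega)
    (by simp only [hσ', hσ, State.charge, State.setN] at *; omega)
    rfl (by simp only [testFlag, Prog.tbound, BExp.cost, NExp.cost, tick] at hK; omega) (by omega)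
  refine ⟨_, Prog.run_simple fuel _ hs ŝ, ?_, ?_, hex, ?_, ?_⟩
  · rw [he]; simp [tick, Prog.exec, State.setN, State.charge, hσ']
  · rw [he]; simp [tick, Prog.exec, State.setN, State.charge, hσ', hσ, NExp.eval]
  · rw [he]; exact h7
  · rw [he]; exact h8

/-- Every guard test before the clock expires advances the clock by at least one unit. This pays for
the fixed overhead of a round, and it bounds the number of rounds in terms of `cap`, even if the
original loop runs much longer. -/
theorem simulates_loop {keep : Bool} {b w cap B f₀ fuel : ℕ} (hw : b + w ≤ B)
    (hfuel : f₀ ≤ fuel ∨ cap + 2 ≤ fuel) {e : BExp F}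
    {p : Prog F} (hp : Simulates keep b w cap B f₀ fuel p) :
    Simulates keep b w cap B f₀ fuel (.loop e p) := by
  have loop : ∀ k k' (s ŝ : State F), ŝ.narr 1 0 = cap → ŝ.narr 4 0 ≤ B → Sim keep b w cap s ŝ →
      cap + Prog.slow keep (.loop e p) ≤ B → Bounded keep w (runLoop e (p.run f₀) k s) →
      -- Either the fuel is at least that of the original loop, or clock plus fuel exceeds the cap
      -- by at least two. A round uses one unit of fuel and advances the clock by at least one, so
      -- the second alternative persists as well.
      (k ≤ k' ∨ (2 ≤ k' ∧ cap + 2 ≤ ŝ.narr 4 0 + k')) →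
      Coup (runLoop e (p.run f₀) k s)
        (((testFlag e).run fuel ŝ).bind fun o => o.elim (PMF.pure none)
          (runLoop (.eq (V 7) (.lit 1)) ((Prog.seq (p.tr keep) (testFlag e)).run fuel) k'))
        (SimPost keep b w cap B (Prog.slow keep (.loop e p)) ŝ) := by
    intro k
    induction k with
    | zero =>
      intro k' s ŝ _ _ _ _ hgood
      obtain ⟨s', h1, -⟩ := hgood none (by simp [runLoop])
      simp at h1
    | succ k ih =>
      intro k' s ŝ hcap hclk hsim hB hgood hk
      obtain ⟨k', rfl⟩ : ∃ m, k' = m + 1 := ⟨k' - 1, by omega⟩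
      have hgrow := fun s' => runLoop_grows (fun s s' => Prog.run_grows f₀ p s s') (b := e) (k + 1)
        s s'
      by_cases hcut : cap ≤ ŝ.narr 4 0
      · obtain ⟨s₁, h1, h2, h3, h4, h5⟩ := testFlag_cut (b := b) (w := w) (fuel := fuel) (e := e)
          (K := p.slow keep + (testFlag e).tbound + e.cost) hcap
          (by simp only [Prog.slow] at hB; omega) hclk hcut (by omega)
        have h6 : Moved b w cap B (Prog.slow keep (.loop e p)) ŝ (s₁.charge 5 1) := by
          refine ⟨h5.frame.trans (Same.charge _ _ _ _ _), h5.hi, ⟨0, h2, ?_⟩, ?_, ?_⟩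
          · simp only [State.charge, Prog.slow]; omega
          · have := h5.peak; simp only [State.charge, Prog.slow] at *; omega
          · have := h5.clk; simp only [State.charge, Prog.slow]; omega
        have := simPost_of_cut (ŝ' := s₁.charge 5 1) hgood hgrow hsim hcut h2 h6
        simpa [h1, runLoop, BExp.eval, BExp.peak, BExp.cost, NExp.eval, NExp.peak, NExp.cost, h3]
          using this
      · have hpw : e.peak s ≤ w := by
          obtain ⟨s', hs', hs'w⟩ := bounded_nonempty hgood
          have : (s.charge (e.cost + 1) (e.peak s)).peak ≤ s'.peak := by
            rw [runLoop] at hs'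
            split at hs'
            · rw [PMF.mem_support_bind_iff] at hs'
              obtain ⟨o, ho, h⟩ := hs'
              cases o with
              | none => simp at h
              | some s₁ =>
                exact (Prog.run_grows _ _ _ _ ho).peak.trans
                  (runLoop_grows (fun s s' => Prog.run_grows f₀ p s s') _ _ _ h).peak
            · simp only [PMF.support_pure, Set.mem_singleton_iff, Option.some.injEq] at hs'
              subst hs'; exact le_rfl
          simp only [State.charge] at this
          omega
        have hslow : Prog.slow keep (.loop e p) = p.slow keep + (testFlag e).tbound + e.cost + 10 :=
          rfl
        set c := Prog.slow keep (.loop e p) with hc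
        obtain ⟨ŝ₁, h1, h2, h3, h4, h5, h6⟩ := testFlag_uncut (fuel := fuel) (K := c)
          hcap (by omega) hB hw hsim (by omega) hpw
        rw [h1, PMF.pure_bind]
        simp only [Option.elim]
        by_cases hb : e.eval s
        · simp only [hb, if_true] at h2
          rw [runLoop, if_pos hb] at hgood ⊢
          have e5 : (BExp.eq (F := F) (V 7) (.lit 1)).eval ŝ₁ = true := by
            simp [BExp.eval, NExp.eval, h2]
          rw [runLoop, if_pos e5]
          set ŝ₂ := ŝ₁.charge ((BExp.eq (F := F) (V 7) (.lit 1)).cost + 1)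
            ((BExp.eq (F := F) (V 7) (.lit 1)).peak ŝ₁) with hŝ₂
          have hm2 : Moved b w cap B c ŝ ŝ₂ := by
            refine ⟨h5.frame.trans (Same.charge _ _ _ _ _), h5.hi, ⟨_, h3, ?_⟩, ?_, h5.clk⟩
            · have : ŝ₂.time = ŝ₁.time + 5 := rfl
              have : c ≤ c * (1 + (e.cost + 1)) := Nat.le_mul_of_pos_right _ (by omega)
              omega
            · have := h5.peak
              simp only [hŝ₂, State.charge, BExp.peak, NExp.peak, NExp.eval, h2]; omega
          have hsim2 : Sim keep b w cap (s.charge (e.cost + 1) (e.peak s)) ŝ₂ :=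
            ⟨h6.clk, fun h => ⟨(h6.rel h).1.charge_right _ _, (h6.rel h).2⟩⟩
          obtain ⟨g1, g2⟩ := bounded_bind (fun s₁ s₂ => runLoop_grows
            (fun s s' => Prog.run_grows f₀ p s s') _ s₁ s₂) hgood
          simp only [Prog.run, PMF.bind_bind]
          refine ((hp _ ŝ₂ (by rw [hm2.cap_eq, hcap]) (hm2.clk_le hclk hB) hsim2 (by omega)
            g1).mono (Q' := fun o o' => o ∈ (p.run f₀ (s.charge (e.cost + 1) (e.peak s))).support ∧
              SimPost keep b w cap B (p.slow keep) ŝ₂ o o') fun o ho o' _ h => ⟨ho, h⟩).bind ?_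
          rintro o o' ⟨ho, s₃, ŝ₃, rfl, rfl, h7, h8⟩
          simp only [Option.elim]
          obtain ⟨d, hd1, hd2⟩ := h8.time
          have hd0 : ŝ₂.narr 4 0 = ŝ.narr 4 0 + (e.cost + 1) := h3
          have hm3 : Moved b w cap B c ŝ ŝ₃ := by
            refine hm2.trans_time h8 le_rfl (by omega) ⟨e.cost + 1 + d, by omega, ?_⟩
            have : ŝ₂.time = ŝ₁.time + 5 := rfl
            have e1 : p.slow keep * (1 + d) ≤ c * (1 + d) := Nat.mul_le_mul_right _ (by omega)
            have e2 : c * (1 + (e.cost + 1 + d)) = c * (1 + d) + c * e.cost + c := by ring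
            omega
          refine (ih k' s₃ ŝ₃ (by rw [hm3.cap_eq, hcap]) (hm3.clk_le hclk hB) h7 hB (g2 s₃ ho)
            (by omega)).mono ?_
          rintro o - o' - ⟨s₄, ŝ₄, rfl, rfl, h9, h10⟩
          refine ⟨s₄, ŝ₄, rfl, rfl, h9, hm3.trans_time h10 le_rfl le_rfl ?_⟩
          obtain ⟨d', hd3, hd4⟩ := h10.time
          -- The clock advances by `e.cost + 1` in the guard test, by `d` in the body and by `d'` in
          -- the remaining rounds. The first of these pays for the test and the constant overhead of
          -- the body.
          refine ⟨e.cost + 1 + d + d', by omega, ?_⟩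
          have : ŝ₂.time = ŝ₁.time + 5 := rfl
          have e1 : p.slow keep * d ≤ c * d := Nat.mul_le_mul_right _ (by omega)
          have e2 : c * (1 + (e.cost + 1 + d + d')) = c * (1 + d') + c * d + c * e.cost + c := by
            ring
          have e3 : p.slow keep * (1 + d) = p.slow keep + p.slow keep * d := by ring
          omega
        · simp only [hb, if_false, Bool.false_eq_true] at h2
          have e5 : ¬ (BExp.eq (F := F) (V 7) (.lit 1)).eval ŝ₁ = true := by
            simp [BExp.eval, NExp.eval, h2]
          rw [runLoop, if_neg hb, runLoop, if_neg e5]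
          refine Coup.pure ⟨_, _, rfl, rfl,
            ⟨h6.clk, fun h => ⟨(h6.rel h).1.charge_right _ _, (h6.rel h).2⟩⟩, ?_⟩
          refine ⟨h5.frame.trans (Same.charge _ _ _ _ _), h5.hi, ⟨_, h3, ?_⟩, ?_, h5.clk⟩
          · have : c ≤ c * (1 + (e.cost + 1)) := Nat.le_mul_of_pos_right _ (by omega)
            simp only [State.charge, BExp.cost, NExp.cost]
            omega
          · have := h5.peak
            simp only [State.charge, BExp.peak, NExp.peak, NExp.eval, h2]; omega
  intro s ŝ hcap hclk hsim hB hgood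
  simp only [Prog.tr, Prog.run] at hgood ⊢
  exact loop f₀ fuel s ŝ hcap hclk hsim hB hgood (by omega)

/-- A program and its moved version can be coupled so that, unless the clock expires, the window
shows the memory of the original run. -/
theorem simulates {keep : Bool} {b w cap B f₀ fuel : ℕ} (hw : b + w ≤ B)
    (hfuel : f₀ ≤ fuel ∨ cap + 2 ≤ fuel) (P : Prog F) :
    Simulates keep b w cap B f₀ fuel P := by
  induction P with
  | skip => exact simulates_skip
  | nset a i e => exact simulates_nset hw a i e
  | fset a i e => exact simulates_fset hw a i e
  | nrand a i k => exact simulates_nrand hw a i k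
  | frand a i => exact simulates_frand hw a i
  | nemit e => exact simulates_nemit hw e
  | femit e => exact simulates_femit hw e
  | seq p q ihp ihq => exact simulates_seq ihp ihq
  | cond e p q ihp ihq => exact simulates_cond hw ihp ihq
  | loop e p ih => exact simulates_loop hw hfuel ih

end Relocation

/-! ### Subroutines -/

/-- The arrays from `40` on are zero from address `b` on. -/
def Fresh (b : ℕ) (s : State F) : Prop :=
  ∀ a i, 40 ≤ a → b ≤ i → s.narr a i = 0 ∧ s.farr a i = 0

/-- The registers hold the size `n`, the width `W` and the start `b` of the next window, which has
not been used yet. -/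
structure Win (n W b : ℕ) (s : State F) : Prop where
  size : s.narr 0 0 = n
  width : s.narr 1 0 = W
  base : s.narr 2 0 = b
  fresh : Fresh b s

theorem Win.same {n W b : ℕ} {l k : List ℕ} {s s' : State F} (h : Win n W b s)
    (hs : Same l k s s') (h0 : 0 ∉ l := by decide) (h1 : 1 ∉ l := by decide)
    (h2 : 2 ∉ l := by decide) (h3 : 40 ∉ l := by decide) (h4 : 40 ∉ k := by decide) :
    Win n W b s' := by
  refine ⟨?_, ?_, ?_, fun a i ha hi => ?_⟩
  · rw [hs.n 0 h0]; exact h.size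
  · rw [hs.n 1 h1]; exact h.width
  · rw [hs.n 2 h2]; exact h.base
  · rw [hs.n a (by rwa [min_eq_right ha]), hs.f a (by rwa [min_eq_right ha])]
    exact h.fresh a i ha hi

/-- Run `P` in a fresh window with clock and output counters reset. -/
def subRun (keep : Bool) (P : Prog F) : Prog F :=
  .seq (.seq (.seq (.nset 4 (.lit 0) (.lit 0)) (.nset 5 (.lit 0) (.lit 0)))
      (.seq (.nset 6 (.lit 0) (.lit 0)) (.nset 40 (V 2) (V 0))))
    (.seq (P.tr keep) (.nset 2 (.lit 0) (.add (V 2) (.add (V 1) (.lit 1)))))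

theorem Prog.slow_pos (keep : Bool) (P : Prog F) : 7 ≤ P.slow keep := by
  induction P with
  | seq p q ihp ihq => simp only [Prog.slow]; omega
  | loop e p ih => simp only [Prog.slow]; omega
  | cond => simp only [Prog.slow]; omega
  | skip => simp [Prog.slow]
  | _ => simp only [Prog.slow, Prog.tr, guarded, Prog.tbound, BExp.cost, NExp.cost, tick]; omega

/-- Time needed to run `P` as a subroutine. -/
def subTime (keep : Bool) (P : Prog F) (W T : ℕ) : ℕ :=
  P.slow keep * (1 + min T (W + P.slow keep)) + 40

/-- The clock stops at `T` or soon after `W`, overshooting by at most `P.slow keep`. Hence the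
minimum in `subTime`, which makes the cost both linear in `T` and polynomial when `W` is. Afterwards
the clock tells whether the run was completed. In that case its outputs are described by `RelM`,
stated for the old base `b` as the base register already points to the next window. -/
theorem impl_subRun {keep : Bool} {P : Prog F} {ŝ : State F} {n W b T w B : ℕ} {x y : List F}
    {Post : State F → Prop} (hP : P.HaltsWithin (initState n x y) T w Post)
    (hw : w ≤ W) (hPost : ∀ s', Post s' → s'.fOut.length ≤ W ∧ (keep = true → s'.nOut.length ≤ W))
    (h0 : ŝ.narr 0 0 = n) (h1 : ŝ.narr 1 0 = W) (h2 : ŝ.narr 2 0 = b)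
    (hn : ∀ a i, 40 ≤ a → b ≤ i → ŝ.narr a i = 0)
    (hf : ∀ a i, ŝ.farr (a + 40) (b + i) = (initState n x y).farr a i)
    (hx : x.length ≤ W + 1) (hy : y.length ≤ W + 1)
    (hB1 : b + W + 1 ≤ B) (hB2 : W + P.slow keep ≤ B) (hB3 : n ≤ B) :
    Impl (subRun keep P) ŝ (subTime keep P W T) B (P.run T (initState n x y)) fun o ŝ' =>
      ∃ s', o = some s' ∧ Post s' ∧ s'.time ≤ T ∧
        Same [2, 4, 5, 6, 7, 30, 40] [30, 40] ŝ ŝ' ∧ Win n W (b + W + 1) ŝ' ∧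
        (s'.time < W → ŝ'.narr 4 0 < W ∧ RelM keep b W s' { ŝ' with
          narr := Function.update ŝ'.narr 2 fun _ => b }) ∧
        (W ≤ s'.time → W ≤ ŝ'.narr 4 0) ∧ ŝ'.narr 4 0 ≤ B := by
  set s := initState n x y with hs
  have h70 := P.slow_pos keep
  refine Impl.seq_pure (a := ()) (t₁ := 20) (t₂ := P.slow keep * (1 + min T (W + P.slow keep)) + 20)
    (Q := fun _ ŝ₁ => ŝ₁.narr 4 0 = 0 ∧ RelM keep b W s ŝ₁ ∧ ŝ₁.narr 1 0 = W ∧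
      Same [4, 5, 6, 40] [] ŝ ŝ₁ ∧ ∀ a i, 40 ≤ a → b + W < i → ŝ₁.narr a i = 0)
    ?_ ?_ (by simp only [subTime]; omega)
  · refine Impl.exec (by rfl) (by simp [Prog.tbound, NExp.cost]) ?_ ?_
    · simp [Prog.exec, State.setN, State.charge, NExp.peak, NExp.eval, h0, h2]; omega
    · set ŝ₁ := Prog.exec _ ŝ with hŝ₁
      have e2 : ŝ₁.narr = Function.update (Function.update (Function.update (Function.update
          ŝ.narr 4 (Function.update (ŝ.narr 4) 0 0)) 5 (Function.update (ŝ.narr 5) 0 0)) 6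
          (Function.update (ŝ.narr 6) 0 0)) 40 (Function.update (ŝ.narr 40) b n) := by
        simp [hŝ₁, Prog.exec, State.setN, State.charge, NExp.eval, h0, h2]
      have e3 : ŝ₁.farr = ŝ.farr := rfl
      refine ⟨by simp [e2], ⟨⟨by simp [e2, h2], ?_, ?_⟩, ?_, ?_⟩, by simp [e2, h1], ?_, ?_⟩
      · intro a i hi
        rw [e2]
        rcases Nat.eq_zero_or_pos a with rfl | ha
        · rcases Nat.eq_zero_or_pos i with rfl | hi'
          · simp [hs, initState]
          · have : b + i ≠ b := by omega
            have h3 := hn 40 (b + i) le_rfl (by omega)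
            simp [this, h3, hs, initState, hi'.ne']
        · have a1 : a + 40 ≠ 40 := by omega
          have a2 : a + 40 ≠ 6 := by omega
          have a3 : a + 40 ≠ 5 := by omega
          have a4 : a + 40 ≠ 4 := by omega
          have h3 := hn (a + 40) (b + i) (by omega) (by omega)
          simp [a1, a2, a3, a4, h3, hs, initState, ha.ne']
      · intro a i _; rw [e3, hf]
      · intro _; simp [e2, hs, initState]
      · simp [e2, hs, initState]
      · refine ⟨fun a ha => ?_, fun _ _ => by rw [e3], rfl, rfl⟩
        have a1 : a ≠ 40 := by rintro rfl; simp at ha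
        have a2 : a ≠ 6 := by rintro rfl; simp at ha
        have a3 : a ≠ 5 := by rintro rfl; simp at ha
        have a4 : a ≠ 4 := by rintro rfl; simp at ha
        simp [e2, a1, a2, a3, a4]
      · intro a i ha hi
        have a2 : a ≠ 6 := by omega
        have a3 : a ≠ 5 := by omega
        have a4 : a ≠ 4 := by omega
        have h3 := hn a i ha (by omega)
        by_cases a1 : a = 40
        · subst a1
          have : i ≠ b := by omega
          simp [e2, this, h3]
        · simp [e2, a1, a2, a3, a4, h3]
  · rintro ŝ₁ ⟨hclk, hrel, hcap, hsame, hhi⟩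
    have hgood : Bounded keep W (P.run T s) := by
      intro o ho
      obtain ⟨s', rfl, -, h4, h5⟩ := hP o ho
      obtain ⟨h6, h7⟩ := hPost s' h5
      exact ⟨s', rfl, h4.trans hw, h6, h7⟩
    have hmain : Impl (P.tr keep) ŝ₁ (P.slow keep * (1 + min T (W + P.slow keep))) B (P.run T s)
        fun o ŝ₂ => ∃ s', o = some s' ∧ Post s' ∧ s'.time ≤ T ∧ Sim keep b W W s' ŝ₂ ∧
          Moved b W W B (P.slow keep) ŝ₁ ŝ₂ := by
      intro fuel hfuel
      -- So the fuel is at least `T`, or at least `W + 2`, as the simulation requires.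
      have hle : 1 + min T (W + P.slow keep) ≤ P.slow keep * (1 + min T (W + P.slow keep)) :=
        Nat.le_mul_of_pos_left _ (by omega)
      have hsim : Sim keep b W W s ŝ₁ := ⟨by simp [hclk], fun _ => ⟨hrel, by simp [hclk, hs, initState]⟩⟩
      refine (simulates (b := b) (w := W) (cap := W) (B := B) (f₀ := T) (fuel := fuel) (by omega)
        (by omega) P s ŝ₁ hcap (by omega) hsim (by omega) hgood).mono ?_
      rintro o ho o' - ⟨s', ŝ₂, rfl, rfl, h3, h4⟩
      obtain ⟨s'', h5, h6, -, h7⟩ := hP _ ho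
      obtain rfl := Option.some.inj h5
      refine ⟨ŝ₂, rfl, ?_, h4.peak, s', rfl, h7, h6, h3, h4⟩
      obtain ⟨d, h8, h9⟩ := h4.time
      have h10 := h4.clk
      have h11 := h3.clk
      refine h9.trans ?_
      have : P.slow keep * (1 + d) ≤ P.slow keep * (1 + min T (W + P.slow keep)) :=
        Nat.mul_le_mul_left _ (by omega)
      omega
    have := Impl.seq (P₂ := .nset 2 (.lit 0) (.add (V 2) (.add (V 1) (.lit 1)))) (t₂ := 20)
      (t := P.slow keep * (1 + min T (W + P.slow keep)) + 20) hmain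
      (f := fun o => PMF.pure o) (Q' := fun o ŝ' =>
      ∃ s', o = some s' ∧ Post s' ∧ s'.time ≤ T ∧
        Same [2, 4, 5, 6, 7, 30, 40] [30, 40] ŝ ŝ' ∧ Win n W (b + W + 1) ŝ' ∧
        (s'.time < W → ŝ'.narr 4 0 < W ∧ RelM keep b W s' { ŝ' with
          narr := Function.update ŝ'.narr 2 fun _ => b }) ∧
        (W ≤ s'.time → W ≤ ŝ'.narr 4 0) ∧ ŝ'.narr 4 0 ≤ B) ?_ le_rfl
    · rwa [PMF.bind_pure] at this
    · rintro o ŝ₂ ⟨s', rfl, hp, hT, hsim, hmv⟩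
      have b2 : ŝ₂.narr 2 0 = b := by
        rw [hmv.frame.n 2 (by decide)]; exact hrel.mem.base
      have b1 : ŝ₂.narr 1 0 = W := by
        rw [hmv.cap_eq]; exact hcap
      have b0 : ŝ₂.narr 0 0 = n := by
        rw [hmv.frame.n 0 (by decide), hsame.n 0 (by decide), h0]
      have hex := Impl.exec (P := (.nset 2 (.lit 0) (.add (V 2) (.add (V 1) (.lit 1))) : Prog F))
        (s := ŝ₂) (t := 20) (w := B)
        (Q := fun _ ŝ' => ŝ'.narr = Function.update ŝ₂.narr 2
          (Function.update (ŝ₂.narr 2) 0 (b + W + 1)) ∧ ŝ'.farr = ŝ₂.farr ∧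
          ŝ'.nOut = ŝ₂.nOut ∧ ŝ'.fOut = ŝ₂.fOut)
        (by rfl) (by simp [Prog.tbound, NExp.cost])
        (by simp [Prog.exec, State.setN, State.charge, NExp.peak, NExp.eval, b1, b2]; omega)
        (by simp [Prog.exec, State.setN, State.charge, NExp.eval, b1, b2, add_assoc])
      have := hex.map (fun _ => some s') (Q' := fun o ŝ' =>
        ∃ s', o = some s' ∧ Post s' ∧ s'.time ≤ T ∧
        Same [2, 4, 5, 6, 7, 30, 40] [30, 40] ŝ ŝ' ∧ Win n W (b + W + 1) ŝ' ∧
        (s'.time < W → ŝ'.narr 4 0 < W ∧ RelM keep b W s' { ŝ' with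
          narr := Function.update ŝ'.narr 2 fun _ => b }) ∧
        (W ≤ s'.time → W ≤ ŝ'.narr 4 0) ∧ ŝ'.narr 4 0 ≤ B) ?_
      · rwa [PMF.pure_map] at this
      · rintro - ŝ' ⟨g1, g2, g3, g4⟩
        have key : ∀ a, a ≠ 2 → ŝ'.narr a = ŝ₂.narr a := by intro a ha; simp [g1, ha]
        refine ⟨s', rfl, hp, hT, ?_, ⟨?_, ?_, ?_, ?_⟩, ?_, ?_, ?_⟩
        · refine ((hsame.mono (by decide) (by decide)).trans
            (hmv.frame.mono (by decide) (by decide))).trans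
            ⟨fun a ha => key a ?_, fun a _ => by rw [g2], g3, g4⟩
          rintro rfl; simp at ha
        · rw [key 0 (by decide), b0]
        · rw [key 1 (by decide), b1]
        · simp [g1]
        · intro a i ha hi
          rw [key a (by omega), g2]
          obtain ⟨g5, g6⟩ := hmv.hi a i ha (by omega)
          refine ⟨by rw [g5, hhi a i ha (by omega)], ?_⟩
          rw [g6, hsame.f a (by simp)]
          obtain ⟨a, rfl⟩ : ∃ a', a = a' + 40 := ⟨a - 40, by omega⟩
          obtain ⟨i, rfl⟩ : ∃ i', i = b + i' := ⟨i - b, by omega⟩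
          rw [hf]
          simp only [initState, hs]
          split
          · rw [List.getD_eq_default]; omega
          · split
            · rw [List.getD_eq_default]; omega
            · rfl
        · intro hlt
          have h3 := hsim.clk
          obtain ⟨h4, h5⟩ := hsim.rel (by omega)
          rw [key 4 (by decide)]
          refine ⟨by omega, ⟨⟨by simp, ?_, ?_⟩, ?_, ?_⟩⟩
          · intro a i hi
            have : a + 40 ≠ 2 := by omega
            simpa [g1, this] using h4.mem.n a i hi
          · intro a i hi
            simpa [g2] using h4.mem.f a i hi
          · simpa [g1] using h4.cn
          · simpa [g1, g2] using h4.cf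
        · intro hle
          rw [key 4 (by decide)]
          by_contra hlt
          have := (hsim.rel (by omega)).2
          omega
        · rw [key 4 (by decide)]
          have := hmv.clk
          omega

/-! ### Matrix routines -/

/-- Field array `a` holds the matrix `A` in row-major order. -/
def HasMat {n : ℕ} (s : State F) (a : ℕ) (A : Mat F n) : Prop :=
  ∀ i j : Fin n, s.farr a (i * n + j) = A i j

theorem HasMat.same {n : ℕ} {l k : List ℕ} {s s' : State F} {a : ℕ} {A : Mat F n}
    (h : HasMat s a A) (hs : Same l k s s') (ha : min a 40 ∉ k := by decide) : HasMat s' a A := by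
  intro i j; rw [hs.f a ha]; exact h i j

theorem idx_lt {n i j : ℕ} (hi : i < n) (hj : j < n) : i * n + j < n * n := by nlinarith

theorem idx_div {n i j : ℕ} (hj : j < n) : (i * n + j) / n = i := by
  rw [Nat.add_comm, Nat.add_mul_div_right _ _ (by omega), Nat.div_eq_of_lt hj, Nat.zero_add]

theorem idx_mod {n i j : ℕ} (hj : j < n) : (i * n + j) % n = j := by
  rw [Nat.add_comm, Nat.add_mul_mod_self_right, Nat.mod_eq_of_lt hj]

theorem div_mod_facts {n x : ℕ} (hx : x < n * n) :
    0 < n ∧ x / n < n ∧ x % n < n ∧ x / n * n + x % n = x ∧ x % n * n + x / n < n * n := by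
  have hn : 0 < n := by
    rcases Nat.eq_zero_or_pos n with rfl | h
    · simp at hx
    · exact h
  have h1 := Nat.div_lt_of_lt_mul hx
  have h2 := Nat.mod_lt x hn
  exact ⟨hn, h1, h2, Nat.div_add_mod' x n, idx_lt h2 h1⟩

theorem HasMat.read {n : ℕ} {s : State F} {a : ℕ} {A : Mat F n} (h : HasMat s a A) {i j : ℕ}
    (hi : i < n) (hj : j < n) : s.farr a (i * n + j) = A ⟨i, hi⟩ ⟨j, hj⟩ := h ⟨i, hi⟩ ⟨j, hj⟩

/-- `dst[off + x] := e` for all `x < n * n`, where register `8` holds `x`. -/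
def mapL (dst : ℕ) (off : NExp) (e : FExp F) : Prog F :=
  forN 8 (.mul (V 0) (V 0)) (.fset dst (.add off (V 8)) e)

/-- The expression is evaluated while `dst` is being overwritten, so its value must not depend on
`dst`. The frame does not distinguish arrays from `40` on, hence the extra clause for all `a ≠ dst`:
filling array `41` has to leave array `40` intact. -/
theorem impl_mapL {dst n w o t : ℕ} {off : NExp} {e : FExp F} {s : State F} (val : ℕ → F)
    (h0 : s.narr 0 0 = n) (hw : o + n * n ≤ w) (hn : n ≤ w)
    (he : ∀ x s', x < n * n → Same [8] [min dst 40] s s' → (∀ a, a ≠ dst → s'.farr a = s.farr a) →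
      s'.narr 8 0 = x → e.eval s' = val x ∧ e.peak s' ≤ w ∧ off.eval s' = o ∧ off.peak s' ≤ w)
    (ht : n * n * (off.cost + e.cost + 20) + 20 ≤ t) :
    Impl (mapL dst off e) s t w (PMF.pure ()) fun _ s' => Same [8] [min dst 40] s s' ∧
      (∀ a, a ≠ dst → s'.farr a = s.farr a) ∧
      (∀ x < n * n, s'.farr dst (o + x) = val x) ∧
      (∀ y, y < o ∨ o + n * n ≤ y → s'.farr dst y = s.farr dst y) := by
  refine Impl.forN_det (N := n * n) (tb := off.cost + e.cost + 4) (fun k s' =>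
    Same [8] [min dst 40] s s' ∧ (∀ a, a ≠ dst → s'.farr a = s.farr a) ∧
    (∀ x < k, s'.farr dst (o + x) = val x) ∧
    (∀ y, y < o ∨ o + k ≤ y → s'.farr dst y = s.farr dst y)) ?_ ?_ (by omega) ?_ ?_ ?_ ?_
  · rintro k s₁ s₂ ⟨h1, h2, h3, h4⟩ h
    have hf : s₂.farr = s₁.farr := funext fun a => h.f a (by simp)
    exact ⟨h1.trans (h.mono (by simp) (by simp)), by rwa [hf], by rwa [hf], by rwa [hf]⟩
  · rintro k s' hk ⟨h1, -⟩ -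
    have : s'.narr 0 0 = n := by rw [h1.n 0 (by decide), h0]
    simp only [NExp.eval, NExp.peak, this, true_and]
    omega
  · exact ⟨Same.refl _ _ _, fun _ _ => rfl, fun x hx => by omega, fun _ _ => rfl⟩
  · rintro k s' hk ⟨h1, h2, h3, h4⟩ h8
    obtain ⟨e1, e2, e3, e4⟩ := he k s' hk h1 h2 h8
    refine Impl.exec (by rfl) (by simp [Prog.tbound, NExp.cost]; omega) ?_ ?_
    · simp only [Prog.exec, State.setF, State.charge, NExp.peak, NExp.eval, e3, h8]; omega
    · simp only [Prog.exec, NExp.eval, e3, h8, e1]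
      refine ⟨h8, h1.trans ((Same.charge _ _ _ _ _).trans (Same.setF _ _ _ _ (by simp))), ?_, ?_, ?_⟩
      · intro a ha
        rw [← h2 a ha]; simp [State.setF, State.charge, ha]
      · intro x hx
        by_cases hxk : x = k
        · subst hxk; simp [State.setF]
        · have : o + x ≠ o + k := by omega
          simpa [State.setF, State.charge, hxk] using h3 x (by omega)
      · intro y hy
        have : y ≠ o + k := by omega
        simpa [State.setF, State.charge, this] using h4 y (by omega)
  · rintro s' ⟨h1, h2, h3, h4⟩
    exact ⟨h1, h2, h3, h4⟩
  · refine le_trans ?_ ht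
    have : (NExp.mul (V 0) (V 0)).cost = 5 := rfl
    rw [this]
    have : off.cost + e.cost + 4 + 5 + 10 ≤ off.cost + e.cost + 20 := by omega
    have := Nat.mul_le_mul_left (n * n) this
    omega

/-- `dst := va * raᵀ` by the naive algorithm. -/
def naive (va ra dst : ℕ) : Prog F :=
  forN 8 (.mul (V 0) (V 0)) (.seq (.fset 29 (.lit 0) (.lit 0))
    (.seq (forN 9 (V 0) (.fset 29 (.lit 0) (.add (.read 29 (.lit 0))
      (.mul (.read va (.add (.mul (.div (V 8) (V 0)) (V 0)) (V 9)))
        (.read ra (.add (.mul (.mod (V 8) (V 0)) (V 0)) (V 9)))))))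
      (.fset dst (V 8) (.read 29 (.lit 0)))))

theorem impl_naive {va ra dst n w t : ℕ} {s : State F} {A R : Mat F n}
    (h0 : s.narr 0 0 = n) (hw : n * n + n ≤ w)
    (hA : HasMat s va A) (hR : HasMat s ra R)
    (hva : va < 40 ∧ va ≠ 29 ∧ va ≠ dst) (hra : ra < 40 ∧ ra ≠ 29 ∧ ra ≠ dst) (hdst : dst < 40 ∧ dst ≠ 29)
    (ht : n * n * (n * 100 + 100) + 20 ≤ t) :
    Impl (naive va ra dst) s t w (PMF.pure ()) fun _ s' => Same [8, 9] [29, dst] s s' ∧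
      HasMat s' dst (A * R.transpose) := by
  set S : ℕ → ℕ → F := fun x k => ∑ k' ∈ Finset.range k,
    s.farr va (x / n * n + k') * s.farr ra (x % n * n + k') with hS
  refine Impl.forN_det (N := n * n) (tb := n * 60 + 60) (fun k s' =>
    Same [8, 9] [29, dst] s s' ∧ (∀ x < k, s'.farr dst x = S x n)) ?_ ?_ (by omega) ?_ ?_ ?_ ?_
  · rintro k s₁ s₂ ⟨h1, h2⟩ h
    have hf : s₂.farr = s₁.farr := funext fun a => h.f a (by simp)
    exact ⟨h1.trans (h.mono (by simp) (by simp)), by rwa [hf]⟩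
  · rintro k s' hk ⟨h1, -⟩ -
    have : s'.narr 0 0 = n := by rw [h1.n 0 (by decide), h0]
    simp only [NExp.eval, NExp.peak, this, true_and]
    omega
  · exact ⟨Same.refl _ _ _, fun x hx => by omega⟩
  · rintro x s' hx ⟨h1, h2⟩ h8
    obtain ⟨hn, hx1, hx2, hx3, hx4⟩ := div_mod_facts hx
    refine Impl.seq_pure (a := ()) (t₁ := 10) (t₂ := n * 60 + 50) (Q := fun _ s₁ =>
      Same [9] [29] s' s₁ ∧ s₁.farr 29 0 = S x 0) ?_ ?_ (by omega)
    · refine Impl.exec (by rfl) (by simp [Prog.tbound, NExp.cost, FExp.cost]) ?_ ?_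
      · simp [Prog.exec, State.setF, State.charge, NExp.peak, FExp.peak]
      · refine ⟨(Same.charge _ _ _ _ _).trans (Same.setF _ _ _ _ (by simp)), ?_⟩
        simp [Prog.exec, State.setF, FExp.eval, hS, NExp.eval]
    rintro s₁ ⟨g1, g2⟩
    refine Impl.seq_pure (a := ()) (t₁ := n * 60 + 30) (t₂ := 20) (Q := fun _ s₂ =>
      Same [9] [29] s' s₂ ∧ s₂.farr 29 0 = S x n) ?_ ?_ (by omega)
    · refine Impl.forN_det (N := n) (tb := 40) (fun k s₂ =>
        Same [9] [29] s' s₂ ∧ s₂.farr 29 0 = S x k) ?_ ?_ (by omega) ⟨g1, g2⟩ ?_ ?_ ?_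
      · rintro k s₂ s₃ ⟨h3, h4⟩ h
        have hf : s₃.farr = s₂.farr := funext fun a => h.f a (by simp)
        exact ⟨h3.trans (h.mono (by simp) (by simp)), by rwa [hf]⟩
      · rintro k s₂ hk ⟨h3, -⟩ -
        have : s₂.narr 0 0 = n := by rw [h3.n 0 (by decide), h1.n 0 (by decide), h0]
        simp only [NExp.eval, NExp.peak, this, true_and]
        omega
      · rintro k s₂ hk ⟨h3, h4⟩ h9
        have e0 : s₂.narr 0 0 = n := by rw [h3.n 0 (by decide), h1.n 0 (by decide), h0]
        have e8 : s₂.narr 8 0 = x := by rw [h3.n 8 (by decide), h8]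
        have ea : s₂.farr va = s.farr va := by
          have : min va 40 = va := by omega
          rw [h3.f va (by simp [this, hva.2.1]), h1.f va (by simp [this, hva])]
        have er : s₂.farr ra = s.farr ra := by
          have : min ra 40 = ra := by omega
          rw [h3.f ra (by simp [this, hra.2.1]), h1.f ra (by simp [this, hra])]
        have i1 := idx_lt hx1 hk
        have i2 := idx_lt hx2 hk
        refine Impl.exec (by rfl) (by simp [Prog.tbound, NExp.cost, FExp.cost]) ?_ ?_
        · simp only [Prog.exec, State.setF, State.charge, NExp.peak, FExp.peak, NExp.eval, e0, e8,
            h9]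
          omega
        · refine ⟨h9, h3.trans ((Same.charge _ _ _ _ _).trans (Same.setF _ _ _ _ (by simp))), ?_⟩
          simp [Prog.exec, State.setF, State.charge, FExp.eval, NExp.eval, e0, e8, h9, ea, er, h4,
            hS, Finset.sum_range_succ]
      · rintro s₂ h; exact h
      · simp only [NExp.cost]; omega
    · rintro s₂ ⟨h3, h4⟩
      have e8 : s₂.narr 8 0 = x := by rw [h3.n 8 (by decide), h8]
      refine Impl.exec (by rfl) (by simp [Prog.tbound, NExp.cost, FExp.cost]) ?_ ?_
      · simp only [Prog.exec, State.setF, State.charge, NExp.peak, FExp.peak, NExp.eval, e8]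
        omega
      · simp only [Prog.exec, NExp.eval, FExp.eval, e8, h4]
        refine ⟨e8, (h1.trans (h3.mono (by simp) (by simp))).trans ((Same.charge _ _ _ _ _).trans
          (Same.setF _ _ _ _ (by simp; omega))), ?_⟩
        intro y hy
        by_cases hyx : y = x
        · subst hyx; simp [State.setF]
        · have hd : s₂.farr dst y = s'.farr dst y := by rw [h3.f dst]; simp; omega
          simpa [State.setF, State.charge, hyx, hd] using h2 y (by omega)
  · rintro s' ⟨h1, h2⟩
    refine ⟨h1, fun i j => ?_⟩
    rw [h2 _ (idx_lt i.2 j.2), hS]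
    simp only [idx_div j.2, idx_mod j.2, Matrix.mul_apply, Matrix.transpose_apply]
    rw [Finset.sum_range]
    exact Finset.sum_congr rfl fun k _ => by rw [hA i k, hR j k]
  · refine le_trans ?_ ht
    have : (NExp.mul (V 0) (V 0)).cost = 5 := rfl
    rw [this]
    have : n * 60 + 60 + 5 + 10 ≤ n * 100 + 100 := by omega
    have := Nat.mul_le_mul_left (n * n) this
    omega

/-! ### Uniform distributions -/

theorem uniform_map_equiv {α β : Type*} [Fintype α] [Nonempty α] [Fintype β] [Nonempty β]
    (e : α ≃ β) : (PMF.uniformOfFintype α).map e = PMF.uniformOfFintype β := by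
  classical
  ext b
  rw [PMF.map_apply, tsum_eq_single (e.symm b)]
  · simp [Fintype.card_congr e]
  · intro a ha
    rw [if_neg]
    rintro rfl; simp at ha

theorem uniform_prod {α β : Type*} [Fintype α] [Nonempty α] [Fintype β] [Nonempty β] :
    ((PMF.uniformOfFintype α).bind fun a => (PMF.uniformOfFintype β).map fun b => (a, b)) =
      PMF.uniformOfFintype (α × β) := by
  classical
  ext ⟨a, b⟩
  rw [PMF.bind_apply, tsum_eq_single a]
  · rw [PMF.map_apply, tsum_eq_single b]
    · simp [Fintype.card_prod, ENNReal.mul_inv]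
    · intro b' hb'
      rw [if_neg]; simpa using fun h => hb' h.symm
  · intro a' ha'
    rw [PMF.map_apply]
    simp [ha'.symm]

/-- Fill the cells from `k` on at random. -/
noncomputable def fillStep (k : ℕ) (a : ℕ → F) : PMF (ℕ → F) :=
  (PMF.uniformOfFintype F).map fun r => Function.update a k r

/-- A uniform vector of length `N + 1` is a uniform vector of length `N` with an independent last
entry. The initial content `a` is irrelevant, as every cell below `N` is overwritten. -/
theorem fill_uniform (N : ℕ) (a : ℕ → F) :
    (iterFrom fillStep 0 N a).map (fun a (i : Fin N) => a i) =
      PMF.uniformOfFintype (Fin N → F) := by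
  induction N with
  | zero =>
    ext x
    have : x = fun i : Fin 0 => a i := Subsingleton.elim _ _
    subst this
    simp [iterFrom, PMF.pure_map]
  | succ N ih =>
    rw [iterFrom_succ, PMF.map_bind, ← uniform_map_equiv (Fin.snocEquiv fun _ : Fin (N + 1) => F),
      ← uniform_prod, ← ih]
    simp only [fillStep, PMF.map_comp, PMF.map, PMF.bind_bind, PMF.pure_bind, Function.comp,
      zero_add]
    rw [PMF.bind_comm]
    congr 1; funext r; congr 1; funext b; congr 1; funext i
    refine Fin.lastCases ?_ (fun i => ?_) i
    · simp [Fin.snocEquiv]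
    · have : (i : ℕ) ≠ N := i.2.ne
      simp [Fin.snocEquiv, this]

/-- Fill field array `dst` with a random matrix. -/
def fillRand (dst : ℕ) : Prog F := forN 8 (.mul (V 0) (V 0)) (.frand dst (V 8))

theorem impl_fillRand {dst n w t : ℕ} {s : State F} (h0 : s.narr 0 0 = n) (hw : n * n + n ≤ w)
    (ht : n * n * 40 + 40 ≤ t) :
    Impl (fillRand dst) s t w (PMF.uniformOfFintype (Mat F n)) fun A s' =>
      Same [8] [min dst 40] s s' ∧ HasMat s' dst A := by
  let e : (Fin (n * n) → F) ≃ Mat F n :=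
    (Equiv.arrowCongr finProdFinEquiv.symm (Equiv.refl F)).trans (Equiv.curry _ _ _)
  have he : ∀ v i j, e v i j = v (finProdFinEquiv (i, j)) := fun v i j => rfl
  rw [← uniform_map_equiv e, ← fill_uniform (n * n) (fun _ => (0 : F)), PMF.map_comp]
  refine Impl.map (Q := fun a s' => Same [8] [min dst 40] s s' ∧ ∀ x < n * n, s'.farr dst x = a x)
    _ ?_ ?_
  · refine Impl.forN (N := n * n) (tb := 5) (fun k a s' =>
      Same [8] [min dst 40] s s' ∧ ∀ x < k, s'.farr dst x = a x) ?_ ?_ (by omega) ?_ ?_ ?_ ?_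
    · rintro k a s₁ s₂ ⟨h1, h2⟩ h
      have hf : s₂.farr = s₁.farr := funext fun a => h.f a (by simp)
      exact ⟨h1.trans (h.mono (by simp) (by simp)), by rwa [hf]⟩
    · rintro k a s' hk ⟨h1, -⟩ -
      have : s'.narr 0 0 = n := by rw [h1.n 0 (by decide), h0]
      simp only [NExp.eval, NExp.peak, this, true_and]
      omega
    · exact ⟨Same.refl _ _ _, fun x hx => by omega⟩
    · rintro k a s' hk ⟨h1, h2⟩ h8
      refine Impl.map _ (Impl.frand (Q := fun r s'' => s''.narr 8 0 = k ∧
        Same [8] [min dst 40] s s'' ∧ (∀ x < k, s''.farr dst x = a x) ∧ s''.farr dst k = r)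
        ?_ (by simp [NExp.cost]) ?_) ?_
      · simp only [NExp.peak, NExp.eval, h8]; omega
      · intro r
        refine ⟨h8, h1.trans ((Same.charge _ _ _ _ _).trans (Same.setF _ _ _ _ (by simp))), ?_, ?_⟩
        · intro x hx
          have : x ≠ k := by omega
          simpa [State.setF, State.charge, NExp.eval, h8, this] using h2 x hx
        · simp [State.setF, NExp.eval, h8]
      · rintro r s'' ⟨h3, h4, h5, h6⟩
        refine ⟨h3, h4, fun x hx => ?_⟩
        by_cases hxk : x = k
        · subst hxk; simp [h6]
        · simpa [hxk] using h5 x (by omega)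
    · exact fun a s' h => h
    · simp only [NExp.cost]; omega
  · rintro a s' ⟨h1, h2⟩
    refine ⟨h1, fun i j => ?_⟩
    rw [h2 _ (idx_lt i.2 j.2)]
    simp only [Function.comp, he]
    congr 1
    simp only [finProdFinEquiv_apply_val]
    ring

/-! ### Random nonzero field elements -/

/-- Store the element at position `narr r [0] - k` of a list. -/
def pick (dst r : ℕ) : List F → ℕ → Prog F
  | [], _ => .skip
  | u :: us, k => .cond (.eq (V r) (.lit k)) (.fset dst (.lit 0) (.lit u)) (pick dst r us (k + 1))

theorem impl_pick {dst r w : ℕ} (us : List F) (k i : ℕ) (s : State F) (u : F)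
    (hr : s.narr r 0 = k + i) (hi : us[i]? = some u) (hw : k + us.length ≤ w) :
    Impl (pick dst r us k) s (us.length * 10) w (PMF.pure ()) fun _ s' =>
      Same [] [min dst 40] s s' ∧ s'.farr dst 0 = u := by
  induction us generalizing k i s with
  | nil => simp at hi
  | cons v us ih =>
    simp only [List.length_cons] at hw
    have hil : i < us.length + 1 := by
      have := (List.getElem?_eq_some_iff.1 hi).1; simpa using this
    refine Impl.cond (t₁ := us.length * 10 + 5) ?_ ?_ ?_ ?_
    · simp only [BExp.peak, NExp.peak, NExp.eval, hr]; omega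
    · intro hb
      simp only [BExp.eval, NExp.eval, hr, decide_eq_true_eq] at hb
      have hi0 : i = 0 := by omega
      subst hi0
      simp only [List.getElem?_cons_zero, Option.some.injEq] at hi
      subst hi
      refine Impl.exec (by rfl) (by simp [Prog.tbound, NExp.cost, FExp.cost]) ?_ ?_
      · simp only [Prog.exec, State.setF, State.charge, NExp.peak, FExp.peak]; omega
      · refine ⟨(Same.charge _ _ _ _ _).trans ((Same.charge _ _ _ _ _).trans
          (Same.setF _ _ _ _ (by simp))), ?_⟩
        simp [Prog.exec, State.setF, FExp.eval, NExp.eval]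
    · intro hb
      simp only [BExp.eval, NExp.eval, hr, decide_eq_false_iff_not] at hb
      obtain ⟨i, rfl⟩ : ∃ j, i = j + 1 := ⟨i - 1, by omega⟩
      refine (ih (k + 1) i (s.charge _ _) (by simp only [State.charge, hr]; omega)
        (by simpa using hi) (by omega)).mono (by omega) ?_
      rintro a - s' ⟨h1, h2⟩
      exact ⟨(Same.charge _ _ _ _ _).trans h1, h2⟩
    · simp only [BExp.cost, NExp.cost, List.length_cons]; omega

/-- The nonzero elements of the field. -/
noncomputable def unitList (F : Type*) [Field F] [Fintype F] [DecidableEq F] : List F :=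
  List.ofFn fun i : Fin (Fintype.card Fˣ) => (((Fintype.equivFin Fˣ).symm i : Fˣ) : F)

/-- Store a random nonzero field element. -/
noncomputable def randUnit (dst : ℕ) : Prog F :=
  .seq (.nrand 20 (.lit 0) (.lit (Fintype.card Fˣ - 1))) (pick dst 20 (unitList F) 0)

/-- A random index into a fixed list of all units. This takes bounded time as the field is fixed,
whereas rejection sampling from the field would have no worst-case time bound. -/
theorem impl_randUnit {dst w t : ℕ} {s : State F} (hw : Fintype.card Fˣ ≤ w)
    (ht : Fintype.card Fˣ * 10 + 10 ≤ t) :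
    Impl (randUnit dst) s t w (PMF.uniformOfFintype Fˣ) fun u s' =>
      Same [20] [min dst 40] s s' ∧ s'.farr dst 0 = u := by
  have hpos : 0 < Fintype.card Fˣ := Fintype.card_pos
  have : NeZero (Fintype.card Fˣ) := ⟨hpos.ne'⟩
  rw [← uniform_map_equiv (Fintype.equivFin Fˣ).symm]
  refine Impl.seq (t₁ := 5) (t₂ := Fintype.card Fˣ * 10) (Q := fun i s' => Same [20] [] s s' ∧
    s'.narr 20 0 = (i : Fin (Fintype.card Fˣ))) (f := fun i => PMF.pure ((Fintype.equivFin Fˣ).symm i))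
    (Impl.nrand (by simp only [NExp.eval]; omega) (by simp [NExp.peak])
      (by simp only [NExp.peak]; omega) (by simp [NExp.cost]) ?_) ?_ (by omega)
  · intro i
    exact ⟨(Same.charge _ _ _ _ _).trans (Same.setN _ _ _ _ (by simp)), by
      simp [State.setN, NExp.eval]⟩
  · rintro i s₁ ⟨h1, h2⟩
    have := (impl_pick (dst := dst) (r := 20) (w := w) (unitList F) 0 i s₁
      (((Fintype.equivFin Fˣ).symm i : Fˣ) : F) (by simpa using h2) (by simp [unitList])
      (by simpa [unitList] using hw)).map (fun _ => (Fintype.equivFin Fˣ).symm i)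
      (Q' := fun (u : Fˣ) s' => Same [20] [min dst 40] s s' ∧ s'.farr dst 0 = u) ?_
    · rw [PMF.pure_map] at this
      simpa [unitList] using this
    · rintro - s' ⟨h3, h4⟩
      exact ⟨(h1.mono (by simp) (by simp)).trans (h3.mono (by simp) (by simp)), h4⟩

/-! ### The number of repetitions -/

/-- Register `3` receives `C * ⌈log₂ n⌉`. -/
def logProg (C : ℕ) : Prog F :=
  .seq (.seq (.nset 3 (.lit 0) (.lit 0)) (.nset 19 (.lit 0) (.lit 1)))
    (forN 8 (V 0) (.cond (.lt (V 19) (V 0))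
      (.seq (.nset 19 (.lit 0) (.mul (V 19) (.lit 2))) (.nset 3 (.lit 0) (.add (V 3) (.lit C))))
      .skip))

/-- Register `19` runs through the powers of two until it reaches `n`, and register `3` grows by `C`
with each doubling. The loop makes `n` rounds, most of them idle; this suffices as `Nat.clog 2 n ≤
n`. -/
theorem impl_logProg {C n w t : ℕ} {s : State F} (h0 : s.narr 0 0 = n)
    (hw : 2 * n + C * n + C + 2 ≤ w) (ht : n * 60 + 60 ≤ t) :
    Impl (logProg C : Prog F) s t w (PMF.pure ()) fun _ s' =>
      Same [3, 8, 19] [] s s' ∧ s'.narr 3 0 = C * Nat.clog 2 n := by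
  refine Impl.seq_pure (a := ()) (t₁ := 10) (t₂ := n * 60 + 50) (Q := fun _ s₁ =>
    Same [3, 19] [] s s₁ ∧ s₁.narr 3 0 = 0 ∧ s₁.narr 19 0 = 1) ?_ ?_ (by omega)
  · refine Impl.exec (by rfl) (by simp [Prog.tbound, NExp.cost]) ?_ ?_
    · simp [Prog.exec, State.setN, State.charge, NExp.peak]; omega
    · refine ⟨((Same.charge _ _ _ _ _).trans (Same.setN _ _ _ _ (by simp))).trans
        ((Same.charge _ _ _ _ _).trans (Same.setN _ _ _ _ (by simp))), ?_, ?_⟩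
      · simp [Prog.exec, State.setN, State.charge, NExp.eval]
      · simp [Prog.exec, State.setN, NExp.eval]
  rintro s₁ ⟨g1, g2, g3⟩
  have hclog : Nat.clog 2 n ≤ n := Nat.clog_le_of_le_pow Nat.lt_two_pow_self.le
  refine Impl.forN_det (N := n) (tb := 40) (fun k s' => Same [3, 8, 19] [] s s' ∧
    s'.narr 3 0 = C * min k (Nat.clog 2 n) ∧ s'.narr 19 0 = 2 ^ min k (Nat.clog 2 n))
    ?_ ?_ (by omega) ?_ ?_ ?_ ?_
  · rintro k s₂ s₃ ⟨h1, h2, h3⟩ h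
    exact ⟨h1.trans (h.mono (by simp) (by simp)), by rw [h.n 3 (by decide), h2],
      by rw [h.n 19 (by decide), h3]⟩
  · rintro k s' hk ⟨h1, -⟩ -
    have : s'.narr 0 0 = n := by rw [h1.n 0 (by decide), h0]
    simp only [NExp.eval, NExp.peak, this, true_and]
    omega
  · exact ⟨g1.mono (by simp) (by simp), by simp [g2], by simp [g3]⟩
  · rintro k s' hk ⟨h1, h2, h3⟩ h8
    have e0 : s'.narr 0 0 = n := by rw [h1.n 0 (by decide), h0]
    have hCk : C * min k (Nat.clog 2 n) ≤ C * n := Nat.mul_le_mul_left _ (by omega)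
    refine Impl.cond (t₁ := 20) ?_ ?_ ?_ (by simp [BExp.cost, NExp.cost])
    · have : 2 ^ min k (Nat.clog 2 n) ≤ 2 * n := by
        rcases Nat.eq_zero_or_pos (min k (Nat.clog 2 n)) with h | h
        · rw [h]; omega
        · obtain ⟨j, hj⟩ : ∃ j, min k (Nat.clog 2 n) = j + 1 := ⟨min k (Nat.clog 2 n) - 1, by omega⟩
          have : 2 ^ j < n := (Nat.lt_clog_iff_pow_lt (by decide)).1 (by omega)
          rw [hj, pow_succ]; omega
      simp only [BExp.peak, NExp.peak, NExp.eval, e0, h3]; omega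
    · intro hb
      simp only [BExp.eval, NExp.eval, h3, e0, decide_eq_true_eq] at hb
      have hlt : min k (Nat.clog 2 n) < Nat.clog 2 n := (Nat.lt_clog_iff_pow_lt (by decide)).2 hb
      have hmin : min k (Nat.clog 2 n) = k := by omega
      have hmin' : min (k + 1) (Nat.clog 2 n) = k + 1 := by omega
      rw [hmin] at h2 h3 hb hCk
      refine Impl.exec (by rfl) (by simp [Prog.tbound, NExp.cost]) ?_ ?_
      · simp [Prog.exec, State.setN, State.charge, NExp.peak, NExp.eval, h3, h2]; omega
      · refine ⟨?_, h1.trans ((Same.charge _ _ _ _ _).trans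
          (((Same.charge _ _ _ _ _).trans (Same.setN _ _ _ _ (by simp))).trans
          ((Same.charge _ _ _ _ _).trans (Same.setN _ _ _ _ (by simp))))), ?_, ?_⟩
        · simpa [Prog.exec, State.setN, State.charge] using h8
        · simp [Prog.exec, State.setN, State.charge, NExp.eval, h2, hmin']; ring
        · simp [Prog.exec, State.setN, State.charge, NExp.eval, h3, hmin', pow_succ]
    · intro hb
      simp only [BExp.eval, NExp.eval, h3, e0, decide_eq_false_iff_not] at hb
      have hge : ¬ min k (Nat.clog 2 n) < Nat.clog 2 n := fun h =>
        hb ((Nat.lt_clog_iff_pow_lt (by decide)).1 h)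
      have hmin : min (k + 1) (Nat.clog 2 n) = min k (Nat.clog 2 n) := by omega
      refine Impl.exec (by rfl) (by simp [Prog.tbound]) ?_ ?_
      · simp only [Prog.exec, State.charge]; omega
      · refine ⟨h8, h1.trans ((Same.charge _ _ _ _ _).trans (Same.charge _ _ _ _ _)), ?_, ?_⟩
        · rw [hmin]; exact h2
        · rw [hmin]; exact h3
  · rintro s' ⟨h1, h2, -⟩
    exact ⟨h1, by rw [h2, min_eq_right hclog]⟩
  · simp only [NExp.cost]; omega

/-! ### Saving the output of a subroutine -/

/-- Copy the output of a subroutine to the arrays `ca`. -/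
def copyOut (ca : ℕ) : Prog F :=
  .seq (forN 8 (V 5) (.nset ca (V 8) (.read 30 (V 8))))
    (forN 8 (V 6) (.fset ca (V 8) (.read 30 (V 8))))

theorem impl_copyOut {ca w t N M : ℕ} {s : State F} (hca : ca = 31 ∨ ca = 32)
    (h5 : s.narr 5 0 = N) (h6 : s.narr 6 0 = M) (hN : N ≤ w) (hM : M ≤ w)
    (hv : ∀ x < N, s.narr 30 x ≤ w) (ht : N * 40 + M * 40 + 40 ≤ t) :
    Impl (copyOut ca : Prog F) s t w (PMF.pure ()) fun _ s' => Same [8, ca] [ca] s s' ∧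
      (∀ x < N, s'.narr ca x = s.narr 30 x) ∧ ∀ x < M, s'.farr ca x = s.farr 30 x := by
  have hc : min ca 40 = ca := by omega
  refine Impl.seq_pure (a := ()) (t₁ := N * 40 + 20) (t₂ := M * 40 + 20) (Q := fun _ s' =>
    Same [8, ca] [] s s' ∧ ∀ x < N, s'.narr ca x = s.narr 30 x) ?_ ?_ (by omega)
  · refine Impl.forN_det (N := N) (tb := 20) (fun k s' => Same [8, ca] [] s s' ∧
      ∀ x < k, s'.narr ca x = s.narr 30 x) ?_ ?_ hN ⟨Same.refl _ _ _, fun x hx => by omega⟩ ?_ ?_ ?_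
    · rintro k s₁ s₂ ⟨h1, h2⟩ h
      refine ⟨h1.trans (h.mono (by simp) (by simp)), ?_⟩
      rwa [h.n ca (by simp; omega)]
    · rintro k s' hk ⟨h1, -⟩ -
      have : s'.narr 5 0 = N := by rw [h1.n 5 (by rcases hca with rfl | rfl <;> decide), h5]
      simp only [NExp.eval, NExp.peak, this, true_and]
      omega
    · rintro k s' hk ⟨h1, h2⟩ h8
      have e30 : s'.narr 30 = s.narr 30 := h1.n 30 (by rcases hca with rfl | rfl <;> decide)
      have hvk := hv k hk
      have hca8 : ca ≠ 8 := by omega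
      refine Impl.exec (by rfl) (by simp [Prog.tbound, NExp.cost]) ?_ ?_
      · simp only [Prog.exec, State.setN, State.charge, NExp.peak, NExp.eval, h8, e30]; omega
      · refine ⟨?_, h1.trans ((Same.charge _ _ _ _ _).trans (Same.setN _ _ _ _ (by simp [hc]))), ?_⟩
        · simpa [Prog.exec, State.setN, State.charge, Ne.symm hca8] using h8
        · intro x hx
          by_cases hxk : x = k
          · subst hxk; simp [Prog.exec, State.setN, NExp.eval, h8, e30]
          · simpa [Prog.exec, State.setN, State.charge, NExp.eval, h8, hxk] using h2 x (by omega)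
    · exact fun s' h => h
    · simp only [NExp.cost]; omega
  · rintro s₁ ⟨g1, g2⟩
    refine Impl.forN_det (N := M) (tb := 20) (fun k s' => Same [8, ca] [ca] s s' ∧
      (∀ x < N, s'.narr ca x = s.narr 30 x) ∧ ∀ x < k, s'.farr ca x = s.farr 30 x) ?_ ?_ hM
      ⟨g1.mono (by simp) (by simp), g2, fun x hx => by omega⟩ ?_ ?_ ?_
    · rintro k s₁ s₂ ⟨h1, h2, h3⟩ h
      refine ⟨h1.trans (h.mono (by simp) (by simp)), ?_, ?_⟩
      · rwa [h.n ca (by simp; omega)]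
      · rwa [h.f ca (by simp)]
    · rintro k s' hk ⟨h1, -⟩ -
      have : s'.narr 6 0 = M := by rw [h1.n 6 (by rcases hca with rfl | rfl <;> decide), h6]
      simp only [NExp.eval, NExp.peak, this, true_and]
      omega
    · rintro k s' hk ⟨h1, h2, h3⟩ h8
      have e30 : s'.farr 30 = s.farr 30 := h1.f 30 (by rcases hca with rfl | rfl <;> decide)
      refine Impl.exec (by rfl) (by simp [Prog.tbound, NExp.cost, FExp.cost]) ?_ ?_
      · simp only [Prog.exec, State.setF, State.charge, NExp.peak, FExp.peak, NExp.eval, h8]; omega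
      · refine ⟨h8, h1.trans ((Same.charge _ _ _ _ _).trans (Same.setF _ _ _ _ (by simp [hc]))),
          h2, ?_⟩
        intro x hx
        by_cases hxk : x = k
        · subst hxk; simp [Prog.exec, State.setF, NExp.eval, FExp.eval, h8, e30]
        · simpa [Prog.exec, State.setF, State.charge, NExp.eval, h8, hxk] using h3 x (by omega)
    · exact fun s' h => h
    · simp only [NExp.cost]; omega

/-! ### Evaluation of circuits -/

theorem Gate.code_length {m : ℕ} (g : Gate F m) : g.code.length = 3 := by
  cases g <;> rfl

theorem flatMap_code_getD {m : ℕ} (l : List (Gate F m)) (l' : List ℕ) (k r : ℕ) (hr : r < 3)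
    (g : Gate F m) (hg : l[k]? = some g) :
    (l.flatMap Gate.code ++ l').getD (3 * k + r) 0 = g.code.getD r 0 := by
  induction l generalizing k with
  | nil => simp at hg
  | cons a l ih =>
    rw [List.flatMap_cons, List.append_assoc]
    cases k with
    | zero =>
      simp only [List.getElem?_cons_zero, Option.some.injEq] at hg
      subst hg
      rw [List.getD_append _ _ _ _ (by rw [Gate.code_length]; omega)]
      simp
    | succ k =>
      simp only [List.getElem?_cons_succ] at hg
      rw [List.getD_append_right _ _ _ _ (by rw [Gate.code_length]; omega), Gate.code_length,
        ← ih k hg]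
      congr 1; omega

theorem flatMap_code_length {m : ℕ} (l : List (Gate F m)) :
    (l.flatMap Gate.code).length = 3 * l.length := by
  induction l with
  | nil => rfl
  | cons a l ih => rw [List.flatMap_cons, List.length_append, ih, Gate.code_length,
      List.length_cons]; ring

theorem Circuit.code_length {m n : ℕ} (C : Circuit F m n) :
    C.code.length = 1 + 3 * C.size + n := by
  simp only [Circuit.code, List.length_cons, List.length_append, flatMap_code_length,
    List.length_ofFn, Circuit.size]; omega

theorem Circuit.code_gate {m n : ℕ} (C : Circuit F m n) (k r : ℕ) (hr : r < 3) (g : Gate F m)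
    (hg : C.gates[k]? = some g) : C.code.getD (1 + 3 * k + r) 0 = g.code.getD r 0 := by
  have : 1 + 3 * k + r = (3 * k + r) + 1 := by omega
  rw [this, Circuit.code, List.getD_cons_succ, flatMap_code_getD _ _ k r hr g hg]

theorem Circuit.code_out {m n : ℕ} (C : Circuit F m n) (i : Fin n) :
    C.code.getD (1 + 3 * C.size + i) 0 = C.out i := by
  have : 1 + 3 * C.size + i = (3 * C.gates.length + i) + 1 := by simp only [Circuit.size]; omega
  rw [this, Circuit.code, List.getD_cons_succ,
    List.getD_append_right _ _ _ _ (by rw [flatMap_code_length]; omega), flatMap_code_length]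
  simp

/-- The values of the first `k` gates. -/
def Circuit.vals {m n : ℕ} (C : Circuit F m n) (v : Fin m → F) (k : ℕ) : List F :=
  (C.gates.take k).foldl (fun w g => w ++ [g.value v w]) []

theorem Circuit.vals_succ {m n : ℕ} (C : Circuit F m n) (v : Fin m → F) (k : ℕ) (g : Gate F m)
    (hg : C.gates[k]? = some g) :
    C.vals v (k + 1) = C.vals v k ++ [g.value v (C.vals v k)] := by
  simp only [Circuit.vals]
  rw [List.take_add_one, hg]
  simp [List.foldl_append]

theorem Circuit.vals_length {m n : ℕ} (C : Circuit F m n) (v : Fin m → F) (k : ℕ)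
    (hk : k ≤ C.size) : (C.vals v k).length = k := by
  induction k with
  | zero => simp [Circuit.vals]
  | succ k ih =>
    have hk' : k < C.gates.length := hk
    rw [C.vals_succ v k C.gates[k] (by simp [hk']), List.length_append, ih (by omega)]
    rfl

theorem Circuit.eval_eq {m n : ℕ} (C : Circuit F m n) (v : Fin m → F) (i : Fin n) :
    C.eval v i = (C.vals v C.size).getD (C.out i) 0 := by
  simp [Circuit.eval, Circuit.vals, Circuit.size]

/-- The arrays hold the encoding of a circuit that multiplies by `R`, and the matrix `R`. -/
structure HoldsCirc {n : ℕ} (σ : ℕ) (R : Mat F n) (nf : ℕ → ℕ) (ff : ℕ → F) : Prop where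
  mat : ∀ i j : Fin n, ff (i * n + j) = R i j
  circ : ∃ C : Circuit F n n, C.size ≤ σ ∧ (∀ v, C.eval v = R.mulVec v) ∧
    (∀ k < C.code.length, nf k = C.code.getD k 0) ∧
    ∀ k < C.size, ff (n * n + k) = C.fcode.getD k 0

/-- Evaluate gate number `narr 9 [0]` of a circuit on row `narr 8 [0]` of a matrix. -/
def circGate (ca inp : ℕ) : Prog F :=
  .cond (.eq (.read ca (.add (.lit 1) (.mul (.lit 3) (V 9)))) (.lit 0))
    (.fset 29 (V 9) (.read inp (.add (.mul (V 8) (V 0))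
      (.read ca (.add (.lit 2) (.mul (.lit 3) (V 9)))))))
  (.cond (.eq (.read ca (.add (.lit 1) (.mul (.lit 3) (V 9)))) (.lit 1))
    (.fset 29 (V 9) (.read ca (.add (.mul (V 0) (V 0)) (V 9))))
  (.cond (.eq (.read ca (.add (.lit 1) (.mul (.lit 3) (V 9)))) (.lit 2))
    (.fset 29 (V 9) (.add (.read 29 (.read ca (.add (.lit 2) (.mul (.lit 3) (V 9)))))
      (.read 29 (.read ca (.add (.lit 3) (.mul (.lit 3) (V 9)))))))
    (.fset 29 (V 9) (.mul (.read 29 (.read ca (.add (.lit 2) (.mul (.lit 3) (V 9)))))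
      (.read 29 (.read ca (.add (.lit 3) (.mul (.lit 3) (V 9)))))))))

/-- `out := inp * Rᵀ`, where the circuit in the arrays `ca` multiplies by `R`. -/
def circApply (ca inp out : ℕ) : Prog F :=
  forN 8 (V 0) (.seq (forN 9 (.read ca (.lit 0)) (circGate ca inp))
    (forN 9 (V 0) (.fset out (.add (.mul (V 8) (V 0)) (V 9))
      (.read 29 (.read ca (.add (.add (.lit 1) (.mul (.lit 3) (.read ca (.lit 0)))) (V 9)))))))

/-- The three code words of gate `k` start at position `1 + 3 * k`, after the number of gates.
Well-formedness ensures that the operands of a gate have already been computed. -/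
theorem impl_circGate {ca inp n w x k : ℕ} {s : State F} {C : Circuit F n n} {v : Fin n → F}
    (h0 : s.narr 0 0 = n) (h8 : s.narr 8 0 = x) (h9 : s.narr 9 0 = k) (hx : x < n)
    (hk : k < C.size) (hw : n * n + 4 * C.size + n + 10 ≤ w)
    (hcode : ∀ k < C.code.length, s.narr ca k = C.code.getD k 0)
    (hf : ∀ k < C.size, s.farr ca (n * n + k) = C.fcode.getD k 0)
    (hv : ∀ j : Fin n, s.farr inp (x * n + j) = v j)
    (hvals : ∀ i < k, s.farr 29 i = (C.vals v k).getD i 0) :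
    Impl (circGate ca inp) s 100 w (PMF.pure ()) fun _ s' => Same [] [29] s s' ∧
      ∀ i < k + 1, s'.farr 29 i = (C.vals v (k + 1)).getD i 0 := by
  have hk' : k < C.gates.length := hk
  obtain ⟨g, hg⟩ : ∃ g, C.gates[k]? = some g := ⟨C.gates[k], by simp [hk']⟩
  have hwf := C.gates_wf k g hg
  have hlen := C.code_length
  have c0 := hcode (1 + 3 * k + 0) (by omega)
  have c1 := hcode (1 + 3 * k + 1) (by omega)
  have c2 := hcode (1 + 3 * k + 2) (by omega)
  rw [C.code_gate k _ (by omega) g hg] at c0 c1 c2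
  have c1' : s.narr ca (2 + 3 * k) = g.code.getD 1 0 := by rw [← c1]; congr 1; omega
  have c2' : s.narr ca (3 + 3 * k) = g.code.getD 2 0 := by rw [← c2]; congr 1; omega
  rw [Nat.add_zero] at c0
  have key : ∀ u : F, u = g.value v (C.vals v k) → ∀ s' : State F,
      s'.farr = (s.setF 29 k u).farr →
      ∀ i < k + 1, s'.farr 29 i = (C.vals v (k + 1)).getD i 0 := by
    rintro u rfl s' hs' i hi
    have hl := C.vals_length v k hk.le
    rw [C.vals_succ v k g hg, getD_append_single _ _ _ _ (by omega), hs', hl]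
    by_cases hik : i = k
    · subst hik; simp [State.setF]
    · simpa [State.setF, hik] using hvals i (by omega)
  have hbase : x * n + n ≤ n * n := by
    calc x * n + n = (x + 1) * n := by ring
      _ ≤ n * n := Nat.mul_le_mul_right _ hx
  have leaf : ∀ (s' : State F) (e : FExp F), Same [] [] s s' → e.eval s' = g.value v (C.vals v k) →
      e.peak s' ≤ w → e.cost ≤ 30 → Impl (.fset 29 (V 9) e) s' 40 w (PMF.pure ()) fun _ s'' =>
        Same [] [29] s s'' ∧ ∀ i < k + 1, s''.farr 29 i = (C.vals v (k + 1)).getD i 0 := by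
    intro s' e hs' he hp hc
    have h9' : s'.narr 9 0 = k := by rw [hs'.n 9 (by decide), h9]
    refine Impl.exec (by rfl) (by simp only [Prog.tbound, NExp.cost]; omega) ?_ ?_
    · simp only [Prog.exec, State.setF, State.charge, NExp.peak, NExp.eval, h9']; omega
    · refine ⟨(hs'.mono (by simp) (by simp)).trans ((Same.charge _ _ _ _ _).trans
        (Same.setF _ _ _ _ (by simp))), key _ he _ ?_⟩
      have : s'.farr = s.farr := funext fun a => hs'.f a (by simp)
      simp [Prog.exec, State.setF, State.charge, NExp.eval, h9', this]
  have test : ∀ (s' : State F) (c : ℕ), Same [] [] s s' → c ≤ 2 →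
      (BExp.eq (F := F) (.read ca (.add (.lit 1) (.mul (.lit 3) (V 9)))) (.lit c)).eval s' =
        decide (g.code.getD 0 0 = c) ∧
      (BExp.eq (F := F) (.read ca (.add (.lit 1) (.mul (.lit 3) (V 9)))) (.lit c)).peak s' ≤ w := by
    intro s' c hs' hc
    have hn : s'.narr = s.narr := funext fun a => hs'.n a (by simp)
    have : g.code.getD 0 0 ≤ 3 := by cases g <;> simp [Gate.code]
    simp only [BExp.eval, BExp.peak, NExp.eval, NExp.peak, hn, h9, c0, true_and]
    omega
  have e1 : ∀ s' : State F, Same [] [] s s' → s'.narr = s.narr ∧ s'.farr = s.farr := fun s' h =>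
    ⟨funext fun a => h.n a (by simp), funext fun a => h.f a (by simp)⟩
  have hff : s.farr ca (n * n + k) = g.fcode := by
    rw [hf k hk]; simp [Circuit.fcode, List.getD, hg]
  have s1 := Same.refl [] [] s
  refine Impl.cond (t₁ := 85) (test s 0 s1 (by omega)).2 (fun hb => ?_) (fun hb => ?_)
    (by simp [BExp.cost, NExp.cost])
  · rw [(test s 0 s1 (by omega)).1] at hb
    have s2 := s1.trans (Same.charge s [] []
      ((BExp.eq (F := F) (.read ca (.add (.lit 1) (.mul (.lit 3) (V 9)))) (.lit 0)).cost + 1)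
      ((BExp.eq (F := F) (.read ca (.add (.lit 1) (.mul (.lit 3) (V 9)))) (.lit 0)).peak s))
    cases g with
    | input i =>
      simp only [Gate.code, List.getD_cons_zero, List.getD_cons_succ] at c1'
      refine (leaf _ _ s2 ?_ ?_ (by simp [FExp.cost, NExp.cost])).mono (by omega) fun _ _ _ h => h
      · simp [FExp.eval, NExp.eval, e1 _ s2, h0, h8, h9, c1', hv, Gate.value]
      · have := i.2
        simp only [FExp.peak, NExp.peak, NExp.eval, e1 _ s2, h0, h8, h9, c1']; omega
    | _ => simp [Gate.code] at hb
  have s2 := s1.trans (Same.charge s [] []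
    ((BExp.eq (F := F) (.read ca (.add (.lit 1) (.mul (.lit 3) (V 9)))) (.lit 0)).cost + 1)
    ((BExp.eq (F := F) (.read ca (.add (.lit 1) (.mul (.lit 3) (V 9)))) (.lit 0)).peak s))
  rw [(test s 0 s1 (by omega)).1] at hb
  generalize s.charge _ _ = s₁ at s2 ⊢
  refine Impl.cond (t₁ := 70) (test s₁ 1 s2 (by omega)).2 (fun hb' => ?_) (fun hb' => ?_)
    (by simp [BExp.cost, NExp.cost])
  · rw [(test s₁ 1 s2 (by omega)).1] at hb'
    have s3 := s2.trans (Same.charge s₁ [] []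
      ((BExp.eq (F := F) (.read ca (.add (.lit 1) (.mul (.lit 3) (V 9)))) (.lit 1)).cost + 1)
      ((BExp.eq (F := F) (.read ca (.add (.lit 1) (.mul (.lit 3) (V 9)))) (.lit 1)).peak s₁))
    cases g with
    | const c =>
      refine (leaf _ _ s3 ?_ ?_ (by simp [FExp.cost, NExp.cost])).mono (by omega) fun _ _ _ h => h
      · simp [FExp.eval, NExp.eval, e1 _ s3, h0, h9, hff, Gate.fcode, Gate.value]
      · simp only [FExp.peak, NExp.peak, NExp.eval, e1 _ s3, h0, h9]; omega
    | _ => simp [Gate.code] at hb'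
  have s3 := s2.trans (Same.charge s₁ [] []
    ((BExp.eq (F := F) (.read ca (.add (.lit 1) (.mul (.lit 3) (V 9)))) (.lit 1)).cost + 1)
    ((BExp.eq (F := F) (.read ca (.add (.lit 1) (.mul (.lit 3) (V 9)))) (.lit 1)).peak s₁))
  rw [(test s₁ 1 s2 (by omega)).1] at hb'
  generalize s₁.charge _ _ = s₂ at s3 ⊢
  have s4 := s3.trans (Same.charge s₂ [] []
    ((BExp.eq (F := F) (.read ca (.add (.lit 1) (.mul (.lit 3) (V 9)))) (.lit 2)).cost + 1)
    ((BExp.eq (F := F) (.read ca (.add (.lit 1) (.mul (.lit 3) (V 9)))) (.lit 2)).peak s₂))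
  refine Impl.cond (t₁ := 50) (test s₂ 2 s3 (by omega)).2 (fun hc => ?_) (fun hc => ?_)
    (by simp [BExp.cost, NExp.cost])
  · rw [(test s₂ 2 s3 (by omega)).1] at hc
    cases g with
    | add i j =>
      simp only [Gate.code, List.getD_cons_zero, List.getD_cons_succ] at c1' c2'
      simp only [Gate.RefsBelow] at hwf
      refine (leaf _ _ s4 ?_ ?_ (by simp [FExp.cost, NExp.cost])).mono (by omega) fun _ _ _ h => h
      · simp only [FExp.eval, NExp.eval, e1 _ s4, h9, c1', c2', hvals i hwf.1, hvals j hwf.2,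
          Gate.value]
      · simp only [FExp.peak, NExp.peak, NExp.eval, e1 _ s4, h9, c1', c2']; omega
    | _ => simp [Gate.code] at hc
  · rw [(test s₂ 2 s3 (by omega)).1] at hc
    cases g with
    | mul i j =>
      simp only [Gate.code, List.getD_cons_zero, List.getD_cons_succ] at c1' c2'
      simp only [Gate.RefsBelow] at hwf
      refine (leaf _ _ s4 ?_ ?_ (by simp [FExp.cost, NExp.cost])).mono (by omega) fun _ _ _ h => h
      · simp only [FExp.eval, NExp.eval, e1 _ s4, h9, c1', c2', hvals i hwf.1, hvals j hwf.2,
          Gate.value]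
      · simp only [FExp.peak, NExp.peak, NExp.eval, e1 _ s4, h9, c1', c2']; omega
    | _ => simp [Gate.code] at *

/-- Row `x` of `A * Rᵀ` is `R` applied to row `x` of `A`. So `n` evaluations of a circuit of size
`Õ(n)` suffice, which is the gain from the trapdoor. -/
theorem impl_circApply {ca inp out n σ w t : ℕ} {s : State F} {A R : Mat F n}
    (h0 : s.narr 0 0 = n) (hR : HoldsCirc σ R (s.narr ca) (s.farr ca)) (hA : HasMat s inp A)
    (hca : ca = 31 ∨ ca = 32) (hinp : inp < 29) (hout : out < 29) (hio : inp ≠ out)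
    (hw : n * n + 4 * σ + n + 10 ≤ w)
    (ht : n * ((σ + n) * 200 + 200) + 40 ≤ t) :
    Impl (circApply ca inp out) s t w (PMF.pure ()) fun _ s' => Same [8, 9] [29, out] s s' ∧
      HasMat s' out (A * R.transpose) := by
  obtain ⟨-, C, hCσ, hCe, hcode, hfc⟩ := hR
  have hlen := C.code_length
  refine Impl.forN_det (N := n) (tb := (σ + n) * 150 + 150) (fun x s' =>
    Same [8, 9] [29, out] s s' ∧ ∀ i j : Fin n, i.val < x →
      s'.farr out (i * n + j) = (A * R.transpose) i j) ?_ ?_ (by omega)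
    ⟨Same.refl _ _ _, fun i j hi => by omega⟩ ?_ ?_ ?_
  · rintro k s₁ s₂ ⟨h1, h2⟩ h
    have hf : s₂.farr = s₁.farr := funext fun a => h.f a (by simp)
    exact ⟨h1.trans (h.mono (by simp) (by simp)), by rwa [hf]⟩
  · rintro k s' hk ⟨h1, -⟩ -
    have : s'.narr 0 0 = n := by rw [h1.n 0 (by decide), h0]
    simp only [NExp.eval, NExp.peak, this, true_and]
    omega
  · rintro x s' hx ⟨h1, h2⟩ h8
    have m1 : min ca 40 ∉ [8, 9] := by rcases hca with rfl | rfl <;> decide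
    have m2 : min ca 40 ∉ [29, out] := by simp; omega
    have m3 : min inp 40 ∉ [29, out] := by simp; omega
    have e0 : s'.narr 0 0 = n := by rw [h1.n 0 (by decide), h0]
    have ec : s'.narr ca = s.narr ca := h1.n ca m1
    have ecf : s'.farr ca = s.farr ca := h1.f ca m2
    have ei : s'.farr inp = s.farr inp := h1.f inp m3
    have hbase : x * n + n ≤ n * n := by
      calc x * n + n = (x + 1) * n := by ring
        _ ≤ n * n := Nat.mul_le_mul_right _ hx
    set v : Fin n → F := A ⟨x, hx⟩ with hv
    refine Impl.seq_pure (a := ()) (t₁ := σ * 150 + 40) (t₂ := n * 100 + 40) (Q := fun _ s₁ =>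
      Same [9] [29] s' s₁ ∧ ∀ i < C.size, s₁.farr 29 i = (C.vals v C.size).getD i 0) ?_ ?_ (by omega)
    · refine Impl.forN_det (N := C.size) (tb := 100) (fun k s₁ =>
        Same [9] [29] s' s₁ ∧ ∀ i < k, s₁.farr 29 i = (C.vals v k).getD i 0) ?_ ?_ (by omega)
        ⟨Same.refl _ _ _, fun i hi => by omega⟩ ?_ ?_ ?_
      · rintro k s₁ s₂ ⟨h3, h4⟩ h
        have hf : s₂.farr = s₁.farr := funext fun a => h.f a (by simp)
        exact ⟨h3.trans (h.mono (by simp) (by simp)), by rwa [hf]⟩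
      · rintro k s₁ hk ⟨h3, -⟩ -
        have : s₁.narr ca 0 = C.size := by
          rw [h3.n ca (by rcases hca with rfl | rfl <;> decide), ec, hcode 0 (by omega)]; rfl
        simp only [NExp.eval, NExp.peak, this, true_and]
        omega
      · rintro k s₁ hk ⟨h3, h4⟩ h9
        have n1 : s₁.narr ca = s.narr ca := by
          rw [h3.n ca (by rcases hca with rfl | rfl <;> decide), ec]
        have n2 : s₁.farr ca = s.farr ca := by
          rw [h3.f ca (by rcases hca with rfl | rfl <;> decide), ecf]
        have n3 : s₁.farr inp = s.farr inp := by rw [h3.f inp (by simp; omega), ei]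
        refine (impl_circGate (C := C) (v := v) (x := x) (k := k) (w := w) (n := n)
          (by rw [h3.n 0 (by decide), e0])
          (by rw [h3.n 8 (by decide), h8]) h9 hx hk (by omega) (by rwa [n1]) (by rwa [n2])
          (fun j => by rw [n3, hv]; exact hA ⟨x, hx⟩ j) h4).imp ?_
        rintro - s₂ ⟨h5, h6⟩
        exact ⟨by rw [h5.n 9 (by decide), h9], h3.trans (h5.mono (by simp) (by simp)), h6⟩
      · exact fun s' h => h
      · simp only [NExp.cost]; omega
    · rintro s₁ ⟨h3, h4⟩
      refine Impl.forN_det (N := n) (tb := 40) (fun k s₂ => Same [9] [29, out] s' s₂ ∧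
        (∀ i < C.size, s₂.farr 29 i = (C.vals v C.size).getD i 0) ∧
        (∀ i j : Fin n, i.val < x → s₂.farr out (i * n + j) = (A * R.transpose) i j) ∧
        ∀ j : Fin n, j.val < k → s₂.farr out (x * n + j) = (A * R.transpose) ⟨x, hx⟩ j)
        ?_ ?_ (by omega) ?_ ?_ ?_ ?_
      · rintro k s₂ s₃ ⟨h3, h4⟩ h
        have hf : s₃.farr = s₂.farr := funext fun a => h.f a (by simp)
        exact ⟨h3.trans (h.mono (by simp) (by simp)), by rwa [hf]⟩
      · rintro k s₂ hk ⟨h3, -⟩ -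
        have : s₂.narr 0 0 = n := by rw [h3.n 0 (by decide), e0]
        simp only [NExp.eval, NExp.peak, this, true_and]
        omega
      · refine ⟨h3.mono (by simp) (by simp), h4, ?_, fun j hj => by omega⟩
        rw [h3.f out (by simp; omega)]; exact h2
      · rintro k s₂ hk ⟨h5, h6, h7, h10⟩ h9
        have f0 : s₂.narr 0 0 = n := by rw [h5.n 0 (by decide), e0]
        have f8 : s₂.narr 8 0 = x := by rw [h5.n 8 (by decide), h8]
        have fc : s₂.narr ca = s.narr ca := by
          rw [h5.n ca (by rcases hca with rfl | rfl <;> decide), ec]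
        have fc0 : s₂.narr ca 0 = C.size := by rw [fc, hcode 0 (by omega)]; rfl
        have fck : s₂.narr ca (1 + 3 * C.size + k) = C.out ⟨k, hk⟩ := by
          rw [fc, hcode _ (by omega)]; exact C.code_out ⟨k, hk⟩
        have hout' := C.out_wf ⟨k, hk⟩
        have hout'' : C.out ⟨k, hk⟩ < C.size := hout'
        have hval : (C.vals v C.size).getD (C.out ⟨k, hk⟩) 0 = (A * R.transpose) ⟨x, hx⟩ ⟨k, hk⟩ := by
          rw [← C.eval_eq, hCe]
          simp only [Matrix.mulVec, dotProduct, Matrix.mul_apply, Matrix.transpose_apply, hv]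
          exact Finset.sum_congr rfl fun _ _ => mul_comm _ _
        refine Impl.exec (by rfl) (by simp [Prog.tbound, NExp.cost, FExp.cost]) ?_ ?_
        · simp only [Prog.exec, State.setF, State.charge, NExp.peak, FExp.peak, NExp.eval, f0, f8,
            h9, fc0, fck]
          omega
        · have hex : (Prog.exec (.fset out (.add (.mul (V 8) (V 0)) (V 9))
              (.read 29 (.read ca (.add (.add (.lit 1) (.mul (.lit 3) (.read ca (.lit 0)))) (V 9)))))
              s₂).farr = Function.update s₂.farr out (Function.update (s₂.farr out) (x * n + k)
                ((A * R.transpose) ⟨x, hx⟩ ⟨k, hk⟩)) := by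
            simp only [Prog.exec, State.setF, State.charge, NExp.eval, FExp.eval, f0, f8, h9, fc0,
              fck]
            rw [← hval, ← h6 _ hout'']
          refine ⟨h9, h5.trans ((Same.charge _ _ _ _ _).trans
            (Same.setF _ _ _ _ (by simp; omega))), ?_, ?_, ?_⟩
          · intro i hi
            rw [hex]
            have : (29 : ℕ) ≠ out := by omega
            simpa [this] using h6 i hi
          · intro i j hi
            rw [hex]
            have h11 : (i : ℕ) * n + j ≠ x * n + k := by
              intro h
              have := congrArg (· / n) h
              simp only [idx_div j.2, idx_div hk] at this
              omega
            simpa [h11] using h7 i j hi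
          · intro j hj
            rw [hex]
            by_cases hjk : j.val = k
            · have : j = ⟨k, hk⟩ := Fin.ext hjk
              subst this; simp
            · simpa [hjk] using h10 j (by omega)
      · rintro s₂ ⟨h5, h6, h7, h10⟩
        refine ⟨by rw [h5.n 8 (by decide), h8], h1.trans (h5.mono (by simp) (by simp)), ?_⟩
        intro i j hi
        by_cases hix : i.val = x
        · have : i = ⟨x, hx⟩ := Fin.ext hix
          subst this; exact h10 j j.2
        · exact h7 i j (by omega)
      · simp only [NExp.cost]; omega
  · rintro s' ⟨h1, h2⟩
    exact ⟨h1, fun i j => h2 i j i.2⟩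
  · refine le_trans ?_ ht
    simp only [NExp.cost]
    have : (σ + n) * 150 + 150 + (1 + 1) + 10 ≤ (σ + n) * 200 + 200 := by omega
    have := Nat.mul_le_mul_left n this
    linarith

/-! ### Plurality -/

/-- How often the value `u t` occurs among `u 0, …, u (m - 1)`. -/
def cntEq (u : ℕ → F) (m t : ℕ) : ℕ := ((Finset.range m).filter fun t' => u t' = u t).card

/-- The largest number of occurrences among the first entries, and the value that attains it. -/
def majAux (u : ℕ → F) (m : ℕ) : ℕ → ℕ × F
  | 0 => (0, 0)
  | t + 1 => if (majAux u m t).1 < cntEq u m t then (cntEq u m t, u t) else majAux u m t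

/-- The most frequent value among `u 0, …, u (m - 1)`. -/
def maj (u : ℕ → F) (m : ℕ) : F := (majAux u m m).2

theorem majAux_spec (u : ℕ → F) (m : ℕ) (k : ℕ) :
    (∀ t < k, cntEq u m t ≤ (majAux u m k).1) ∧ (majAux u m k = (0, 0) ∨
      ∃ t < k, majAux u m k = (cntEq u m t, u t)) := by
  induction k with
  | zero => exact ⟨fun t ht => by omega, Or.inl rfl⟩
  | succ k ih =>
    obtain ⟨h1, h2⟩ := ih
    simp only [majAux]
    split
    · rename_i h
      refine ⟨fun t ht => ?_, Or.inr ⟨k, by omega, rfl⟩⟩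
      rcases Nat.lt_succ_iff_lt_or_eq.1 ht with h3 | rfl
      · exact (h1 t h3).trans h.le
      · exact le_rfl
    · rename_i h
      refine ⟨fun t ht => ?_, h2.imp_right fun ⟨t, ht, h3⟩ => ⟨t, by omega, h3⟩⟩
      rcases Nat.lt_succ_iff_lt_or_eq.1 ht with h3 | rfl
      · exact h1 t h3
      · omega

/-- A value that is strictly more frequent than any other is the only one to attain the maximal
count. It does occur, since a field has a second element, whose count is smaller. This excludes the
default value of `majAux`. -/
theorem maj_eq (u : ℕ → F) (m : ℕ) (x : F)
    (hx : ∀ y, y ≠ x → ((Finset.range m).filter fun t => u t = y).card <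
      ((Finset.range m).filter fun t => u t = x).card) : maj u m = x := by
  obtain ⟨h1, h2⟩ := majAux_spec u m m
  have hne : ((Finset.range m).filter fun t => u t = x).Nonempty := by
    rw [← Finset.card_pos]
    obtain ⟨y, hy⟩ := exists_ne x
    have := hx y hy
    omega
  obtain ⟨t, ht⟩ := hne
  simp only [Finset.mem_filter, Finset.mem_range] at ht
  have h3 := h1 t ht.1
  have h4 : cntEq u m t = ((Finset.range m).filter fun t => u t = x).card := by
    simp only [cntEq, ht.2]
  rcases h2 with h2 | ⟨t', ht', h2⟩
  · rw [h2] at h3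
    have := h3
    obtain ⟨y, hy⟩ := exists_ne x
    have := hx y hy
    omega
  · by_contra hne
    have h5 : maj u m = u t' := by simp [maj, h2]
    rw [h5] at hne
    have := hx _ hne
    rw [h2] at h3
    simp only [cntEq] at h3 h4
    omega

/-- Field array `24` receives the entrywise plurality of the matrices in field array `23`. -/
def majProg : Prog F :=
  forN 8 (.mul (V 0) (V 0)) (.seq (.seq (.nset 18 (.lit 0) (.lit 0)) (.fset 7 (.lit 0) (.lit 0)))
    (.seq (forN 9 (V 3) (.seq (.nset 17 (.lit 0) (.lit 0)) (.seq
        (forN 10 (V 3) (.cond (.feq (.read 23 (.add (.mul (V 10) (.mul (V 0) (V 0))) (V 8)))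
          (.read 23 (.add (.mul (V 9) (.mul (V 0) (V 0))) (V 8))))
          (.nset 17 (.lit 0) (.add (V 17) (.lit 1))) .skip))
        (.cond (.lt (V 18) (V 17)) (.seq (.nset 18 (.lit 0) (V 17))
          (.fset 7 (.lit 0) (.read 23 (.add (.mul (V 9) (.mul (V 0) (V 0))) (V 8))))) .skip))))
      (.fset 24 (V 8) (.read 7 (.lit 0)))))

set_option maxHeartbeats 1000000 in
-- Counting afresh for each candidate costs O(m²) per entry, which is harmless as `m` is logarithmic
-- in `n`.
theorem impl_majProg {n m w t : ℕ} {s : State F} (h0 : s.narr 0 0 = n) (h3 : s.narr 3 0 = m)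
    (hw : m * (n * n) + n * n + n + m + 1 ≤ w)
    (ht : n * n * (m * (m * 80 + 160) + 160) + 40 ≤ t) :
    Impl (majProg : Prog F) s t w (PMF.pure ()) fun _ s' =>
      Same [8, 9, 10, 17, 18] [7, 24] s s' ∧
      ∀ x < n * n, s'.farr 24 x = maj (fun t => s.farr 23 (t * (n * n) + x)) m := by
  have hidx : ∀ {t x : ℕ}, t < m → x < n * n → t * (n * n) + n * n ≤ m * (n * n) := by
    intro t x ht hx
    calc t * (n * n) + n * n = (t + 1) * (n * n) := by ring
      _ ≤ _ := Nat.mul_le_mul_right _ ht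
  refine Impl.forN_det (N := n * n) (tb := m * (m * 60 + 120) + 100) (fun k s' =>
    Same [8, 9, 10, 17, 18] [7, 24] s s' ∧
    ∀ x < k, s'.farr 24 x = maj (fun t => s.farr 23 (t * (n * n) + x)) m) ?_ ?_ (by omega)
    ⟨Same.refl _ _ _, fun x hx => by omega⟩ ?_ ?_ ?_
  · rintro k s₁ s₂ ⟨h1, h2⟩ h
    have hf : s₂.farr = s₁.farr := funext fun a => h.f a (by simp)
    exact ⟨h1.trans (h.mono (by simp) (by simp)), by rwa [hf]⟩
  · rintro k s' hk ⟨h1, -⟩ -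
    have : s'.narr 0 0 = n := by rw [h1.n 0 (by decide), h0]
    simp only [NExp.eval, NExp.peak, this, true_and]
    omega
  · rintro x s' hx ⟨h1, h2⟩ h8
    set u : ℕ → F := fun t => s.farr 23 (t * (n * n) + x) with hu
    refine Impl.seq_pure (a := ()) (t₁ := 10) (t₂ := m * (m * 60 + 120) + 80) (Q := fun _ s₁ =>
      Same [18] [7] s' s₁ ∧ s₁.narr 18 0 = 0 ∧ s₁.farr 7 0 = 0) ?_ ?_ (by omega)
    · refine Impl.exec (by rfl) (by simp [Prog.tbound, NExp.cost, FExp.cost]) ?_ ?_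
      · simp [Prog.exec, State.setN, State.setF, State.charge, NExp.peak, FExp.peak]
      · refine ⟨((Same.charge _ _ _ _ _).trans (Same.setN _ _ _ _ (by simp))).trans
          ((Same.charge _ _ _ _ _).trans (Same.setF _ _ _ _ (by simp))), ?_, ?_⟩
        · simp [Prog.exec, State.setN, State.setF, State.charge, NExp.eval]
        · simp [Prog.exec, State.setF, NExp.eval, FExp.eval]
    rintro s₁ ⟨g1, g2, g3⟩
    refine Impl.seq_pure (a := ()) (t₁ := m * (m * 60 + 120) + 40) (t₂ := 20) (Q := fun _ s₂ =>
      Same [9, 10, 17, 18] [7] s' s₂ ∧ s₂.farr 7 0 = maj u m) ?_ ?_ (by omega)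
    · refine Impl.forN_det (N := m) (tb := m * 60 + 100) (fun k s₂ =>
        Same [9, 10, 17, 18] [7] s' s₂ ∧ (s₂.narr 18 0, s₂.farr 7 0) = majAux u m k) ?_ ?_ (by omega)
        ⟨g1.mono (by simp) (by simp), by simp [g2, g3, majAux]⟩ ?_ ?_ ?_
      · rintro k s₂ s₃ ⟨h4, h5⟩ h
        have hf : s₃.farr = s₂.farr := funext fun a => h.f a (by simp)
        exact ⟨h4.trans (h.mono (by simp) (by simp)), by rw [hf, h.n 18 (by decide), h5]⟩
      · rintro k s₂ hk ⟨h4, -⟩ -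
        have : s₂.narr 3 0 = m := by rw [h4.n 3 (by decide), h1.n 3 (by decide), h3]
        simp only [NExp.eval, NExp.peak, this, true_and]
        omega
      · rintro k s₂ hk ⟨h4, h5⟩ h9
        have hidxk := hidx hk hx
        refine Impl.seq_pure (a := ()) (t₁ := 5) (t₂ := m * 60 + 90) (Q := fun _ s₃ =>
          Same [17] [] s₂ s₃ ∧ s₃.narr 17 0 = 0) ?_ ?_ (by omega)
        · refine Impl.exec (by rfl) (by simp [Prog.tbound, NExp.cost]) ?_ ?_
          · simp [Prog.exec, State.setN, State.charge, NExp.peak]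
          · exact ⟨(Same.charge _ _ _ _ _).trans (Same.setN _ _ _ _ (by simp)), by
              simp [Prog.exec, State.setN, NExp.eval]⟩
        rintro s₃ ⟨h6, h7⟩
        refine Impl.seq_pure (a := ()) (t₁ := m * 60 + 20) (t₂ := 60) (Q := fun _ s₄ =>
          Same [10, 17] [] s₂ s₄ ∧ s₄.narr 17 0 = cntEq u m k) ?_ ?_ (by omega)
        · refine Impl.forN_det (N := m) (tb := 45) (fun j s₄ => Same [10, 17] [] s₂ s₄ ∧
            s₄.narr 17 0 = ((Finset.range j).filter fun t' => u t' = u k).card) ?_ ?_ (by omega)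
            ⟨h6.mono (by simp) (by simp), by simp [h7]⟩ ?_ ?_ ?_
          · rintro j s₄ s₅ ⟨h10, h11⟩ h
            exact ⟨h10.trans (h.mono (by simp) (by simp)), by rw [h.n 17 (by decide), h11]⟩
          · rintro j s₄ hj ⟨h10, -⟩ -
            have : s₄.narr 3 0 = m := by
              rw [h10.n 3 (by decide), h4.n 3 (by decide), h1.n 3 (by decide), h3]
            simp only [NExp.eval, NExp.peak, this, true_and]
            omega
          · rintro j s₄ hj ⟨h10, h11⟩ h12
            have e0 : s₄.narr 0 0 = n := by
              rw [h10.n 0 (by decide), h4.n 0 (by decide), h1.n 0 (by decide), h0]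
            have e8 : s₄.narr 8 0 = x := by rw [h10.n 8 (by decide), h4.n 8 (by decide), h8]
            have e9 : s₄.narr 9 0 = k := by rw [h10.n 9 (by decide), h9]
            have e23 : s₄.farr 23 = s.farr 23 := by
              rw [h10.f 23 (by decide), h4.f 23 (by decide), h1.f 23 (by decide)]
            have hidxj := hidx hj hx
            have hcard : ((Finset.range j).filter fun t' => u t' = u k).card ≤ j := by
              simpa using Finset.card_filter_le (Finset.range j) fun t' => u t' = u k
            have hb0 : (BExp.feq (.read 23 (.add (.mul (V 10) (.mul (V 0) (V 0))) (V 8)))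
                (.read 23 (.add (.mul (V 9) (.mul (V 0) (V 0))) (V 8)))).eval s₄ =
                decide (u j = u k) := by
              simp only [BExp.eval, FExp.eval, NExp.eval, e0, e8, e9, e23, h12, hu]
            refine Impl.cond (t₁ := 10) ?_ ?_ ?_ (by simp [BExp.cost, FExp.cost, NExp.cost])
            · have : n ≤ n * n := Nat.le_mul_self n
              simp only [BExp.peak, FExp.peak, NExp.peak, NExp.eval, e0, e8, e9, h12]
              refine max_le (max_le ?_ ?_) (max_le ?_ ?_) <;> omega
            · intro hb
              rw [hb0, decide_eq_true_eq] at hb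
              refine Impl.exec (by rfl) (by simp [Prog.tbound, NExp.cost]) ?_ ?_
              · simp only [Prog.exec, State.setN, State.charge, NExp.peak, NExp.eval, h11]; omega
              · refine ⟨by simpa [Prog.exec, State.setN, State.charge] using h12,
                  h10.trans ((Same.charge _ _ _ _ _).trans ((Same.charge _ _ _ _ _).trans
                    (Same.setN _ _ _ _ (by simp)))), ?_⟩
                rw [Finset.range_add_one, Finset.filter_insert, if_pos hb,
                  Finset.card_insert_of_notMem (by simp)]
                simp [Prog.exec, State.setN, State.charge, NExp.eval, h11]
            · intro hb
              rw [hb0, decide_eq_false_iff_not] at hb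
              refine Impl.exec (by rfl) (by simp [Prog.tbound]) ?_ ?_
              · simp only [Prog.exec, State.charge]; omega
              · refine ⟨h12, h10.trans ((Same.charge _ _ _ _ _).trans (Same.charge _ _ _ _ _)), ?_⟩
                rw [Finset.range_add_one, Finset.filter_insert, if_neg hb]
                exact h11
          · exact fun s' h => h
          · simp only [NExp.cost]; omega
        rintro s₄ ⟨h10, h11⟩
        have e0 : s₄.narr 0 0 = n := by
          rw [h10.n 0 (by decide), h4.n 0 (by decide), h1.n 0 (by decide), h0]
        have e8 : s₄.narr 8 0 = x := by rw [h10.n 8 (by decide), h4.n 8 (by decide), h8]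
        have e9 : s₄.narr 9 0 = k := by rw [h10.n 9 (by decide), h9]
        have e23 : s₄.farr 23 = s.farr 23 := by
          rw [h10.f 23 (by decide), h4.f 23 (by decide), h1.f 23 (by decide)]
        have e18 : s₄.narr 18 0 = (majAux u m k).1 := by rw [h10.n 18 (by decide), ← h5]
        have e7 : s₄.farr 7 0 = (majAux u m k).2 := by rw [h10.f 7 (by decide), ← h5]
        have hcard : cntEq u m k ≤ m := by
          simpa [cntEq] using Finset.card_filter_le (Finset.range m) fun t' => u t' = u k
        have hle : (majAux u m k).1 ≤ m := by
          rcases (majAux_spec u m k).2 with h | ⟨t, -, h⟩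
          · rw [h]; exact Nat.zero_le _
          · rw [h]; simpa [cntEq] using Finset.card_filter_le (Finset.range m) fun t' => u t' = u t
        refine Impl.cond (t₁ := 30) ?_ ?_ ?_ (by simp [BExp.cost, NExp.cost])
        · simp only [BExp.peak, NExp.peak, NExp.eval, e18, h11]; omega
        · intro hb
          simp only [BExp.eval, NExp.eval, e18, h11, decide_eq_true_eq] at hb
          refine Impl.exec (by rfl) (by simp [Prog.tbound, NExp.cost, FExp.cost]) ?_ ?_
          · have h13 : ∀ (s₅ : State F) v, (s₅.setN 18 0 v).narr 8 = s₅.narr 8 ∧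
                (s₅.setN 18 0 v).narr 9 = s₅.narr 9 ∧ (s₅.setN 18 0 v).narr 0 = s₅.narr 0 := by
              intro s₅ v; simp [State.setN]
            simp only [Prog.exec, NExp.peak, NExp.eval, FExp.peak, State.charge, h11]
            simp only [State.setF, h13, e0, e8, e9]
            simp only [State.setN]
            omega
          · refine ⟨by simpa [Prog.exec, State.setN, State.setF, State.charge] using e9,
              h4.trans ((h10.mono (by simp) (by simp)).trans ((Same.charge _ _ _ _ _).trans
                (((Same.charge _ _ _ _ _).trans (Same.setN _ _ _ _ (by simp))).trans
                ((Same.charge _ _ _ _ _).trans (Same.setF _ _ _ _ (by simp)))))), ?_⟩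
            have hm : majAux u m (k + 1) = (cntEq u m k, u k) := by simp only [majAux, if_pos hb]
            rw [hm]
            simp [Prog.exec, State.setN, State.setF, State.charge, NExp.eval, FExp.eval,
              h11, e0, e8, e9, e23]
            rfl
        · intro hb
          simp only [BExp.eval, NExp.eval, e18, h11, decide_eq_false_iff_not] at hb
          refine Impl.exec (by rfl) (by simp [Prog.tbound]) ?_ ?_
          · simp only [Prog.exec, State.charge]; omega
          · refine ⟨e9, h4.trans ((h10.mono (by simp) (by simp)).trans
              ((Same.charge _ _ _ _ _).trans (Same.charge _ _ _ _ _))), ?_⟩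
            simp [Prog.exec, State.charge, majAux, hb, e18, e7]
      · rintro s₂ ⟨h4, h5⟩
        exact ⟨h4, by rw [maj, ← h5]⟩
      · simp only [NExp.cost]
        have : m * (m * 60 + 100 + (1 + 1) + 10) ≤ m * (m * 60 + 120) :=
          Nat.mul_le_mul_left _ (by omega)
        linarith
    · rintro s₂ ⟨h4, h5⟩
      have e8 : s₂.narr 8 0 = x := by rw [h4.n 8 (by decide), h8]
      refine Impl.exec (by rfl) (by simp [Prog.tbound, NExp.cost, FExp.cost]) ?_ ?_
      · simp only [Prog.exec, State.setF, State.charge, NExp.peak, FExp.peak, NExp.eval, e8]; omega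
      · refine ⟨e8, h1.trans ((h4.mono (by simp) (by simp)).trans ((Same.charge _ _ _ _ _).trans
          (Same.setF _ _ _ _ (by simp)))), ?_⟩
        intro y hy
        by_cases hyx : y = x
        · subst hyx; simp [Prog.exec, State.setF, State.charge, NExp.eval, FExp.eval, e8, h5, hu]
        · have := h2 y (by omega)
          rw [← h4.f 24 (by decide)] at this
          simpa [Prog.exec, State.setF, State.charge, NExp.eval, FExp.eval, e8, hyx] using this
  · exact fun s' h => h
  · refine le_trans ?_ ht
    simp only [NExp.cost]
    have h5 : m * (m * 60 + 120) ≤ m * (m * 80 + 160) := Nat.mul_le_mul_left _ (by omega)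
    have h6 : m * (m * 60 + 120) + 100 + (1 + 1 + (1 + 1) + 1) + 10 ≤ m * (m * 80 + 160) + 160 := by
      linarith
    have := Nat.mul_le_mul_left (n * n) h6
    linarith

/-! ### Comparison and output -/

/-- Write `1` to the output if the matrices in `a` and `b` are equal, and `0` otherwise. -/
def compareProg (a b : ℕ) : Prog F :=
  .seq (.nset 17 (.lit 0) (.lit 1)) (.seq (forN 8 (.mul (V 0) (V 0))
    (.cond (.feq (.read a (V 8)) (.read b (V 8))) .skip (.nset 17 (.lit 0) (.lit 0))))
    (.nemit (V 17)))

theorem impl_compareProg {a b n w t : ℕ} {s : State F} {A B : Mat F n} (h0 : s.narr 0 0 = n)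
    (hA : HasMat s a A) (hB : HasMat s b B) (ho : s.nOut = []) (hw : n * n + n + 1 ≤ w)
    (ht : n * n * 60 + 60 ≤ t) :
    Impl (compareProg a b : Prog F) s t w (PMF.pure ()) fun _ s' =>
      s'.nOut = [if A = B then 1 else 0] := by
  refine Impl.seq_pure (a := ()) (t₁ := 5) (t₂ := n * n * 60 + 50) (Q := fun _ s₁ =>
    Same [17] [] s s₁ ∧ s₁.narr 17 0 = 1) ?_ ?_ (by omega)
  · refine Impl.exec (by rfl) (by simp [Prog.tbound, NExp.cost]) ?_ ?_
    · simp only [Prog.exec, State.setN, State.charge, NExp.peak]; omega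
    · exact ⟨(Same.charge _ _ _ _ _).trans (Same.setN _ _ _ _ (by simp)), by
        simp [Prog.exec, State.setN, NExp.eval]⟩
  rintro s₁ ⟨g1, g2⟩
  refine Impl.seq_pure (a := ()) (t₁ := n * n * 60 + 20) (t₂ := 10) (Q := fun _ s₂ =>
    s₂.nOut = [] ∧ s₂.narr 17 0 = if A = B then 1 else 0) ?_ ?_ (by omega)
  · refine Impl.forN_det (N := n * n) (tb := 30) (fun k s₂ => Same [8, 17] [] s s₂ ∧
      s₂.narr 17 0 = if ∀ x < k, s.farr a x = s.farr b x then 1 else 0) ?_ ?_ (by omega) ?_ ?_ ?_ ?_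
    · rintro k s₂ s₃ ⟨h1, h2⟩ h
      exact ⟨h1.trans (h.mono (by simp) (by simp)), by rw [h.n 17 (by decide), h2]⟩
    · rintro k s₂ hk ⟨h1, -⟩ -
      have : s₂.narr 0 0 = n := by rw [h1.n 0 (by decide), h0]
      simp only [NExp.eval, NExp.peak, this, true_and]
      omega
    · exact ⟨g1.mono (by simp) (by simp), by simp [g2]⟩
    · rintro k s₂ hk ⟨h1, h2⟩ h8
      have ea : s₂.farr a = s.farr a := h1.f a (by simp)
      have eb : s₂.farr b = s.farr b := h1.f b (by simp)
      refine Impl.cond (t₁ := 10) ?_ ?_ ?_ (by simp [BExp.cost, FExp.cost, NExp.cost])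
      · simp only [BExp.peak, FExp.peak, NExp.peak, NExp.eval, h8]; omega
      · intro hb
        simp only [BExp.eval, FExp.eval, NExp.eval, h8, ea, eb, decide_eq_true_eq] at hb
        refine Impl.exec (by rfl) (by simp [Prog.tbound]) ?_ ?_
        · simp only [Prog.exec, State.charge]; omega
        · refine ⟨h8, h1.trans ((Same.charge _ _ _ _ _).trans (Same.charge _ _ _ _ _)), ?_⟩
          have : (∀ x < k + 1, s.farr a x = s.farr b x) ↔ ∀ x < k, s.farr a x = s.farr b x := by
            constructor
            · exact fun h x hx => h x (by omega)
            · intro h x hx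
              rcases Nat.lt_succ_iff_lt_or_eq.1 hx with h' | rfl
              · exact h x h'
              · exact hb
          simp only [this]
          exact h2
      · intro hb
        simp only [BExp.eval, FExp.eval, NExp.eval, h8, ea, eb, decide_eq_false_iff_not] at hb
        refine Impl.exec (by rfl) (by simp [Prog.tbound, NExp.cost]) ?_ ?_
        · simp only [Prog.exec, State.charge, State.setN, NExp.peak]; omega
        · refine ⟨by simpa [Prog.exec, State.setN, State.charge] using h8,
            h1.trans ((Same.charge _ _ _ _ _).trans ((Same.charge _ _ _ _ _).trans
              (Same.setN _ _ _ _ (by simp)))), ?_⟩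
          have : ¬ ∀ x < k + 1, s.farr a x = s.farr b x := fun h => hb (h k (by omega))
          rw [if_neg this]
          simp [Prog.exec, State.setN, NExp.eval]
    · rintro s₂ ⟨h1, h2⟩
      refine ⟨by rw [h1.no, ho], ?_⟩
      rw [h2]
      have : (∀ x < n * n, s.farr a x = s.farr b x) ↔ A = B := by
        constructor
        · intro h
          ext i j
          rw [← hA i j, ← hB i j, h _ (idx_lt i.2 j.2)]
        · rintro rfl x hx
          obtain ⟨-, h5, h6, h7, -⟩ := div_mod_facts hx
          rw [← h7, hA.read h5 h6, hB.read h5 h6]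
      simp only [this]
    · simp only [NExp.cost]; omega
  · rintro s₂ ⟨h1, h2⟩
    refine Impl.exec (by rfl) (by simp [Prog.tbound, NExp.cost]) ?_ ?_
    · have : (if A = B then 1 else 0) ≤ 1 := by split <;> omega
      simp only [Prog.exec, State.charge, State.emitN, NExp.peak, NExp.eval, h2]; omega
    · simp [Prog.exec, State.charge, State.emitN, NExp.eval, h1, h2]

/-- Write the values of an expression in register `8` to the output. -/
def emitAll (e : FExp F) : Prog F := forN 8 (.mul (V 0) (V 0)) (.femit e)

theorem impl_emitAll {n w t : ℕ} {s : State F} {e : FExp F} {A : Mat F n} (h0 : s.narr 0 0 = n)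
    (ho : s.fOut = [])
    (he : ∀ (i j : Fin n) s', s'.narr 8 0 = i * n + j → (∀ a, a ≠ 8 → s'.narr a = s.narr a) →
      s'.farr = s.farr → e.eval s' = A i j ∧ e.peak s' ≤ w)
    (hw : n * n + n + 1 ≤ w) (ht : n * n * (e.cost + 20) + 20 ≤ t) :
    Impl (emitAll e) s t w (PMF.pure ()) fun _ s' => s'.fOut.length = n * n ∧ s'.outMat n = A := by
  refine Impl.forN_det (N := n * n) (tb := e.cost + 1) (fun k s' =>
    (∀ a, a ≠ 8 → s'.narr a = s.narr a) ∧ s'.farr = s.farr ∧ s'.fOut.length = k ∧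
      ∀ i j : Fin n, (i * n + j : ℕ) < k → s'.fOut.getD (i * n + j) 0 = A i j) ?_ ?_ (by omega) ?_ ?_
    ?_ ?_
  · rintro k s₁ s₂ ⟨h1, h2, h3, h4⟩ h
    refine ⟨fun a ha => ?_, ?_, by rw [h.fo, h3], by rwa [h.fo]⟩
    · rw [h.n a (by simp; omega), h1 a ha]
    · rw [← h2]; exact funext fun a => h.f a (by simp)
  · rintro k s' hk ⟨h1, -⟩ -
    have : s'.narr 0 0 = n := by rw [h1 0 (by decide), h0]
    simp only [NExp.eval, NExp.peak, this, true_and]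
    omega
  · exact ⟨fun _ _ => rfl, rfl, by simp [ho], fun i j h => by omega⟩
  · rintro k s' hk ⟨h1, h2, h3, h4⟩ h8
    obtain ⟨-, h5, h6, h7, -⟩ := div_mod_facts hk
    obtain ⟨e1, e2⟩ := he ⟨k / n, h5⟩ ⟨k % n, h6⟩ s' (by rw [h8]; exact h7.symm) h1 h2
    refine Impl.exec (by rfl) (by simp [Prog.tbound]) ?_ ?_
    · simp only [Prog.exec, State.charge, State.emitF]; omega
    · refine ⟨h8, h1, h2, by simp [Prog.exec, State.charge, State.emitF, h3], ?_⟩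
      intro i j hij
      simp only [Prog.exec, State.charge, State.emitF, e1]
      rw [getD_append_single _ _ _ _ (by omega), h3]
      split
      · rename_i h
        have hi : (⟨k / n, h5⟩ : Fin n) = i := Fin.ext (by simp [← h, idx_div j.2])
        have hj : (⟨k % n, h6⟩ : Fin n) = j := Fin.ext (by simp only [← h]; exact idx_mod j.2)
        rw [hi, hj]
      · exact h4 i j (by omega)
  · rintro s' ⟨-, -, h3, h4⟩
    refine ⟨h3, ?_⟩
    ext i j
    exact h4 i j (idx_lt i.2 j.2)
  · refine le_trans ?_ ht
    simp only [NExp.cost]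
    have : e.cost + 1 + (1 + 1 + (1 + 1) + 1) + 10 ≤ e.cost + 20 := by omega
    have := Nat.mul_le_mul_left (n * n) this
    linarith

/-! ### Masking -/

/-- The window registers are set up, and the next window starts at an address of at most `b`. -/
def WinLe (n W b : ℕ) (s : State F) : Prop := ∃ b' ≤ b, Win n W b' s

theorem WinLe.same {n W b : ℕ} {l k : List ℕ} {s s' : State F} (h : WinLe n W b s)
    (hs : Same l k s s') (h0 : 0 ∉ l := by decide) (h1 : 1 ∉ l := by decide)
    (h2 : 2 ∉ l := by decide) (h3 : 40 ∉ l := by decide) (h4 : 40 ∉ k := by decide) :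
    WinLe n W b s' := by
  obtain ⟨b', hb, h⟩ := h
  exact ⟨b', hb, h.same hs h0 h1 h2 h3 h4⟩

theorem WinLe.mono {n W b b' : ℕ} {s : State F} (h : WinLe n W b s) (hb : b ≤ b') :
    WinLe n W b' s := by
  obtain ⟨b'', hb', h⟩ := h
  exact ⟨b'', hb'.trans hb, h⟩

theorem WinLe.size {n W b : ℕ} {s : State F} (h : WinLe n W b s) : s.narr 0 0 = n := by
  obtain ⟨b', -, h⟩ := h; exact h.size

/-- A deterministic program may be viewed as an experiment with any prescribed outcome `a`, which
the postcondition then relates to the final state. -/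
theorem Impl.drop {α : Type*} {P : Prog F} {s : State F} {t w : ℕ} {a : α}
    {Q : Unit → State F → Prop} {Q' : α → State F → Prop}
    (h : Impl P s t w (PMF.pure ()) Q) (hQ : ∀ s', Q () s' → Q' a s') :
    Impl P s t w (PMF.pure a) Q' := by
  have := h.map (fun _ => a) (Q' := Q') fun _ s' h => hQ s' h
  rwa [PMF.pure_map] at this

/-- The matrix is scaled, shifted and masked. -/
def hide {n : ℕ} [NeZero n] (X : Mat F n) (x : Mat F n × Fin n × Fˣ) : Mat F n :=
  fun i j => (x.2.2 : F) * X (i + x.2.1) j + x.1 i j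

/-- A mask from `μ`, a random shift and a random scalar. -/
noncomputable def maskDist {n : ℕ} [NeZero n] (μ : PMF (Mat F n)) : PMF (Mat F n × Fin n × Fˣ) :=
  μ.bind fun R => (PMF.uniformOfFintype (Fin n)).bind fun r =>
    (PMF.uniformOfFintype Fˣ).map fun u => (R, r, u)

/-- Hide the matrix in field array `10 + σ` with a mask from `gm`. -/
noncomputable def maskStep (gm : Prog F) (σ : ℕ) : Prog F :=
  .seq gm (.seq (.nrand (12 + σ) (.lit 0) (.sub (V 0) (.lit 1))) (.seq (randUnit (17 + σ))
    (mapL (13 + σ) (.lit 0) (.add (.mul (.read (17 + σ) (.lit 0))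
      (.read (10 + σ) (.add (.mul (.mod (.add (.div (V 8) (V 0)) (V (12 + σ))) (V 0)) (V 0))
        (.mod (V 8) (V 0))))) (.read (31 + σ) (V 8))))))

/-- What is known after a masking step. -/
structure Masked {n : ℕ} [NeZero n] (σ : ℕ) (X : Mat F n) (x : Mat F n × Fin n × Fˣ)
    (s : State F) : Prop where
  shift : s.narr (12 + σ) 0 = x.2.1
  unit : s.farr (17 + σ) 0 = x.2.2
  mat : HasMat s (13 + σ) (hide X x)
  mask : HasMat s (31 + σ) x.1

/-- The source `gm` of the mask is left open: the algorithm uses trapdoored samples, the test a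
mixture of samples, its input and uniform matrices. `Q` carries along what is known about the mask
besides its entries. -/
theorem impl_maskStep {n w t tg σ : ℕ} [NeZero n] {gm : Prog F} {s : State F} {X : Mat F n}
    {μ : PMF (Mat F n)} {Q : Mat F n → State F → Prop} (hσ : σ < 2)
    (hgm : Impl gm s tg w μ fun R s' => s'.narr 0 0 = n ∧ HasMat s' (10 + σ) X ∧
      HasMat s' (31 + σ) R ∧ Q R s')
    (hQ : ∀ R s₁ s₂, Q R s₁ → Same [8, 12 + σ, 20] [13 + σ, 17 + σ] s₁ s₂ → Q R s₂)
    (hw : n * n + 3 * n + Fintype.card Fˣ ≤ w)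
    (ht : tg + Fintype.card Fˣ * 10 + n * n * 60 + 100 ≤ t) :
    Impl (maskStep gm σ) s t w (maskDist μ) fun x s' => Masked σ X x s' ∧ Q x.1 s' := by
  have hn : 0 < n := Nat.pos_of_ne_zero (NeZero.ne n)
  refine Impl.seq (t₂ := Fintype.card Fˣ * 10 + n * n * 60 + 100) hgm ?_ (by omega)
  rintro R s₁ ⟨h0, hX, hR, hq⟩
  refine Impl.seq (t₁ := 10) (t₂ := Fintype.card Fˣ * 10 + n * n * 60 + 80)
    (Q := fun (r : Fin n) s₂ => Same [12 + σ] [] s₁ s₂ ∧ s₂.narr (12 + σ) 0 = (r : ℕ)) ?_ ?_ ?_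
  rotate_left 2
  · omega
  · refine Impl.nrand ?_ ?_ ?_ (by simp [NExp.cost]) ?_
    · simp only [NExp.eval, h0]; omega
    · simp [NExp.peak]
    · simp only [NExp.eval, NExp.peak, h0]; omega
    · intro r
      exact ⟨(Same.charge _ _ _ _ _).trans (Same.setN _ _ _ _ (by simp; omega)), by
        simp [State.setN, NExp.eval]⟩
  rintro r s₂ ⟨h2, hr⟩
  refine Impl.seq (t₁ := Fintype.card Fˣ * 10 + 10) (t₂ := n * n * 60 + 40)
    (impl_randUnit (by omega) le_rfl) ?_ (by omega)
  rintro u s₃ ⟨h3, hu⟩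
  have hs3 : Same [12 + σ, 20] [17 + σ] s₁ s₃ :=
    (h2.mono (by simp) (by simp)).trans (h3.mono (by simp) (by simp; omega))
  refine Impl.drop (impl_mapL (dst := 13 + σ) (n := n) (o := 0)
    (fun x => (u : F) * s₁.farr (10 + σ) ((x / n + r) % n * n + x % n) + s₁.farr (31 + σ) x)
    ?_ (by omega) (by omega) ?_ (by simp only [NExp.cost, FExp.cost]; omega)) ?_
  · rw [hs3.n 0 (by simp; omega), h0]
  · rintro x s' hx h4 h5 h8
    obtain ⟨-, hx1, hx2, -⟩ := div_mod_facts hx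
    have e0 : s'.narr 0 0 = n := by rw [h4.n 0 (by simp), hs3.n 0 (by simp; omega), h0]
    have er : s'.narr (12 + σ) 0 = r := by
      rw [h4.n _ (by simp; omega), h3.n _ (by simp; omega), hr]
    have eu : s'.farr (17 + σ) 0 = u := by rw [h5 _ (by omega), hu]
    have e10 : s'.farr (10 + σ) = s₁.farr (10 + σ) := by
      rw [h5 _ (by omega), hs3.f _ (by simp; omega)]
    have e31 : s'.farr (31 + σ) = s₁.farr (31 + σ) := by
      rw [h5 _ (by omega), hs3.f _ (by simp; omega)]
    have hmod : (x / n + r) % n < n := Nat.mod_lt _ hn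
    have hidx := idx_lt hmod hx2
    have hr' := r.2
    refine ⟨?_, ?_, rfl, ?_⟩
    · simp only [FExp.eval, NExp.eval, e0, er, eu, e10, e31, h8]
    · simp only [FExp.peak, NExp.peak, NExp.eval, e0, er, h8]; omega
    · simp [NExp.peak]
  · rintro s₄ ⟨h4, h5, h6, -⟩
    have hs4 : Same [8, 12 + σ, 20] [13 + σ, 17 + σ] s₁ s₄ :=
      (hs3.mono (by simp) (by simp)).trans (h4.mono (by simp) (by simp; omega))
    refine ⟨⟨?_, ?_, ?_, ?_⟩, hQ _ _ _ hq hs4⟩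
    · rw [h4.n _ (by simp; omega), h3.n _ (by simp; omega), hr]
    · rw [h5 _ (by omega), hu]
    · intro i j
      rw [← Nat.zero_add ((i : ℕ) * n + j), h6 _ (idx_lt i.2 j.2), idx_div j.2, idx_mod j.2, hR i j]
      have := hX (i + r) j
      rw [Fin.val_add] at this
      rw [this]; rfl
    · exact hR.same hs4 (by simp; omega)

/-! ### Running a multiplication algorithm with a time limit -/

theorem matList_length {n : ℕ} (A : Mat F n) : (matList A).length = n * n := by simp [matList]

theorem matList_getD {n : ℕ} (A : Mat F n) (i j : Fin n) :
    (matList A).getD (i * n + j) 0 = A i j := by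
  have h := idx_lt i.2 j.2
  rw [List.getD_eq_getElem _ _ (by rw [matList_length]; exact h)]
  simp only [matList, List.getElem_ofFn]
  have : (⟨(i : ℕ) * n + j, h⟩ : Fin (n * n)) = finProdFinEquiv (i, j) := by
    ext; simp [finProdFinEquiv]; ring
  rw [this]; simp

theorem HasMat.matList_eq {n a x : ℕ} {s : State F} {A : Mat F n} (h : HasMat s a A)
    (hx : x < n * n) : s.farr a x = (matList A).getD x 0 := by
  obtain ⟨-, h1, h2, h3, -⟩ := div_mod_facts hx
  rw [← h3, h.read h1 h2]
  exact (matList_getD A ⟨_, h1⟩ ⟨_, h2⟩).symm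

/-- The output of `M`, replaced by the correct product if the running time is at least `W`. -/
noncomputable def cutDist (M : Prog F) (T W : ℕ) {n : ℕ} (X Y : Mat F n) : PMF (Mat F n) :=
  (M.run T (initState n (matList X) (matList Y))).map fun o =>
    o.elim 0 fun s => if s.time < W then s.outMat n else X * Y

/-- Field array `19` receives the product of the matrix in field array `13` and the transpose of
the one in field array `14`, as computed by `M`. -/
def runMul (M : Prog F) : Prog F :=
  .seq (.seq (mapL 40 (V 2) (.read 13 (V 8)))
    (mapL 41 (V 2) (.read 14 (.add (.mul (.mod (V 8) (V 0)) (V 0)) (.div (V 8) (V 0))))))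
    (.seq (subRun false M) (.cond (.lt (V 4) (V 1)) (mapL 19 (.lit 0) (.read 30 (V 8)))
      (naive 13 14 19)))

/-- Time for `runMul`. -/
def mulTime (M : Prog F) (n W T : ℕ) : ℕ :=
  subTime false M W T + (if W ≤ T then n * n * (n * 100 + 100) else 0) + n * n * 140 + 200

/-- If the clock has expired, the product is computed naively, in cubic time. This is charged only
if `W ≤ T`, since otherwise the clock cannot expire. -/
theorem impl_runMul {M : Prog F} {n W T b w v : ℕ} {s : State F} {X U : Mat F n}
    (hM : M.HaltsWithin (initState n (matList X) (matList U.transpose)) T v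
      fun s => s.fOut.length = n * n)
    (hv : v ≤ W) (hnW : n * n ≤ W) (hs : WinLe n W b s) (hX : HasMat s 13 X) (hU : HasMat s 14 U)
    (hw : b + W + n * n + n + 1 ≤ w) (hw' : W + M.slow false ≤ w) :
    Impl (runMul M) s (mulTime M n W T) w (cutDist M T W X U.transpose) fun Z s' =>
      HasMat s' 19 Z ∧ WinLe n W (b + W + 1) s' ∧
      Same [2, 4, 5, 6, 7, 8, 9, 30, 40] [19, 29, 30, 40] s s' := by
  obtain ⟨b₀, hb', hs⟩ := hs
  refine Impl.seq_pure (a := ()) (t₁ := n * n * 80 + 60)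
    (t₂ := subTime false M W T + ((if W ≤ T then n * n * (n * 100 + 100) else 0) + n * n * 40 + 130))
    (Q := fun _ s₁ => Same [8] [40] s s₁ ∧
      ∀ a i, s₁.farr (a + 40) (b₀ + i) =
        (initState n (matList X) (matList U.transpose)).farr a i) ?_ ?_
    (by simp only [mulTime]; omega)
  · refine Impl.seq_pure (a := ()) (t₁ := n * n * 30 + 20) (t₂ := n * n * 40 + 20)
      (impl_mapL (n := n) (o := b₀) (fun x => s.farr 13 x) hs.size (by omega) (by omega) ?_
        (by simp only [NExp.cost, FExp.cost]; omega)) ?_ (by omega)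
    · rintro x s' hx h1 h2 h8
      have e2 : s'.narr 2 0 = b₀ := by rw [h1.n 2 (by decide), hs.base]
      simp only [FExp.eval, FExp.peak, NExp.eval, NExp.peak, e2, h8, h2 13 (by decide), true_and]
      omega
    · rintro s₁ ⟨h1, h2, h3, h4⟩
      have e0 : s₁.narr 0 0 = n := by rw [h1.n 0 (by decide), hs.size]
      refine (impl_mapL (n := n) (o := b₀) (fun x => s₁.farr 14 (x % n * n + x / n)) e0 (by omega)
        (by omega) ?_ (by simp only [NExp.cost, FExp.cost]; omega)).imp ?_
      · rintro x s' hx g1 g2 h8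
        obtain ⟨-, hx1, hx2, -, hx4⟩ := div_mod_facts hx
        have e2 : s'.narr 2 0 = b₀ := by rw [g1.n 2 (by decide), h1.n 2 (by decide), hs.base]
        have e0' : s'.narr 0 0 = n := by rw [g1.n 0 (by decide), e0]
        simp only [FExp.eval, FExp.peak, NExp.eval, NExp.peak, e2, e0', h8, g2 14 (by decide),
          true_and]
        generalize x / n = d at *
        generalize x % n = r at *
        omega
      · rintro - s₂ ⟨g1, g2, g3, g4⟩
        refine ⟨(h1.mono (by simp) (by simp)).trans (g1.mono (by simp) (by simp)), ?_⟩
        rintro (_ | _ | a) i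
        · rw [g2 40 (by decide)]
          simp only [initState, if_true]
          by_cases hi : i < n * n
          · rw [h3 i hi, hX.matList_eq hi]
          · rw [h4 _ (by omega), (hs.fresh 40 _ le_rfl (by omega)).2,
              List.getD_eq_default _ _ (by rw [matList_length]; omega)]
        · simp only [initState, Nat.zero_add]
          by_cases hi : i < n * n
          · obtain ⟨-, hx1, hx2, hx3, hx4⟩ := div_mod_facts hi
            have h5 : s₁.farr 14 = s.farr 14 := h1.f 14 (by decide)
            rw [g3 i hi, h5, hU.read hx2 hx1]
            have := matList_getD U.transpose ⟨_, hx1⟩ ⟨_, hx2⟩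
            simp only [hx3] at this
            exact this.symm
          · rw [g4 _ (by omega), h2 41 (by decide), (hs.fresh 41 _ (by omega) (by omega)).2]
            simp only [one_ne_zero, if_false, if_true]
            rw [List.getD_eq_default _ _ (by rw [matList_length]; omega)]
        · have e : a + 1 + 1 + 40 = a + 42 := by omega
          rw [e, g2 _ (by omega), h2 _ (by omega), (hs.fresh _ _ (by omega) (by omega)).2]
          simp [initState]
  rintro s₁ ⟨h1, h2⟩
  refine Impl.seq (t₁ := subTime false M W T) (impl_subRun (B := w) (b := b₀) hM hv ?_ ?_ ?_ ?_ ?_ h2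
    ?_ ?_ (by omega) hw' (by omega)) (f := fun o => PMF.pure (o.elim 0 fun s =>
      if s.time < W then s.outMat n else X * U.transpose)) ?_ le_rfl
  · exact fun s' h => ⟨by omega, by simp⟩
  · rw [h1.n 0 (by decide), hs.size]
  · rw [h1.n 1 (by decide), hs.width]
  · rw [h1.n 2 (by decide), hs.base]
  · intro a i ha hi
    rw [h1.n a (by simp; omega)]
    exact (hs.fresh a i ha hi).1
  · rw [matList_length]; omega
  · rw [matList_length]; omega
  rintro o s₂ ⟨s', rfl, h3, h4, h5, h6, h7, h8, h9⟩
  have hfr : Same [2, 4, 5, 6, 7, 8, 30, 40] [30, 40] s s₂ :=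
    (h1.mono (by simp) (by simp)).trans (h5.mono (by simp) (by simp))
  refine Impl.cond (t₁ := (if W ≤ T then n * n * (n * 100 + 100) else 0) + n * n * 40 + 120)
    ?_ ?_ ?_ (by simp only [BExp.cost, NExp.cost]; omega)
  · simp only [BExp.peak, NExp.peak, NExp.eval, h6.width]; omega
  · intro hb
    simp only [BExp.eval, NExp.eval, h6.width, decide_eq_true_eq] at hb
    have hlt : s'.time < W := by
      by_contra hge
      have := h8 (by omega)
      omega
    obtain ⟨-, h10⟩ := h7 hlt
    have hfr' := hfr.trans (Same.charge s₂ _ _ ((BExp.lt (F := F) (V 4) (V 1)).cost + 1)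
      ((BExp.lt (F := F) (V 4) (V 1)).peak s₂))
    refine Impl.drop (impl_mapL (n := n) (o := 0) (fun x => s₂.farr 30 x)
      h6.size (by omega) (by omega) ?_ (by simp only [NExp.cost, FExp.cost]; omega)) ?_
    · rintro x s₃ hx g1 g2 g8
      simp only [FExp.eval, FExp.peak, NExp.eval, NExp.peak, g8, g2 30 (by decide), true_and,
        State.charge]
      omega
    · rintro s₃ ⟨g1, g2, g3, -⟩
      refine ⟨fun i j => ?_, ⟨_, Nat.add_le_add_right (Nat.add_le_add_right hb' W) 1,
        (h6.same (Same.charge _ [] [] _ _)).same g1⟩,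
        (hfr'.mono (by simp) (by simp)).trans (g1.mono (by simp) (by simp))⟩
      have hij := idx_lt i.2 j.2
      rw [← Nat.zero_add ((i : ℕ) * n + j), g3 _ hij]
      simp only [Option.elim, if_pos hlt, State.outMat]
      exact h10.cf.2 _ (by omega)
  · intro hb
    simp only [BExp.eval, NExp.eval, h6.width, decide_eq_false_iff_not] at hb
    have hge : ¬ s'.time < W := fun hlt => hb (h7 hlt).1
    have hfr' := hfr.trans (Same.charge s₂ _ _ ((BExp.lt (F := F) (V 4) (V 1)).cost + 1)
      ((BExp.lt (F := F) (V 4) (V 1)).peak s₂))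
    refine Impl.drop (impl_naive (n := n) h6.size (by omega) (hX.same hfr') (hU.same hfr')
      (by decide) (by decide) (by decide) (by rw [if_pos (by omega)]; omega)) ?_
    rintro s₃ ⟨g1, g2⟩
    simp only [Option.elim, if_neg hge]
    exact ⟨g2, ⟨_, Nat.add_le_add_right (Nat.add_le_add_right hb' W) 1,
        (h6.same (Same.charge _ [] [] _ _)).same g1⟩,
        (hfr'.mono (by simp) (by simp)).trans (g1.mono (by simp) (by simp))⟩

/-! ### A single estimate of a product -/

/-- The estimate of `X * Yᵀ` that is derived from a claimed product `Z` of the hidden matrices. -/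
def estimate {n : ℕ} [NeZero n] (X Y : Mat F n) (x y : Mat F n × Fin n × Fˣ) (Z : Mat F n) :
    Mat F n :=
  fun i j => (X * Y.transpose) i j + ((x.2.2 : F) * (y.2.2 : F))⁻¹ *
    (Z - hide X x * (hide Y y).transpose) (i - x.2.1) (j - y.2.1)

/-- `estimate` is defined by its error and mentions the unknown product. Expanding (uX + R)(u'Y +
R')ᵀ shows that it can be computed from `Z` and two products with transposed masks: the cross terms
are (uX)R'ᵀ and R(u'Y + R')ᵀ, and the latter is the transpose of a product with Rᵀ. -/
theorem estimate_eq {n : ℕ} [NeZero n] (X Y : Mat F n) (x y : Mat F n × Fin n × Fˣ) (Z : Mat F n)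
    (i j : Fin n) : estimate X Y x y Z i j = ((x.2.2 : F) * (y.2.2 : F))⁻¹ *
      (Z (i - x.2.1) (j - y.2.1) - (hide Y y * x.1.transpose) (j - y.2.1) (i - x.2.1) -
        ((hide X x - x.1) * y.1.transpose) (i - x.2.1) (j - y.2.1)) := by
  obtain ⟨R, r, u⟩ := x
  obtain ⟨R', r', u'⟩ := y
  have hu : (u : F) * (u' : F) ≠ 0 := mul_ne_zero u.ne_zero u'.ne_zero
  simp only [estimate]
  rw [eq_inv_mul_iff_mul_eq₀ hu, mul_add, mul_inv_cancel_left₀ hu]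
  simp only [Matrix.sub_apply, Matrix.mul_apply, Matrix.transpose_apply, hide, sub_add_cancel,
    Finset.mul_sum, sub_sub]
  have key : ∑ k, (u : F) * u' * (X i k * Y j k) -
      ∑ k, (u * X i k + R (i - r) k) * (u' * Y j k + R' (j - r') k) =
      -(∑ k, (u' * Y j k + R' (j - r') k) * R (i - r) k +
        ∑ k, (u * X i k + R (i - r) k - R (i - r) k) * R' (j - r') k) := by
    rw [← Finset.sum_add_distrib, ← Finset.sum_sub_distrib, ← Finset.sum_neg_distrib]
    exact Finset.sum_congr rfl fun k _ => by ring
  linear_combination key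

/-- The distribution of the estimate of `X * Yᵀ` for masks from `ν₀` and `ν₁`, where the product of
the hidden matrices is computed by `μ`. -/
noncomputable def trialDist {n : ℕ} [NeZero n] (μ : Mat F n → Mat F n → PMF (Mat F n))
    (ν₀ ν₁ : PMF (Mat F n)) (X Y : Mat F n) : PMF (Mat F n) :=
  (maskDist ν₀).bind fun x => (maskDist ν₁).bind fun y =>
    (μ (hide X x) (hide Y y).transpose).map fun Z => estimate X Y x y Z

/-- Compute the estimate from the result of the multiplication of the hidden matrices, and append
it to field array `23`. -/
def unmask (ap : ℕ → ℕ → ℕ → Prog F) : Prog F :=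
  .seq (ap 0 14 20) (.seq (mapL 21 (.lit 0) (.sub (.read 13 (V 8)) (.read 31 (V 8))))
    (.seq (ap 1 21 22) (mapL 23 (.mul (V 11) (.mul (V 0) (V 0)))
      (.mul (.inv (.mul (.read 17 (.lit 0)) (.read 18 (.lit 0))))
        (.sub (.sub
          (.read 19 (.add (.mul (.mod (.add (.sub (V 0) (V 12)) (.div (V 8) (V 0))) (V 0)) (V 0))
            (.mod (.add (.sub (V 0) (V 13)) (.mod (V 8) (V 0))) (V 0))))
          (.read 20 (.add (.mul (.mod (.add (.sub (V 0) (V 13)) (.mod (V 8) (V 0))) (V 0)) (V 0))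
            (.mod (.add (.sub (V 0) (V 12)) (.div (V 8) (V 0))) (V 0)))))
          (.read 22 (.add (.mul (.mod (.add (.sub (V 0) (V 12)) (.div (V 8) (V 0))) (V 0)) (V 0))
            (.mod (.add (.sub (V 0) (V 13)) (.mod (V 8) (V 0))) (V 0)))))))))

/-- Compute an estimate of the product of the matrix in field array `10` and the transpose of the
one in field array `11`, and append it to field array `23`. -/
noncomputable def trial (gm : ℕ → Prog F) (ap : ℕ → ℕ → ℕ → Prog F) (M : Prog F) : Prog F :=
  .seq (maskStep (gm 0) 0) (.seq (maskStep (gm 1) 1) (.seq (runMul M) (unmask ap)))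

/-- The integer arrays that are changed by a trial. -/
abbrev trialN : List ℕ := [2, 4, 5, 6, 7, 8, 9, 12, 13, 20, 30, 31, 32, 40]

/-- The field arrays that are changed by a trial. -/
abbrev trialF : List ℕ := [13, 14, 17, 18, 19, 20, 21, 22, 23, 29, 30, 31, 32, 40]

/-- The programs `gm σ` provide masks and the programs `ap σ` multiply by the transposed masks.
The distribution of the mask is `ν (2 * t + σ)` in trial number `t`. -/
structure MaskOps (n W w tg ta m : ℕ) (gm : ℕ → Prog F) (ap : ℕ → ℕ → ℕ → Prog F)
    (ν : ℕ → PMF (Mat F n)) (Ctx : State F → Prop)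
    (Aux : Mat F n → (ℕ → ℕ) → (ℕ → F) → Prop) : Prop where
  ctx : ∀ s s', Ctx s → Same (3 :: 10 :: 11 :: 17 :: 18 :: 19 :: trialN)
    (7 :: 10 :: 11 :: 12 :: 24 :: trialF) s s' → Ctx s'
  aux : ∀ R nf ff, Aux R nf ff → ∀ i j : Fin n, ff (i * n + j) = R i j
  gen : ∀ σ < 2, ∀ t < m, ∀ b s, b + W + n * n + n + 1 ≤ w → WinLe n W b s → s.narr 11 0 = t →
    Ctx s → Impl (gm σ) s tg w (ν (2 * t + σ)) fun R s' =>
      Aux R (s'.narr (31 + σ)) (s'.farr (31 + σ)) ∧ WinLe n W (b + W + 1) s' ∧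
      Same [2, 4, 5, 6, 7, 8, 9, 20, 30, 40, 31 + σ] [29, 30, 40, 31 + σ] s s'
  app : ∀ σ < 2, ∀ inp < 29, ∀ out < 29, inp ≠ out → ∀ s A R, s.narr 0 0 = n →
    Aux R (s.narr (31 + σ)) (s.farr (31 + σ)) → HasMat s inp A →
    Impl (ap σ inp out) s ta w (PMF.pure ()) fun _ s' => Same [8, 9] [29, out] s s' ∧
      HasMat s' out (A * R.transpose)

/-- The two mask products are formed through `MaskOps.app`, and the formula of `estimate_eq` is
evaluated entrywise. Estimate number `t` occupies its own block of n² cells, so earlier estimates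
are preserved. -/
theorem impl_unmask {n W w tg ta m t b : ℕ} [NeZero n] {gm : ℕ → Prog F}
    {ap : ℕ → ℕ → ℕ → Prog F} {ν : ℕ → PMF (Mat F n)} {Ctx : State F → Prop}
    {Aux : Mat F n → (ℕ → ℕ) → (ℕ → F) → Prop} (h : MaskOps n W w tg ta m gm ap ν Ctx Aux)
    {X Y Z : Mat F n} {x y : Mat F n × Fin n × Fˣ} {s : State F}
    (hs : WinLe n W b s) (h11 : s.narr 11 0 = t) (ht : t < m)
    (hx : Masked 0 X x s) (hy : Masked 1 Y y s) (hx' : Aux x.1 (s.narr 31) (s.farr 31))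
    (hy' : Aux y.1 (s.narr 32) (s.farr 32)) (hZ : HasMat s 19 Z)
    (hw : m * (n * n) + n * n + 2 * n + m ≤ w) :
    Impl (unmask ap) s (2 * ta + n * n * 250 + 100) w (PMF.pure ()) fun _ s' =>
      WinLe n W b s' ∧ Same [8, 9] [20, 21, 22, 23, 29] s s' ∧
      (∀ i j : Fin n, s'.farr 23 (t * (n * n) + (i * n + j)) = estimate X Y x y Z i j) ∧
      (∀ z < t * (n * n), s'.farr 23 z = s.farr 23 z) := by
  have hn : 0 < n := Nat.pos_of_ne_zero (NeZero.ne n)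
  have hnn : n ≤ n * n := Nat.le_mul_self n
  have htn : t * (n * n) + n * n ≤ m * (n * n) := by
    calc t * (n * n) + n * n = (t + 1) * (n * n) := by ring
      _ ≤ _ := Nat.mul_le_mul_right _ ht
  refine Impl.seq_pure (a := ()) (t₁ := ta) (t₂ := ta + n * n * 250 + 100)
    (h.app 0 (by omega) 14 (by omega) 20 (by omega) (by omega) s _ _ hs.size hx' hy.mat) ?_
    (by omega)
  rintro s₁ ⟨h1, h2⟩
  have f1 : Same [8, 9] [20, 21, 22, 23, 29] s s₁ := h1.mono (by simp) (by simp)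
  refine Impl.seq_pure (a := ()) (t₁ := n * n * 40 + 20) (t₂ := ta + n * n * 210 + 80)
    (impl_mapL (n := n) (o := 0) (fun z => s.farr 13 z - s.farr 31 z)
      (by rw [f1.n 0 (by decide), hs.size]) (by omega) (by omega) ?_
      (by simp only [NExp.cost, FExp.cost]; omega)) ?_ (by omega)
  · rintro z s' hz g1 g2 g8
    simp only [FExp.eval, NExp.eval, FExp.peak, NExp.peak, g8, g2 13 (by decide),
      g2 31 (by decide), f1.f 13 (by decide), f1.f 31 (by decide), true_and]
    omega
  rintro s₂ ⟨h3, h4, h5, -⟩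
  have f2 : Same [8, 9] [20, 21, 22, 23, 29] s s₂ := f1.trans (h3.mono (by simp) (by simp))
  have h21 : HasMat s₂ 21 (hide X x - x.1) := by
    intro i j
    rw [← Nat.zero_add ((i : ℕ) * n + j), h5 _ (idx_lt i.2 j.2), hx.mat i j, hx.mask i j]
    rfl
  refine Impl.seq_pure (a := ()) (t₁ := ta) (t₂ := n * n * 210 + 60)
    (h.app 1 (by omega) 21 (by omega) 22 (by omega) (by omega) s₂ _ y.1
      (by rw [f2.n 0 (by decide), hs.size])
      (by rw [f2.n _ (by decide), f2.f _ (by decide)]; exact hy') h21) ?_ (by omega)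
  rintro s₃ ⟨h6, h7⟩
  have f3 : Same [8, 9] [20, 21, 22, 23, 29] s s₃ := f2.trans (h6.mono (by simp) (by simp))
  have h20 : HasMat s₃ 20 (hide Y y * x.1.transpose) :=
    (h2.same h3 (by decide)).same h6 (by decide)
  have h19 : HasMat s₃ 19 Z := hZ.same f3 (by decide)
  have e12 : s₃.narr 12 0 = x.2.1 := by rw [f3.n 12 (by decide)]; exact hx.shift
  have e13 : s₃.narr 13 0 = y.2.1 := by rw [f3.n 13 (by decide)]; exact hy.shift
  have e17 : s₃.farr 17 0 = x.2.2 := by rw [f3.f 17 (by decide)]; exact hx.unit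
  have e18 : s₃.farr 18 0 = y.2.2 := by rw [f3.f 18 (by decide)]; exact hy.unit
  have e11 : s₃.narr 11 0 = t := by rw [f3.n 11 (by decide), h11]
  have e0 : s₃.narr 0 0 = n := by rw [f3.n 0 (by decide), hs.size]
  set val : ℕ → F := fun z => if hz : z < n * n then
    estimate X Y x y Z ⟨z / n, (div_mod_facts hz).2.1⟩ ⟨z % n, (div_mod_facts hz).2.2.1⟩ else 0
    with hval
  refine (impl_mapL (n := n) (o := t * (n * n)) val e0 (by omega) (by omega) ?_
    (by simp only [NExp.cost, FExp.cost]; omega)).imp ?_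
  · rintro z s' hz g1 g2 g8
    obtain ⟨-, hz1, hz2, -⟩ := div_mod_facts hz
    have a0 : s'.narr 0 0 = n := by rw [g1.n 0 (by decide), e0]
    have a11 : s'.narr 11 0 = t := by rw [g1.n 11 (by decide), e11]
    have a12 : s'.narr 12 0 = x.2.1 := by rw [g1.n 12 (by decide), e12]
    have a13 : s'.narr 13 0 = y.2.1 := by rw [g1.n 13 (by decide), e13]
    set i : Fin n := ⟨z / n, hz1⟩ with hi
    set j : Fin n := ⟨z % n, hz2⟩ with hj
    -- Truncated subtraction is harmless in this order, and the result is the cyclic difference by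
    -- which the row shift is undone.
    have b1 : (n - (x.2.1 : ℕ) + z / n) % n = ((i - x.2.1 : Fin n) : ℕ) := by
      rw [Fin.val_sub]
    have b2 : (n - (y.2.1 : ℕ) + z % n) % n = ((j - y.2.1 : Fin n) : ℕ) := by
      rw [Fin.val_sub]
    have c1 := h19 (i - x.2.1) (j - y.2.1)
    have c2 := h20 (j - y.2.1) (i - x.2.1)
    have c3 := h7 (i - x.2.1) (j - y.2.1)
    have l1 := idx_lt (i - x.2.1).2 (j - y.2.1).2
    have l2 := idx_lt (j - y.2.1).2 (i - x.2.1).2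
    have l3 := (i - x.2.1).2
    have l4 := (j - y.2.1).2
    refine ⟨?_, ?_, ?_, ?_⟩
    · simp only [FExp.eval, NExp.eval, a0, a12, a13, g8, b1, b2, g2 17 (by decide),
        g2 18 (by decide), g2 19 (by decide), g2 20 (by decide), g2 22 (by decide), c1, c2, c3,
        e17, e18, hval, dif_pos hz]
      rw [estimate_eq]
    · have l5 := x.2.1.2
      have l6 := y.2.1.2
      simp only [FExp.peak, NExp.peak, NExp.eval, a0, a12, a13, g8, b1, b2]
      generalize ((i - x.2.1 : Fin n) : ℕ) = p at l1 l2 l3 ⊢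
      generalize ((j - y.2.1 : Fin n) : ℕ) = q at l1 l2 l4 ⊢
      have l9 := hz1
      have l10 := hz2
      generalize z / n = d at l9 ⊢
      generalize z % n = r at l10 ⊢
      have l7 : p * n ≤ n * n := Nat.mul_le_mul_right _ l3.le
      have l8 : q * n ≤ n * n := Nat.mul_le_mul_right _ l4.le
      simp only [max_le_iff]
      omega
    · simp only [NExp.eval, a0, a11]
    · simp only [NExp.peak, NExp.eval, a0, a11]; omega
  · rintro - s₄ ⟨g1, g2, g3, g4⟩
    have f4 : Same [8, 9] [20, 21, 22, 23, 29] s s₄ := f3.trans (g1.mono (by simp) (by simp))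
    refine ⟨?_, f4, ?_, ?_⟩
    · exact hs.same f4
    · intro i j
      have hij := idx_lt i.2 j.2
      rw [g3 _ hij, hval]
      simp only [dif_pos hij, idx_div j.2, idx_mod j.2]
    · intro z hz
      rw [g4 z (Or.inl hz)]
      have : s₃.farr 23 = s.farr 23 := by
        rw [h6.f 23 (by decide), h3.f 23 (by decide), h1.f 23 (by decide)]
      rw [this]

theorem Masked.same {n σ : ℕ} [NeZero n] {X : Mat F n} {x : Mat F n × Fin n × Fˣ}
    {l k : List ℕ} {s s' : State F} (h : Masked σ X x s) (hs : Same l k s s')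
    (h1 : min (12 + σ) 40 ∉ l := by decide) (h2 : min (17 + σ) 40 ∉ k := by decide)
    (h3 : min (13 + σ) 40 ∉ k := by decide) (h4 : min (31 + σ) 40 ∉ k := by decide) :
    Masked σ X x s' :=
  ⟨by rw [hs.n _ h1, h.shift], by rw [hs.f _ h2, h.unit], h.mat.same hs h3, h.mask.same hs h4⟩

/-- Time for a trial. -/
def trialTime (F : Type*) [Field F] [Fintype F] [DecidableEq F] (M : Prog F)
    (n W T tg ta : ℕ) : ℕ :=
  2 * tg + 2 * ta + mulTime M n W T + Fintype.card Fˣ * 20 + n * n * 400 + 400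

/-- A trial uses at most three windows, one for each mask and one for `M`. The base is known only up
to an upper bound, since some masks of the hybrid argument do not use a window. -/
theorem impl_trial {n W w tg ta m t b T v : ℕ} [NeZero n] {gm : ℕ → Prog F}
    {ap : ℕ → ℕ → ℕ → Prog F} {ν : ℕ → PMF (Mat F n)} {Ctx : State F → Prop}
    {Aux : Mat F n → (ℕ → ℕ) → (ℕ → F) → Prop} (h : MaskOps n W w tg ta m gm ap ν Ctx Aux)
    {M : Prog F} (hM : ∀ A B : Mat F n, M.HaltsWithin (initState n (matList A) (matList B)) T v
      fun s => s.fOut.length = n * n) (hv : v ≤ W) (hnW : n * n ≤ W)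
    {X Y : Mat F n} {s : State F} (hs : WinLe n W b s) (h11 : s.narr 11 0 = t) (ht : t < m)
    (hX : HasMat s 10 X) (hY : HasMat s 11 Y) (hctx : Ctx s)
    (hw : b + 3 * (W + 1) + m * (n * n) + n * n + 3 * n + m + Fintype.card Fˣ + 1 ≤ w)
    (hw' : W + M.slow false ≤ w) :
    Impl (trial gm ap M) s (trialTime F M n W T tg ta) w
      (trialDist (cutDist M T W) (ν (2 * t)) (ν (2 * t + 1)) X Y) fun Z s' =>
      WinLe n W (b + 3 * (W + 1)) s' ∧ Same trialN trialF s s' ∧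
      (∀ i j : Fin n, s'.farr 23 (t * (n * n) + (i * n + j)) = Z i j) ∧
      (∀ z < t * (n * n), s'.farr 23 z = s.farr 23 z) := by
  unfold trialTime
  refine Impl.seq (t₁ := tg + Fintype.card Fˣ * 10 + n * n * 60 + 100)
    (t₂ := tg + 2 * ta + mulTime M n W T + Fintype.card Fˣ * 10 + n * n * 340 + 300)
    (impl_maskStep (X := X) (Q := fun R s' => Aux R (s'.narr 31) (s'.farr 31) ∧
      WinLe n W (b + W + 1) s' ∧ s'.farr 23 = s.farr 23 ∧ Same trialN trialF s s') (by omega)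
      ((h.gen 0 (by omega) t ht b s (by omega) hs h11 hctx).imp ?_) ?_ (by omega) le_rfl) ?_
    (by omega)
  · rintro R s' ⟨h1, h2, h3⟩
    exact ⟨h2.size, hX.same h3, h.aux _ _ _ h1, h1, h2, h3.f 23 (by decide),
      h3.mono (by decide) (by decide)⟩
  · rintro R s₁ s₂ ⟨h1, h2, h3, h4⟩ h5
    exact ⟨by rwa [h5.n 31 (by decide), h5.f 31 (by decide)], h2.same h5,
      by rw [h5.f 23 (by decide), h3], h4.trans (h5.mono (by decide) (by decide))⟩
  rintro x s₁ ⟨hx, hxa, hs₁, h23, f1⟩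
  have hctx₁ : Ctx s₁ := h.ctx _ _ hctx (f1.mono (by decide) (by decide))
  have h11' : s₁.narr 11 0 = t := by rw [f1.n 11 (by decide), h11]
  have hY₁ : HasMat s₁ 11 Y := hY.same f1
  refine Impl.seq (t₁ := tg + Fintype.card Fˣ * 10 + n * n * 60 + 100)
    (t₂ := 2 * ta + mulTime M n W T + n * n * 280 + 200)
    (impl_maskStep (X := Y) (Q := fun R s' => Aux R (s'.narr 32) (s'.farr 32) ∧
      WinLe n W (b + W + 1 + W + 1) s' ∧ Masked 0 X x s' ∧ Aux x.1 (s'.narr 31) (s'.farr 31) ∧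
      s'.farr 23 = s.farr 23 ∧ Same trialN trialF s s') (by omega)
      ((h.gen 1 (by omega) t ht (b + W + 1) s₁ (by omega) hs₁ h11' hctx₁).imp ?_) ?_ (by omega)
      le_rfl) ?_ (by omega)
  · rintro R s' ⟨h1, h2, h3⟩
    exact ⟨h2.size, hY₁.same h3, h.aux _ _ _ h1, h1, h2, hx.same h3,
      by rwa [h3.n 31 (by decide), h3.f 31 (by decide)], by rw [h3.f 23 (by decide), h23],
      f1.trans (h3.mono (by decide) (by decide))⟩
  · rintro R s₁ s₂ ⟨h1, h2, h3, h4, h6, h7⟩ h5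
    exact ⟨by rwa [h5.n 32 (by decide), h5.f 32 (by decide)], h2.same h5, h3.same h5,
      by rwa [h5.n 31 (by decide), h5.f 31 (by decide)], by rw [h5.f 23 (by decide), h6],
      h7.trans (h5.mono (by decide) (by decide))⟩
  rintro y s₂ ⟨hy, hya, hs₂, hx₂, hxa₂, h23₂, f2⟩
  refine Impl.seq (t₁ := mulTime M n W T) (t₂ := 2 * ta + n * n * 280 + 200)
    (impl_runMul (hM _ _) hv hnW hs₂ hx₂.mat hy.mat (by omega) hw')
    (f := fun Z => PMF.pure (estimate X Y x y Z)) ?_ (by omega)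
  rintro Z s₃ ⟨h19, hs₃, f3⟩
  refine Impl.drop ((impl_unmask h hs₃ (by rw [f3.n 11 (by decide), f2.n 11 (by decide), h11]) ht
    (hx₂.same f3) (hy.same f3) (by rwa [f3.n 31 (by decide), f3.f 31 (by decide)])
    (by rwa [f3.n 32 (by decide), f3.f 32 (by decide)]) h19 (by omega)).mono
    (by omega) (fun _ _ _ h => h)) ?_
  rintro s₄ ⟨h5, h6, h7, h8⟩
  refine ⟨h5.mono (by omega), f2.trans ((f3.mono (by decide) (by decide)).trans
    (h6.mono (by decide) (by decide))), h7, fun z hz => ?_⟩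
  rw [h8 z hz, f3.f 23 (by decide), h23₂]

/-! ### The plurality of many estimates -/

/-- The integer arrays that are changed by `core`. -/
abbrev coreN : List ℕ := 10 :: 11 :: 17 :: 18 :: trialN

/-- The field arrays that are changed by `core`. -/
abbrev coreF : List ℕ := 7 :: 24 :: trialF

/-- Field array `24` receives the entrywise plurality of estimates of the product of the matrix in
field array `10` and the transpose of the one in field array `11`. -/
noncomputable def core (gm : ℕ → Prog F) (ap : ℕ → ℕ → ℕ → Prog F) (M : Prog F) : Prog F :=
  .seq (forN 11 (V 3) (trial gm ap M)) majProg

/-- Record another estimate. -/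
noncomputable def estStep {n : ℕ} [NeZero n] (μ : Mat F n → Mat F n → PMF (Mat F n))
    (ν : ℕ → PMF (Mat F n)) (X Y : Mat F n) (t : ℕ) (a : ℕ → Mat F n) : PMF (ℕ → Mat F n) :=
  (trialDist μ (ν (2 * t)) (ν (2 * t + 1)) X Y).map (Function.update a t)

/-- The entrywise plurality of the first `m` matrices of a sequence. -/
def majMat {n : ℕ} (m : ℕ) (a : ℕ → Mat F n) : Mat F n := fun i j => maj (fun t => a t i j) m

/-- The distribution of the entrywise plurality of `m` estimates. -/
noncomputable def coreDist {n : ℕ} [NeZero n] (μ : Mat F n → Mat F n → PMF (Mat F n))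
    (ν : ℕ → PMF (Mat F n)) (m : ℕ) (X Y : Mat F n) : PMF (Mat F n) :=
  (iterFrom (estStep μ ν X Y) 0 m fun _ => 0).map (majMat m)

theorem maj_congr {u v : ℕ → F} {m : ℕ} (h : ∀ t < m, u t = v t) : maj u m = maj v m := by
  have h1 : ∀ t < m, cntEq u m t = cntEq v m t := by
    intro t ht
    unfold cntEq
    congr 1
    refine Finset.filter_congr fun t' ht' => ?_
    rw [h t ht, h t' (Finset.mem_range.1 ht')]
  have h2 : ∀ k ≤ m, majAux u m k = majAux v m k := by
    intro k
    induction k with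
    | zero => intro _; rfl
    | succ k ih => intro hk; simp only [majAux, ih (by omega), h1 k (by omega), h k (by omega)]
  simp only [maj, h2 m le_rfl]

/-- Time for `core`. -/
def coreTime (F : Type*) [Field F] [Fintype F] [DecidableEq F] (M : Prog F)
    (n W T tg ta m : ℕ) : ℕ :=
  m * (trialTime F M n W T tg ta + 20) + n * n * (m * (m * 80 + 160) + 160) + 100

theorem impl_core {n W w tg ta m b T v : ℕ} [NeZero n] {gm : ℕ → Prog F}
    {ap : ℕ → ℕ → ℕ → Prog F} {ν : ℕ → PMF (Mat F n)} {Ctx : State F → Prop}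
    {Aux : Mat F n → (ℕ → ℕ) → (ℕ → F) → Prop} (h : MaskOps n W w tg ta m gm ap ν Ctx Aux)
    {M : Prog F} (hM : ∀ A B : Mat F n, M.HaltsWithin (initState n (matList A) (matList B)) T v
      fun s => s.fOut.length = n * n) (hv : v ≤ W) (hnW : n * n ≤ W)
    {X Y : Mat F n} {s : State F} (hs : WinLe n W b s) (h3 : s.narr 3 0 = m)
    (hX : HasMat s 10 X) (hY : HasMat s 11 Y) (hctx : Ctx s)
    (hw : b + m * (3 * (W + 1)) + m * (n * n) + n * n + 3 * n + m + Fintype.card Fˣ + 1 ≤ w)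
    (hw' : W + M.slow false ≤ w) :
    Impl (core gm ap M) s (coreTime F M n W T tg ta m) w (coreDist (cutDist M T W) ν m X Y)
      fun Z s' => HasMat s' 24 Z ∧ WinLe n W (b + m * (3 * (W + 1))) s' ∧
        Same coreN coreF s s' := by
  unfold coreTime
  refine Impl.seq (t₁ := m * (trialTime F M n W T tg ta + 20) + 20)
    (t₂ := n * n * (m * (m * 80 + 160) + 160) + 40)
    (Impl.forN (tb := trialTime F M n W T tg ta) (N := m) (a₀ := fun _ => (0 : Mat F n))
      (f := estStep (cutDist M T W) ν X Y)
      (Q := fun a s' => WinLe n W (b + m * (3 * (W + 1))) s' ∧ Same (11 :: trialN) trialF s s' ∧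
        ∀ t < m, ∀ i j : Fin n, s'.farr 23 (t * (n * n) + (i * n + j)) = a t i j)
      (fun t a s' => WinLe n W (b + t * (3 * (W + 1))) s' ∧ Same (11 :: trialN) trialF s s' ∧
        ∀ t' < t, ∀ i j : Fin n, s'.farr 23 (t' * (n * n) + (i * n + j)) = a t' i j)
      ?_ ?_ (by omega) ?_ ?_ (fun _ _ h => h) ?_) (f := fun a => PMF.pure (majMat m a)) ?_
      (by omega)
  · rintro k a s₁ s₂ ⟨g1, g2, g3⟩ hs
    exact ⟨g1.same hs, g2.trans (hs.mono (by decide) (by decide)), by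
      rwa [hs.f 23 (by decide)]⟩
  · rintro k a s' hk ⟨g1, g2, g3⟩ -
    have : s'.narr 3 0 = m := by rw [g2.n 3 (by decide), h3]
    simp only [NExp.eval, NExp.peak, this, true_and]
    omega
  · exact ⟨hs.mono (by omega), Same.refl _ _ _, fun t ht => by omega⟩
  · rintro t a s' ht ⟨g1, g2, g3⟩ g11
    have hb : t * (3 * (W + 1)) + 3 * (W + 1) ≤ m * (3 * (W + 1)) := by
      calc _ = (t + 1) * (3 * (W + 1)) := by ring
        _ ≤ _ := Nat.mul_le_mul_right _ ht
    refine (impl_trial h hM hv hnW g1 g11 ht (hX.same g2) (hY.same g2)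
      (h.ctx _ _ hctx (g2.mono (by decide) (by decide))) (by omega) hw').map _ ?_
    rintro Z s'' ⟨k1, k2, k3, k4⟩
    refine ⟨by rw [k2.n 11 (by decide), g11], k1.mono (by rw [add_mul, one_mul]; omega),
      g2.trans (k2.mono (by decide) (by decide)), ?_⟩
    intro t' ht' i j
    rcases Nat.lt_succ_iff_lt_or_eq.1 ht' with h1 | rfl
    · have h2 : t' * (n * n) + (i * n + j) < t * (n * n) := by
        have := idx_lt i.2 j.2
        calc t' * (n * n) + (i * n + j) < t' * (n * n) + n * n := by omega
          _ = (t' + 1) * (n * n) := by ring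
          _ ≤ _ := Nat.mul_le_mul_right _ h1
      rw [k4 _ h2, Function.update_of_ne (by omega), g3 t' h1]
    · rw [k3, Function.update_self]
  · have : m * (trialTime F M n W T tg ta + (V 3).cost + 10) ≤
        m * (trialTime F M n W T tg ta + 20) := Nat.mul_le_mul_left _ (by simp [NExp.cost])
    simp only [NExp.cost] at this ⊢
    omega
  · rintro a s₁ ⟨g1, g2, g3⟩
    refine Impl.drop (impl_majProg (n := n) (m := m) g1.size (by rw [g2.n 3 (by decide), h3])
      (by omega) le_rfl) ?_
    rintro s₂ ⟨k1, k2⟩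
    refine ⟨?_, g1.same k1, (g2.mono (by decide) (by decide)).trans (k1.mono (by decide) (by decide))⟩
    intro i j
    rw [k2 _ (idx_lt i.2 j.2)]
    exact maj_congr fun t ht => g3 t ht i j

/-! ### Masks from a trapdoored family -/

/-- The code is copied from one array to another, so its words must respect the bound on integers.
References and output positions are below the size, input numbers below `m`. -/
theorem Circuit.code_le {m n : ℕ} (C : Circuit F m n) : ∀ x ∈ C.code, x ≤ m + C.size + 3 := by
  intro x hx
  simp only [Circuit.code, List.mem_cons, List.mem_append, List.mem_flatMap, List.mem_ofFn] at hx
  rcases hx with rfl | ⟨g, hg, hx⟩ | ⟨i, rfl⟩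
  · simp only [Circuit.size]; omega
  · obtain ⟨k, hk⟩ := List.mem_iff_getElem?.1 hg
    have hwf := C.gates_wf k g hk
    have hlt : k < C.size := by
      by_contra h
      rw [List.getElem?_eq_none (by simpa [Circuit.size] using h)] at hk
      simp at hk
    cases g with
    | input i =>
      have := i.2
      simp only [Gate.code, List.mem_cons, List.not_mem_nil, or_false] at hx
      omega
    | const c =>
      simp only [Gate.code, List.mem_cons, List.not_mem_nil, or_false] at hx
      omega
    | add i j =>
      simp only [Gate.RefsBelow] at hwf
      simp only [Gate.code, List.mem_cons, List.not_mem_nil, or_false] at hx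
      omega
    | mul i j =>
      simp only [Gate.RefsBelow] at hwf
      simp only [Gate.code, List.mem_cons, List.not_mem_nil, or_false] at hx
      omega
  · have := C.out_wf i
    simp only [Circuit.size]; omega

/-- Sample a trapdoored matrix and store it in the arrays `ca`. -/
def sampleTo (S : Prog F) (ca : ℕ) : Prog F := .seq (subRun true S) (copyOut ca)

/-- Time for `sampleTo`. -/
def sampleTime (S : Prog F) (n W τ σ : ℕ) : ℕ :=
  subTime true S W τ + n * n * 40 + n * 40 + σ * 160 + 80

/-- As `τ < W`, the clock never expires, and the sampler is always simulated to its end. -/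
theorem impl_sampleTo {S : Prog F} {n W τ σ b w v ca : ℕ} {s : State F} (hca : ca = 31 ∨ ca = 32)
    (hS : S.HaltsWithin (initState n [] []) τ v (OutputsTrapdooredPair n σ))
    (hv : v ≤ W) (hτ : τ < W) (hW : n * n + n + 3 * σ + 3 ≤ W) (hs : WinLe n W b s)
    (hw : b + W + n * n + n + 1 ≤ w) (hw' : W + S.slow true ≤ w) :
    Impl (sampleTo S ca) s (sampleTime S n W τ σ) w (sampledMat S τ n) fun R s' =>
      HoldsCirc σ R (s'.narr ca) (s'.farr ca) ∧ WinLe n W (b + W + 1) s' ∧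
      Same [2, 4, 5, 6, 7, 8, 30, 40, ca] [30, 40, ca] s s' := by
  obtain ⟨b₀, hb, hs⟩ := hs
  unfold sampleTime
  have hlen : ∀ (R : Mat F n) (C : Circuit F n n), (matList R ++ C.fcode).length =
      n * n + C.size := by
    intro R C; rw [List.length_append, matList_length]; simp [Circuit.fcode, Circuit.size]
  rw [show sampledMat S τ n = (S.run τ (initState n [] [])).bind fun o =>
    PMF.pure (o.elim 0 (State.outMat n)) from rfl]
  refine Impl.seq (t₁ := subTime true S W τ) (t₂ := n * n * 40 + n * 40 + σ * 160 + 80)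
    (impl_subRun (B := w) (b := b₀) hS hv ?_ hs.size hs.width hs.base
      (fun a i ha hi => (hs.fresh a i ha hi).1) ?_ (by simp) (by simp) (by omega) hw' (by omega))
    (f := fun o => PMF.pure (o.elim 0 (State.outMat n))) ?_ ?_
  on_goal 4 => omega
  · rintro s' ⟨R, C, h1, h2, h3, h4⟩
    rw [h1, h2, hlen, C.code_length]
    exact ⟨by omega, fun _ => by omega⟩
  · intro a i
    rw [(hs.fresh (a + 40) _ (by omega) (by omega)).2]
    simp [initState]
  rintro o s₁ ⟨s', rfl, ⟨R, C, h1, h2, h3, h4⟩, h5, h6, h7, h8, -⟩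
  obtain ⟨-, h8⟩ := h8 (by omega)
  have hR : s'.outMat n = R := by
    ext i j
    simp only [State.outMat, h1]
    rw [List.getD_append _ _ _ _ (by rw [matList_length]; exact idx_lt i.2 j.2), matList_getD]
  have e5 : s₁.narr 5 0 = C.code.length := by
    have := (h8.cn rfl).1
    rw [h2] at this
    simpa using this
  have e30 : ∀ k < C.code.length, s₁.narr 30 k = C.code.getD k 0 := by
    intro k hk
    have := (h8.cn rfl).2 k (by rwa [h2])
    rw [h2] at this
    simpa using this
  have e6 : s₁.narr 6 0 = n * n + C.size := by
    have := h8.cf.1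
    rw [h1, hlen] at this
    simpa using this
  have g30 : ∀ k < n * n + C.size, s₁.farr 30 k = (matList R ++ C.fcode).getD k 0 := by
    intro k hk
    have := h8.cf.2 k (by rwa [h1, hlen])
    rw [h1] at this
    exact this
  have hcl := C.code_length
  refine Impl.drop (impl_copyOut hca e5 e6 (by omega) (by omega) ?_ ?_) ?_
  · intro k hk
    rw [e30 k hk, List.getD_eq_getElem _ _ hk]
    have := C.code_le _ (List.getElem_mem hk)
    omega
  · rw [hcl]; nlinarith
  rintro s₂ ⟨k1, k2, k3⟩
  have hca' : ca < 40 := by omega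
  refine ⟨⟨?_, C, h3, ?_, ?_, ?_⟩, ⟨b₀ + W + 1, by omega, h7.same k1 ?_ ?_ ?_ ?_ ?_⟩,
    (h6.mono (by simp) (by simp)).trans (k1.mono (by simp) (by simp))⟩
  · intro i j
    have hij := idx_lt i.2 j.2
    rw [k3 _ (by omega), g30 _ (by omega),
      List.getD_append _ _ _ _ (by rw [matList_length]; exact hij), matList_getD]
    simp only [Option.elim, hR]
  · simpa only [Option.elim, hR] using h4
  · intro k hk
    rw [k2 k hk, e30 k hk]
  · intro k hk
    rw [k3 _ (by omega), g30 _ (by omega), List.getD_append_right _ _ _ _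
      (by rw [matList_length]; omega), matList_length, Nat.add_sub_cancel_left]
  all_goals (simp; omega)

/-- The masks of the algorithm itself. All are independent samples, and multiplication by a mask
takes time `Õ(n²)` by its circuit. -/
theorem maskOps_sample {S : Prog F} {n W τ σ w v m : ℕ}
    (hS : S.HaltsWithin (initState n [] []) τ v (OutputsTrapdooredPair n σ))
    (hv : v ≤ W) (hτ : τ < W) (hW : n * n + n + 3 * σ + 3 ≤ W) (hw : n * n + 4 * σ + n + 10 ≤ w)
    (hw' : W + S.slow true ≤ w) :
    MaskOps n W w (sampleTime S n W τ σ) (n * ((σ + n) * 200 + 200) + 40) m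
      (fun i => sampleTo S (31 + i)) (fun i => circApply (31 + i)) (fun _ => sampledMat S τ n)
      (fun _ => True) (HoldsCirc σ) where
  ctx := fun _ _ _ _ => trivial
  aux := fun R nf ff h => h.mat
  gen := by
    intro i hi t ht b s hb hs h11 _
    refine (impl_sampleTo (by omega) hS hv hτ hW hs hb hw').imp ?_
    rintro R s' ⟨h1, h2, h3⟩
    exact ⟨h1, h2, h3.mono (by intro a; simp; omega) (by intro a; simp; omega)⟩
  app := by
    intro i hi inp hinp out hout hio s A R h0 hR hA
    exact impl_circApply h0 hR hA (by omega) hinp hout hio hw le_rfl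

/-! ### Masks for the hybrid argument -/

/-- The mask with number `narr 16 [0]` is the input, earlier masks are samples and later ones are
random. -/
def hybridMask (S : Prog F) (i : ℕ) : Prog F :=
  .cond (.lt (.add (.mul (.lit 2) (V 11)) (.lit i)) (V 16)) (sampleTo S (31 + i))
    (.cond (.eq (.add (.mul (.lit 2) (V 11)) (.lit i)) (V 16))
      (mapL (31 + i) (.lit 0) (.read 0 (V 8))) (fillRand (31 + i)))

/-- The distributions of the masks in the hybrid argument. -/
noncomputable def hybrid {n : ℕ} (ρ ρ' : PMF (Mat F n)) (h j : ℕ) : PMF (Mat F n) :=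
  if j < h then ρ else if j = h then ρ' else PMF.uniformOfFintype (Mat F n)

/-- The masks of the test. No circuit is known for the input matrix or for uniform masks, so masks
are multiplied naively; polynomial time is all that is required here. The context records that a
trial changes neither the position `h` nor the input `R₀`. -/
theorem maskOps_hybrid {S : Prog F} {n W τ σ w v m h : ℕ} {R₀ : Mat F n}
    (hS : S.HaltsWithin (initState n [] []) τ v (OutputsTrapdooredPair n σ))
    (hv : v ≤ W) (hτ : τ < W) (hW : n * n + n + 3 * σ + 3 ≤ W) (hw : n * n + n ≤ w)
    (hm : 2 * m + 2 ≤ w) (hh : h ≤ w) (hw' : W + S.slow true ≤ w) :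
    MaskOps n W w (sampleTime S n W τ σ + 60) (n * n * (n * 100 + 100) + 20) m
      (hybridMask S) (fun i inp out => naive inp (31 + i) out)
      (hybrid (sampledMat S τ n) (PMF.pure R₀) h)
      (fun s => s.narr 16 0 = h ∧ HasMat s 0 R₀) (fun R _ ff => ∀ i j : Fin n, ff (i * n + j) = R i j)
    where
  ctx := fun s s' ⟨h1, h2⟩ hs => ⟨by rw [hs.n 16 (by decide), h1], h2.same hs⟩
  aux := fun R nf ff h => h
  gen := by
    rintro i hi t ht b s hb hs h11 ⟨h16, h0⟩
    have hslow := S.slow_pos true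
    have hidx' : (NExp.add (.mul (.lit 2) (V 11)) (.lit i)).peak s ≤ w := by
      simp only [NExp.peak, NExp.eval, h11]; omega
    refine Impl.cond (t₁ := sampleTime S n W τ σ + 50) ?_ ?_ ?_ (by simp only [BExp.cost, NExp.cost]; omega)
    · simp only [BExp.peak, max_le_iff]
      refine ⟨hidx', ?_⟩
      simp only [NExp.peak, NExp.eval, h16]; omega
    · intro hc
      simp only [BExp.eval, NExp.eval, h11, h16, decide_eq_true_eq] at hc
      rw [hybrid, if_pos hc]
      set s₁ := s.charge _ _ with hs₁
      have f1 : Same [] [] s s₁ := Same.charge _ _ _ _ _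
      refine (impl_sampleTo (by omega) hS hv hτ hW (hs.same f1) hb hw').mono (by omega) ?_
      rintro R - s' ⟨h1, h2, h3⟩
      exact ⟨h1.mat, h2, (f1.mono (by simp) (by simp)).trans
        (h3.mono (by intro a; simp; omega) (by intro a; simp; omega))⟩
    · intro hc
      simp only [BExp.eval, NExp.eval, h11, h16, decide_eq_false_iff_not] at hc
      set s₁ := s.charge _ _ with hs₁
      have f1 : Same [] [] s s₁ := Same.charge _ _ _ _ _
      have e11 : s₁.narr 11 0 = t := h11
      have e16 : s₁.narr 16 0 = h := h16
      have hidx₁' : (NExp.add (.mul (.lit 2) (V 11)) (.lit i)).peak s₁ ≤ w := by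
        simp only [NExp.peak, NExp.eval, e11]; omega
      refine Impl.cond (t₁ := sampleTime S n W τ σ + 30) ?_ ?_ ?_ (by simp only [BExp.cost, NExp.cost]; omega)
      · simp only [BExp.peak, max_le_iff]
        refine ⟨hidx₁', ?_⟩
        simp only [NExp.peak, NExp.eval, e16]; omega
      · intro hc'
        simp only [BExp.eval, NExp.eval, e11, e16, decide_eq_true_eq] at hc'
        rw [hybrid, if_neg hc, if_pos hc']
        set s₂ := s₁.charge _ _ with hs₂
        have f2 : Same [] [] s s₂ := f1.trans (Same.charge _ _ _ _ _)
        refine Impl.drop (impl_mapL (n := n) (o := 0) (fun x => s₂.farr 0 x) hs.size (by omega)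
          (by omega) ?_ (by simp only [sampleTime, NExp.cost, FExp.cost]; omega)) ?_
        · rintro x s' hx g1 g2 g8
          simp only [FExp.eval, FExp.peak, NExp.eval, NExp.peak, g8, g2 0 (by omega), true_and]
          omega
        · rintro s₃ ⟨g1, g2, g3, -⟩
          refine ⟨?_, ((hs.same f2).same g1 (by decide) (by decide) (by decide) (by decide)
            (by simp; omega)).mono (by omega), (f2.mono (by simp) (by simp)).trans
              (g1.mono (by intro a; simp; omega) (by intro a; simp; omega))⟩
          intro k l
          rw [← Nat.zero_add ((k : ℕ) * n + l), g3 _ (idx_lt k.2 l.2)]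
          exact h0 k l
      · intro hc'
        simp only [BExp.eval, NExp.eval, e11, e16, decide_eq_false_iff_not] at hc'
        rw [hybrid, if_neg hc, if_neg hc']
        set s₂ := s₁.charge _ _ with hs₂
        have f2 : Same [] [] s s₂ := f1.trans (Same.charge _ _ _ _ _)
        refine (impl_fillRand (n := n) (s := s₂) (t := sampleTime S n W τ σ + 30) hs.size (by omega)
          (by simp only [sampleTime]; omega)).imp ?_
        rintro R s₃ ⟨g1, g2⟩
        exact ⟨g2, ((hs.same f2).same g1 (by decide) (by decide) (by decide) (by decide)
            (by simp; omega)).mono (by omega), (f2.mono (by simp) (by simp)).trans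
              (g1.mono (by intro a; simp; omega) (by intro a; simp; omega))⟩
  app := by
    intro i hi inp hinp out hout hio s A R h0 hR hA
    refine (impl_naive h0 hw hA hR (by omega) (by omega) (by omega) le_rfl).imp ?_
    rintro - s' ⟨h1, h2⟩
    exact ⟨h1, h2⟩

/-! ### Reduction of a product to products of random matrices -/

/-- The expression `(n + 2) ^ k`. -/
def powExp : ℕ → NExp
  | 0 => .lit 1
  | k + 1 => .mul (powExp k) (.add (V 0) (.lit 2))

theorem powExp_eval {n : ℕ} {s : State F} (h0 : s.narr 0 0 = n) (k : ℕ) :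
    (powExp k).eval s = (n + 2) ^ k ∧ (powExp k).peak s ≤ (n + 2) ^ (k + 1) ∧
      (powExp k).cost ≤ 6 * k + 1 := by
  induction k with
  | zero => simp [powExp, NExp.eval, NExp.peak, NExp.cost]
  | succ k ih =>
    obtain ⟨h1, h2, h3⟩ := ih
    have h4 : (n + 2) ^ (k + 1) ≤ (n + 2) ^ (k + 1 + 1) := Nat.pow_le_pow_right (by omega) (by omega)
    have h5 : n + 2 ≤ (n + 2) ^ (k + 1 + 1) := Nat.le_self_pow (by omega) _
    simp only [powExp, NExp.eval, NExp.peak, NExp.cost, h1, h0]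
    refine ⟨by ring, ?_, by omega⟩
    rw [← pow_succ]
    simp only [max_le_iff]
    omega

/-- `dst` receives an estimate of the product of the matrix in `p` and the transpose of the one in
`q`. -/
noncomputable def prodStep (gm : ℕ → Prog F) (ap : ℕ → ℕ → ℕ → Prog F) (M : Prog F)
    (p q dst : ℕ) : Prog F :=
  .seq (mapL 10 (.lit 0) (.read p (V 8))) (.seq (mapL 11 (.lit 0) (.read q (V 8)))
    (.seq (core gm ap M) (mapL dst (.lit 0) (.read 24 (V 8)))))

theorem impl_copy {src dst n w t : ℕ} {s : State F} {A : Mat F n} (h0 : s.narr 0 0 = n)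
    (hA : HasMat s src A) (hsd : src ≠ dst) (hw : n * n + n ≤ w) (ht : n * n * 30 + 20 ≤ t) :
    Impl (mapL dst (.lit 0) (.read src (V 8)) : Prog F) s t w (PMF.pure ()) fun _ s' =>
      HasMat s' dst A ∧ Same [8] [min dst 40] s s' := by
  refine (impl_mapL (n := n) (o := 0) (fun x => s.farr src x) h0 (by omega) (by omega) ?_
    (by simp only [NExp.cost, FExp.cost]; omega)).imp ?_
  · rintro x s' hx g1 g2 g8
    simp only [FExp.eval, FExp.peak, NExp.eval, NExp.peak, g8, g2 src hsd, true_and]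
    omega
  · rintro - s₃ ⟨g1, g2, g3, -⟩
    refine ⟨fun i j => ?_, g1⟩
    rw [← Nat.zero_add ((i : ℕ) * n + j), g3 _ (idx_lt i.2 j.2)]
    exact hA i j

theorem impl_prodStep {n W w tg ta m b T v p q dst : ℕ} [NeZero n] {gm : ℕ → Prog F}
    {ap : ℕ → ℕ → ℕ → Prog F} {ν : ℕ → PMF (Mat F n)} {Ctx : State F → Prop}
    {Aux : Mat F n → (ℕ → ℕ) → (ℕ → F) → Prop} (h : MaskOps n W w tg ta m gm ap ν Ctx Aux)
    {M : Prog F} (hM : ∀ A B : Mat F n, M.HaltsWithin (initState n (matList A) (matList B)) T v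
      fun s => s.fOut.length = n * n) (hv : v ≤ W) (hnW : n * n ≤ W)
    {X Y : Mat F n} {s : State F} (hs : WinLe n W b s) (h3 : s.narr 3 0 = m)
    (hX : HasMat s p X) (hY : HasMat s q Y) (hctx : Ctx s)
    (hp : p ≠ 10) (hq : q < 40 ∧ q ≠ 10 ∧ q ≠ 11) (hdst : dst < 40 ∧ dst ≠ 24)
    (hw : b + m * (3 * (W + 1)) + m * (n * n) + n * n + 3 * n + m + Fintype.card Fˣ + 1 ≤ w)
    (hw' : W + M.slow false ≤ w) :
    Impl (prodStep gm ap M p q dst) s (coreTime F M n W T tg ta m + n * n * 90 + 60) w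
      (coreDist (cutDist M T W) ν m X Y) fun Z s' =>
      HasMat s' dst Z ∧ WinLe n W (b + m * (3 * (W + 1))) s' ∧
      Same coreN (10 :: 11 :: dst :: coreF) s s' := by
  refine Impl.seq_pure (a := ()) (t₁ := n * n * 30 + 20)
    (t₂ := coreTime F M n W T tg ta m + n * n * 60 + 40)
    (impl_copy hs.size hX hp (by omega) le_rfl) ?_ (by omega)
  rintro s₁ ⟨h1, f1⟩
  have f1' : Same (3 :: 10 :: 11 :: 17 :: 18 :: 19 :: trialN)
      (7 :: 10 :: 11 :: 12 :: 24 :: trialF) s s₁ := f1.mono (by simp) (by simp)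
  refine Impl.seq_pure (a := ()) (t₁ := n * n * 30 + 20)
    (t₂ := coreTime F M n W T tg ta m + n * n * 30 + 20)
    (impl_copy (A := Y) (by rw [f1.n 0 (by decide), hs.size]) (hY.same f1 (by simp; omega))
      hq.2.2 (by omega) le_rfl) ?_ (by omega)
  rintro s₂ ⟨h2, f2⟩
  refine Impl.seq (t₁ := coreTime F M n W T tg ta m) (t₂ := n * n * 30 + 20)
    (impl_core h hM hv hnW ((hs.same f1).same f2) (by rw [f2.n 3 (by decide), f1.n 3 (by decide), h3])
      (h1.same f2) h2 (h.ctx _ _ (h.ctx _ _ hctx f1') (f2.mono (by simp) (by simp))) hw hw')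
    (f := fun Z => PMF.pure Z) ?_ (by omega) |> fun h => by rwa [PMF.bind_pure] at h
  rintro Z s₃ ⟨k1, k2, k3⟩
  refine Impl.drop (impl_copy k2.size k1 (by omega) (by omega) le_rfl) ?_
  rintro s₄ ⟨h4, f4⟩
  refine ⟨h4, k2.same f4 (by decide) (by decide) (by decide) (by decide) (by simp; omega),
    (f1.mono (by simp) (by simp)).trans ((f2.mono (by simp) (by simp)).trans
      ((k3.mono (by simp) (by simp)).trans (f4.mono (by simp) (by simp; omega))))⟩

/-- The sum of four estimated products, for random summands of the factors. -/
noncomputable def splitDist {n : ℕ} (κ : Mat F n → Mat F n → PMF (Mat F n)) (A B : Mat F n) :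
    PMF (Mat F n) :=
  (PMF.uniformOfFintype (Mat F n)).bind fun U => (PMF.uniformOfFintype (Mat F n)).bind fun V =>
    (κ U V).bind fun P₁ => (κ U (B.transpose - V)).bind fun P₂ =>
      (κ (A - U) V).bind fun P₃ => (κ (A - U) (B.transpose - V)).bind fun P₄ =>
        PMF.pure (P₁ + P₂ + P₃ + P₄)

/-- Split the input matrices at random. -/
def splitProg (k₀ C : ℕ) : Prog F :=
  .seq (.seq (.nset 1 (.lit 0) (powExp k₀)) (.nset 2 (.lit 0) (.lit 0))) (.seq (logProg C)
    (.seq (fillRand 2) (.seq (fillRand 3)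
      (.seq (mapL 4 (.lit 0) (.sub (.read 0 (V 8)) (.read 2 (V 8))))
        (mapL 5 (.lit 0) (.sub (.read 1 (.add (.mul (.mod (V 8) (V 0)) (V 0)) (.div (V 8) (V 0))))
          (.read 3 (V 8))))))))

/-- Multiply the input matrices by means of `M` and masks. -/
noncomputable def splitMul (gm : ℕ → Prog F) (ap : ℕ → ℕ → ℕ → Prog F) (M : Prog F)
    (k₀ C : ℕ) : Prog F :=
  .seq (splitProg k₀ C) (.seq (prodStep gm ap M 2 3 25) (.seq (prodStep gm ap M 2 5 26)
    (.seq (prodStep gm ap M 4 3 27) (.seq (prodStep gm ap M 4 5 28)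
      (emitAll (.add (.add (.add (.read 25 (V 8)) (.read 26 (V 8))) (.read 27 (V 8)))
        (.read 28 (V 8))))))))

theorem impl_splitProg {n w k₀ C : ℕ} {A B : Mat F n} {s : State F}
    (hs : Same [] [] (initState n (matList A) (matList B)) s)
    (hw : (n + 2) ^ (k₀ + 1) + n * n + 2 * n + C * n + C + 2 ≤ w) :
    Impl (splitProg k₀ C) s
      (n * n * 160 + n * 60 + 6 * k₀ + 260) w
      ((PMF.uniformOfFintype (Mat F n)).bind fun U => (PMF.uniformOfFintype (Mat F n)).bind fun V =>
        PMF.pure (U, V)) fun UV s' =>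
      WinLe n ((n + 2) ^ k₀) 0 s' ∧ s'.narr 3 0 = C * Nat.clog 2 n ∧ s'.fOut = [] ∧
      HasMat s' 2 UV.1 ∧ HasMat s' 3 UV.2 ∧ HasMat s' 4 (A - UV.1) ∧
      HasMat s' 5 (B.transpose - UV.2) := by
  have h0 : s.narr 0 0 = n := by rw [hs.n 0 (by simp)]; rfl
  obtain ⟨p1, p2, p3⟩ := powExp_eval h0 k₀
  have hA : HasMat s 0 A := HasMat.same (fun i j => matList_getD A i j) hs (by simp)
  have hB : HasMat s 1 B := HasMat.same (fun i j => matList_getD B i j) hs (by simp)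
  refine Impl.seq_pure (a := ()) (t₁ := 6 * k₀ + 20) (t₂ := n * n * 160 + n * 60 + 240)
    (Q := fun _ s₁ => Win n ((n + 2) ^ k₀) 0 s₁ ∧ Same [1, 2] [] s s₁) ?_ ?_ (by omega)
  · refine Impl.exec (by rfl) (by simp only [Prog.tbound, NExp.cost]; omega) ?_ ?_
    · simp only [Prog.exec, State.setN, State.charge, NExp.peak, p1]
      omega
    · refine ⟨⟨?_, ?_, ?_, ?_⟩, ((Same.charge _ _ _ _ _).trans (Same.setN _ _ _ _ (by simp))).trans
        ((Same.charge _ _ _ _ _).trans (Same.setN _ _ _ _ (by simp)))⟩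
      · simp [Prog.exec, State.setN, State.charge, NExp.eval, h0]
      · simp [Prog.exec, State.setN, State.charge, NExp.eval, p1]
      · simp [Prog.exec, State.setN, State.charge, NExp.eval]
      · intro a i ha _
        have a0 : a ≠ 0 := by omega
        have a1 : a ≠ 1 := by omega
        have a2 : a ≠ 2 := by omega
        have h1 : s.narr a = _ := hs.n a (by simp)
        have h2 : s.farr a = _ := hs.f a (by simp)
        simp [Prog.exec, State.setN, State.charge, NExp.eval, h1, h2, initState, a0, a1, a2]
  rintro s₁ ⟨w1, f1⟩
  refine Impl.seq_pure (a := ()) (t₁ := n * 60 + 60) (t₂ := n * n * 160 + 180)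
    (impl_logProg (n := n) (C := C) w1.size (by omega) le_rfl) ?_ (by omega)
  rintro s₂ ⟨f2, h3⟩
  have w2 := w1.same f2
  have g2 : Same [1, 2, 3, 8, 19] [2, 3, 4, 5] s s₂ :=
    (f1.mono (by simp) (by simp)).trans (f2.mono (by simp) (by simp))
  refine Impl.seq (t₁ := n * n * 40 + 40) (t₂ := n * n * 120 + 140)
    (impl_fillRand (n := n) (dst := 2) w2.size (by omega) le_rfl) ?_ ?_
  on_goal 2 => omega
  rintro U s₃ ⟨f3, hU⟩
  have w3 := w2.same f3
  have g3 := g2.trans (f3.mono (by simp) (by simp))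
  refine Impl.seq (t₁ := n * n * 40 + 40) (t₂ := n * n * 80 + 100)
    (impl_fillRand (n := n) (dst := 3) w3.size (by omega) le_rfl) ?_ ?_
  on_goal 2 => omega
  rintro V' s₄ ⟨f4, hV⟩
  have w4 := w3.same f4
  have g4 := g3.trans (f4.mono (by simp) (by simp))
  refine Impl.seq_pure (a := ()) (t₁ := n * n * 35 + 20) (t₂ := n * n * 45 + 60)
    (impl_mapL (n := n) (o := 0) (fun x => s.farr 0 x - s₄.farr 2 x) w4.size (by omega) (by omega)
      ?_ (by simp only [NExp.cost, FExp.cost]; omega)) ?_ (by omega)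
  · rintro x s' hx k1 k2 k8
    simp only [FExp.eval, NExp.eval, FExp.peak, NExp.peak, k8, k2 0 (by decide),
      k2 2 (by decide), g4.f 0 (by decide), true_and]
    omega
  rintro s₅ ⟨f5, -, h5, -⟩
  have w5 := w4.same f5
  have g5 := g4.trans (f5.mono (by simp) (by simp))
  refine Impl.drop (impl_mapL (n := n) (o := 0)
    (fun x => s.farr 1 (x % n * n + x / n) - s₅.farr 3 x) w5.size (by omega) (by omega) ?_
      (by simp only [NExp.cost, FExp.cost]; omega)) ?_
  · rintro x s' hx k1 k2 k8
    obtain ⟨-, hx1, hx2, -, hx4⟩ := div_mod_facts hx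
    have e0 : s'.narr 0 0 = n := by rw [k1.n 0 (by decide), w5.size]
    have := Nat.div_le_self x n
    simp only [FExp.eval, NExp.eval, FExp.peak, NExp.peak, k8, k2 1 (by decide),
      k2 3 (by decide), g5.f 1 (by decide), true_and, e0]
    generalize x / n = d at *
    generalize x % n = r at *
    omega
  rintro s₆ ⟨f6, -, h6, -⟩
  refine ⟨⟨0, le_rfl, w5.same f6⟩, ?_, ?_, ?_, ?_, ?_, ?_⟩
  · rw [f6.n 3 (by decide), f5.n 3 (by decide), f4.n 3 (by decide), f3.n 3 (by decide), h3]
  · rw [f6.fo, g5.fo, hs.fo]; rfl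
  · exact ((hU.same f4).same f5).same f6
  · exact (hV.same f5).same f6
  · refine HasMat.same (s := s₅) ?_ f6
    intro i j
    rw [← Nat.zero_add ((i : ℕ) * n + j), h5 _ (idx_lt i.2 j.2), hA i j, hU.same f4 (by decide) i j]
    rfl
  · intro i j
    rw [← Nat.zero_add ((i : ℕ) * n + j), h6 _ (idx_lt i.2 j.2), idx_div j.2, idx_mod j.2, hB j i,
      hV.same f5 (by decide) i j]
    rfl

/-- Time for `splitMul`. -/
def splitTime (F : Type*) [Field F] [Fintype F] [DecidableEq F] (M : Prog F)
    (n W T tg ta m k₀ : ℕ) : ℕ :=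
  4 * coreTime F M n W T tg ta m + n * n * 600 + n * 60 + 6 * k₀ + 600

theorem impl_splitMul {n w tg ta T v k₀ C : ℕ} [NeZero n] {gm : ℕ → Prog F}
    {ap : ℕ → ℕ → ℕ → Prog F} {ν : ℕ → PMF (Mat F n)} {Ctx : State F → Prop}
    {Aux : Mat F n → (ℕ → ℕ) → (ℕ → F) → Prop}
    (h : MaskOps n ((n + 2) ^ k₀) w tg ta (C * Nat.clog 2 n) gm ap ν Ctx Aux) (hctx : ∀ s, Ctx s)
    {M : Prog F} (hM : ∀ A B : Mat F n, M.HaltsWithin (initState n (matList A) (matList B)) T v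
      fun s => s.fOut.length = n * n) (hv : v ≤ (n + 2) ^ k₀) (hnW : n * n ≤ (n + 2) ^ k₀)
    (A B : Mat F n) {s : State F} (hs : Same [] [] (initState n (matList A) (matList B)) s)
    (hw : (n + 2) ^ (k₀ + 1) + C * Nat.clog 2 n * (12 * ((n + 2) ^ k₀ + 1)) +
      C * Nat.clog 2 n * (n * n) + n * n + 3 * n + C * Nat.clog 2 n + C * n + C +
      Fintype.card Fˣ + 2 ≤ w)
    (hw' : (n + 2) ^ k₀ + M.slow false ≤ w) :
    Impl (splitMul gm ap M k₀ C) s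
      (splitTime F M n ((n + 2) ^ k₀) T tg ta (C * Nat.clog 2 n) k₀) w
      (splitDist (coreDist (cutDist M T ((n + 2) ^ k₀)) ν (C * Nat.clog 2 n)) A B) fun P s' =>
      s'.fOut.length = n * n ∧ s'.outMat n = P := by
  set m := C * Nat.clog 2 n with hm
  set W := (n + 2) ^ k₀ with hW
  set κ := coreDist (cutDist M T W) ν m with hκ
  set ct := coreTime F M n W T tg ta m with hct
  -- Four products, each with `m` trials of three windows.
  have e12 : m * (12 * (W + 1)) = 4 * (m * (3 * (W + 1))) := by ring
  set q := m * (3 * (W + 1)) with hq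
  unfold splitTime
  have hd : splitDist κ A B = ((PMF.uniformOfFintype (Mat F n)).bind fun U =>
      (PMF.uniformOfFintype (Mat F n)).bind fun V => PMF.pure (U, V)).bind fun UV =>
        (κ UV.1 UV.2).bind fun P₁ => (κ UV.1 (B.transpose - UV.2)).bind fun P₂ =>
      (κ (A - UV.1) UV.2).bind fun P₃ => (κ (A - UV.1) (B.transpose - UV.2)).bind fun P₄ =>
        PMF.pure (P₁ + P₂ + P₃ + P₄) := by
    simp [splitDist, PMF.bind_bind]
  rw [hd]
  refine Impl.seq (t₁ := n * n * 160 + n * 60 + 6 * k₀ + 260) (t₂ := 4 * ct + n * n * 440 + 340)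
    (impl_splitProg hs (by omega)) ?_ ?_
  on_goal 2 => omega
  rintro ⟨U, V'⟩ s₁ ⟨w1, h3, ho, hU, hV, hU', hV'⟩
  dsimp only at hU hV hU' hV' ⊢
  refine Impl.seq (t₁ := ct + n * n * 90 + 60) (t₂ := 3 * ct + n * n * 350 + 280)
    (impl_prodStep h hM hv hnW w1 h3 hU hV (hctx _) (by decide) (by decide) (by decide)
      (by omega) hw') ?_ ?_
  on_goal 2 => omega
  rintro P₁ s₂ ⟨c1, w2, f2⟩
  have h3₂ : s₂.narr 3 0 = m := by rw [f2.n 3 (by decide), h3]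
  refine Impl.seq (t₁ := ct + n * n * 90 + 60) (t₂ := 2 * ct + n * n * 260 + 220)
    (impl_prodStep h hM hv hnW w2 h3₂ (hU.same f2) (hV'.same f2) (hctx _) (by decide) (by decide)
      (by decide) (by omega) hw') ?_ ?_
  on_goal 2 => omega
  rintro P₂ s₃ ⟨c2, w3, f3⟩
  have h3₃ : s₃.narr 3 0 = m := by rw [f3.n 3 (by decide), h3₂]
  refine Impl.seq (t₁ := ct + n * n * 90 + 60) (t₂ := ct + n * n * 170 + 160)
    (impl_prodStep h hM hv hnW w3 h3₃ ((hU'.same f2).same f3) ((hV.same f2).same f3) (hctx _)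
      (by decide) (by decide) (by decide) (by omega) hw') ?_ ?_
  on_goal 2 => omega
  rintro P₃ s₄ ⟨c3, w4, f4⟩
  have h3₄ : s₄.narr 3 0 = m := by rw [f4.n 3 (by decide), h3₃]
  refine Impl.seq (t₁ := ct + n * n * 90 + 60) (t₂ := n * n * 80 + 100)
    (impl_prodStep h hM hv hnW w4 h3₄ (((hU'.same f2).same f3).same f4)
      (((hV'.same f2).same f3).same f4) (hctx _)
      (by decide) (by decide) (by decide) (by omega) hw') ?_ ?_
  on_goal 2 => omega
  rintro P₄ s₅ ⟨c4, w5, f5⟩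
  have d1 : HasMat s₅ 25 P₁ := ((c1.same f3).same f4).same f5
  have d2 : HasMat s₅ 26 P₂ := (c2.same f4).same f5
  have d3 : HasMat s₅ 27 P₃ := c3.same f5
  refine Impl.drop (impl_emitAll (n := n) (A := P₁ + P₂ + P₃ + P₄) w5.size ?_ ?_ (by omega)
    (by simp only [NExp.cost, FExp.cost]; omega)) (fun _ h => h)
  · rw [f5.fo, f4.fo, f3.fo, f2.fo, ho]
  · intro i j s' h8 hn hf
    have := idx_lt i.2 j.2
    simp only [FExp.eval, FExp.peak, NExp.eval, NExp.peak, h8, hf, d1 i j, d2 i j, d3 i j, c4 i j,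
      Matrix.add_apply, true_and]
    omega

/-- Multiply the input matrices by the naive algorithm. -/
def naiveMul : Prog F :=
  .seq (mapL 2 (.lit 0) (.read 1 (.add (.mul (.mod (V 8) (V 0)) (V 0)) (.div (V 8) (V 0)))))
    (.seq (naive 0 2 25) (emitAll (.read 25 (V 8))))

theorem impl_naiveMul {n w t : ℕ} {s : State F} {A B : Mat F n} (h0 : s.narr 0 0 = n)
    (hA : HasMat s 0 A) (hB : HasMat s 1 B) (ho : s.fOut = []) (hw : n * n + n + 1 ≤ w)
    (ht : n * n * (n * 100 + 300) + 100 ≤ t) :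
    Impl (naiveMul : Prog F) s t w (PMF.pure ()) fun _ s' =>
      s'.fOut.length = n * n ∧ s'.outMat n = A * B := by
  have e : n * n * (n * 100 + 300) = n * n * (n * 100 + 100) + n * n * 200 := by ring
  obtain ⟨G, hG⟩ : ∃ G, G = n * n * (n * 100 + 100) := ⟨_, rfl⟩
  rw [e, ← hG] at ht
  clear e
  refine Impl.seq_pure (a := ()) (t₁ := n * n * 50 + 20) (t₂ := G + n * n * 150 + 80)
    (impl_mapL (n := n) (o := 0) (fun x => s.farr 1 (x % n * n + x / n)) h0 (by omega) (by omega) ?_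
      (by simp only [NExp.cost, FExp.cost]; omega)) ?_ (by omega)
  · rintro x s' hx k1 k2 k8
    obtain ⟨-, hx1, hx2, -, hx4⟩ := div_mod_facts hx
    have e0 : s'.narr 0 0 = n := by rw [k1.n 0 (by decide), h0]
    simp only [FExp.eval, NExp.eval, FExp.peak, NExp.peak, k8, k2 1 (by decide), true_and, e0]
    generalize x / n = d at *
    generalize x % n = r at *
    omega
  rintro s₁ ⟨f1, -, h1, -⟩
  have hB' : HasMat s₁ 2 B.transpose := by
    intro i j
    rw [← Nat.zero_add ((i : ℕ) * n + j), h1 _ (idx_lt i.2 j.2), idx_div j.2, idx_mod j.2, hB j i]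
    rfl
  refine Impl.seq_pure (a := ()) (t₁ := G + 20) (t₂ := n * n * 150 + 60)
    (impl_naive (n := n) (by rw [f1.n 0 (by decide), h0]) (by omega) (hA.same f1) hB' (by decide)
      (by decide) (by decide) (by rw [hG])) ?_ (by omega)
  rintro s₂ ⟨f2, h2⟩
  rw [Matrix.transpose_transpose] at h2
  refine impl_emitAll (n := n) (by rw [f2.n 0 (by decide), f1.n 0 (by decide), h0])
    (by rw [f2.fo, f1.fo, ho]) ?_ hw (by simp only [NExp.cost, FExp.cost]; omega)
  intro i j s' h8 hn hf
  have := idx_lt i.2 j.2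
  simp only [FExp.eval, FExp.peak, NExp.eval, NExp.peak, h8, hf, h2 i j, true_and]
  omega

/-- Multiply the input matrices, by the naive algorithm if they have fewer than `N₀` rows. -/
noncomputable def mainProg (gm : ℕ → Prog F) (ap : ℕ → ℕ → ℕ → Prog F) (M : Prog F)
    (k₀ C N₀ : ℕ) : Prog F :=
  .cond (.lt (V 0) (.lit N₀)) naiveMul (splitMul gm ap M k₀ C)

/-- Time for `mainProg`. -/
def mainTime (F : Type*) [Field F] [Fintype F] [DecidableEq F] (M : Prog F)
    (n W T tg ta m k₀ : ℕ) : ℕ :=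
  splitTime F M n W T tg ta m k₀ + 10

theorem impl_mainProg_small {n w k₀ C N₀ : ℕ} {gm : ℕ → Prog F} {ap : ℕ → ℕ → ℕ → Prog F}
    {M : Prog F} (A B : Mat F n) (hn : n < N₀) (hw : n * n + n + N₀ + 1 ≤ w) :
    Impl (mainProg gm ap M k₀ C N₀) (initState n (matList A) (matList B))
      (n * n * (n * 100 + 300) + 110) w (PMF.pure (A * B)) fun P s' =>
      s'.fOut.length = n * n ∧ s'.outMat n = P := by
  have h0 : (initState n (matList A) (matList B)).narr 0 0 = n := rfl
  refine Impl.cond (t₁ := n * n * (n * 100 + 300) + 100) ?_ ?_ ?_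
    (by simp only [BExp.cost, NExp.cost]; omega)
  · simp only [BExp.peak, NExp.peak, NExp.eval, h0]; omega
  · intro _
    refine Impl.drop (impl_naiveMul (n := n) h0 (fun i j => matList_getD A i j)
      (fun i j => matList_getD B i j) rfl (by omega) le_rfl) (fun _ h => h)
  · intro hb
    simp only [BExp.eval, NExp.eval, h0, decide_eq_false_iff_not] at hb
    omega

theorem impl_mainProg_large {n w tg ta T v k₀ C N₀ : ℕ} [NeZero n] {gm : ℕ → Prog F}
    {ap : ℕ → ℕ → ℕ → Prog F} {ν : ℕ → PMF (Mat F n)} {Ctx : State F → Prop}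
    {Aux : Mat F n → (ℕ → ℕ) → (ℕ → F) → Prop} (hn : N₀ ≤ n)
    (h : MaskOps n ((n + 2) ^ k₀) w tg ta (C * Nat.clog 2 n) gm ap ν Ctx Aux) (hctx : ∀ s, Ctx s)
    {M : Prog F} (hM : ∀ A B : Mat F n, M.HaltsWithin (initState n (matList A) (matList B)) T v
      fun s => s.fOut.length = n * n) (hv : v ≤ (n + 2) ^ k₀) (hnW : n * n ≤ (n + 2) ^ k₀)
    (A B : Mat F n)
    (hw : (n + 2) ^ (k₀ + 1) + C * Nat.clog 2 n * (12 * ((n + 2) ^ k₀ + 1)) +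
      C * Nat.clog 2 n * (n * n) + n * n + 3 * n + C * Nat.clog 2 n + C * n + C +
      Fintype.card Fˣ + 2 ≤ w)
    (hw' : (n + 2) ^ k₀ + M.slow false ≤ w) :
    Impl (mainProg gm ap M k₀ C N₀) (initState n (matList A) (matList B))
      (mainTime F M n ((n + 2) ^ k₀) T tg ta (C * Nat.clog 2 n) k₀) w
      (splitDist (coreDist (cutDist M T ((n + 2) ^ k₀)) ν (C * Nat.clog 2 n)) A B) fun P s' =>
      s'.fOut.length = n * n ∧ s'.outMat n = P := by
  have h0 : (initState n (matList A) (matList B)).narr 0 0 = n := rfl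
  unfold mainTime
  refine Impl.cond (t₁ := splitTime F M n ((n + 2) ^ k₀) T tg ta (C * Nat.clog 2 n) k₀) ?_ ?_ ?_
    (by simp only [BExp.cost, NExp.cost]; omega)
  · simp only [BExp.peak, NExp.peak, NExp.eval, h0]; omega
  · intro hb
    simp only [BExp.eval, NExp.eval, h0, decide_eq_true_eq] at hb
    omega
  · intro _
    exact impl_splitMul h hctx hM hv hnW A B (Same.charge _ _ _ _ _) hw hw'

/-! ### The distinguisher -/

/-- Test the plurality of estimates on random matrices, where the input is used as a mask. -/
noncomputable def distinguisher (S M : Prog F) (k₀ C : ℕ) : Prog F :=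
  .cond (.lt (V 0) (.lit 2)) .skip
    (.seq (.seq (.nset 1 (.lit 0) (powExp k₀)) (.nset 2 (.lit 0) (.lit 0))) (.seq (logProg C)
      (.seq (fillRand 10) (.seq (fillRand 11)
        (.seq (.nrand 16 (.lit 0) (.sub (.mul (.lit 2) (V 3)) (.lit 1)))
          (.seq (core (hybridMask S) (fun i inp out => naive inp (31 + i) out) M)
            (.seq (naive 10 11 12) (compareProg 24 12))))))))

/-- The distribution of the result of the test for the input `R`. -/
noncomputable def testDist {n : ℕ} [NeZero n] (μ : Mat F n → Mat F n → PMF (Mat F n))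
    (ρ : PMF (Mat F n)) (m : ℕ) [NeZero (2 * m)] (R : Mat F n) : PMF Bool :=
  (PMF.uniformOfFintype (Mat F n)).bind fun X => (PMF.uniformOfFintype (Mat F n)).bind fun Y =>
    (PMF.uniformOfFintype (Fin (2 * m))).bind fun h =>
      (coreDist μ (hybrid ρ (PMF.pure R) h) m X Y).bind fun Z =>
        PMF.pure (decide (Z = X * Y.transpose))

/-- Time for `distinguisher`. -/
def testTime (F : Type*) [Field F] [Fintype F] [DecidableEq F] (M : Prog F)
    (n W T tg ta m k₀ : ℕ) : ℕ :=
  coreTime F M n W T tg ta m + n * n * (n * 100 + 300) + n * 60 + 6 * k₀ + 600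

theorem impl_distinguisher_small {n w k₀ C : ℕ} {S M : Prog F} (R : Mat F n) (hn : n < 2)
    (hw : 2 ≤ w) :
    Impl (distinguisher S M k₀ C) (initState n (matList R) []) 10 w (PMF.pure ())
      fun _ _ => True := by
  have h0 : (initState n (matList R) []).narr 0 0 = n := rfl
  refine Impl.cond (t₁ := 4) ?_ ?_ ?_ (by simp [BExp.cost, NExp.cost])
  · simp only [BExp.peak, NExp.peak, NExp.eval, h0]; omega
  · intro _
    refine Impl.exec (by rfl) (by simp [Prog.tbound]) ?_ trivial
    simp only [Prog.exec, State.charge]; omega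
  · intro hb
    simp only [BExp.eval, NExp.eval, h0, decide_eq_false_iff_not] at hb
    omega

/-- The test needs a mask number to choose, so it requires a positive number of trials. This
excludes `n < 2`, where `Nat.clog 2 n` is zero. -/
theorem impl_distinguisher_large {n w T τ σ v v' k₀ C : ℕ} [NeZero n] [NeZero (2 * (C * Nat.clog 2 n))]
    {S M : Prog F} (R : Mat F n) (hn : 2 ≤ n)
    (hS : S.HaltsWithin (initState n [] []) τ v' (OutputsTrapdooredPair n σ))
    (hM : ∀ A B : Mat F n, M.HaltsWithin (initState n (matList A) (matList B)) T v
      fun s => s.fOut.length = n * n) (hv : v ≤ (n + 2) ^ k₀) (hv' : v' ≤ (n + 2) ^ k₀)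
    (hτ : τ < (n + 2) ^ k₀) (hσ : n * n + n + 3 * σ + 3 ≤ (n + 2) ^ k₀)
    (hw : (n + 2) ^ (k₀ + 1) + C * Nat.clog 2 n * (3 * ((n + 2) ^ k₀ + 1)) +
      C * Nat.clog 2 n * (n * n) + n * n + 3 * n + 2 * (C * Nat.clog 2 n) + C * n + C +
      Fintype.card Fˣ + 2 ≤ w)
    (hw' : (n + 2) ^ k₀ + M.slow false ≤ w) (hw'' : (n + 2) ^ k₀ + S.slow true ≤ w) :
    Impl (distinguisher S M k₀ C) (initState n (matList R) [])
      (testTime F M n ((n + 2) ^ k₀) T (sampleTime S n ((n + 2) ^ k₀) τ σ + 60)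
        (n * n * (n * 100 + 100) + 20) (C * Nat.clog 2 n) k₀) w
      (testDist (cutDist M T ((n + 2) ^ k₀)) (sampledMat S τ n) (C * Nat.clog 2 n) R) fun b s' =>
      s'.nOut = [if b then 1 else 0] := by
  set m := C * Nat.clog 2 n with hm
  set W := (n + 2) ^ k₀ with hW
  set tg := sampleTime S n W τ σ + 60 with htg
  set ta := n * n * (n * 100 + 100) + 20 with hta
  have hta' : n * n * (n * 100 + 300) = n * n * (n * 100 + 100) + n * n * 200 := by ring
  have hm0 : 0 < m := by have := NeZero.ne (2 * m); omega
  set s₀ := initState n (matList R) [] with hs₀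
  have h0 : s₀.narr 0 0 = n := rfl
  unfold testTime
  set ct := coreTime F M n W T tg ta m with hct
  rw [hta']
  refine Impl.cond (t₁ := ct + (n * n * (n * 100 + 100) + n * n * 200) + n * 60 + 6 * k₀ + 590)
    ?_ ?_ ?_ (by simp only [BExp.cost, NExp.cost]; omega)
  · simp only [BExp.peak, NExp.peak, NExp.eval, h0]; omega
  · intro hb
    simp only [BExp.eval, NExp.eval, h0, decide_eq_true_eq] at hb
    omega
  intro _
  have hs : Same [] [] s₀ (s₀.charge ((BExp.lt (F := F) (V 0) (.lit 2)).cost + 1)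
    ((BExp.lt (F := F) (V 0) (.lit 2)).peak s₀)) := Same.charge _ _ _ _ _
  set s := s₀.charge ((BExp.lt (F := F) (V 0) (.lit 2)).cost + 1)
    ((BExp.lt (F := F) (V 0) (.lit 2)).peak s₀)
  have h0' : s.narr 0 0 = n := rfl
  obtain ⟨p1, p2, p3⟩ := powExp_eval h0' k₀
  have hR : HasMat s 0 R := HasMat.same (fun i j => matList_getD R i j) hs (by simp)
  refine Impl.seq_pure (a := ()) (t₁ := 6 * k₀ + 20)
    (t₂ := ct + (n * n * (n * 100 + 100) + n * n * 200) + n * 60 + 570)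
    (Q := fun _ s₁ => Win n W 0 s₁ ∧ Same [1, 2] [] s s₁) ?_ ?_ (by omega)
  · refine Impl.exec (by rfl) (by simp only [Prog.tbound, NExp.cost]; omega) ?_ ?_
    · simp only [Prog.exec, State.setN, State.charge, NExp.peak, p1]
      omega
    · refine ⟨⟨?_, ?_, ?_, ?_⟩, ((Same.charge _ _ _ _ _).trans (Same.setN _ _ _ _ (by simp))).trans
        ((Same.charge _ _ _ _ _).trans (Same.setN _ _ _ _ (by simp)))⟩
      · simp [Prog.exec, State.setN, State.charge, NExp.eval, h0']
      · simp [Prog.exec, State.setN, State.charge, NExp.eval, p1, hW]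
      · simp [Prog.exec, State.setN, State.charge, NExp.eval]
      · intro a i ha _
        have a0 : a ≠ 0 := by omega
        have a1 : a ≠ 1 := by omega
        have a2 : a ≠ 2 := by omega
        have h1 : s.narr a = s₀.narr a := rfl
        have h2 : s.farr a = s₀.farr a := rfl
        simp [Prog.exec, State.setN, State.charge, NExp.eval, h1, h2, hs₀, initState, a0, a1, a2]
  rintro s₁ ⟨w1, f1⟩
  refine Impl.seq_pure (a := ()) (t₁ := n * 60 + 60)
    (t₂ := ct + (n * n * (n * 100 + 100) + n * n * 200) + 510)
    (impl_logProg (n := n) (C := C) w1.size (by omega) le_rfl) ?_ (by omega)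
  rintro s₂ ⟨f2, h3⟩
  have w2 := w1.same f2
  have g2 : Same [1, 2, 3, 8, 16, 19] [10, 11] s s₂ :=
    (f1.mono (by simp) (by simp)).trans (f2.mono (by simp) (by simp))
  refine Impl.seq (t₁ := n * n * 40 + 40)
    (t₂ := ct + (n * n * (n * 100 + 100) + n * n * 160) + 470)
    (impl_fillRand (n := n) (dst := 10) w2.size (by omega) le_rfl) ?_ ?_
  on_goal 2 => omega
  rintro X s₃ ⟨f3, hX⟩
  have w3 := w2.same f3
  have g3 := g2.trans (f3.mono (by simp) (by simp))
  refine Impl.seq (t₁ := n * n * 40 + 40)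
    (t₂ := ct + (n * n * (n * 100 + 100) + n * n * 120) + 430)
    (impl_fillRand (n := n) (dst := 11) w3.size (by omega) le_rfl) ?_ ?_
  on_goal 2 => omega
  rintro Y s₄ ⟨f4, hY⟩
  have w4 := w3.same f4
  have g4 := g3.trans (f4.mono (by simp) (by simp))
  have h3' : s₄.narr 3 0 = m := by rw [f4.n 3 (by decide), f3.n 3 (by decide), h3]
  refine Impl.seq (t₁ := 20) (t₂ := ct + (n * n * (n * 100 + 100) + n * n * 120) + 400)
    (Q := fun (h : Fin (2 * m)) s₅ => Same [16] [] s₄ s₅ ∧ s₅.narr 16 0 = (h : ℕ)) ?_ ?_ ?_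
  on_goal 3 => omega
  · refine Impl.nrand ?_ ?_ ?_ (by simp [NExp.cost]) ?_
    · simp only [NExp.eval, h3']; omega
    · simp [NExp.peak]
    · simp only [NExp.peak, NExp.eval, h3']; omega
    · intro h
      exact ⟨(Same.charge _ _ _ _ _).trans (Same.setN _ _ _ _ (by simp)), by
        simp [State.setN, NExp.eval]⟩
  rintro h s₅ ⟨f5, h16⟩
  have g5 := g4.trans (f5.mono (by simp) (by simp))
  have hh := h.2
  have ops := maskOps_hybrid (S := S) (n := n) (W := W) (τ := τ) (σ := σ) (w := w) (v := v')
    (m := m) (h := h) (R₀ := R) hS hv' hτ hσ (by omega) (by omega) (by omega) hw''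
  refine Impl.seq (t₁ := ct) (t₂ := (n * n * (n * 100 + 100) + n * n * 120) + 400)
    (impl_core ops hM hv (by omega) ⟨0, le_rfl, w4.same f5⟩ (by rw [f5.n 3 (by decide), h3'])
      ((hX.same f4).same f5) (hY.same f5) ⟨h16, hR.same g5⟩ (by omega) hw') ?_ ?_
  on_goal 2 => omega
  rintro Z s₆ ⟨hZ, w6, f6⟩
  refine Impl.drop (Impl.seq_pure (a := ()) (t₁ := n * n * (n * 100 + 100) + 20)
    (t₂ := n * n * 120 + 380) (impl_naive (n := n) w6.size (by omega)
      (((hX.same f4).same f5).same f6) ((hY.same f5).same f6) (by decide) (by decide) (by decide)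
      le_rfl) (Q' := fun _ s' => s'.nOut = [if Z = X * Y.transpose then 1 else 0]) ?_ (by omega)) ?_
  · rintro s₇ ⟨f7, hP⟩
    refine (impl_compareProg (n := n) (by rw [f7.n 0 (by decide), w6.size]) (hZ.same f7) hP ?_
      (by omega) (by omega)).imp (fun _ _ h => h)
    rw [f7.no, f6.no, g5.no]; rfl
  · intro s' h
    simpa using h

/-! ### Expectations -/

/-- The expectation of a nonnegative function. -/
noncomputable def ex {α : Type*} (μ : PMF α) (f : α → ENNReal) : ENNReal := ∑' a, μ a * f a

section Expectation

open scoped ENNReal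

variable {α β : Type*}

theorem ex_mono {μ : PMF α} {f g : α → ENNReal} (h : ∀ a, f a ≤ g a) : ex μ f ≤ ex μ g :=
  ENNReal.tsum_le_tsum fun a => mul_le_mul_right (h a) _

theorem ex_congr {μ : PMF α} {f g : α → ENNReal} (h : ∀ a, f a = g a) : ex μ f = ex μ g := by
  rw [funext h]

theorem ex_pure (a : α) (f : α → ENNReal) : ex (PMF.pure a) f = f a := by
  classical
  simp only [ex, PMF.pure_apply]
  rw [tsum_eq_single a]
  · simp
  · intro b hb; simp [hb]

theorem ex_bind (μ : PMF α) (κ : α → PMF β) (f : β → ENNReal) :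
    ex (μ.bind κ) f = ex μ fun a => ex (κ a) f := by
  simp only [ex, PMF.bind_apply, ← ENNReal.tsum_mul_right, ← ENNReal.tsum_mul_left]
  rw [ENNReal.tsum_comm]
  simp only [mul_assoc]

theorem ex_map (μ : PMF α) (g : α → β) (f : β → ENNReal) : ex (μ.map g) f = ex μ (f ∘ g) := by
  rw [PMF.map, ex_bind]
  simp only [Function.comp_apply, ex_pure]
  rfl

theorem ex_add (μ : PMF α) (f g : α → ENNReal) : ex μ (fun a => f a + g a) = ex μ f + ex μ g := by
  simp only [ex, mul_add, ENNReal.tsum_add]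

theorem ex_mul_const (μ : PMF α) (f : α → ENNReal) (c : ENNReal) :
    ex μ (fun a => f a * c) = ex μ f * c := by
  simp only [ex, ← mul_assoc, ENNReal.tsum_mul_right]

theorem ex_const (μ : PMF α) (c : ENNReal) : ex μ (fun _ => c) = c := by
  simp only [ex, ENNReal.tsum_mul_right, PMF.tsum_coe, one_mul]

theorem ex_sum {ι : Type*} (μ : PMF α) (s : Finset ι) (f : ι → α → ENNReal) :
    ex μ (fun a => ∑ i ∈ s, f i a) = ∑ i ∈ s, ex μ (f i) := by
  classical
  induction s using Finset.induction_on with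
  | empty => simp [ex]
  | insert i s hi ih => simp only [Finset.sum_insert hi, ex_add, ih]

theorem ex_comm (μ : PMF α) (ν : PMF β) (f : α → β → ENNReal) :
    ex μ (fun a => ex ν fun b => f a b) = ex ν fun b => ex μ fun a => f a b := by
  simp only [ex, ← ENNReal.tsum_mul_left]
  rw [ENNReal.tsum_comm]
  simp only [mul_left_comm]

theorem ex_fintype [Fintype α] (μ : PMF α) (f : α → ℝ) (hf : ∀ a, 0 ≤ f a) :
    ex μ (fun a => ENNReal.ofReal (f a)) = ENNReal.ofReal (∑ a, (μ a).toReal * f a) := by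
  rw [ex, tsum_fintype, ENNReal.ofReal_sum_of_nonneg
    fun a _ => mul_nonneg ENNReal.toReal_nonneg (hf a)]
  refine Finset.sum_congr rfl fun a _ => ?_
  rw [ENNReal.ofReal_mul ENNReal.toReal_nonneg, ENNReal.ofReal_toReal (PMF.apply_ne_top μ a)]

theorem ex_uniform [Fintype α] [Nonempty α] (f : α → ℝ) (hf : ∀ a, 0 ≤ f a) :
    ex (PMF.uniformOfFintype α) (fun a => ENNReal.ofReal (f a)) =
      ENNReal.ofReal ((∑ a, f a) / Fintype.card α) := by
  rw [ex_fintype _ _ hf]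
  congr 1
  simp only [PMF.uniformOfFintype_apply, ENNReal.toReal_inv, ENNReal.toReal_natCast,
    ← Finset.mul_sum]
  ring

theorem ex_uniform_equiv [Fintype α] [Nonempty α] [Fintype β] [Nonempty β] (e : α ≃ β)
    (f : β → ENNReal) :
    ex (PMF.uniformOfFintype α) (fun a => f (e a)) = ex (PMF.uniformOfFintype β) f := by
  rw [← uniform_map_equiv e, ex_map]
  rfl

end Expectation

/-! ### The hybrid argument -/

section Hybrid

variable {n : ℕ} [NeZero n] {μ : Mat F n → Mat F n → PMF (Mat F n)} {X Y : Mat F n}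

theorem maskDist_bind {α : Type*} (κ : PMF α) (f : α → PMF (Mat F n)) :
    maskDist (κ.bind f) = κ.bind fun a => maskDist (f a) := by
  simp only [maskDist, PMF.bind_bind]

/-- A trial is linear in the distribution of each of its masks. -/
theorem trialDist_bind_left {α : Type*} (κ : PMF α) (f : α → PMF (Mat F n)) (ν : PMF (Mat F n)) :
    trialDist μ (κ.bind f) ν X Y = κ.bind fun a => trialDist μ (f a) ν X Y := by
  simp only [trialDist, maskDist_bind, PMF.bind_bind]

theorem trialDist_bind_right {α : Type*} (κ : PMF α) (f : α → PMF (Mat F n))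
    (ν : PMF (Mat F n)) :
    trialDist μ ν (κ.bind f) X Y = κ.bind fun a => trialDist μ ν (f a) X Y := by
  simp only [trialDist, maskDist_bind, PMF.bind_bind]
  rw [PMF.bind_comm]

theorem iterFrom_congr {α : Type*} {f g : ℕ → α → PMF α} {i : ℕ} (j : ℕ)
    (h : ∀ k, i ≤ k → k < i + j → f k = g k) (a : α) : iterFrom f i j a = iterFrom g i j a := by
  induction j generalizing i a with
  | zero => rfl
  | succ j ih =>
    simp only [iterFrom]
    rw [h i le_rfl (by omega)]
    congr 1
    funext b
    exact ih (fun k hk hk' => h k (by omega) (by omega)) b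

/-- Only step `l` depends on `b`. So `b` may be drawn at this step instead of at the beginning: the
draw commutes with the earlier steps and does not affect the later ones. -/
theorem iterFrom_bind {α β : Type*} (κ : PMF β) (f : β → ℕ → α → PMF α) (g : ℕ → α → PMF α)
    (l : ℕ) (hl : ∀ a, (κ.bind fun b => f b l a) = g l a) (hne : ∀ b k, k ≠ l → f b k = g k)
    (i j : ℕ) (a : α) : (κ.bind fun b => iterFrom (f b) i j a) = iterFrom g i j a := by
  induction j generalizing i a with
  | zero => simp only [iterFrom, PMF.bind_const]
  | succ j ih =>
    simp only [iterFrom]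
    by_cases hi : i = l
    · subst hi
      have h1 : ∀ b, iterFrom (f b) (i + 1) j = iterFrom g (i + 1) j := fun b =>
        funext (iterFrom_congr j fun k hk _ => hne b k (by omega))
      simp only [h1, ← hl, PMF.bind_bind]
    · simp only [hne _ i hi]
      rw [PMF.bind_comm]
      simp only [ih]

/-- Feeding the test a matrix drawn from `κ` amounts to drawing mask number `h` from `κ`. This mask
occurs only in trial `h / 2`, on the left if `h` is even and on the right if it is odd. -/
theorem coreDist_hybrid (ρ κ : PMF (Mat F n)) (h m : ℕ) :
    (κ.bind fun R => coreDist μ (hybrid ρ (PMF.pure R) h) m X Y) =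
      coreDist μ (hybrid ρ κ h) m X Y := by
  simp only [coreDist, PMF.map, ← PMF.bind_bind]
  congr 1
  refine iterFrom_bind κ _ _ (h / 2) ?_ ?_ _ _ _
  · intro a
    simp only [estStep, PMF.map, ← PMF.bind_bind]
    congr 1
    have e1 : ∀ κ' : PMF (Mat F n), hybrid ρ κ' h h = κ' := by simp [hybrid]
    obtain ⟨q, rfl | rfl⟩ := h.even_or_odd'
    · have e : 2 * q / 2 = q := by omega
      have e2 : ∀ κ' : PMF (Mat F n), hybrid ρ κ' (2 * q) (2 * q + 1) =
          PMF.uniformOfFintype _ := by simp [hybrid]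
      simp only [e, e1, e2]
      rw [← trialDist_bind_left, PMF.bind_pure]
    · have e : (2 * q + 1) / 2 = q := by omega
      have e2 : ∀ κ' : PMF (Mat F n), hybrid ρ κ' (2 * q + 1) (2 * q) = ρ := by simp [hybrid]
      simp only [e, e1, e2]
      rw [← trialDist_bind_right, PMF.bind_pure]
  · intro R k hk
    have e : ∀ j, j ≠ h → hybrid ρ (PMF.pure R) h j = hybrid ρ κ h j := by
      intro j hj
      simp only [hybrid, if_neg hj]
    funext a
    simp only [estStep, e (2 * k) (by omega), e (2 * k + 1) (by omega)]

/-- The distribution of the correctness of the result for random matrices. -/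
noncomputable def pairDist (μ : Mat F n → Mat F n → PMF (Mat F n)) (ν : ℕ → PMF (Mat F n))
    (m : ℕ) : PMF Bool :=
  (PMF.uniformOfFintype (Mat F n)).bind fun X => (PMF.uniformOfFintype (Mat F n)).bind fun Y =>
    (coreDist μ ν m X Y).bind fun Z => PMF.pure (decide (Z = X * Y.transpose))

theorem bind_testDist (ρ κ : PMF (Mat F n)) (m : ℕ) [NeZero (2 * m)] :
    κ.bind (testDist μ ρ m) = (PMF.uniformOfFintype (Fin (2 * m))).bind fun h =>
      pairDist μ (hybrid ρ κ h) m := by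
  have h1 : ∀ R, testDist μ ρ m R = (PMF.uniformOfFintype (Fin (2 * m))).bind fun h =>
      pairDist μ (hybrid ρ (PMF.pure R) h) m := by
    intro R
    simp only [testDist, pairDist]
    rw [PMF.bind_comm (PMF.uniformOfFintype (Fin (2 * m)))]
    congr 1; funext X
    rw [PMF.bind_comm]
  rw [funext h1, PMF.bind_comm]
  congr 1; funext h
  simp only [pairDist]
  rw [PMF.bind_comm]
  congr 1; funext X
  rw [PMF.bind_comm]
  congr 1; funext Y
  rw [← coreDist_hybrid, PMF.bind_bind]

theorem bool_pmf (p : PMF Bool) : (p true).toReal = 1 - (p false).toReal := by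
  have h := PMF.tsum_coe p
  rw [tsum_fintype, Fintype.sum_bool] at h
  have := congrArg ENNReal.toReal h
  rw [ENNReal.toReal_add (PMF.apply_ne_top _ _) (PMF.apply_ne_top _ _)] at this
  simp only [ENNReal.toReal_one] at this
  linarith

theorem uniform_bind_toReal {N : ℕ} [NeZero N] (f : Fin N → PMF Bool) :
    (((PMF.uniformOfFintype (Fin N)).bind f) true).toReal =
      (∑ h : Fin N, ((f h) true).toReal) / N := by
  rw [PMF.bind_apply, tsum_fintype, ENNReal.toReal_sum]
  · simp only [PMF.uniformOfFintype_apply, ENNReal.toReal_mul, ENNReal.toReal_inv,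
      ENNReal.toReal_natCast, Fintype.card_fin, ← Finset.mul_sum]
    ring
  · intro h _
    exact ENNReal.mul_ne_top (PMF.apply_ne_top _ _) (PMF.apply_ne_top _ _)

/-- With position `h`, a uniform input gives `h` sampled masks followed by uniform ones, and a
sampled input gives `h + 1` of them. Averaged over the `2 * m` positions, the acceptance
probabilities differ by a telescoping sum, so the extreme hybrids differ by `2 * m` times the
advantage. -/
theorem hybrid_gap (ρ : PMF (Mat F n)) (m : ℕ) [NeZero (2 * m)] :
    (pairDist μ (fun _ => ρ) m false).toReal ≤
      (pairDist μ (fun _ => PMF.uniformOfFintype (Mat F n)) m false).toReal +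
      2 * m * |((PMF.uniformOfFintype (Mat F n)).bind (testDist μ ρ m) true).toReal -
        (ρ.bind (testDist μ ρ m) true).toReal| := by
  set p : ℕ → ℝ := fun h =>
    (pairDist μ (hybrid ρ (PMF.uniformOfFintype (Mat F n)) h) m true).toReal with hp
  have h1 : ∀ h, hybrid ρ ρ h = hybrid ρ (PMF.uniformOfFintype (Mat F n)) (h + 1) := by
    intro h; funext j
    simp only [hybrid]
    split_ifs <;> first | rfl | omega
  have hm : (0 : ℝ) < ((2 * m : ℕ) : ℝ) := by
    have := NeZero.ne (2 * m)
    exact_mod_cast Nat.pos_of_ne_zero this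
  have h2 : (((PMF.uniformOfFintype (Mat F n)).bind (testDist μ ρ m)) true).toReal =
      (∑ h ∈ Finset.range (2 * m), p h) / (2 * m : ℕ) := by
    rw [bind_testDist, uniform_bind_toReal, Finset.sum_range]
  have h3 : ((ρ.bind (testDist μ ρ m)) true).toReal =
      (∑ h ∈ Finset.range (2 * m), p (h + 1)) / (2 * m : ℕ) := by
    rw [bind_testDist, uniform_bind_toReal, Finset.sum_range]
    simp only [h1, hp]
  have h4 : pairDist μ (fun _ => PMF.uniformOfFintype (Mat F n)) m =
      pairDist μ (hybrid ρ (PMF.uniformOfFintype (Mat F n)) 0) m := by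
    congr 1; funext j; simp [hybrid]
  have h5 : pairDist μ (fun _ => ρ) m =
      pairDist μ (hybrid ρ (PMF.uniformOfFintype (Mat F n)) (2 * m)) m := by
    have : ∀ X Y : Mat F n, coreDist μ (fun _ => ρ) m X Y =
        coreDist μ (hybrid ρ (PMF.uniformOfFintype (Mat F n)) (2 * m)) m X Y := by
      intro X Y
      simp only [coreDist]
      congr 1
      refine iterFrom_congr m (fun k _ hk => ?_) _
      funext a
      simp only [estStep, hybrid, if_pos (show 2 * k < 2 * m by omega),
        if_pos (show 2 * k + 1 < 2 * m by omega)]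
    simp only [pairDist, this]
  have h6 : ∀ q : PMF Bool, (q false).toReal = 1 - (q true).toReal := by
    intro q; rw [bool_pmf]; ring
  have h7 := Finset.sum_range_sub p (2 * m)
  rw [Finset.sum_sub_distrib] at h7
  rw [h6, h6, h4, h5, h2, h3, ← sub_div, abs_div, abs_of_pos hm]
  have h8 : (2 * (m : ℝ)) = ((2 * m : ℕ) : ℝ) := by push_cast; ring
  rw [h8, mul_div_cancel₀ _ hm.ne']
  have h9 := abs_sub_comm (∑ h ∈ Finset.range (2 * m), p h) (∑ h ∈ Finset.range (2 * m), p (h + 1))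
  rw [h9, h7]
  have := neg_abs_le (p (2 * m) - p 0)
  change 1 - p (2 * m) ≤ 1 - p 0 + _
  linarith

end Hybrid

/-! ### Estimates with uniformly random masks -/

section Ideal

attribute [local irreducible] ex

variable {n : ℕ} [NeZero n]

/-- A weight that favours the error `y` over the absence of an error. -/
noncomputable def weight (s : ℝ) (y e : F) : ℝ := if e = y then s else if e = 0 then s⁻¹ else 1

theorem weight_nonneg {s : ℝ} (hs : 0 < s) (y e : F) : 0 ≤ weight s y e := by
  unfold weight
  split_ifs <;> positivity

/-- The mean weight of an error `e` that is multiplied by a random unit. -/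
noncomputable def meanWeight (F : Type*) [Field F] [Fintype F] [DecidableEq F] (s : ℝ) (e : F) : ℝ :=
  if e = 0 then s⁻¹ else 1 + (s - 1) / (Fintype.card F - 1)

theorem two_le_card : (2 : ℝ) ≤ Fintype.card F := by
  exact_mod_cast Fintype.one_lt_card (α := F)

theorem meanWeight_nonneg {s : ℝ} (hs : 1 ≤ s) (e : F) : 0 ≤ meanWeight F s e := by
  have h2 := two_le_card (F := F)
  unfold meanWeight
  split_ifs
  · positivity
  · have : 0 ≤ (s - 1) / ((Fintype.card F : ℝ) - 1) := div_nonneg (by linarith) (by linarith)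
    linarith

/-- For a nonzero error, scaling by a random unit makes all p - 1 nonzero values equally likely, so
the weight `s` is received with probability 1/(p - 1). Randomness of one of the two units is enough.
-/
theorem ex_unit {s : ℝ} (hs : 0 < s) {y : F} (hy : y ≠ 0) (e : F) (u' : Fˣ) :
    ex (PMF.uniformOfFintype Fˣ)
      (fun u => ENNReal.ofReal (weight s y (((u : F) * (u' : F))⁻¹ * e))) =
      ENNReal.ofReal (meanWeight F s e) := by
  by_cases he : e = 0
  · subst he
    simp only [mul_zero, weight, hy.symm, if_false, if_true, meanWeight]
    exact ex_const _ _
  · set e' : Fˣ := Units.mk0 e he with he'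
    set y' : Fˣ := Units.mk0 y hy with hy'
    have h1 := ex_uniform_equiv (((Equiv.mulRight u').trans (Equiv.inv Fˣ)).trans
      (Equiv.mulRight e')) fun v : Fˣ => ENNReal.ofReal (weight s y (v : F))
    have h2 : ∀ u : Fˣ, (((((Equiv.mulRight u').trans (Equiv.inv Fˣ)).trans
        (Equiv.mulRight e')) u : Fˣ) : F) = ((u : F) * (u' : F))⁻¹ * e := by
      intro u
      simp [he', mul_comm]
    simp only [h2] at h1
    rw [h1, ex_uniform _ fun v => weight_nonneg hs _ _]
    congr 1
    have h3 : ∀ v : Fˣ, weight s y (v : F) = 1 + if v = y' then s - 1 else 0 := by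
      intro v
      have : ((v : F) = y) ↔ v = y' := by
        rw [Units.ext_iff]; simp [hy']
      simp only [weight, this, v.ne_zero, if_false]
      split_ifs <;> ring
    simp only [h3, Finset.sum_add_distrib, Finset.sum_ite_eq', Finset.mem_univ, if_true,
      Finset.sum_const, Finset.card_univ, nsmul_eq_mul, mul_one, meanWeight, he, if_false]
    have h4 : (Fintype.card Fˣ : ℝ) = Fintype.card F - 1 := by
      rw [Fintype.card_units, Nat.cast_sub Fintype.card_pos]; simp
    have h5 := two_le_card (F := F)
    rw [h4, add_div, div_self (by linarith)]

/-- The two shifts move a fixed position to a uniformly random one. So the number of wrong entries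
counts, not their location. -/
theorem ex_shift {h : F → ℝ} (hh : ∀ e, 0 ≤ h e) (D : Mat F n) (i j : Fin n) :
    ex (PMF.uniformOfFintype (Fin n)) (fun r => ex (PMF.uniformOfFintype (Fin n)) fun r' =>
      ENNReal.ofReal (h (D (i - r) (j - r')))) =
      ENNReal.ofReal ((∑ k, ∑ l, h (D k l)) / (n : ℝ) ^ 2) := by
  have h1 : ∀ k, ex (PMF.uniformOfFintype (Fin n)) (fun r' => ENNReal.ofReal (h (D k (j - r')))) =
      ENNReal.ofReal ((∑ l, h (D k l)) / n) := by
    intro k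
    have := ex_uniform_equiv (Equiv.subLeft j) fun l => ENNReal.ofReal (h (D k l))
    simp only [Equiv.subLeft_apply] at this
    rw [this, ex_uniform _ fun _ => hh _, Fintype.card_fin]
  simp only [h1]
  have := ex_uniform_equiv (Equiv.subLeft i) fun k => ENNReal.ofReal ((∑ l, h (D k l)) / n)
  simp only [Equiv.subLeft_apply] at this
  rw [this]
  refine (ex_uniform (fun k => (∑ l, h (D k l)) / n)
    fun _ => div_nonneg (Finset.sum_nonneg fun _ _ => hh _) (by positivity)).trans ?_
  rw [Fintype.card_fin, ← Finset.sum_div, div_div, sq]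

/-- The mean weight takes one value at correct entries and another at wrong ones, so the total is
affine in the Hamming distance. This is why a bound on its expectation suffices. -/
theorem sum_meanWeight (s : ℝ) (P Z : Mat F n) :
    ∑ k, ∑ l, meanWeight F s ((Z - P) k l) = (n : ℝ) ^ 2 * s⁻¹ +
      matDist P Z * (1 + (s - 1) / (Fintype.card F - 1) - s⁻¹) := by
  have h1 : ∀ k l, meanWeight F s ((Z - P) k l) = s⁻¹ + (if P k l ≠ Z k l then (1 : ℝ) else 0) *
      (1 + (s - 1) / (Fintype.card F - 1) - s⁻¹) := by
    intro k l
    have : (Z - P) k l = 0 ↔ P k l = Z k l := by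
      rw [Matrix.sub_apply, sub_eq_zero, eq_comm]
    simp only [meanWeight, this, ne_eq, ite_not]
    split_ifs <;> ring
  have h2 : (matDist P Z : ℝ) = ∑ k, ∑ l, if P k l ≠ Z k l then (1 : ℝ) else 0 := by
    rw [← Finset.sum_product', Finset.univ_product_univ]
    simp only [matDist, hammingDist]
    rw [Finset.card_eq_sum_ones, Finset.sum_filter]
    push_cast
    rfl
  simp only [h1, Finset.sum_add_distrib, ← Finset.sum_mul, ← h2]
  simp [sq, mul_assoc]

/-- The mean number of wrong entries in the products that are computed by `μ`. -/
noncomputable def meanDist (μ : Mat F n → Mat F n → PMF (Mat F n)) : ENNReal :=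
  ex (PMF.uniformOfFintype (Mat F n)) fun A => ex (PMF.uniformOfFintype (Mat F n)) fun B =>
    ex (μ A B) fun Z => ENNReal.ofReal (matDist (A * B) Z)

/-- A uniform mask is a one-time pad: adding a fixed matrix is a bijection. -/
theorem ex_hide (X : Mat F n) (r : Fin n) (u : Fˣ) (f : Mat F n → ENNReal) :
    ex (PMF.uniformOfFintype (Mat F n)) (fun R => f (hide X (R, r, u))) =
      ex (PMF.uniformOfFintype (Mat F n)) f := by
  rw [← ex_uniform_equiv (α := Mat F n) (β := Mat F n)
    (Equiv.addLeft (show Mat F n from fun i j => (u : F) * X (i + r) j)) f]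
  rfl

/-- The hidden matrix is uniform and independent of shift and scalar, since it is uniform for every
fixed choice of these. -/
theorem ex_maskDist_uniform (X : Mat F n) (f : Mat F n → Fin n → Fˣ → ENNReal) :
    ex (maskDist (PMF.uniformOfFintype (Mat F n))) (fun x => f (hide X x) x.2.1 x.2.2) =
      ex (PMF.uniformOfFintype (Mat F n)) fun A => ex (PMF.uniformOfFintype (Fin n)) fun r =>
        ex (PMF.uniformOfFintype Fˣ) fun u => f A r u := by
  simp only [maskDist, ex_bind, ex_map, Function.comp_def]
  rw [ex_comm, ex_comm (PMF.uniformOfFintype (Mat F n)) (PMF.uniformOfFintype (Fin n))]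
  congr 1; funext r
  rw [ex_comm, ex_comm (PMF.uniformOfFintype (Mat F n))]
  congr 1; funext u
  exact ex_hide X r u fun A => f A r u

/-- Repeated exchange of expectations, by which scalars and shifts are averaged for a fixed result
`Z` of the multiplication. -/
theorem ex_reorder {α₁ α₂ α₃ α₄ α₅ α₆ β : Type*} (p₁ : PMF α₁) (p₂ : PMF α₂) (p₃ : PMF α₃)
    (p₄ : PMF α₄) (p₅ : PMF α₅) (p₆ : PMF α₆) (κ : α₁ → α₄ → PMF β)
    (f : α₁ → α₂ → α₃ → α₄ → α₅ → α₆ → β → ENNReal) :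
    (ex p₁ fun A => ex p₂ fun r => ex p₃ fun u => ex p₄ fun B => ex p₅ fun r' => ex p₆ fun u' =>
      ex (κ A B) fun Z => f A r u B r' u' Z) =
    ex p₁ fun A => ex p₄ fun B => ex (κ A B) fun Z => ex p₂ fun r => ex p₅ fun r' =>
      ex p₆ fun u' => ex p₃ fun u => f A r u B r' u' Z := by
  refine ex_congr fun A => ?_
  refine (ex_congr fun r => ex_comm p₃ p₄ _).trans ((ex_comm p₂ p₄ _).trans ?_)
  refine ex_congr fun B => ?_
  refine Eq.trans (ex_congr fun r => (ex_congr fun u => (ex_congr fun r' => ex_comm _ _ _).trans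
    (ex_comm _ _ _)).trans (ex_comm _ _ _)) ((ex_comm _ _ _).trans ?_)
  refine ex_congr fun Z => ex_congr fun r => ?_
  exact (ex_comm _ _ _).trans (ex_congr fun r' => ex_comm _ _ _)

theorem ex_maskDist_pair (μ : Mat F n → Mat F n → PMF (Mat F n)) (X Y : Mat F n)
    (G : Mat F n → Fin n → Fˣ → Mat F n → Fin n → Fˣ → Mat F n → ENNReal) :
    (ex (maskDist (PMF.uniformOfFintype (Mat F n))) fun x =>
      ex (maskDist (PMF.uniformOfFintype (Mat F n))) fun y =>
        ex (μ (hide X x) (hide Y y).transpose) fun Z =>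
          G (hide X x) x.2.1 x.2.2 (hide Y y) y.2.1 y.2.2 Z) =
    ex (PMF.uniformOfFintype (Mat F n)) fun A => ex (PMF.uniformOfFintype (Mat F n)) fun B =>
      ex (μ A B.transpose) fun Z => ex (PMF.uniformOfFintype (Fin n)) fun r =>
        ex (PMF.uniformOfFintype (Fin n)) fun r' => ex (PMF.uniformOfFintype Fˣ) fun u' =>
          ex (PMF.uniformOfFintype Fˣ) fun u => G A r u B r' u' Z := by
  have h1 := ex_maskDist_uniform X fun A r u => ex (maskDist (PMF.uniformOfFintype (Mat F n)))
    fun y => ex (μ A (hide Y y).transpose) fun Z => G A r u (hide Y y) y.2.1 y.2.2 Z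
  have h2 : ∀ A r u, _ := fun A r u => ex_maskDist_uniform Y fun B r' u' =>
    ex (μ A B.transpose) fun Z => G A r u B r' u' Z
  refine (ex_congr fun x => ?_).trans (h1.trans (ex_congr fun A => ex_congr fun r =>
    ex_congr fun u => h2 A r u) |>.trans ?_)
  · rfl
  exact ex_reorder _ _ _ _ _ _ (fun A B => μ A B.transpose) G

/-- The right side depends neither on `X`, `Y` nor on the entry: uniform masks turn the average-case
guarantee into a statement about each entry of each product. The error at (i, j) is a scaled error
at a random position, so `ex_unit`, `ex_shift` and `sum_meanWeight` apply in turn. -/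
theorem ex_trialDist {μ : Mat F n → Mat F n → PMF (Mat F n)} {s : ℝ} (hs : 1 ≤ s) {y : F}
    (hy : y ≠ 0) (X Y : Mat F n) (i j : Fin n) :
    ex (trialDist μ (PMF.uniformOfFintype _) (PMF.uniformOfFintype _) X Y)
      (fun Z => ENNReal.ofReal (weight s y (Z i j - (X * Y.transpose) i j))) =
    ENNReal.ofReal s⁻¹ + meanDist μ *
      ENNReal.ofReal ((1 + (s - 1) / (Fintype.card F - 1) - s⁻¹) / (n : ℝ) ^ 2) := by
  have hs0 : 0 < s := by linarith
  have h2 := two_le_card (F := F)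
  have hinv : s⁻¹ ≤ 1 := inv_le_one_of_one_le₀ hs
  have hpos : 0 ≤ (s - 1) / ((Fintype.card F : ℝ) - 1) := div_nonneg (by linarith) (by linarith)
  have hn : (0 : ℝ) < (n : ℝ) ^ 2 := by
    have := Nat.pos_of_ne_zero (NeZero.ne n)
    positivity
  obtain ⟨G, hG⟩ : ∃ G : Mat F n → Fin n → Fˣ → Mat F n → Fin n → Fˣ → Mat F n → ENNReal,
      ∀ A r u B r' u' Z, G A r u B r' u' Z = ENNReal.ofReal (weight s y
        (((u : F) * (u' : F))⁻¹ * (Z - A * B.transpose) (i - r) (j - r'))) := ⟨_, fun _ _ _ _ _ _ _ => rfl⟩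
  have h3 : ex (trialDist μ (PMF.uniformOfFintype _) (PMF.uniformOfFintype _) X Y)
      (fun Z => ENNReal.ofReal (weight s y (Z i j - (X * Y.transpose) i j))) =
      ex (maskDist (PMF.uniformOfFintype (Mat F n))) fun x =>
        ex (maskDist (PMF.uniformOfFintype (Mat F n))) fun y' =>
          ex (μ (hide X x) (hide Y y').transpose) fun Z =>
            G (hide X x) x.2.1 x.2.2 (hide Y y') y'.2.1 y'.2.2 Z := by
    simp only [trialDist, ex_bind, ex_map, Function.comp_def, estimate, add_sub_cancel_left, hG]
  rw [h3, ex_maskDist_pair μ X Y G]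
  simp only [hG]
  have h4 : ∀ D : Mat F n, (ex (PMF.uniformOfFintype (Fin n)) fun r =>
      ex (PMF.uniformOfFintype (Fin n)) fun r' => ex (PMF.uniformOfFintype Fˣ) fun u' =>
      ex (PMF.uniformOfFintype Fˣ) fun u =>
        ENNReal.ofReal (weight s y (((u : F) * (u' : F))⁻¹ * D (i - r) (j - r')))) =
      ENNReal.ofReal ((∑ k, ∑ l, meanWeight F s (D k l)) / (n : ℝ) ^ 2) := by
    intro D
    rw [← ex_shift (meanWeight_nonneg hs) D i j]
    refine ex_congr fun r => ex_congr fun r' => ?_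
    exact (ex_congr fun u' => ex_unit hs0 hy _ u').trans (ex_const _ _)
  simp only [h4]
  have h5 : ∀ A B Z : Mat F n,
      ENNReal.ofReal ((∑ k, ∑ l, meanWeight F s ((Z - A * B) k l)) / (n : ℝ) ^ 2) =
      ENNReal.ofReal s⁻¹ + ENNReal.ofReal (matDist (A * B) Z) *
        ENNReal.ofReal ((1 + (s - 1) / (Fintype.card F - 1) - s⁻¹) / (n : ℝ) ^ 2) := by
    intro A B Z
    rw [sum_meanWeight, add_div, mul_div_cancel_left₀ _ hn.ne',
      mul_div_assoc, ENNReal.ofReal_add (by positivity), ENNReal.ofReal_mul (by positivity)]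
    exact mul_nonneg (by positivity) (div_nonneg (by linarith) hn.le)
  simp only [h5, ex_add, ex_const, ex_mul_const, meanDist]
  -- The second factor is passed on transposed, and the transpose of a uniform matrix is uniform.
  have h6 : ∀ A : Mat F n, (ex (PMF.uniformOfFintype (Mat F n)) fun B =>
      ex (μ A B.transpose) fun Z => ENNReal.ofReal (matDist (A * B.transpose) Z)) =
      ex (PMF.uniformOfFintype (Mat F n)) fun B => ex (μ A B) fun Z =>
        ENNReal.ofReal (matDist (A * B) Z) := fun A =>
    ex_uniform_equiv (α := Mat F n) (β := Mat F n)
      (⟨Matrix.transpose, Matrix.transpose, fun _ => rfl, fun _ => rfl⟩ : Mat F n ≃ Mat F n)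
      fun B => ex (μ A B) fun Z => ENNReal.ofReal (matDist (A * B) Z)
  simp only [h6]

/-- With the base `1 + ε` and t = 1/(1 + ε), the left side is at most 1 - ε² t (1 - 1/p), where both
t and 1 - 1/p are at least 1/2. The terms of first order in ε cancel, as a pure guesser is right
with probability exactly 1/p. -/
theorem weight_bound {ε p : ℝ} (hε : 0 < ε) (hp : 2 ≤ p) (h0 : 0 ≤ 1 - 1 / p - ε) :
    (1 + ε)⁻¹ + (1 - 1 / p - ε) * (1 + (1 + ε - 1) / (p - 1) - (1 + ε)⁻¹) ≤ 1 - ε ^ 2 / 4 := by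
  have hp0 : 0 < p := by linarith
  have hp1 : 0 < p - 1 := by linarith
  have hip : 1 / p ≤ 1 / 2 := one_div_le_one_div_of_le (by norm_num) hp
  have hip0 : 0 < 1 / p := by positivity
  have hε1 : ε ≤ 1 := by linarith
  set t := (1 + ε)⁻¹ with ht
  have ht1 : t * (1 + ε) = 1 := inv_mul_cancel₀ (by linarith)
  have ht2 : 1 / 2 ≤ t := by nlinarith
  have h1 : (1 - 1 / p) * (ε / (p - 1)) = ε / p := by
    field_simp
  have h2 : 0 ≤ ε / (p - 1) := by positivity
  have h3 : (1 - 1 / p - ε) * (1 + (1 + ε - 1) / (p - 1) - t) ≤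
      (1 - 1 / p - ε) * (1 - t) + ε / p := by
    have : (1 - 1 / p - ε) * (1 + (1 + ε - 1) / (p - 1) - t) =
      (1 - 1 / p - ε) * (1 - t) + (1 - 1 / p) * (ε / (p - 1)) - ε * (ε / (p - 1)) := by ring
    rw [this, h1]
    nlinarith
  have h4 : 1 - t = ε * t := by linarith
  have h5 : ε / p = ε * (1 / p) := by ring
  rw [h4, h5] at h3
  have h6 : t + ((1 - 1 / p - ε) * (ε * t) + ε * (1 / p)) = 1 - ε ^ 2 * t * (1 - 1 / p) := by
    have : t = 1 - ε * t := by linarith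
    linear_combination (1 - ε * (1 / p)) * this
  have h7 : ε ^ 2 / 4 ≤ ε ^ 2 * t * (1 - 1 / p) := by
    have : 1 / 4 ≤ t * (1 - 1 / p) := by nlinarith
    nlinarith [sq_nonneg ε]
  linarith

end Ideal

/-! ### The error of the plurality -/

section Plurality

/-- The recorded values are independent, so the expectation of the product factors. -/
theorem ex_iterFrom_prod {α : Type*} (D : PMF α) (G : α → ENNReal) (m : ℕ) (a₀ : ℕ → α) :
    ex (iterFrom (fun t a => D.map (Function.update a t)) 0 m a₀)
      (fun a => ∏ t ∈ Finset.range m, G (a t)) = ex D G ^ m := by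
  induction m with
  | zero => simp only [iterFrom, ex_pure, Finset.range_zero, Finset.prod_empty, pow_zero]
  | succ m ih =>
    rw [iterFrom_succ, ex_bind, pow_succ, ← ih, ← ex_mul_const]
    refine ex_congr fun a => ?_
    rw [ex_map, mul_comm, ← ex_mul_const]
    refine ex_congr fun Z => ?_
    simp only [Function.comp_apply, zero_add]
    rw [Finset.prod_range_succ, Function.update_self, mul_comm]
    congr 1
    refine Finset.prod_congr rfl fun t ht => ?_
    rw [Function.update_of_ne (Finset.mem_range.1 ht).ne]

theorem prod_weight {s : ℝ} {y : F} (hy : y ≠ 0) (u : ℕ → F) (x : F) (m : ℕ) :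
    ∏ t ∈ Finset.range m, weight s y (u t - x) =
      s ^ ((Finset.range m).filter fun t => u t = x + y).card *
        s⁻¹ ^ ((Finset.range m).filter fun t => u t = x).card := by
  have h1 : ∀ t, weight s y (u t - x) =
      (if u t = x + y then s else 1) * (if u t = x then s⁻¹ else 1) := by
    intro t
    have e1 : u t - x = y ↔ u t = x + y := by rw [sub_eq_iff_eq_add, add_comm]
    simp only [weight, e1, sub_eq_zero]
    by_cases e2 : u t = x + y
    · have : u t ≠ x := by rw [e2]; simpa using hy
      simp [e2, hy]
    · simp [e2]
  simp only [h1, Finset.prod_mul_distrib, Finset.prod_ite, Finset.prod_const, one_pow,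
    mul_one]

/-- If the plurality misses `x`, some other value x + y is at least as frequent. The product of
weights is `s` to the difference of the two frequencies, hence at least `1`. Ties count as failures.
-/
theorem one_le_prod_weight {s : ℝ} (hs : 1 ≤ s) {u : ℕ → F} {x : F} {m : ℕ} (h : maj u m ≠ x) :
    ∃ y, y ≠ 0 ∧ 1 ≤ ∏ t ∈ Finset.range m, weight s y (u t - x) := by
  by_contra! hc
  refine h (maj_eq u m x fun y hy => ?_)
  have h1 := hc (y - x) (sub_ne_zero.2 hy)
  rw [prod_weight (sub_ne_zero.2 hy), add_sub_cancel] at h1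
  by_contra! h2
  have h3 : (0 : ℝ) < s := by linarith
  have h4 := pow_le_pow_right₀ hs h2
  have h5 : 0 < s ^ ((Finset.range m).filter fun t => u t = x).card := by positivity
  rw [inv_pow, ← div_eq_mul_inv, div_lt_one h5] at h1
  linarith

variable {n : ℕ} [NeZero n]

/-- Chernoff bound and union bound: the indicator of failure is at most the sum of the weight
products over all entries and all nonzero errors `y`, and each of these has expectation at most `q ^
m`. -/
theorem ex_coreDist_le {μ : Mat F n → Mat F n → PMF (Mat F n)} {s : ℝ} (hs : 1 ≤ s)
    {q : ENNReal} (X Y : Mat F n)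
    (hq : ∀ y : F, y ≠ 0 → ∀ i j,
      ex (trialDist μ (PMF.uniformOfFintype _) (PMF.uniformOfFintype _) X Y)
        (fun Z => ENNReal.ofReal (weight s y (Z i j - (X * Y.transpose) i j))) ≤ q) (m : ℕ) :
    ex (coreDist μ (fun _ => PMF.uniformOfFintype _) m X Y)
      (fun Z => if Z = X * Y.transpose then 0 else 1) ≤
      ((n * n * Fintype.card F : ℕ) : ENNReal) * q ^ m := by
  classical
  set P := X * Y.transpose with hP
  have hs0 : 0 < s := by linarith
  set g : F → Fin n → Fin n → Mat F n → ENNReal := fun y i j Z =>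
    ENNReal.ofReal (weight s y (Z i j - P i j)) with hg
  have h1 : ∀ a : ℕ → Mat F n, (if majMat m a = P then (0 : ENNReal) else 1) ≤
      ∑ ij : Fin n × Fin n, ∑ y ∈ Finset.univ.filter fun y : F => y ≠ 0,
        ∏ t ∈ Finset.range m, g y ij.1 ij.2 (a t) := by
    intro a
    split_ifs with h
    · exact zero_le
    · have : ∃ i j, majMat m a i j ≠ P i j := by
        by_contra! hc
        exact h (by ext i j; exact hc i j)
      obtain ⟨i, j, hij⟩ := this
      obtain ⟨y, hy, hy'⟩ := one_le_prod_weight hs (u := fun t => a t i j) (x := P i j) hij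
      have h2 : 1 ≤ ∏ t ∈ Finset.range m, g y i j (a t) := by
        rw [← ENNReal.ofReal_prod_of_nonneg fun t _ => weight_nonneg hs0 _ _]
        rwa [ENNReal.one_le_ofReal]
      refine h2.trans (le_trans ?_ (Finset.single_le_sum
        (f := fun ij : Fin n × Fin n => ∑ y ∈ Finset.univ.filter fun y : F => y ≠ 0,
          ∏ t ∈ Finset.range m, g y ij.1 ij.2 (a t))
        (fun _ _ => zero_le) (Finset.mem_univ (i, j))))
      exact Finset.single_le_sum (f := fun y => ∏ t ∈ Finset.range m, g y i j (a t))
        (fun _ _ => zero_le) (by simpa using hy)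
  rw [coreDist, ex_map]
  refine (ex_mono h1).trans ?_
  rw [ex_sum]
  have h3 : ∀ ij : Fin n × Fin n, (ex (iterFrom (estStep μ (fun _ => PMF.uniformOfFintype _) X Y)
      0 m fun _ => 0) fun a => ∑ y ∈ Finset.univ.filter fun y : F => y ≠ 0,
        ∏ t ∈ Finset.range m, g y ij.1 ij.2 (a t)) ≤ Fintype.card F * q ^ m := by
    intro ij
    rw [ex_sum]
    refine (Finset.sum_le_sum (g := fun _ => q ^ m) fun y hy => ?_).trans ?_
    · refine (ex_iterFrom_prod _ (g y ij.1 ij.2) m _).le.trans ?_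
      exact pow_le_pow_left' (hq y (by simpa using hy) _ _) m
    · rw [Finset.sum_const, nsmul_eq_mul]
      gcongr
      exact Finset.card_le_univ _
  refine (Finset.sum_le_sum fun ij _ => h3 ij).trans ?_
  rw [Finset.sum_const, nsmul_eq_mul, Finset.card_univ, Fintype.card_prod, Fintype.card_fin]
  push_cast
  simp only [mul_assoc, le_refl]

theorem ex_trialDist_le {μ : Mat F n → Mat F n → PMF (Mat F n)} {ε : ℝ} (hε : 0 < ε)
    (h0 : 0 ≤ 1 - 1 / (Fintype.card F : ℝ) - ε)
    (hμ : meanDist μ ≤ ENNReal.ofReal ((1 - 1 / (Fintype.card F : ℝ) - ε) * (n : ℝ) ^ 2)) {y : F}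
    (hy : y ≠ 0) (X Y : Mat F n) (i j : Fin n) :
    ex (trialDist μ (PMF.uniformOfFintype _) (PMF.uniformOfFintype _) X Y)
      (fun Z => ENNReal.ofReal (weight (1 + ε) y (Z i j - (X * Y.transpose) i j))) ≤
    ENNReal.ofReal (1 - ε ^ 2 / 4) := by
  have hs : (1 : ℝ) ≤ 1 + ε := by linarith
  have h2 := two_le_card (F := F)
  rw [ex_trialDist hs hy]
  have hn : (0 : ℝ) < (n : ℝ) ^ 2 := by
    have := Nat.pos_of_ne_zero (NeZero.ne n)
    positivity
  refine (add_le_add le_rfl (mul_le_mul_left hμ _)).trans ?_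
  rw [← ENNReal.ofReal_mul (by positivity), ← ENNReal.ofReal_add (by positivity)]
  · refine ENNReal.ofReal_le_ofReal (le_trans (le_of_eq ?_) (weight_bound hε h2 h0))
    rw [mul_assoc ((1 : ℝ) - _ - _), mul_div_cancel₀ _ hn.ne']
  · have hinv : (1 + ε)⁻¹ ≤ 1 := inv_le_one_of_one_le₀ hs
    have hpos : 0 ≤ (1 + ε - 1) / ((Fintype.card F : ℝ) - 1) :=
      div_nonneg (by linarith) (by linarith)
    exact mul_nonneg (by positivity) (div_nonneg (by linarith) hn.le)

theorem pmf_bool_apply (p : PMF Bool) : p false = ex p fun b => if b then 0 else 1 := by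
  rw [ex, tsum_fintype, Fintype.sum_bool]
  simp

theorem pairDist_false (μ : Mat F n → Mat F n → PMF (Mat F n)) (ν : ℕ → PMF (Mat F n)) (m : ℕ) :
    pairDist μ ν m false = ex (PMF.uniformOfFintype (Mat F n)) fun X =>
      ex (PMF.uniformOfFintype (Mat F n)) fun Y =>
        ex (coreDist μ ν m X Y) fun Z => if Z = X * Y.transpose then 0 else 1 := by
  rw [pmf_bool_apply, pairDist]
  simp only [ex_bind, ex_pure, decide_eq_true_eq]

theorem pairDist_uniform_le {μ : Mat F n → Mat F n → PMF (Mat F n)} {ε : ℝ} (hε : 0 < ε)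
    (h0 : 0 ≤ 1 - 1 / (Fintype.card F : ℝ) - ε)
    (hμ : meanDist μ ≤ ENNReal.ofReal ((1 - 1 / (Fintype.card F : ℝ) - ε) * (n : ℝ) ^ 2)) (m : ℕ) :
    (pairDist μ (fun _ => PMF.uniformOfFintype _) m false).toReal ≤
      n * n * Fintype.card F * (1 - ε ^ 2 / 4) ^ m := by
  have h2 := two_le_card (F := F)
  have h3 : 0 ≤ 1 - ε ^ 2 / 4 := by
    have : 0 < 1 / (Fintype.card F : ℝ) := by positivity
    nlinarith
  refine ENNReal.toReal_le_of_le_ofReal (by positivity) ?_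
  rw [pairDist_false]
  refine (ex_mono fun X => ex_mono fun Y => ex_coreDist_le (s := 1 + ε) (by linarith) X Y
    (fun y hy i j => ex_trialDist_le hε h0 hμ hy X Y i j) m).trans ?_
  rw [ex_const, ex_const, ENNReal.ofReal_mul (by positivity), ENNReal.ofReal_pow h3]
  gcongr
  rw [← ENNReal.ofReal_natCast]
  push_cast
  rfl

/-! ### The error of the random splitting -/

/-- A B is the sum of the four products of U, A - U with the transposes of V, Bᵀ - V, and each of
the four pairs is uniform. The pairs depend on each other, but a union bound does not mind. -/
theorem ex_splitDist_le (κ : Mat F n → Mat F n → PMF (Mat F n)) (A B : Mat F n) :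
    ex (splitDist κ A B) (fun Z => if Z = A * B then 0 else 1) ≤
      4 * ex (PMF.uniformOfFintype (Mat F n)) fun X => ex (PMF.uniformOfFintype (Mat F n)) fun Y =>
        ex (κ X Y) fun Z => if Z = X * Y.transpose then 0 else 1 := by
  set I : Mat F n → Mat F n → Mat F n → ENNReal :=
    fun X Y Z => if Z = X * Y.transpose then 0 else 1 with hI
  set g : Mat F n → Mat F n → ENNReal := fun X Y => ex (κ X Y) (I X Y) with hg
  have h1 : ∀ U V P₁ P₂ P₃ P₄ : Mat F n, (if P₁ + P₂ + P₃ + P₄ = A * B then (0 : ENNReal) else 1) ≤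
      I U V P₁ + I U (B.transpose - V) P₂ + I (A - U) V P₃ +
        I (A - U) (B.transpose - V) P₄ := by
    intro U V P₁ P₂ P₃ P₄
    split_ifs with h
    · exact zero_le
    -- A sum of indicators below `1` has only zero terms, so all four products are right.
    · by_contra! hc
      refine h ?_
      have hz : ∀ X Y P : Mat F n, I X Y P < 1 → P = X * Y.transpose := by
        intro X Y P hlt
        by_contra hne
        simp only [hI, if_neg hne] at hlt
        exact lt_irrefl _ hlt
      have k4 := hz _ _ _ (lt_of_le_of_lt le_add_self hc)
      have hc := lt_of_le_of_lt le_self_add hc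
      have k3 := hz _ _ _ (lt_of_le_of_lt le_add_self hc)
      have hc := lt_of_le_of_lt le_self_add hc
      have k2 := hz _ _ _ (lt_of_le_of_lt le_add_self hc)
      have k1 := hz _ _ _ (lt_of_le_of_lt le_self_add hc)
      rw [k1, k2, k3, k4, Matrix.transpose_sub, Matrix.transpose_transpose]
      noncomm_ring
  simp only [splitDist, ex_bind, ex_pure]
  refine (ex_mono fun U => ex_mono fun V => ex_mono fun P₁ => ex_mono fun P₂ => ex_mono fun P₃ =>
    ex_mono fun P₄ => h1 U V P₁ P₂ P₃ P₄).trans (le_of_eq ?_)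
  simp only [ex_add, ex_const]
  have e1 : ∀ f : Mat F n → ENNReal, ex (PMF.uniformOfFintype (Mat F n)) (fun U => f (A - U)) =
      ex (PMF.uniformOfFintype (Mat F n)) f :=
    fun f => ex_uniform_equiv (Equiv.subLeft A) f
  have e2 : ∀ f : Mat F n → ENNReal,
      ex (PMF.uniformOfFintype (Mat F n)) (fun V => f (B.transpose - V)) =
      ex (PMF.uniformOfFintype (Mat F n)) f :=
    fun f => ex_uniform_equiv (Equiv.subLeft B.transpose) f
  have e3 : ∀ X, ex (PMF.uniformOfFintype (Mat F n)) (fun V =>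
      ex (κ X (B.transpose - V)) (I X (B.transpose - V))) =
      ex (PMF.uniformOfFintype (Mat F n)) (g X) := fun X => e2 (g X)
  simp only [e3]
  rw [e1 fun X => ex (PMF.uniformOfFintype (Mat F n)) fun V => ex (κ X V) (I X V)]
  simp only [hg]
  ring

theorem toReal_splitDist {μ : Mat F n → Mat F n → PMF (Mat F n)} {ν : ℕ → PMF (Mat F n)} {m : ℕ}
    (A B : Mat F n) :
    1 - 4 * (pairDist μ ν m false).toReal ≤
      (splitDist (coreDist μ ν m) A B (A * B)).toReal := by
  classical
  set D := splitDist (coreDist μ ν m) A B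
  have h1 := ex_splitDist_le (coreDist μ ν m) A B
  rw [← pairDist_false] at h1
  have h2 : D (A * B) + ex D (fun Z => if Z = A * B then 0 else 1) = 1 := by
    have : (fun _ : Mat F n => (1 : ENNReal)) =
        fun Z => ((if Z = A * B then 1 else 0) + (if Z = A * B then 0 else 1) : ENNReal) := by
      funext Z; split_ifs <;> simp
    have e := ex_const D 1
    rw [this, ex_add] at e
    refine Eq.trans ?_ e
    congr 1
    simp only [ex, mul_ite, mul_one, mul_zero, tsum_ite_eq]
  have h3 : (1 : ENNReal) ≤ D (A * B) + 4 * pairDist μ ν m false := by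
    rw [← h2]; gcongr
  have h4 : 4 * pairDist μ ν m false ≠ ⊤ :=
    ENNReal.mul_ne_top (by simp) (PMF.apply_ne_top _ _)
  have h5 := ENNReal.toReal_mono (ENNReal.add_ne_top.2 ⟨PMF.apply_ne_top _ _, h4⟩) h3
  rw [ENNReal.toReal_add (PMF.apply_ne_top _ _) h4, ENNReal.toReal_mul] at h5
  simp only [ENNReal.toReal_one, ENNReal.toReal_ofNat] at h5
  linarith

end Plurality

/-! ### Implementations as algorithms -/

section Interface

theorem Impl.haltsWithin {α : Type*} {P : Prog F} {n t T w : ℕ} {x y : List F} {μ : PMF α}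
    {Q : α → State F → Prop} {R : State F → Prop} (h : Impl P (initState n x y) t w μ Q)
    (ht : t ≤ T) (hR : ∀ a s, Q a s → R s) : P.HaltsWithin (initState n x y) T w R :=
  (h T ht).forall_right fun a o ⟨s', h1, h2, h3, h4⟩ =>
    ⟨s', h1, (h2.trans (by simp [initState])).trans ht, h3.trans (by simp [initState]), hR a s' h4⟩

theorem Impl.output_eq {P : Prog F} {n t T w : ℕ} {A B : Mat F n} {μ : PMF (Mat F n)}
    {Q : Mat F n → State F → Prop} (h : Impl P (initState n (matList A) (matList B)) t w μ Q)
    (ht : t ≤ T) (hQ : ∀ Z s, Q Z s → s.outMat n = Z) : output P T A B = μ := by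
  have := (h T ht).map_eq (f := id) (g := fun o => o.elim 0 (State.outMat n)) (by
    rintro Z o ⟨s', rfl, -, -, h4⟩
    exact (hQ Z s' h4).symm)
  rw [PMF.map_id] at this
  exact this.symm

theorem acceptProb_eq {D : Prog F} {n t T w : ℕ} {f : Mat F n → PMF Bool}
    (h : ∀ R, Impl D (initState n (matList R) []) t w (f R) fun b s =>
      s.nOut = [if b then 1 else 0]) (ht : t ≤ T) (κ : PMF (Mat F n)) :
    acceptProb D T κ = ((κ.bind f) true).toReal := by
  classical
  set g : Option (State F) → Bool := fun o => decide (∃ s, o = some s ∧ s.nOut = [1]) with hg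
  have h1 : ∀ R, (D.run T (initState n (matList R) [])).map g = f R := by
    intro R
    have := (h R T ht).map_eq (f := id) (g := g) (by
      rintro b o ⟨s', rfl, -, -, h4⟩
      cases b <;> simp_all)
    rw [PMF.map_id] at this
    exact this.symm
  have h2 : κ.bind f = (κ.bind fun R => D.run T (initState n (matList R) [])).map g := by
    rw [PMF.map_bind]
    simp only [h1]
  rw [acceptProb, h2, ← PMF.toOuterMeasure_apply_singleton, PMF.toOuterMeasure_map_apply]
  congr 2
  ext o
  simp [hg]

/-- Each element of the output takes a unit of time. So the running time of `M` is at least n², and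
`Õ(n²)` overheads are affordable. -/
theorem le_time_of_haltsWithin {P : Prog F} {s : State F} {T w N : ℕ}
    (h : P.HaltsWithin s T w fun s' => s'.fOut.length = N) (hs : s.fOut = []) : N ≤ T := by
  obtain ⟨o, ho⟩ := (P.run T s).support_nonempty
  obtain ⟨s', rfl, h1, -, rfl⟩ := h o ho
  have := (P.run_grows T s s' ho).fOut_time
  rw [hs] at this
  simp only [List.length_nil] at this
  omega

/-- Cutting long runs replaces their outputs by the correct product, at distance zero. -/
theorem meanDist_cutDist_le (M : Prog F) (T W n : ℕ) [NeZero n] :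
    meanDist (n := n) (cutDist M T W) ≤ ENNReal.ofReal (expectedDist M T n) := by
  have h1 : ∀ A B : Mat F n, ex (cutDist M T W A B) (fun Z => ENNReal.ofReal (matDist (A * B) Z)) ≤
      ex (output M T A B) fun Z => ENNReal.ofReal (matDist (A * B) Z) := by
    intro A B
    rw [cutDist, output, ex_map, ex_map]
    refine ex_mono fun o => ?_
    cases o with
    | none => exact le_rfl
    | some s =>
      simp only [Function.comp_apply, Option.elim_some]
      split_ifs
      · exact le_rfl
      · simp [matDist]
  refine (ex_mono fun A => ex_mono fun B => h1 A B).trans (le_of_eq ?_)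
  have h2 : ∀ A B : Mat F n, _ := fun A B => ex_fintype (output M T A B)
    (fun Z => (matDist (A * B) Z : ℝ)) fun _ => Nat.cast_nonneg _
  have h3 : ∀ A B Z : Mat F n, 0 ≤ (output M T A B Z).toReal * (matDist (A * B) Z : ℝ) :=
    fun A B Z => mul_nonneg ENNReal.toReal_nonneg (Nat.cast_nonneg _)
  have h4 : ∀ A : Mat F n, 0 ≤ (∑ B : Mat F n, ∑ Z : Mat F n,
      (output M T A B Z).toReal * (matDist (A * B) Z : ℝ)) / Fintype.card (Mat F n) := fun A =>
    div_nonneg (Finset.sum_nonneg fun B _ => Finset.sum_nonneg fun Z _ => h3 A B Z)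
      (Nat.cast_nonneg _)
  simp only [h2]
  have h5 : ∀ A : Mat F n, _ := fun A => ex_uniform (α := Mat F n)
    (fun B => ∑ Z : Mat F n, (output M T A B Z).toReal * (matDist (A * B) Z : ℝ))
    fun B => Finset.sum_nonneg fun Z _ => h3 A B Z
  simp only [h5]
  refine (ex_uniform _ h4).trans ?_
  rw [← Finset.sum_div, div_div, ← sq]
  rfl

theorem expectedDist_nonneg (M : Prog F) (T n : ℕ) : 0 ≤ expectedDist M T n :=
  div_nonneg (Finset.sum_nonneg fun _ _ => Finset.sum_nonneg fun _ _ => Finset.sum_nonneg fun _ _ =>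
    mul_nonneg ENNReal.toReal_nonneg (Nat.cast_nonneg _)) (by positivity)

end Interface

/-! ### Polynomial and quasilinear bounds -/

section Growth

/-- The function is bounded by a fixed power of `n + 2`. -/
def PolyBdd (f : ℕ → ℕ) : Prop := ∃ k, ∀ n, f n ≤ (n + 2) ^ k

namespace PolyBdd

variable {f g : ℕ → ℕ}

theorem mono (hf : PolyBdd f) (h : ∀ n, g n ≤ f n) : PolyBdd g :=
  hf.imp fun _ hk n => (h n).trans (hk n)

theorem const (c : ℕ) : PolyBdd fun _ => c :=
  ⟨c, fun n => Nat.lt_two_pow_self.le.trans (Nat.pow_le_pow_left (by omega) c)⟩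

theorem id : PolyBdd fun n => n := ⟨1, fun n => by simp⟩

theorem add (hf : PolyBdd f) (hg : PolyBdd g) : PolyBdd fun n => f n + g n := by
  obtain ⟨a, ha⟩ := hf
  obtain ⟨b, hb⟩ := hg
  refine ⟨max a b + 1, fun n => ?_⟩
  have h1 := (ha n).trans (Nat.pow_le_pow_right (by omega) (le_max_left a b))
  have h2 := (hb n).trans (Nat.pow_le_pow_right (by omega) (le_max_right a b))
  rw [pow_succ]
  nlinarith

theorem mul (hf : PolyBdd f) (hg : PolyBdd g) : PolyBdd fun n => f n * g n := by
  obtain ⟨a, ha⟩ := hf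
  obtain ⟨b, hb⟩ := hg
  exact ⟨a + b, fun n => by rw [pow_add]; exact Nat.mul_le_mul (ha n) (hb n)⟩

theorem pow (k : ℕ) : PolyBdd fun n => (n + 2) ^ k := ⟨k, fun _ => le_rfl⟩

theorem clog : PolyBdd fun n => Nat.clog 2 n :=
  id.mono fun _ => Nat.clog_le_of_le_pow Nat.lt_two_pow_self.le

/-- The logarithm is at most `n + 2` in absolute value, and the finitely many values before the
asymptotic bound sets in are absorbed by a constant, their sum. -/
theorem of_softO {a : ℕ} (h : SoftO (fun n => (f n : ℝ)) fun n => (n : ℝ) ^ a) : PolyBdd f := by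
  obtain ⟨k, h⟩ := h
  obtain ⟨c, hc⟩ := h.bound
  obtain ⟨N, hN⟩ := eventually_atTop.1 hc
  refine PolyBdd.mono (f := fun n => ⌈|c|⌉₊ * (n + 2) ^ (a + k) + ∑ i ∈ Finset.range N, f i)
    (((const _).mul (pow _)).add (const _)) fun n => ?_
  rcases lt_or_ge n N with hn | hn
  · exact (Finset.single_le_sum (f := f) (fun _ _ => Nat.zero_le _)
      (Finset.mem_range.2 hn)).trans (Nat.le_add_left _ _)
  · refine le_trans ?_ (Nat.le_add_right _ _)
    have h1 := hN n hn
    rw [Real.norm_of_nonneg (Nat.cast_nonneg _)] at h1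
    have h2 : |Real.log n| ≤ (n : ℝ) + 2 := by
      rcases Nat.eq_zero_or_pos n with rfl | hn0
      · simp
      · have hn1 : (1 : ℝ) ≤ n := by exact_mod_cast hn0
        rw [abs_of_nonneg (Real.log_nonneg hn1)]
        have := Real.log_le_sub_one_of_pos (show (0 : ℝ) < n by linarith)
        linarith
    have h3 : ‖(n : ℝ) ^ a * Real.log n ^ k‖ ≤ ((n : ℝ) + 2) ^ (a + k) := by
      rw [norm_mul, norm_pow, norm_pow, Real.norm_eq_abs, Real.norm_eq_abs, pow_add,
        abs_of_nonneg (Nat.cast_nonneg n : (0 : ℝ) ≤ n)]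
      gcongr
      linarith
    have h4 : (f n : ℝ) ≤ ⌈|c|⌉₊ * ((n : ℝ) + 2) ^ (a + k) :=
      h1.trans (mul_le_mul ((le_abs_self c).trans (Nat.le_ceil _)) h3 (norm_nonneg _)
        (Nat.cast_nonneg _))
    exact_mod_cast h4

end PolyBdd

/-- Quasilinear bounds between functions with natural values. -/
def Soft (f g : ℕ → ℕ) : Prop := SoftO (fun n => (f n : ℝ)) fun n => (g n : ℝ)

theorem log_pow_isBigO {a b : ℕ} (h : a ≤ b) :
    (fun n : ℕ => Real.log n ^ a) =O[atTop] fun n : ℕ => Real.log n ^ b := by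
  refine IsBigO.of_bound 1 ?_
  filter_upwards [eventually_ge_atTop 3] with n hn
  have h1 : (1 : ℝ) ≤ Real.log n := by
    rw [Real.le_log_iff_exp_le (by positivity)]
    exact Real.exp_one_lt_three.le.trans (by exact_mod_cast hn)
  rw [one_mul, norm_pow, norm_pow, Real.norm_of_nonneg (by linarith)]
  exact pow_le_pow_right₀ h1 h

namespace Soft

variable {f f₁ f₂ g g₁ g₂ h : ℕ → ℕ}

theorem lift {k l : ℕ} (hkl : k ≤ l)
    (hf : (fun n => (f n : ℝ)) =O[atTop] fun n : ℕ => (g n : ℝ) * Real.log n ^ k) :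
    (fun n => (f n : ℝ)) =O[atTop] fun n : ℕ => (g n : ℝ) * Real.log n ^ l :=
  hf.trans ((isBigO_refl _ _).mul (log_pow_isBigO hkl))

theorem add (h₁ : Soft f₁ g) (h₂ : Soft f₂ g) : Soft (fun n => f₁ n + f₂ n) g := by
  obtain ⟨k, hk⟩ := h₁
  obtain ⟨l, hl⟩ := h₂
  refine ⟨max k l, ?_⟩
  have := (lift (le_max_left k l) hk).add (lift (le_max_right k l) hl)
  simpa using this

theorem mul (h₁ : Soft f₁ g₁) (h₂ : Soft f₂ g₂) :
    Soft (fun n => f₁ n * f₂ n) fun n => g₁ n * g₂ n := by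
  obtain ⟨k, hk⟩ := h₁
  obtain ⟨l, hl⟩ := h₂
  refine ⟨k + l, (hk.mul hl).congr (fun n => by push_cast; rfl) fun n => by push_cast; ring⟩

theorem trans (h₁ : Soft f g) (h₂ : Soft g h) : Soft f h := by
  obtain ⟨k, hk⟩ := h₁
  obtain ⟨l, hl⟩ := h₂
  refine ⟨l + k, hk.trans ((hl.mul (isBigO_refl _ _)).congr_right fun n => by ring)⟩

theorem of_le {N : ℕ} (hfg : ∀ n ≥ N, f n ≤ g n) : Soft f g := by
  refine ⟨0, IsBigO.of_bound 1 ?_⟩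
  filter_upwards [eventually_ge_atTop N] with n hn
  simpa using hfg n hn

theorem refl (f : ℕ → ℕ) : Soft f f := of_le (N := 0) fun _ _ => le_rfl

theorem const (c : ℕ) (hg : ∀ n ≥ 1, 1 ≤ g n) : Soft (fun _ => c) g := by
  refine ⟨0, IsBigO.of_bound c ?_⟩
  filter_upwards [eventually_ge_atTop 1] with n hn
  have : (1 : ℝ) ≤ g n := by exact_mod_cast hg n hn
  simp only [Real.norm_natCast, pow_zero, mul_one]
  nlinarith [(Nat.cast_nonneg c : (0 : ℝ) ≤ c)]

theorem const_mul (c : ℕ) (hf : Soft f g) : Soft (fun n => c * f n) g :=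
  ((const c (g := fun _ => 1) fun _ _ => le_rfl).mul hf).trans
    (of_le (N := 0) fun _ _ => by simp)

theorem polylog_mul (h₁ : Soft f₁ fun _ => 1) (h₂ : Soft f₂ g) : Soft (fun n => f₁ n * f₂ n) g :=
  (h₁.mul h₂).trans (of_le (N := 0) fun _ _ => by simp)

theorem clog : Soft (fun n => Nat.clog 2 n) fun _ => 1 := by
  refine ⟨1, IsBigO.of_bound 4 ?_⟩
  filter_upwards [eventually_ge_atTop 3] with n hn
  have h1 : Nat.clog 2 n ≤ Nat.log 2 n + 1 :=
    Nat.clog_le_of_le_pow (Nat.lt_pow_succ_log_self (by norm_num) n).le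
  have h2 : ((2 ^ Nat.log 2 n : ℕ) : ℝ) ≤ n := by
    exact_mod_cast Nat.pow_log_le_self 2 (by omega)
  have h3 : (Nat.log 2 n : ℝ) * Real.log 2 ≤ Real.log n := by
    rw [← Real.log_pow]
    exact Real.log_le_log (by positivity) (by exact_mod_cast h2)
  have h4 : (1 : ℝ) ≤ Real.log n := by
    rw [Real.le_log_iff_exp_le (by positivity)]
    exact Real.exp_one_lt_three.le.trans (by exact_mod_cast hn)
  have h5 := Real.log_two_gt_d9
  have h6 : (Nat.clog 2 n : ℝ) ≤ Nat.log 2 n + 1 := by exact_mod_cast h1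
  rw [Real.norm_natCast, Nat.cast_one, one_mul, pow_one, Real.norm_of_nonneg (by linarith)]
  nlinarith [(Nat.cast_nonneg (Nat.log 2 n) : (0 : ℝ) ≤ Nat.log 2 n)]

end Soft

end Growth

/-! ### The running times of the programs -/

section Time

/-- Uses the first side of the minimum in `subTime`: the simulation is slower by a constant factor
only. -/
theorem soft_subTime {keep : Bool} {P : Prog F} {W τ g : ℕ → ℕ} (hτ : Soft τ g)
    (hg : ∀ n ≥ 1, 1 ≤ g n) : Soft (fun n => subTime keep P (W n) (τ n)) g := by
  unfold subTime
  refine Soft.add (Soft.const_mul _ (Soft.add (Soft.const _ hg) ?_)) (Soft.const _ hg)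
  exact (Soft.of_le (N := 0) fun n _ => min_le_left _ _).trans hτ

/-- Sampling, masking and unmasking take `Õ(n²)`, hence `Õ(T)`, and the number of trials is
logarithmic. The naive product after an expired clock is paid for by n²(n + 1) ≤ W ≤ T. -/
theorem soft_mainTime {S M : Prog F} {T τ σ W : ℕ → ℕ} (C k₀ : ℕ) (hT : ∀ n, n * n ≤ T n)
    (hτ : Soft τ fun n => n * n) (hσ : Soft σ fun n => n) (hW : ∀ n, n * n * (n + 1) ≤ W n) :
    Soft (fun n => mainTime F M n (W n) (T n) (sampleTime S n (W n) (τ n) (σ n))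
      (n * ((σ n + n) * 200 + 200) + 40) (C * Nat.clog 2 n) k₀) T := by
  have h1 : ∀ n ≥ 1, 1 ≤ n * n := fun n hn => Nat.mul_le_mul hn hn
  have h2 : ∀ n ≥ 1, 1 ≤ T n := fun n hn => (h1 n hn).trans (hT n)
  have hid : Soft (fun n => n) fun n => n := Soft.refl _
  have hc : ∀ c : ℕ, Soft (fun _ => c) fun n => n := fun c => Soft.const c fun _ h => h
  have hs : Soft (fun n => n * n) T := Soft.of_le (N := 0) fun n _ => hT n
  have hn2 : Soft (fun n => n) fun n => n * n := Soft.of_le (N := 0) fun n _ => Nat.le_mul_self n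
  have hm : Soft (fun n => C * Nat.clog 2 n) fun _ => 1 := Soft.const_mul C Soft.clog
  have hc1 : ∀ c : ℕ, Soft (fun _ => c) fun _ => 1 := fun c => Soft.const c fun _ _ => le_rfl
  have hcT : ∀ c : ℕ, Soft (fun _ => c) T := fun c => Soft.const c h2
  have hmc : ∀ {f g : ℕ → ℕ} (c : ℕ), Soft f g → Soft (fun n => f n * c) g := fun c h =>
    (Soft.of_le (N := 0) fun n _ => (mul_comm _ _).le).trans (Soft.const_mul c h)
  have htg : Soft (fun n => sampleTime S n (W n) (τ n) (σ n)) T := by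
    unfold sampleTime
    exact (((((soft_subTime hτ h1).add (hmc 40 (Soft.refl _))).add (hmc 40 hn2)).add
      (hmc 160 (hσ.trans hn2))).add (Soft.const _ h1)).trans hs
  have hta : Soft (fun n => n * ((σ n + n) * 200 + 200) + 40) T :=
    ((hid.mul ((hmc 200 (hσ.add hid)).add (hc 200))).trans hs).add (hcT 40)
  have hmul : Soft (fun n => mulTime M n (W n) (T n)) T := by
    unfold mulTime
    refine (((soft_subTime (Soft.refl T) h2).add ?_).add (hmc 140 hs)).add (hcT 200)
    refine (Soft.of_le (N := 0) (g := fun n => 100 * T n) fun n _ => ?_).trans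
      (Soft.const_mul 100 (Soft.refl T))
    split_ifs with h
    · have := (hW n).trans h
      calc n * n * (n * 100 + 100) = 100 * (n * n * (n + 1)) := by ring
        _ ≤ 100 * T n := Nat.mul_le_mul_left _ this
    · exact Nat.zero_le _
  unfold mainTime splitTime coreTime trialTime
  refine (((((Soft.const_mul 4 ((Soft.add ?_ ?_).add (hcT 100))).add (hmc 600 hs)).add
    (hmc 60 (hn2.trans hs))).add (hcT _)).add (hcT 600)).add (hcT 10)
  · exact Soft.polylog_mul hm ((((((((Soft.const_mul 2 htg).add (Soft.const_mul 2 hta)).add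
      hmul).add (hcT _)).add (hmc 400 hs)).add (hcT 400)).add (hcT 20)))
  · refine (Soft.of_le (N := 0) fun n _ => (mul_comm _ _).le).trans (Soft.polylog_mul ?_ hs)
    exact ((hm.mul ((hmc 80 hm).add (hc1 160))).trans (Soft.of_le (N := 0) fun _ _ => le_rfl)).add
      (hc1 160)

/-- Uses the other side of the minimum in `subTime`: under the clock, the simulation takes
polynomial time however large `T` is. -/
theorem polyBdd_subTime {keep : Bool} {P : Prog F} {W : ℕ → ℕ} (hW : PolyBdd W) (T : ℕ → ℕ) :
    PolyBdd fun n => subTime keep P (W n) (T n) :=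
  (((PolyBdd.const (P.slow keep)).mul ((PolyBdd.const 1).add
    (hW.add (PolyBdd.const (P.slow keep))))).add (PolyBdd.const 40)).mono fun n => by
      unfold subTime
      gcongr
      exact min_le_right _ _

theorem polyBdd_testTime {S M : Prog F} {T τ σ W : ℕ → ℕ} (C k₀ : ℕ) (hW : PolyBdd W)
    (hσ : PolyBdd σ) :
    PolyBdd fun n => testTime F M n (W n) (T n) (sampleTime S n (W n) (τ n) (σ n) + 60)
      (n * n * (n * 100 + 100) + 20) (C * Nat.clog 2 n) k₀ := by
  have hc := PolyBdd.const
  have hid := PolyBdd.id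
  have hm : PolyBdd fun n => C * Nat.clog 2 n := (hc C).mul PolyBdd.clog
  have hnn := hid.mul hid
  have htg : PolyBdd fun n => sampleTime S n (W n) (τ n) (σ n) :=
    ((((polyBdd_subTime hW τ).add (hnn.mul (hc 40))).add (hid.mul (hc 40))).add
      (hσ.mul (hc 160))).add (hc 80)
  have hn3 := hnn.mul ((hid.mul (hc 100)).add (hc 100))
  have hmul : PolyBdd fun n => mulTime M n (W n) (T n) := by
    unfold mulTime
    refine (((polyBdd_subTime hW T).add (hn3.mono fun n => ?_)).add (hnn.mul (hc 140))).add
      (hc 200)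
    split_ifs
    · exact le_rfl
    · exact Nat.zero_le _
  unfold testTime coreTime trialTime
  refine (((((PolyBdd.add ?_ ?_).add (hc 100)).add
    (hnn.mul ((hid.mul (hc 100)).add (hc 300)))).add (hid.mul (hc 60))).add (hc (6 * k₀))).add
      (hc 600)
  · exact hm.mul (((((((hc 2).mul (htg.add (hc 60))).add ((hc 2).mul (hn3.add (hc 20)))).add
      hmul).add (hc _)).add (hnn.mul (hc 400))).add (hc 400) |>.add (hc 20))
  · exact hnn.mul ((hm.mul ((hm.mul (hc 80)).add (hc 160))).add (hc 160))

end Time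

/-! ### The probability of an error -/

section Error

/-- If `ρ ^ C` is below `2 ^ -(c + 3)`, then `C * Nat.clog 2 n` repetitions leave at most `n ^ -(c +
3)`. Two powers of `n` are spent on the union over the entries, and one is spare. -/
theorem exists_repetitions {ρ : ℝ} (h0 : 0 ≤ ρ) (h1 : ρ < 1) (c : ℕ) :
    ∃ C : ℕ, 1 ≤ C ∧ ∀ n : ℕ, 1 ≤ n → (n : ℝ) * n * ρ ^ (C * Nat.clog 2 n) ≤ 1 / (n : ℝ) ^ (c + 1) := by
  obtain ⟨C, hC⟩ := exists_pow_lt_of_lt_one (show (0 : ℝ) < (1 / 2) ^ (c + 3) by positivity) h1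
  refine ⟨C, ?_, fun n hn => ?_⟩
  · by_contra! h
    obtain rfl : C = 0 := by omega
    have : ((1 : ℝ) / 2) ^ (c + 3) ≤ 1 := pow_le_one₀ (by norm_num) (by norm_num)
    rw [pow_zero] at hC
    linarith
  · have hn' : (0 : ℝ) < n := by exact_mod_cast hn
    have h2 : ((1 : ℝ) / 2) ^ Nat.clog 2 n ≤ 1 / n := by
      rw [div_pow, one_pow]
      exact one_div_le_one_div_of_le hn' (by exact_mod_cast Nat.le_pow_clog (by norm_num) n)
    have h3 : ρ ^ (C * Nat.clog 2 n) ≤ (1 / n) ^ (c + 3) := by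
      rw [pow_mul]
      refine (pow_le_pow_left₀ (by positivity) hC.le _).trans ?_
      rw [← pow_mul, mul_comm, pow_mul]
      exact pow_le_pow_left₀ (by positivity) h2 _
    calc (n : ℝ) * n * ρ ^ (C * Nat.clog 2 n) ≤ n * n * (1 / n) ^ (c + 3) := by gcongr
      _ = 1 / (n : ℝ) ^ (c + 1) := by
        rw [div_pow, one_pow, show c + 3 = (c + 1) + 2 by ring, pow_add]
        field_simp

/-- The failure with uniform masks and the loss in the hybrid argument are each at most `1 / (8 * n
^ c)`. The factor `4` anticipates the four products of the splitting. -/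
theorem eventually_pairDist_le {M S : Prog F} {T τ : ℕ → ℕ} {ε : ℝ} {c C k₀ : ℕ} {adv : ℕ → ℝ}
    (hε : 0 < ε)
    (hdist : ∀ᶠ n : ℕ in atTop,
      expectedDist M (T n) n ≤ (1 - 1 / (Fintype.card F : ℝ) - ε) * (n : ℝ) ^ 2)
    (hC : 1 ≤ C) (hρ : ∀ n : ℕ, 1 ≤ n →
      (n : ℝ) * n * (1 - ε ^ 2 / 4) ^ (C * Nat.clog 2 n) ≤ 1 / (n : ℝ) ^ (c + 1))
    (hadv : SuperpolynomialDecay atTop (fun n : ℕ => (n : ℝ)) adv)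
    (hadv' : ∀ n, 2 ≤ n → ∀ [NeZero n] [NeZero (2 * (C * Nat.clog 2 n))],
      |((PMF.uniformOfFintype (Mat F n)).bind (testDist (cutDist M (T n) ((n + 2) ^ k₀))
          (sampledMat S (τ n) n) (C * Nat.clog 2 n)) true).toReal -
        ((sampledMat S (τ n) n).bind (testDist (cutDist M (T n) ((n + 2) ^ k₀))
          (sampledMat S (τ n) n) (C * Nat.clog 2 n)) true).toReal| = adv n) :
    ∀ᶠ n : ℕ in atTop, ∀ [NeZero n],
      4 * (pairDist (cutDist M (T n) ((n + 2) ^ k₀)) (fun _ => sampledMat S (τ n) n)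
        (C * Nat.clog 2 n) false).toReal ≤ 1 / (n : ℝ) ^ c := by
  set p := (Fintype.card F : ℝ) with hp
  have hp2 : 2 ≤ p := two_le_card (F := F)
  have hC' : (1 : ℝ) ≤ C := by exact_mod_cast hC
  -- The exponent is `c + 1` because the hybrid argument multiplies the advantage by at most `2 * C
  -- * n`.
  have h1 := (hadv (c + 1)).eventually_le_const
    (show (0 : ℝ) < 1 / (16 * C) by positivity)
  -- For `n ≥ 8 * Fintype.card F` the spare power of `n` outweighs the union over error values and
  -- the factor `8`.
  filter_upwards [hdist, h1, eventually_ge_atTop 2, eventually_ge_atTop (8 * Fintype.card F)]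
    with n h2 h3 h4 h5 _
  have hn : (2 : ℝ) ≤ n := by exact_mod_cast h4
  have h5' : 8 * p ≤ n := by rw [hp]; exact_mod_cast h5
  have hm : 0 < Nat.clog 2 n := Nat.clog_pos (by norm_num) h4
  have : NeZero (2 * (C * Nat.clog 2 n)) := ⟨by positivity⟩
  have hn2 : (0 : ℝ) < (n : ℝ) ^ 2 := by positivity
  have h0 : 0 ≤ 1 - 1 / p - ε := by
    have := (expectedDist_nonneg M (T n) n).trans h2
    exact nonneg_of_mul_nonneg_left this hn2
  have h6 := pairDist_uniform_le hε h0 ((meanDist_cutDist_le M (T n) ((n + 2) ^ k₀) n).trans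
    (ENNReal.ofReal_le_ofReal h2)) (C * Nat.clog 2 n)
  have h7 := hybrid_gap (μ := cutDist M (T n) ((n + 2) ^ k₀)) (sampledMat S (τ n) n)
    (C * Nat.clog 2 n)
  rw [hadv' n h4] at h7
  have h8 : (Nat.clog 2 n : ℝ) ≤ n := by
    exact_mod_cast Nat.clog_le_of_le_pow Nat.lt_two_pow_self.le
  have hnc : (0 : ℝ) < (n : ℝ) ^ c := by positivity
  have h9 : (n : ℝ) * n * p * (1 - ε ^ 2 / 4) ^ (C * Nat.clog 2 n) ≤ 1 / (8 * (n : ℝ) ^ c) := by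
    calc (n : ℝ) * n * p * (1 - ε ^ 2 / 4) ^ (C * Nat.clog 2 n) =
        p * (n * n * (1 - ε ^ 2 / 4) ^ (C * Nat.clog 2 n)) := by ring
      _ ≤ p * (1 / (n : ℝ) ^ (c + 1)) := by gcongr; exact hρ n (by omega)
      _ ≤ 1 / (8 * (n : ℝ) ^ c) := by
        rw [pow_succ, mul_one_div, div_le_div_iff₀ (by positivity) (by positivity)]
        nlinarith
  have hadv0 : 0 ≤ adv n := by rw [← hadv' n h4]; exact abs_nonneg _
  have h10 : 2 * ((C * Nat.clog 2 n : ℕ) : ℝ) * adv n ≤ 1 / (8 * (n : ℝ) ^ c) := by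
    have e1 : (n : ℝ) * adv n ≤ 1 / (16 * C * (n : ℝ) ^ c) := by
      rw [le_div_iff₀ (by positivity)] at h3 ⊢
      rw [pow_succ] at h3
      linarith
    push_cast
    calc 2 * ((C : ℝ) * Nat.clog 2 n) * adv n ≤ 2 * (C * n) * adv n := by gcongr
      _ = 2 * C * (n * adv n) := by ring
      _ ≤ 2 * C * (1 / (16 * C * (n : ℝ) ^ c)) := by gcongr
      _ = 1 / (8 * (n : ℝ) ^ c) := by field_simp; norm_num
  have h11 : 1 / (8 * (n : ℝ) ^ c) = 1 / (n : ℝ) ^ c / 8 := by field_simp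
  rw [h11] at h9 h10
  linarith

end Error

/-! ### The distinguisher as a polynomial-time algorithm -/

section Distinguisher

/-- A single exponent `k` dominates the time and the word size of the test. The acceptance
probability is expressed by `testDist`, in which the program no longer occurs. -/
theorem exists_polyTime_distinguisher {S M : Prog F} {T τ σ : ℕ → ℕ} {k₀ kM kS C : ℕ} (hC : 1 ≤ C)
    (hS : ∀ n, S.HaltsWithin (initState n [] []) (τ n) ((n + 2) ^ kS)
      (OutputsTrapdooredPair n (σ n)))
    (hM : ∀ (n : ℕ) (A B : Mat F n), M.HaltsWithin (initState n (matList A) (matList B)) (T n)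
      ((n + 2) ^ kM) fun s => s.fOut.length = n * n) (hσ : PolyBdd σ)
    (hk₀ : ∀ n, (n + 2) ^ kM + (n + 2) ^ kS + (τ n + 1) + (n * n + n + 3 * σ n + 3) +
      n * n * (n + 1) ≤ (n + 2) ^ k₀) :
    ∃ k, PolyTime (distinguisher S M k₀ C) k ∧
      ∀ n, 2 ≤ n → ∀ [NeZero n] [NeZero (2 * (C * Nat.clog 2 n))] (κ : PMF (Mat F n)),
        acceptProb (distinguisher S M k₀ C) ((n + 2) ^ k) κ =
          (κ.bind (testDist (cutDist M (T n) ((n + 2) ^ k₀)) (sampledMat S (τ n) n)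
            (C * Nat.clog 2 n)) true).toReal := by
  have hc := PolyBdd.const
  have hid := PolyBdd.id
  have hm : PolyBdd fun n => C * Nat.clog 2 n := (hc C).mul PolyBdd.clog
  have hnn := hid.mul hid
  have hW := PolyBdd.pow k₀
  obtain ⟨k, hk⟩ := ((polyBdd_testTime (S := S) (M := M) (T := T) (τ := τ) C k₀ hW hσ).add
    (((PolyBdd.pow (k₀ + 1)).add (hm.mul ((hc 3).mul (hW.add (hc 1))))).add
    ((((((hm.mul hnn).add hnn).add ((hc 3).mul hid)).add ((hc 2).mul hm)).add
      ((hc C).mul hid)).add (hc (C + Fintype.card Fˣ + M.slow false + S.slow true + 12))))).add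
      (hW.add hW)
  beta_reduce at hk
  have hlarge : ∀ n, 2 ≤ n → ∀ [NeZero n] [NeZero (2 * (C * Nat.clog 2 n))] (R : Mat F n), _ :=
    fun n hn _ _ R => impl_distinguisher_large (w := (n + 2) ^ k) (C := C) (k₀ := k₀) R hn (hS n)
      (hM n) (by have := hk₀ n; omega) (by have := hk₀ n; omega) (by have := hk₀ n; omega)
      (by have := hk₀ n; omega) (by have := hk n; omega) (by have := hk n; omega)
      (by have := hk n; omega)
  refine ⟨k, fun n R => ?_, fun n hn _ _ κ => ?_⟩
  · have h1 := hk n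
    rcases lt_or_ge n 2 with hn | hn
    · exact (impl_distinguisher_small R hn (by omega)).haltsWithin (by omega) fun _ _ _ => trivial
    · have : NeZero n := ⟨by omega⟩
      have hpos : 0 < Nat.clog 2 n := Nat.clog_pos (by norm_num) hn
      have : NeZero (2 * (C * Nat.clog 2 n)) := ⟨by positivity⟩
      exact (hlarge n hn R).haltsWithin (by omega) fun _ _ _ => trivial
  · exact acceptProb_eq (hlarge n hn) (by have := hk n; omega) κ

theorem exists_program {S M : Prog F} {T τ σ : ℕ → ℕ} {k₀ kM kS : ℕ} (C N₀ : ℕ) (hN₀ : 1 ≤ N₀)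
    (hS : ∀ n, S.HaltsWithin (initState n [] []) (τ n) ((n + 2) ^ kS)
      (OutputsTrapdooredPair n (σ n)))
    (hM : ∀ (n : ℕ) (A B : Mat F n), M.HaltsWithin (initState n (matList A) (matList B)) (T n)
      ((n + 2) ^ kM) fun s => s.fOut.length = n * n)
    (hτ : Soft τ fun n => n * n) (hσ : Soft σ fun n => n) (hσ' : PolyBdd σ)
    (hk₀ : ∀ n, (n + 2) ^ kM + (n + 2) ^ kS + (τ n + 1) + (n * n + n + 3 * σ n + 3) +
      n * n * (n + 1) ≤ (n + 2) ^ k₀) :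
    ∃ (P : Prog F) (T' : ℕ → ℕ), RunsInTime P T' ∧ Soft T' T ∧
      ∀ (n : ℕ) (A B : Mat F n),
        (n < N₀ → output P (T' n) A B = PMF.pure (A * B)) ∧
        ∀ [NeZero n], N₀ ≤ n → output P (T' n) A B =
          splitDist (coreDist (cutDist M (T n) ((n + 2) ^ k₀)) (fun _ => sampledMat S (τ n) n)
            (C * Nat.clog 2 n)) A B := by
  have hT : ∀ n, n * n ≤ T n := fun n => le_time_of_haltsWithin (hM n 0 0) rfl
  have hsoft := soft_mainTime (F := F) (S := S) (M := M) (W := fun n => (n + 2) ^ k₀) C k₀ hT hτ hσ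
    fun n => by have := hk₀ n; omega
  set t₁ : ℕ → ℕ := fun n => mainTime F M n ((n + 2) ^ k₀) (T n)
    (sampleTime S n ((n + 2) ^ k₀) (τ n) (σ n)) (n * ((σ n + n) * 200 + 200) + 40)
      (C * Nat.clog 2 n) k₀ with ht₁
  have hc := PolyBdd.const
  have hid := PolyBdd.id
  have hm : PolyBdd fun n => C * Nat.clog 2 n := (hc C).mul PolyBdd.clog
  have hnn := hid.mul hid
  have hW := PolyBdd.pow k₀
  obtain ⟨k, hk⟩ := (((PolyBdd.pow (k₀ + 1)).add (hm.mul ((hc 12).mul (hW.add (hc 1))))).add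
    ((((((hm.mul hnn).add hnn).add ((hc 3).mul hid)).add hm).add ((hc C).mul hid)).add
      (hc (C + Fintype.card Fˣ + M.slow false + S.slow true + N₀ + 12)))).add
      ((hW.add hW).add ((hc 4).mul hσ'))
  beta_reduce at hk
  set P := mainProg (fun i => sampleTo S (31 + i)) (fun i => circApply (F := F) (31 + i)) M k₀ C N₀
  have hsmall : ∀ n (A B : Mat F n), n < N₀ → _ := fun n A B hn =>
    impl_mainProg_small (w := (n + 2) ^ k) (gm := fun i => sampleTo S (31 + i))
      (ap := fun i => circApply (31 + i)) (M := M) (k₀ := k₀) (C := C) A B hn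
      (by have := hk n; omega)
  have hlarge : ∀ n (A B : Mat F n) [NeZero n], N₀ ≤ n → _ := fun n A B _ hn =>
    impl_mainProg_large (w := (n + 2) ^ k) hn
      (maskOps_sample (hS n) (W := (n + 2) ^ k₀) (w := (n + 2) ^ k) (m := C * Nat.clog 2 n)
        (by have := hk₀ n; omega) (by have := hk₀ n; omega) (by have := hk₀ n; omega)
        (by have := hk n; omega) (by have := hk n; omega)) (fun _ => trivial) (hM n)
      (by have := hk₀ n; omega) (by have := hk₀ n; omega) A B (by have := hk n; omega)
      (by have := hk n; omega)
  -- The naive algorithm is used for finitely many `n` only, so its cubic time does not affect the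
  -- asymptotic bound.
  refine ⟨P, fun n => if n < N₀ then n * n * (n * 100 + 300) + 110 else t₁ n, ⟨k, fun n A B => ?_⟩,
    (Soft.of_le (N := N₀) fun n hn => by simp [not_lt.2 hn]).trans hsoft, fun n A B =>
      ⟨fun hn => ?_, fun hn => ?_⟩⟩
  · rcases lt_or_ge n N₀ with hn | hn
    · exact (hsmall n A B hn).haltsWithin (by simp [hn]) fun _ _ h => h.1
    · have : NeZero n := ⟨by omega⟩
      exact (hlarge n A B hn).haltsWithin (by simp [not_lt.2 hn, ht₁]) fun _ _ h => h.1
  · exact (hsmall n A B hn).output_eq (by simp [hn]) fun _ _ h => h.2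
  · exact (hlarge n A B hn).output_eq (by simp [not_lt.2 hn, ht₁]) fun _ _ h => h.2

end Distinguisher

end WordRAM

theorem mainTheorem1 {F : Type*} [Field F] [Fintype F] [DecidableEq F]
    (hF : ∃ S : WordRAM.Prog F, WordRAM.IsTrapdooredFamily S)
    (ε : ℝ) (hε : 0 < ε)
    (M : WordRAM.Prog F) (T : ℕ → ℕ) (hM : WordRAM.RunsInTime M T)
    (hdist : ∀ᶠ n : ℕ in Filter.atTop,
      WordRAM.expectedDist M (T n) n ≤ (1 - 1 / (Fintype.card F : ℝ) - ε) * (n : ℝ) ^ 2)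
    (c : ℕ) :
    ∃ (P : WordRAM.Prog F) (T' : ℕ → ℕ),
      WordRAM.RunsInTime P T' ∧
      WordRAM.SoftO (fun n => (T' n : ℝ)) (fun n => (T n : ℝ)) ∧
      ∀ (n : ℕ) (A B : WordRAM.Mat F n),
        1 - 1 / (n : ℝ) ^ c ≤ (WordRAM.output P (T' n) A B (A * B)).toReal := by
  open WordRAM in
  obtain ⟨S, τ, σ, hτ, hσ, ⟨kS, hS⟩, hind⟩ := hF
  obtain ⟨kM, hM⟩ := hM
  have hτ' : PolyBdd τ := PolyBdd.of_softO hτ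
  have hσ' : PolyBdd σ := PolyBdd.of_softO (a := 1) (by simpa using hσ)
  have hid := PolyBdd.id
  have hc := PolyBdd.const
  -- The window width and time limit `(n + 2) ^ k₀` exceeds the word sizes of `M` and `S`, the time
  -- of the sampler, the lengths of its outputs, and the cubic cost of the naive product up to a
  -- constant factor.
  obtain ⟨k₀, hk₀⟩ := ((((PolyBdd.pow kM).add (PolyBdd.pow kS)).add (hτ'.add (hc 1))).add
    ((((hid.mul hid).add hid).add ((hc 3).mul hσ')).add (hc 3))).add
      ((hid.mul hid).mul (hid.add (hc 1)))
  -- An expected distance is nonnegative, so the hypothesis at a single `n ≥ 1` forces `ε < 1`, and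
  -- the base `1 - ε ^ 2 / 4` below lies between `0` and `1`.
  have h0 : 0 ≤ 1 - 1 / (Fintype.card F : ℝ) - ε := by
    obtain ⟨n, h1, h2⟩ := (hdist.and (Filter.eventually_ge_atTop 1)).exists
    have hn : (0 : ℝ) < (n : ℝ) ^ 2 := by positivity
    exact nonneg_of_mul_nonneg_left ((expectedDist_nonneg M (T n) n).trans h1) hn
  have hp : 0 < 1 / (Fintype.card F : ℝ) := by positivity
  obtain ⟨C, hC, hρ⟩ := exists_repetitions (ρ := 1 - ε ^ 2 / 4) (by nlinarith) (by nlinarith) c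
  obtain ⟨k, hD, hacc⟩ := exists_polyTime_distinguisher (k₀ := k₀) hC hS hM hσ' hk₀
  have herr := eventually_pairDist_le (τ := τ) (k₀ := k₀) hε hdist hC hρ (hind _ k hD)
    fun n hn _ _ => by rw [hacc n hn, hacc n hn]
  obtain ⟨N, hN⟩ := Filter.eventually_atTop.1 herr
  -- The threshold `N + 1` rather than `N` sends `n = 0` to the naive algorithm, as the masking
  -- needs a nonempty index set.
  obtain ⟨P, T', h1, h2, h3⟩ := exists_program (k₀ := k₀) C (N + 1) (by omega) hS hM
    (by simpa [Soft, sq] using hτ) hσ hσ' hk₀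
  refine ⟨P, T', h1, h2, fun n A B => ?_⟩
  rcases lt_or_ge n (N + 1) with hn | hn
  · rw [(h3 n A B).1 hn, PMF.pure_apply, if_pos rfl, ENNReal.toReal_one]
    have : 0 ≤ 1 / (n : ℝ) ^ c := by positivity
    linarith
  · have : NeZero n := ⟨by omega⟩
    rw [(h3 n A B).2 hn]
    have h4 := toReal_splitDist (μ := cutDist M (T n) ((n + 2) ^ k₀))
      (ν := fun _ => sampledMat S (τ n) n) (m := C * Nat.clog 2 n) A B
    have h5 := hN n (by omega)
    linarith
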